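/- Let $K=\mathbb{C}(q)$ with $q$ an indeterminate, or $K=\mathbb{C}$ with $q\in\mathbb{C}^{\times}$ and $q^2\neq\pm1$ (more generally, let $K\supseteq\mathbb{C}$ be a field and $q\in K^\times$ with $q^2\ne\pm1$), and let $n\ge 1$. Write $[A,B]_q=(qAB-q^{-1}BA)/(q-q^{-1})$. A connected set is a non-empty set of consecutive integers. A sequence of sets is increasing (decreasing) if all elements of each set are smaller (larger) than those of the next, and monotonic if it is increasing or decreasing. **The algebra.** $\mathfrak{aw}(n)$ is the unital associative $K$-algebra generated by elements $C_I$, $I\subseteq\{1,\dots,n\}$ connected, with $C_\varnothing:=1$, subject to the relations * $[C_I,C_J]=0$ if $I\cap J=\varnothing$ or $I\subseteq J$; * $C_{I_1I_2}=-[C_{I_2I_3},C_{I_1I_3}]_q+C_{I_1}C_{I_2}+C_{I_3}C_{I_1I_2I_3}$ for every monotonic sequence $(I_1,I_2,I_3)$ of adjacent connected subsets; * $C_{I_1I_4}=-[C_{I_1I_3},C_{I_3I_4}]_q+C_{I_1}C_{I_4}+C_{I_3}C_{I_1I_3I_4}$ for every monotonic sequence $(I_1,I_2,I_3,I_4)$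 of adjacent connected subsets. Here juxtaposed adjacent sets are merged, and for a monotonic sequence $(I_1,\dots,I_k)$ of connected sets with non-empty holes between consecutive sets, $C_{I_1\cdots I_k}$ is defined recursively by $$C_{I_1I_2\cdots I_k}=-[C_{I_1H},C_{HI_2\cdots I_k}]_q+C_{I_1}C_{I_2\cdots I_k}+C_HC_{I_1HI_2\cdots I_k},$$ $H$ being the hole between $I_1$ and $I_2$. For an arbitrary $S\subseteq\{1,\dots,n\}$, $C_S$ denotes the element attached to the increasing sequence of the maximal connected subsets of $S$. **The maps $r_a$.** On generators, $r_0$ fixes $C_I$ if $1\notin I$, and $r_0(C_{1\dots k})=C_{\{k+1,\dots,n\},1}$. For $1\le i\le n-1$, $r_i(C_{i+1\dots k})=C_{i,\,i+2\dots k}$, $r_i(C_{j\dots i})=C_{i+1,\,i-1\dots j}$, and $r_i(C_I)=C_I$ if $I$ contains both or none of $i,i+1$. **The elements $\omega_S$.** For $I_1<I_2<I_3$ (arbitrary subsets), writing $C_{AB}=C_{A\cup B}$, let $$\begin{aligned}\Omega_{I_1,I_2,I_3}={}&qC_{I_1I_2}C_{I_2I_3}C_{I_1I_3}+\frac{q^{2}C_{I_1I_2}^{2}+q^{-2}C_{I_2I_3}^{2}+q^{2}C_{I_1I_3}^{2}+C_{I_1I_2I_3}^{2}+C_{I_1}^{2}+C_{I_2}^{2}+C_{I_3}^{2}}{q+q^{-1}}\\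 &-qC_{I_1I_2}(C_{I_1}C_{I_2}+C_{I_3}C_{I_1I_2I_3})-q^{-1}C_{I_2I_3}(C_{I_2}C_{I_3}+C_{I_1}C_{I_1I_2I_3})\\ &-qC_{I_1I_3}(C_{I_1}C_{I_3}+C_{I_2}C_{I_1I_2I_3})+(q+q^{-1})C_{I_1}C_{I_2}C_{I_3}C_{I_1I_2I_3}-\frac{1}{q+q^{-1}}.\end{aligned}$$ For $S\subseteq\{1,\dots,n\}$ with $|S|\ge3$, cut $S=I_1\cup I_2\cup I_3$ into non-empty pieces $I_1<I_2<I_3$ and set $$\omega_S=\sum_{I\subseteq I_1,\,J\subseteq I_2,\,L\subseteq I_3}(-1)^{|S|-|I|-|J|-|L|}\,\Omega_{I,J,L};$$ for $|S|\le2$ put $\omega_S=0$. Let $\Gamma_n=\mathrm{Span}_K\{\omega_S : S\subseteq\{1,\dots,n\}\}$. **Statement.** 1. The elements $\omega_S$ do not depend on the choice of the cut of $S$, and they are central in $\mathfrak{aw}(n)$. 2. The maps $r_0,\dots,r_{n-1}$ extend to algebra automorphisms of $\mathfrak{aw}(n)$ that satisfy the relations of the braid group $B_{n+1}$ on $n+1$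 strands, so that $\sigma_a\mapsto r_a$ defines an action of $B_{n+1}$ on $\mathfrak{aw}(n)$ by automorphisms. 3. $r_0(\Gamma_n)=\Gamma_n$, and $r_0^2(\omega_S)=\omega_S$ for every $S\subseteq\{1,\dots,n\}$. 4. Every element of $B_{n+1}$ maps $\Gamma_n$ to itself, and the resulting linear action of $B_{n+1}$ on $\Gamma_n$ factors through the canonical surjection of $B_{n+1}$ onto the symmetric group on $n+1$ letters, which sends $\sigma_a$ to the transposition of two consecutive letters. -/

import Mathlib

open scoped Classical in
/-- The smallest interval of integers containing `S`. -/
noncomputable def awHull (S : Finset ℕ) : Finset ℕ :=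
  (Finset.range (S.sup id + 1)).filter (fun x => ∃ a ∈ S, ∃ b ∈ S, a ≤ x ∧ x ≤ b)

/-- The hole between two disjoint connected sets of integers (empty if they are adjacent,
or if one of them is empty). -/
noncomputable def awHole (I J : Finset ℕ) : Finset ℕ := awHull (I ∪ J) \ (I ∪ J)

/-- `I < J`: all elements of `I` are strictly smaller than all elements of `J`. -/
def AWLt (I J : Finset ℕ) : Prop := ∀ a ∈ I, ∀ b ∈ J, a < b

/-- `I` is a non-empty connected subset of `{1,…,n}`, i.e. a non-empty set of consecutive
integers. -/
def AWConn (n : ℕ) (I : Finset ℕ) : Prop :=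
  I ⊆ Finset.Icc 1 n ∧ I.Nonempty ∧ (I : Set ℕ).OrdConnected

/-- The `q`-commutator `[A,B]_q = (q A B - q⁻¹ B A) / (q - q⁻¹)`. -/
noncomputable def qComm {K A : Type*} [Field K] [Ring A] [Algebra K A] (q : K) (a b : A) : A :=
  (q - q⁻¹)⁻¹ • (q • (a * b) - q⁻¹ • (b * a))

open scoped Classical in
/-- The element `C_{I₁ I₂ … I_k}` attached to a monotonic (increasing or decreasing) sequence of
connected sets, in terms of the elements `c I` attached to the connected sets. Consecutive sets
without a hole between them are merged, and at the first hole `H` (between `I` and `J`) one has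
`C_{I J L} = -[C_{I H}, C_{H J L}]_q + C_I C_{J L} + C_H C_{I H J L}`. -/
noncomputable def awSeq {K A : Type*} [Field K] [Ring A] [Algebra K A] (q : K)
    (c : Finset ℕ → A) : List (Finset ℕ) → A
  | [] => 1
  | [I] => c I
  | I :: J :: L =>
    if awHole I J = ∅ then awSeq q c ((I ∪ J) :: L)
    else
      -qComm q (c (I ∪ awHole I J)) (awSeq q c ((awHole I J ∪ J) :: L))
        + c I * awSeq q c (J :: L)
        + c (awHole I J) * awSeq q c ((I ∪ awHole I J ∪ J) :: L)
  termination_by L => L.length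

/-- The index set of the generators: non-empty connected subsets of `{1,…,n}`. -/
abbrev AWIndex (n : ℕ) : Type := {I : Finset ℕ // AWConn n I}

open scoped Classical in
/-- The generator `C_I` in the free algebra, with `C_∅ = 1` (and the value `0`, never used,
if `I` is not connected). -/
noncomputable def awFreeC (K : Type*) [Field K] (n : ℕ) (I : Finset ℕ) :
    FreeAlgebra K (AWIndex n) :=
  if h : AWConn n I then FreeAlgebra.ι K ⟨I, h⟩ else if I = ∅ then 1 else 0

/-- `(I₁, I₂, …)` is a monotonic sequence of adjacent non-empty connected subsets of `{1,…,n}`. -/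
def AWMonoAdj (n : ℕ) (L : List (Finset ℕ)) : Prop :=
  (∀ I ∈ L, AWConn n I) ∧ (L.Pairwise AWLt ∨ L.Pairwise (fun I J => AWLt J I)) ∧
    L.IsChain (fun I J => AWConn n (I ∪ J))

/-- The defining relations of the Askey–Wilson algebra `𝔞𝔴(n)`. -/
inductive AWRel (K : Type*) [Field K] (q : K) (n : ℕ) :
    FreeAlgebra K (AWIndex n) → FreeAlgebra K (AWIndex n) → Prop
  | comm (I J : Finset ℕ) (hI : AWConn n I) (hJ : AWConn n J) (hIJ : Disjoint I J ∨ I ⊆ J) :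
      AWRel K q n (awFreeC K n I * awFreeC K n J) (awFreeC K n J * awFreeC K n I)
  | three (I₁ I₂ I₃ : Finset ℕ) (h : AWMonoAdj n [I₁, I₂, I₃]) :
      AWRel K q n (awFreeC K n (I₁ ∪ I₂))
        (-qComm q (awFreeC K n (I₂ ∪ I₃)) (awSeq q (awFreeC K n) [I₁, I₃])
          + awFreeC K n I₁ * awFreeC K n I₂
          + awFreeC K n I₃ * awFreeC K n (I₁ ∪ I₂ ∪ I₃))
  | four (I₁ I₂ I₃ I₄ : Finset ℕ) (h : AWMonoAdj n [I₁, I₂, I₃, I₄]) :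
      AWRel K q n (awSeq q (awFreeC K n) [I₁, I₄])
        (-qComm q (awSeq q (awFreeC K n) [I₁, I₃]) (awFreeC K n (I₃ ∪ I₄))
          + awFreeC K n I₁ * awFreeC K n I₄
          + awFreeC K n I₃ * awSeq q (awFreeC K n) [I₁, I₃ ∪ I₄])

/-- The Askey–Wilson algebra `𝔞𝔴(n)` over `K` with parameter `q`. -/
abbrev AW (K : Type*) [Field K] (q : K) (n : ℕ) : Type _ := RingQuot (AWRel K q n)

section

variable {K : Type*} [Field K] (q : K) (n : ℕ)

/-- The element `C_I` of `𝔞𝔴(n)`, for `I` connected or empty. -/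
noncomputable def awC (I : Finset ℕ) : AW K q n :=
  RingQuot.mkAlgHom K (AWRel K q n) (awFreeC K n I)

/-- The element `C_S` of `𝔞𝔴(n)` for an arbitrary subset `S = {i₁ < i₂ < … < i_k}` of `{1,…,n}`,
seen as an increasing sequence of connected subsets. -/
noncomputable def awCinc (S : Finset ℕ) : AW K q n :=
  awSeq q (awC q n) ((S.sort (· ≤ ·)).map (fun i => {i}))

/-- The Casimir element `Ω_{I₁,I₂,I₃}`, for `I₁ < I₂ < I₃`. -/
noncomputable def awCasimir (I₁ I₂ I₃ : Finset ℕ) : AW K q n :=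
  let C : Finset ℕ → AW K q n := awCinc q n
  q • (C (I₁ ∪ I₂) * C (I₂ ∪ I₃) * C (I₁ ∪ I₃))
    + (q + q⁻¹)⁻¹ • (q ^ 2 • C (I₁ ∪ I₂) ^ 2 + (q⁻¹) ^ 2 • C (I₂ ∪ I₃) ^ 2
        + q ^ 2 • C (I₁ ∪ I₃) ^ 2 + C (I₁ ∪ I₂ ∪ I₃) ^ 2 + C I₁ ^ 2 + C I₂ ^ 2 + C I₃ ^ 2)
    - q • (C (I₁ ∪ I₂) * (C I₁ * C I₂ + C I₃ * C (I₁ ∪ I₂ ∪ I₃)))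
    - q⁻¹ • (C (I₂ ∪ I₃) * (C I₂ * C I₃ + C I₁ * C (I₁ ∪ I₂ ∪ I₃)))
    - q • (C (I₁ ∪ I₃) * (C I₁ * C I₃ + C I₂ * C (I₁ ∪ I₂ ∪ I₃)))
    + (q + q⁻¹) • (C I₁ * C I₂ * C I₃ * C (I₁ ∪ I₂ ∪ I₃))
    - (q + q⁻¹)⁻¹ • (1 : AW K q n)

/-- `(I₁, I₂, I₃)` cuts `S` into three non-empty consecutive pieces `I₁ < I₂ < I₃`. -/
def AWCut (S I₁ I₂ I₃ : Finset ℕ) : Prop :=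
  I₁.Nonempty ∧ I₂.Nonempty ∧ I₃.Nonempty ∧ AWLt I₁ I₂ ∧ AWLt I₂ I₃ ∧ I₁ ∪ I₂ ∪ I₃ = S

/-- The alternating sum of Casimir elements that gives `ω_S` from the cut `(I₁, I₂, I₃)` of `S`. -/
noncomputable def awOmegaCut (S I₁ I₂ I₃ : Finset ℕ) : AW K q n :=
  ∑ I ∈ I₁.powerset, ∑ J ∈ I₂.powerset, ∑ L ∈ I₃.powerset,
    (-1 : AW K q n) ^ (S.card - I.card - J.card - L.card) * awCasimir q n I J L

open scoped Classical in
/-- The element `ω_S`, computed with some cut of `S` into three non-empty pieces; it is `0` by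
convention if there is none, i.e. if `S` has at most two elements. -/
noncomputable def awOmega (S : Finset ℕ) : AW K q n :=
  if h : ∃ t : Finset ℕ × Finset ℕ × Finset ℕ, AWCut S t.1 t.2.1 t.2.2 then
    awOmegaCut q n S h.choose.1 h.choose.2.1 h.choose.2.2
  else 0

/-- `Γ_n`, the span of the elements `ω_S`, `S ⊆ {1,…,n}`. -/
noncomputable def awGamma : Submodule K (AW K q n) :=
  Submodule.span K {x | ∃ S : Finset ℕ, S ⊆ Finset.Icc 1 n ∧ x = awOmega q n S}

open scoped Classical in
/-- The image of the generator `C_I` under `r_a`, for `a ∈ {0,1,…,n-1}` and `I` connected: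
`r_0` fixes `C_I` if `1 ∉ I` and sends `C_{1…k}` to `C_{{k+1,…,n},1}`; for `a ≥ 1`, `r_a` sends
`C_{a+1…k}` to `C_{a,a+2…k}` and `C_{j…a}` to `C_{a+1,a-1…j}`, and it fixes the other `C_I`. -/
noncomputable def awR (a : ℕ) (I : Finset ℕ) : AW K q n :=
  if a = 0 then
    if 1 ∈ I then awSeq q (awC q n) [Finset.Icc 1 n \ I, {1}] else awC q n I
  else if a + 1 ∈ I ∧ a ∉ I then awSeq q (awC q n) [{a}, I \ {a + 1}]
  else if a ∈ I ∧ a + 1 ∉ I then awSeq q (awC q n) [{a + 1}, I \ {a}]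
  else awC q n I

end

/-- The relations of the braid group on `n + 1` strands, with generators `σ_0, …, σ_{n-1}`. -/
def braidRels (n : ℕ) : Set (FreeGroup (Fin n)) :=
  {w | ∃ a b : Fin n, (a : ℕ) + 1 = b ∧
      w = FreeGroup.of a * FreeGroup.of b * FreeGroup.of a *
        (FreeGroup.of b * FreeGroup.of a * FreeGroup.of b)⁻¹} ∪
  {w | ∃ a b : Fin n, (a : ℕ) + 1 < b ∧
      w = FreeGroup.of a * FreeGroup.of b * (FreeGroup.of b * FreeGroup.of a)⁻¹}

/-- The braid group on `n + 1` strands. -/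
abbrev BraidGroupSucc (n : ℕ) : Type := PresentedGroup (braidRels n)

/-- The standard generator `σ_a` of the braid group on `n + 1` strands. -/
def braidσ {n : ℕ} (a : Fin n) : BraidGroupSucc n := PresentedGroup.of a

theorem braidRels_swap (n : ℕ) : ∀ w ∈ braidRels n,
    FreeGroup.lift (fun a : Fin n => Equiv.swap a.castSucc a.succ) w = 1 := by
  rintro w (⟨a, b, hab, rfl⟩ | ⟨a, b, hab, rfl⟩)
  · have hb : b.castSucc = a.succ := by ext; simp [← hab]
    have h1 : a.castSucc ≠ a.succ := by simp [Fin.ext_iff]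
    have h2 : a.castSucc ≠ b.succ := by simp [Fin.ext_iff]; omega
    have h3 : a.succ ≠ b.succ := by simp [Fin.ext_iff]; omega
    simp only [map_mul, map_inv, FreeGroup.lift_apply_of, hb, mul_inv_eq_one]
    rw [Equiv.swap_mul_swap_mul_swap h1 h2, Equiv.swap_comm a.castSucc a.succ,
      Equiv.swap_comm a.succ b.succ, Equiv.swap_mul_swap_mul_swap h3.symm h2.symm]
    exact Equiv.swap_comm _ _
  · simp only [map_mul, map_inv, FreeGroup.lift_apply_of, mul_inv_eq_one]
    ext x : 1
    simp only [Equiv.Perm.mul_apply, Equiv.swap_apply_def, Fin.ext_iff, Fin.val_castSucc,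
      Fin.val_succ]
    split_ifs <;> first | rfl | (exfalso; simp only [Fin.val_castSucc, Fin.val_succ] at *; omega)

/-- The canonical morphism from the braid group on `n + 1` strands to the symmetric group on
`n + 1` letters, sending `σ_a` to the transposition of the letters `a` and `a + 1`. -/
def braidPerm (n : ℕ) : BraidGroupSucc n →* Equiv.Perm (Fin (n + 1)) :=
  PresentedGroup.toGroup (braidRels_swap n)

/-! Draw a convex polygon with vertices `0, …, n` and attach to the connected set `Ioc x y = {x + 1,
…, y}` the chord `{x, y}`, with `1` for a chord of length zero. The letter `i` becomes the side `{i
- 1, i}`, and the side `{n, 0}` plays the role of an additional letter, which is why `n + 1` strands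
appear. In this picture chords that do not cross commute. The q-commutator of two crossing chords,
in either order, defines the two resolutions of the crossing (`chordCrossing`), which are the
elements attached to two intervals with a hole. The relation `three` concerns the quadrilaterals and
the relation `four` the pentagons.

The first point is that these relations have the dihedral symmetry of the polygon, although the
presentation singles out a linear order. For quadrilaterals this is immediate. For pentagons the
rotation by one vertex is `PrePentagon.ra_add_four`: the defect of the rotated relation q-commutes
with a diagonal and also satisfies a cubic relation with it, and both together force it to vanish
(`eq_zero_of_qcomm_of_cubic`). Hence `𝔞𝔴(n)` is the universal algebra with a `ChordSystem`
(`aw_chordSystem`, `exists_awHom`).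

The map `r_a` is the half twist of the two sides that meet at the vertex `o = a`, with neighbours
`u` and `v`: a chord `{o, x}` is replaced by its resolved crossing with `{u, v}`, and other chords
stay. To extend it to a morphism it suffices that the twisted family is again a chord system
(`chordSystem_twist`). A relation that is linear in the chords at `o` follows from the same relation
at `u`, `o` and `v` (`VertexLinear.transfer`). The relation of a quadrilateral that is quadratic in
these chords is recovered from the other relations of a pentagon (`PrePentagon.of_incomplete`,
`quadRel_twist`). The inverse is obtained by conjugation with the anti-automorphism that fixes all
chords, and the braid relations are pentagon identities.

The second point is the behaviour of the Casimir element of a quadrilateral. It does not depend on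
the starting vertex, it commutes with chords that cross one of its sides
(`Pentagon.casimir_commute`), and under a half twist that involves one of its sides it becomes an
alternating sum of three Casimir elements (`Pentagon.twist_casimir`). Arbitrary subsets are reduced
to intervals. The half twists move a letter to a free neighbouring position, as is shown by
linearity of the "rows" (`half_twist_awCinc`), so products of half twists carry a given
configuration of blocks to adjacent intervals (`Transport`).

For four consecutive blocks this yields the cocycle identities `casimir_cocycle_left` and
`casimir_cocycle_right`, whose alternating sums say that `ω_S` does not depend on the cut. Every cut
gives `ω_S` minus the Casimir element of the cut as a combination of Casimir elements of smaller
sets. By induction `ω_S` is therefore equal, modulo the centre, to the Casimir element of any cut,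
and for each generator there is a cut whose Casimir element commutes with it. So `ω_S` is central.

For `a ≥ 1` a cut adapted to `a` and `a + 1` shows that `r_a` sends `ω_S` to `ω` of the set with `a`
and `a + 1` exchanged. The automorphism `r_0` does not permute the `ω_S`, but the three-term formula
shows that it keeps `Γ_n` stable and that its square fixes it pointwise. All generators thus act on
`Γ_n` by involutions. A braid that acts trivially on the letters acts trivially in any group in
which the generators become involutions (`BraidInvolutions.eq_one_of_fixes`), and this is the
factorization through the symmetric group. -/

set_option linter.unusedSimpArgs false

/-! ### Pentagon relations and their invariance under rotation -/

section Pentagon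

variable {R A : Type*} [CommRing R] [Ring A] [Algebra R A] {p : R}

/-- `z = -[x, y]_q + m` for `p = q ^ 2`, with denominators cleared. -/
abbrev TriRel (p : R) (x y z m : A) : Prop :=
  p • (x * y) - y * x = (p - 1) • (m - z)

theorem fin5_add (i j k : Fin 5) : i + j + k = i + (j + k) := add_assoc i j k

/-- Relations between the sides `a i = {i, i + 1}` (scalars) and the diagonals
`d i = {i - 1, i + 1}` of a pentagon, except for those which involve all five vertices; `w i`
and `v i` stand for the two resolutions of the crossing of `d i` and `d (i + 1)`. -/
structure PrePentagon (p : R) (a : Fin 5 → R) (d w v : Fin 5 → A) : Prop where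
  unit : IsUnit p
  unit_sub : IsUnit (p - 1)
  unit_add : IsUnit (p + 1)
  z : ∀ i, TriRel p (d i) (d (i + 1)) (w i) ((a (i + 4) * a (i + 1)) • 1 + a i • d (i + 3))
  vz : ∀ i, TriRel p (d (i + 1)) (d i) (v i) ((a (i + 4) * a (i + 1)) • 1 + a i • d (i + 3))
  x : ∀ i, TriRel p (d (i + 1)) (w i) (d i) ((a (i + 4) * a i) • 1 + a (i + 1) • d (i + 3))
  vy : ∀ i, TriRel p (d i) (v i) (d (i + 1)) ((a i * a (i + 1)) • 1 + a (i + 4) • d (i + 3))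
  c : ∀ i, d i * d (i + 2) = d (i + 2) * d i

/-- Identities are verified after multiplication by such a unit, so that all coefficients are
polynomials in `p`. -/
theorem smul_cancel_units {p : R} (h : IsUnit p) (h₁ : IsUnit (p - 1)) (h₂ : IsUnit (p + 1))
    (k l m : ℕ) {x y : A}
    (H : (p ^ k * (p - 1) ^ l * (p + 1) ^ m) • x = (p ^ k * (p - 1) ^ l * (p + 1) ^ m) • y) :
    x = y :=
  (((h.pow k).mul (h₁.pow l)).mul (h₂.pow m)).smul_left_cancel.mp H

/-- When `y * x = p • (x * y)`, the three cubic words are multiples of `x * y * y` and their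
coefficients `p`, `p ^ 3`, `-p * (p ^ 2 + 1)` add up to zero. What remains is `(p - 1) ^ 2 • x = 0`.
-/
theorem eq_zero_of_qcomm_of_cubic {p : R} (h₁ : IsUnit (p - 1)) {x y : A}
    (hx : p • (x * y) = y * x)
    (hc : p • (x * y * y) + p • (y * y * x) - (p ^ 2 + 1) • (y * x * y) + (p - 1) ^ 2 • x = 0) :
    x = 0 := by
  refine ((h₁.pow 2).smul_left_cancel).mp ?_
  rw [smul_zero]
  linear_combination (norm := skip) hc + p • (y * hx) - hx * y
  simp only [smul_mul_assoc, mul_smul_comm, mul_assoc]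
  module

namespace PrePentagon

variable {a : Fin 5 → R} {d w v : Fin 5 → A}

theorem cancel (h : PrePentagon p a d w v) (k l m : ℕ) {x y : A}
    (H : (p ^ k * (p - 1) ^ l * (p + 1) ^ m) • x = (p ^ k * (p - 1) ^ l * (p + 1) ^ m) • y) :
    x = y :=
  smul_cancel_units h.unit h.unit_sub h.unit_add k l m H

/-- The nested q-commutators `[d i, [d (i + 1), d i]_q]_q` and `[[d i, d (i + 1)]_q, d i]_q` are
equal, and the inner ones define `v i` and `w i`. This turns the relation `vy` for one resolution
into a relation for the other; `vx` arises from `x` in the same way. -/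
theorem y (h : PrePentagon p a d w v) (i : Fin 5) :
    TriRel p (w i) (d i) (d (i + 1)) ((a i * a (i + 1)) • 1 + a (i + 4) • d (i + 3)) := by
  refine h.cancel 0 1 0 ?_
  -- The given relations are multiplied by words from the left and from the right. After expansion
  -- into words the claim is linear algebra over `R`, which `module` decides; the same scheme serves
  -- for all the pentagon identities.
  linear_combination (norm := skip)
    ((p - 1) * (p + 1) * a i) • (h.c (i + 3)) + ((p - 1)) • (h.vy i) - (p) • (d i * (h.vz i))
    + ((h.vz i) * d i) - (d i * (h.z i)) + (p) • ((h.z i) * d i)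
  simp only [smul_mul_assoc, mul_smul_comm, mul_add, add_mul, mul_sub, sub_mul, smul_add,
    smul_sub, mul_assoc, mul_one, one_mul, mul_neg, neg_mul,
    smul_neg, fin5_add, Fin.isValue, Fin.reduceAdd, add_zero]
  module

theorem vx (h : PrePentagon p a d w v) (i : Fin 5) :
    TriRel p (v i) (d (i + 1)) (d i) ((a (i + 4) * a i) • 1 + a (i + 1) • d (i + 3)) := by
  refine h.cancel 0 1 0 ?_
  linear_combination (norm := skip)
    -((p - 1) * (p + 1) * a i) • (h.c (i + 1)) + (p) • ((h.vz i) * d (i + 1))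
    - (d (i + 1) * (h.vz i)) + ((p - 1)) • (h.x i) - (p) • (d (i + 1) * (h.z i))
    + ((h.z i) * d (i + 1))
  simp only [smul_mul_assoc, mul_smul_comm, mul_add, add_mul, mul_sub, sub_mul, smul_add,
    smul_sub, mul_assoc, mul_one, one_mul, mul_neg, neg_mul,
    smul_neg, fin5_add, Fin.isValue, Fin.reduceAdd, add_zero]
  module

/-- The chord `d (i + 3)` is the fourth side of the quadrilateral in which `d i` and `d (i + 1)`
cross. It commutes with both of them and so with their resolution. -/
theorem cw (h : PrePentagon p a d w v) (i : Fin 5) :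
    d (i + 3) * w i = w i * d (i + 3) := by
  refine h.cancel 0 1 0 ?_
  linear_combination (norm := skip)
    -((h.c (i + 1)) * d i) + (p) • (d i * (h.c (i + 1))) + (d (i + 1) * (h.c (i + 3)))
    - (p) • ((h.c (i + 3)) * d (i + 1)) - ((h.z i) * d (i + 3)) + (d (i + 3) * (h.z i))
  simp only [smul_mul_assoc, mul_smul_comm, mul_add, add_mul, mul_sub, sub_mul, smul_add,
    smul_sub, mul_assoc, mul_one, one_mul, mul_neg, neg_mul,
    smul_neg, fin5_add, Fin.isValue, Fin.reduceAdd, add_zero]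
  module

theorem cv (h : PrePentagon p a d w v) (i : Fin 5) :
    d (i + 3) * v i = v i * d (i + 3) := by
  refine h.cancel 0 1 0 ?_
  linear_combination (norm := skip)
    -(d i * (h.c (i + 1))) + (p) • ((h.c (i + 1)) * d i) + ((h.c (i + 3)) * d (i + 1))
    - (p) • (d (i + 1) * (h.c (i + 3))) + (d (i + 3) * (h.vz i)) - ((h.vz i) * d (i + 3))
  simp only [smul_mul_assoc, mul_smul_comm, mul_add, add_mul, mul_sub, sub_mul, smul_add,
    smul_sub, mul_assoc, mul_one, one_mul, mul_neg, neg_mul,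
    smul_neg, fin5_add, Fin.isValue, Fin.reduceAdd, add_zero]
  module

/-- The reflected pentagon. -/
theorem reflect (h : PrePentagon p a d w v) :
    PrePentagon p (fun i => a (4 - i)) (fun i => d (-i)) (fun i => v (4 - i))
      (fun i => w (4 - i)) := by
  -- The vertex `k` goes to `-k`, so the side `{i, i + 1}` becomes the side with index `4 - i`. The
  -- two diagonals of a crossing change their order, which exchanges `w` and `v`.
  refine ⟨h.unit, h.unit_sub, h.unit_add, fun i => ?_, fun i => ?_, fun i => ?_, fun i => ?_,
    fun i => ?_⟩
  all_goals
    have n1 : (-1 : Fin 5) = 4 := rfl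
    have n2 : (-2 : Fin 5) = 3 := rfl
    have n3 : (-3 : Fin 5) = 2 := rfl
    have n4 : (-4 : Fin 5) = 1 := rfl
  · have := h.vz (4 - i); fin_cases i <;> simpa [mul_comm, n1, n2, n3, n4] using this
  · have := h.z (4 - i); fin_cases i <;> simpa [mul_comm, n1, n2, n3, n4] using this
  · have := h.vy (4 - i); fin_cases i <;> simpa [mul_comm, n1, n2, n3, n4] using this
  · have := h.x (4 - i); fin_cases i <;> simpa [mul_comm, n1, n2, n3, n4] using this
  · have := h.c (3 - i); fin_cases i <;> simpa [n1, n2, n3, n4] using this.symm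

/-- The outer diagonals `d (i + 2)` and `d (i + 4)` commute, hence `[[d (i + 2), d (i + 3)]_q, d (i
+ 4)]_q = [d (i + 2), [d (i + 3), d (i + 4)]_q]_q`, and both sides resolve to `w i`. -/
theorem rb_of_ra (h : PrePentagon p a d w v) (i : Fin 5)
    (ra : TriRel p (w (i + 2)) (d (i + 4)) (w i)
      ((a (i + 1) * a (i + 4)) • 1 + a (i + 3) • v (i + 1))) :
    TriRel p (d (i + 2)) (w (i + 3)) (w i)
      ((a (i + 1) * a (i + 4)) • 1 + a (i + 2) • v (i + 4)) := by
  refine h.cancel 0 1 0 ?_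
  linear_combination (norm := skip)
    (p) • ((h.c (i + 2)) * d (i + 3)) - (p) • (d (i + 3) * (h.c (i + 2))) + ((p - 1)) • ra
    + ((p - 1) * a (i + 3)) • (h.vz (i + 1)) - ((p - 1) * a (i + 2)) • (h.vz (i + 4))
    + (d (i + 4) * (h.z (i + 2))) - (p) • ((h.z (i + 2)) * d (i + 4))
    + (p) • (d (i + 2) * (h.z (i + 3))) - ((h.z (i + 3)) * d (i + 2))
  simp only [smul_mul_assoc, mul_smul_comm, mul_add, add_mul, mul_sub, sub_mul, smul_add,
    smul_sub, mul_assoc, mul_one, one_mul, mul_neg, neg_mul,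
    smul_neg, fin5_add, Fin.isValue, Fin.reduceAdd, add_zero]
  module

/-- Rotation of the pentagon relation by one vertex. The difference of the two sides of the rotated
relation q-commutes with `d (i + 4)` and satisfies the cubic relation of `eq_zero_of_qcomm_of_cubic`
with it. -/
theorem ra_add_four (h : PrePentagon p a d w v) (i : Fin 5)
    (ra : TriRel p (w (i + 2)) (d (i + 4)) (w i)
      ((a (i + 1) * a (i + 4)) • 1 + a (i + 3) • v (i + 1))) :
    TriRel p (w (i + 1)) (d (i + 3)) (w (i + 4)) ((a i * a (i + 3)) • 1 + a (i + 2) • v i) := by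
  have rb := h.rb_of_ra i ra
  -- The cubic relations of `w (i + 4)`, `d (i + 3)` and `d i` with `d (i + 4)`: in each case the
  -- third element of a quadrilateral is eliminated from two of its relations.
  have q1 : p • (w (i + 4) * d (i + 4) * d (i + 4)) + p • (d (i + 4) * d (i + 4) * w (i + 4))
      - (p ^ 2 + 1) • (d (i + 4) * w (i + 4) * d (i + 4)) + (p - 1) ^ 2 • w (i + 4)
      = -((p - 1) ^ 2 • (d (i + 4) * ((a (i + 4) * a i) • 1 + a (i + 3) • d (i + 2))
        - ((a (i + 3) * a i) • 1 + a (i + 4) • d (i + 2)))) := by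
    linear_combination (norm := skip)
      ((p - 1) * a (i + 3)) • (h.c (i + 2)) + ((h.y (i + 4)) * d (i + 4))
      - (p) • (d (i + 4) * (h.y (i + 4))) + ((p - 1)) • (h.z (i + 4))
    simp only [smul_mul_assoc, mul_smul_comm, mul_add, add_mul, mul_sub, sub_mul, smul_add,
      smul_sub, mul_assoc, mul_one, one_mul, mul_neg, neg_mul,
      smul_neg, fin5_add, Fin.isValue, Fin.reduceAdd, add_zero]
    module
  have q2 : p • (d (i + 3) * d (i + 4) * d (i + 4)) + p • (d (i + 4) * d (i + 4) * d (i + 3))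
      - (p ^ 2 + 1) • (d (i + 4) * d (i + 3) * d (i + 4)) + (p - 1) ^ 2 • d (i + 3)
      = -((p - 1) ^ 2 • (d (i + 4) * ((a (i + 2) * a (i + 4)) • 1 + a (i + 3) • d (i + 1))
        - ((a (i + 2) * a (i + 3)) • 1 + a (i + 4) • d (i + 1)))) := by
    linear_combination (norm := skip)
      -((p - 1) * a (i + 3)) • (h.c (i + 4)) + ((p - 1)) • (h.x (i + 3))
      - (p) • (d (i + 4) * (h.z (i + 3))) + ((h.z (i + 3)) * d (i + 4))
    simp only [smul_mul_assoc, mul_smul_comm, mul_add, add_mul, mul_sub, sub_mul, smul_add,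
      smul_sub, mul_assoc, mul_one, one_mul, mul_neg, neg_mul,
      smul_neg, fin5_add, Fin.isValue, Fin.reduceAdd, add_zero]
    module
  have q3 : p • (d i * d (i + 4) * d (i + 4)) + p • (d (i + 4) * d (i + 4) * d i)
      - (p ^ 2 + 1) • (d (i + 4) * d i * d (i + 4)) + (p - 1) ^ 2 • d i
      = -((p - 1) ^ 2 • (d (i + 4) * ((a (i + 3) * a i) • 1 + a (i + 4) • d (i + 2))
        - ((a (i + 4) * a i) • 1 + a (i + 3) • d (i + 2)))) := by
    linear_combination (norm := skip)
      -(p * (p - 1) * a (i + 4)) • (h.c (i + 2)) + ((p - 1)) • (h.y (i + 4))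
      + (d (i + 4) * (h.z (i + 4))) - (p) • ((h.z (i + 4)) * d (i + 4))
    simp only [smul_mul_assoc, mul_smul_comm, mul_add, add_mul, mul_sub, sub_mul, smul_add,
      smul_sub, mul_assoc, mul_one, one_mul, mul_neg, neg_mul,
      smul_neg, fin5_add, Fin.isValue, Fin.reduceAdd, add_zero]
    module
  refine sub_eq_zero.mp (eq_zero_of_qcomm_of_cubic h.unit_sub (y := d (i + 4)) ?_ ?_)
  · refine h.cancel 0 0 0 ?_
    linear_combination (norm := skip)
      -(p * a (i + 2)) • ((h.c (i + 4)) * d i) + (p * a (i + 2)) • (d i * (h.c (i + 4)))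
      - (p) • ((h.cw (i + 1)) * d (i + 3)) + (p) • (d (i + 3) * (h.cw (i + 1)))
      + (p) • ((h.cw (i + 3)) * d (i + 2)) - (p) • (d (i + 2) * (h.cw (i + 3)))
      + (p) • (d (i + 1) * rb) - (rb * d (i + 1)) + (a (i + 2)) • (d (i + 4) * (h.vz i))
      - (p * a (i + 2)) • ((h.vz i) * d (i + 4)) + (p * a (i + 2)) • (d (i + 1) * (h.vz (i + 4)))
      - (a (i + 2)) • ((h.vz (i + 4)) * d (i + 1)) - ((p - 1)) • (h.x i)
      - ((p - 1) * a (i + 1)) • (h.x (i + 3)) + ((p - 1) * a (i + 3)) • (h.y (i + 1))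
      + ((p - 1)) • (h.y (i + 4)) + (w (i + 3) * (h.z (i + 1))) - (p) • ((h.z (i + 1)) * w (i + 3))
      + ((p - 1) * a (i + 2) * a (i + 4)) • (h.z (i + 1)) + (p) • (w (i + 1) * (h.z (i + 3)))
      - ((h.z (i + 3)) * w (i + 1)) - ((p - 1) * a i * a (i + 2)) • (h.z (i + 3))
    simp only [smul_mul_assoc, mul_smul_comm, mul_add, add_mul, mul_sub, sub_mul, smul_add,
      smul_sub, mul_assoc, mul_one, one_mul, mul_neg, neg_mul,
      smul_neg, fin5_add, Fin.isValue, Fin.reduceAdd, add_zero]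
    module
  -- Words are normalized by moving `d (i + 4)` to the right past `d (i + 1)` and `w (i + 1)`, with
  -- which it commutes.
  · have hc := h.c (i + 4)
    have hw := h.cw (i + 1)
    simp only [fin5_add, Fin.isValue, Fin.reduceAdd] at hc hw
    have hc2 : ∀ x, d (i + 4) * (d (i + 1) * x) = d (i + 1) * (d (i + 4) * x) := fun x => by
      rw [← mul_assoc, hc, mul_assoc]
    have hw2 : ∀ x, d (i + 4) * (w (i + 1) * x) = w (i + 1) * (d (i + 4) * x) := fun x => by
      rw [← mul_assoc, hw, mul_assoc]
    linear_combination (norm := skip)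
      ((p - 1)^3 * a (i + 3)) • (h.c (i + 2)) + ((p - 1)) • q1 - ((p - 1) * a i * a (i + 2)) • q2
      + (p) • (w (i + 1) * q2) - (q2 * w (i + 1)) + (p * a (i + 2)) • (d (i + 1) * q3)
      - (a (i + 2)) • (q3 * d (i + 1)) - (p * a (i + 2)) • ((h.vz i) * d (i + 4) * d (i + 4))
      - (p * a (i + 2)) • (d (i + 4) * d (i + 4) * (h.vz i))
      + ((1 + p^2) * a (i + 2)) • (d (i + 4) * (h.vz i) * d (i + 4))
      - ((p - 1)^2 * a (i + 2)) • (h.vz i) - ((p - 1)^2 * a (i + 3)) • ((h.y (i + 1)) * d (i + 4))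
      + ((p - 1)^2 * a (i + 4)) • (h.y (i + 1)) + ((p - 1)^2 * a (i + 2) * a (i + 3)) • (h.z (i + 1))
      - ((p - 1)^2 * a (i + 2) * a (i + 4)) • (d (i + 4) * (h.z (i + 1)))
    simp only [smul_mul_assoc, mul_smul_comm, mul_add, add_mul, mul_sub, sub_mul, smul_add,
      smul_sub, mul_assoc, mul_one, one_mul, mul_neg, neg_mul,
      smul_neg, hc, hc2, hw, hw2, fin5_add, Fin.isValue, Fin.reduceAdd, add_zero]
    module

end PrePentagon

end Pentagon

/-! ### Complete pentagons and the products of resolved crossings -/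

section Pentagon

variable {R A : Type*} [CommRing R] [Ring A] [Algebra R A] {p : R}

namespace PrePentagon

variable {a : Fin 5 → R} {d w v : Fin 5 → A}

theorem ra_of_rb (h : PrePentagon p a d w v) (i : Fin 5)
    (rb : TriRel p (d (i + 2)) (w (i + 3)) (w i)
      ((a (i + 1) * a (i + 4)) • 1 + a (i + 2) • v (i + 4))) :
    TriRel p (w (i + 2)) (d (i + 4)) (w i)
      ((a (i + 1) * a (i + 4)) • 1 + a (i + 3) • v (i + 1)) := by
  refine h.cancel 0 1 0 ?_
  linear_combination (norm := skip)
    -(p) • ((h.c (i + 2)) * d (i + 3)) + (p) • (d (i + 3) * (h.c (i + 2))) + ((p - 1)) • rb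
    - ((p - 1) * a (i + 3)) • (h.vz (i + 1)) + ((p - 1) * a (i + 2)) • (h.vz (i + 4))
    - (d (i + 4) * (h.z (i + 2))) + (p) • ((h.z (i + 2)) * d (i + 4))
    - (p) • (d (i + 2) * (h.z (i + 3))) + ((h.z (i + 3)) * d (i + 2))
  simp only [smul_mul_assoc, mul_smul_comm, mul_add, add_mul, mul_sub, sub_mul, smul_add,
    smul_sub, mul_assoc, mul_one, one_mul, mul_neg, neg_mul,
    smul_neg, fin5_add, Fin.isValue, Fin.reduceAdd, add_zero]
  module

/-- The step by `4 = -1` reaches all indices modulo five. -/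
theorem ra_of_ra (h : PrePentagon p a d w v) {j : Fin 5}
    (ra : TriRel p (w (j + 2)) (d (j + 4)) (w j)
      ((a (j + 1) * a (j + 4)) • 1 + a (j + 3) • v (j + 1))) (i : Fin 5) :
    TriRel p (w (i + 2)) (d (i + 4)) (w i)
      ((a (i + 1) * a (i + 4)) • 1 + a (i + 3) • v (i + 1)) := by
  have step : ∀ j, TriRel p (w (j + 2)) (d (j + 4)) (w j)
      ((a (j + 1) * a (j + 4)) • 1 + a (j + 3) • v (j + 1)) →
      TriRel p (w (j + 4 + 2)) (d (j + 4 + 4)) (w (j + 4))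
      ((a (j + 4 + 1) * a (j + 4 + 4)) • 1 + a (j + 4 + 3) • v (j + 4 + 1)) := fun j hj => by
    simpa only [fin5_add, Fin.isValue, Fin.reduceAdd, add_zero] using h.ra_add_four j hj
  have h1 := step _ ra
  have h2 := step _ h1
  have h3 := step _ h2
  have h4 := step _ h3
  have hi : ∀ i j : Fin 5, i = j ∨ i = j + 4 ∨ i = j + 4 + 4 ∨ i = j + 4 + 4 + 4 ∨
      i = j + 4 + 4 + 4 + 4 := by decide
  rcases hi i j with rfl | rfl | rfl | rfl | rfl <;> assumption

theorem vb_of_va (h : PrePentagon p a d w v) {j : Fin 5}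
    (va : TriRel p (d (j + 4)) (v (j + 2)) (v j)
      ((a (j + 1) * a (j + 4)) • 1 + a (j + 3) • w (j + 1))) (i : Fin 5) :
    TriRel p (v (i + 3)) (d (i + 2)) (v i)
      ((a (i + 1) * a (i + 4)) • 1 + a (i + 2) • w (i + 4)) := by
  have n1 : (-1 : Fin 5) = 4 := rfl
  have n2 : (-2 : Fin 5) = 3 := rfl
  have n3 : (-3 : Fin 5) = 2 := rfl
  have n4 : (-4 : Fin 5) = 1 := rfl
  -- The relations `va` and `vb` are `rb` and `ra` of the reflected pentagon.
  have H := h.reflect.ra_of_ra (j := 4 - j) (h.reflect.ra_of_rb (4 - j) (by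
    fin_cases j <;> simpa [mul_comm, n1, n2, n3, n4] using va)) (4 - i)
  fin_cases i <;> simpa [mul_comm, n1, n2, n3, n4] using H

theorem va_of_va (h : PrePentagon p a d w v) {j : Fin 5}
    (va : TriRel p (d (j + 4)) (v (j + 2)) (v j)
      ((a (j + 1) * a (j + 4)) • 1 + a (j + 3) • w (j + 1))) (i : Fin 5) :
    TriRel p (d (i + 4)) (v (i + 2)) (v i)
      ((a (i + 1) * a (i + 4)) • 1 + a (i + 3) • w (i + 1)) := by
  have n1 : (-1 : Fin 5) = 4 := rfl
  have n2 : (-2 : Fin 5) = 3 := rfl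
  have n3 : (-3 : Fin 5) = 2 := rfl
  have n4 : (-4 : Fin 5) = 1 := rfl
  have H := h.reflect.rb_of_ra (4 - i) (by
    have := h.vb_of_va va i
    fin_cases i <;> simpa [mul_comm, n1, n2, n3, n4] using this)
  fin_cases i <;> simpa [mul_comm, n1, n2, n3, n4] using H

end PrePentagon

/-- All relations between the sides, the diagonals and the resolved crossings of a pentagon. -/
structure Pentagon (p : R) (a : Fin 5 → R) (d w v : Fin 5 → A) : Prop
    extends PrePentagon p a d w v where
  ra : ∀ i, TriRel p (w (i + 2)) (d (i + 4)) (w i)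
    ((a (i + 1) * a (i + 4)) • 1 + a (i + 3) • v (i + 1))
  va : ∀ i, TriRel p (d (i + 4)) (v (i + 2)) (v i)
    ((a (i + 1) * a (i + 4)) • 1 + a (i + 3) • w (i + 1))

/-- One relation with five vertices for each of the two resolutions is enough, at whatever positions
`j` and `k` they are known. -/
theorem PrePentagon.toPentagon {a : Fin 5 → R} {d w v : Fin 5 → A}
    (h : PrePentagon p a d w v) {j k : Fin 5}
    (ra : TriRel p (w (j + 2)) (d (j + 4)) (w j)
      ((a (j + 1) * a (j + 4)) • 1 + a (j + 3) • v (j + 1)))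
    (va : TriRel p (d (k + 4)) (v (k + 2)) (v k)
      ((a (k + 1) * a (k + 4)) • 1 + a (k + 3) • w (k + 1))) : Pentagon p a d w v :=
  ⟨h, h.ra_of_ra ra, h.va_of_va va⟩

/-- A pentagon with two equal consecutive vertices. -/
theorem PrePentagon.toPentagon_of_degenerate {a : Fin 5 → R} {d w v : Fin 5 → A}
    (h : PrePentagon p a d w v) (i : Fin 5) (ha : a i = 1) (h0 : d i = a (i + 4) • 1)
    (h1 : d (i + 1) = a (i + 1) • 1) (h4 : d (i + 4) = d (i + 2)) : Pentagon p a d w v := by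
  have cancel : ∀ {x y : A}, (p - 1) • x = (p - 1) • y → x = y :=
    fun H => h.unit_sub.smul_left_cancel.mp H
  -- When two consecutive vertices coincide, each of these crossings has two commuting diagonals and
  -- resolves to a side or to a diagonal.
  have W1 : w (i + 1) = a (i + 2) • 1 := by
    refine cancel ?_
    have := h.z (i + 1)
    simp only [fin5_add, Fin.isValue, Fin.reduceAdd, add_zero, ha, h0, h1, h4] at this
    linear_combination (norm := skip) this
    simp only [smul_mul_assoc, mul_smul_comm, one_mul, mul_one]
    module
  have W4 : w (i + 4) = a (i + 3) • 1 := by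
    refine cancel ?_
    have := h.z (i + 4)
    simp only [fin5_add, Fin.isValue, Fin.reduceAdd, add_zero, ha, h0, h1, h4] at this
    linear_combination (norm := skip) this
    simp only [smul_mul_assoc, mul_smul_comm, one_mul, mul_one]
    module
  have V1 : v (i + 1) = a (i + 2) • 1 := by
    refine cancel ?_
    have := h.vz (i + 1)
    simp only [fin5_add, Fin.isValue, Fin.reduceAdd, add_zero, ha, h0, h1, h4] at this
    linear_combination (norm := skip) this
    simp only [smul_mul_assoc, mul_smul_comm, one_mul, mul_one]
    module
  have V4 : v (i + 4) = a (i + 3) • 1 := by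
    refine cancel ?_
    have := h.vz (i + 4)
    simp only [fin5_add, Fin.isValue, Fin.reduceAdd, add_zero, ha, h0, h1, h4] at this
    linear_combination (norm := skip) this
    simp only [smul_mul_assoc, mul_smul_comm, one_mul, mul_one]
    module
  have W0 : w i = d (i + 3) := by
    refine cancel ?_
    have := h.z i
    simp only [ha, h0, h1] at this
    linear_combination (norm := skip) this
    simp only [smul_mul_assoc, mul_smul_comm, one_mul, mul_one]
    module
  have V0 : v i = d (i + 3) := by
    refine cancel ?_
    have := h.vz i
    simp only [ha, h0, h1] at this
    linear_combination (norm := skip) this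
    simp only [smul_mul_assoc, mul_smul_comm, one_mul, mul_one]
    module
  refine h.toPentagon (j := i + 4) (k := i + 4) ?_ ?_
  all_goals
    simp only [TriRel, fin5_add, Fin.isValue, Fin.reduceAdd, add_zero, ha, W1, W4, V0, V1, V4, W0,
      smul_mul_assoc, mul_smul_comm, one_mul, mul_one]
    module

namespace Pentagon

variable {a : Fin 5 → R} {d w v : Fin 5 → A}

theorem rb (h : Pentagon p a d w v) (i : Fin 5) :
    TriRel p (d (i + 2)) (w (i + 3)) (w i)
      ((a (i + 1) * a (i + 4)) • 1 + a (i + 2) • v (i + 4)) :=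
  h.rb_of_ra i (h.ra i)

theorem vb (h : Pentagon p a d w v) (i : Fin 5) :
    TriRel p (v (i + 3)) (d (i + 2)) (v i)
      ((a (i + 1) * a (i + 4)) • 1 + a (i + 2) • w (i + 4)) :=
  h.vb_of_va (h.va 0) i

/-- In terms of sets this is the case of two nested unions `(a, b] ∪ (c, d] ⊆ (a, b] ∪ (c, e]`. It
makes two twisted chords commute in `chordComm_twist`. -/
theorem cwv (h : Pentagon p a d w v) (i : Fin 5) :
    w (i + 1) * v i = v i * w (i + 1) := by
  refine h.cancel 0 1 1 ?_
  linear_combination (norm := skip)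
    -((p - 1) * (p + 1)) • (h.c i) - ((p - 1) * (p + 1) * a (i + 1)) • (d i * (h.c (i + 4)))
    + ((p - 1) * (p + 1)) • (h.cv (i + 3)) + ((p - 1) * (p + 1) * a (i + 1)) • (h.ra (i + 2))
    - (p * (p - 1) * a (i + 1)) • (h.rb (i + 2)) - ((p + 1)) • (d (i + 1) * (h.va (i + 3)))
    + ((p + 1)) • ((h.va (i + 3)) * d (i + 1)) - ((p - 1) * a (i + 1)) • (h.vb (i + 2))
    + ((p + 1)) • ((h.vx i) * d (i + 2)) - ((p + 1)) • (d (i + 2) * (h.vx i))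
    + (p * a (i + 1)) • (d (i + 4) * (h.vz i)) - (a (i + 1)) • ((h.vz i) * d (i + 4))
    - (p * (p - 1) * a (i + 1) * a (i + 4)) • (h.vz (i + 1))
    + ((p - 1) * a (i + 1)) • (h.vz (i + 2))
    + ((p - 1) * (p + 1) * a i * a (i + 1)) • (h.vz (i + 3))
    - (p * a (i + 1)) • ((h.z i) * d (i + 4)) + (p^2 * a (i + 1)) • (d (i + 4) * (h.z i))
    - ((p + 1)) • (v i * (h.z (i + 1))) + ((p + 1)) • ((h.z (i + 1)) * v i)
    - ((p - 1) * a (i + 1) * a (i + 4)) • (h.z (i + 1)) - ((p - 1) * a (i + 1)) • (h.z (i + 2))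
    - ((p - 1) * (p + 1) * a (i + 1)) • ((h.z (i + 4)) * d (i + 1))
  simp only [smul_mul_assoc, mul_smul_comm, mul_add, add_mul, mul_sub, sub_mul, smul_add,
    smul_sub, mul_assoc, mul_one, one_mul, mul_neg, neg_mul,
    smul_neg, fin5_add, Fin.isValue, Fin.reduceAdd, add_zero]
  module

/-- The diagonal `d (i + 4)` is recovered from two resolved crossings; this is a relation of a
quadrilateral after the half twist in `quadRel_twist_corner`. -/
theorem w_w_two (h : Pentagon p a d w v) (i : Fin 5) :
    TriRel p (w i) (w (i + 2)) (d (i + 4)) ((a (i + 3) * a (i + 4)) • 1 + a (i + 1) • v (i + 1)) := by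
  refine h.cancel 0 1 0 ?_
  linear_combination (norm := skip)
    (p) • (d (i + 2) * (h.cw i)) - (p) • ((h.cw i) * d (i + 2)) - (p) • ((h.ra (i + 3)) * d (i + 3))
    + (d (i + 3) * (h.ra (i + 3))) - ((p - 1) * a (i + 1)) • (h.vb (i + 1))
    + ((p - 1) * a (i + 2)) • (h.y i) + ((p - 1)) • (h.y (i + 3)) + (p) • (w i * (h.z (i + 2)))
    - ((h.z (i + 2)) * w i)
  simp only [smul_mul_assoc, mul_smul_comm, mul_add, add_mul, mul_sub, sub_mul, smul_add,
    smul_sub, mul_assoc, mul_one, one_mul, mul_neg, neg_mul,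
    smul_neg, fin5_add, Fin.isValue, Fin.reduceAdd, add_zero]
  module

/-- Both products come from words in `d i`, `d (i + 1)`, `d (i + 2)`, in which the outer two
commute. They can be exchanged at the price of terms linear in the crossings; the next three
identities are the other orders. -/
theorem exch_dw (h : Pentagon p a d w v) (i : Fin 5) :
      - ((p + 1)) • (d i * v (i + 1)) + ((p + 1)) • (d (i + 2) * w i) =
      - ((p + 1) * a i) • w (i + 2) - w (i + 3) + v (i + 3) + ((p + 1) * a (i + 1)) • v (i + 4) := by
  refine h.cancel 0 2 0 ?_
  linear_combination (norm := skip)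
    -(p) • (d (i + 1) * (h.c i)) + (p^3) • ((h.c i) * d (i + 1)) + ((p - 1)) • (h.ra (i + 3))
    - ((p - 1)) • (h.vb (i + 3)) + (p) • ((h.vz (i + 1)) * d i) - (p^2) • (d i * (h.vz (i + 1)))
    - (p * (p - 1) * a (i + 1)) • (h.vz (i + 4)) - (p) • ((h.z i) * d (i + 2))
    + (p^2) • (d (i + 2) * (h.z i)) + (p * (p - 1) * a i) • (h.z (i + 2))
  simp only [smul_mul_assoc, mul_smul_comm, mul_add, add_mul, mul_sub, sub_mul, smul_add,
    smul_sub, mul_assoc, mul_one, one_mul, mul_neg, neg_mul,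
    smul_neg, fin5_add, Fin.isValue, Fin.reduceAdd, add_zero]
  module

theorem exch_wd (h : Pentagon p a d w v) (i : Fin 5) :
      ((p + 1)) • (w i * d (i + 2)) - ((p + 1)) • (v (i + 1) * d i) =
      - ((p + 1) * a i) • w (i + 2) - (p) • w (i + 3) + (p) • v (i + 3)
      + ((p + 1) * a (i + 1)) • v (i + 4) := by
  refine h.cancel 0 2 0 ?_
  linear_combination (norm := skip)
    -(d (i + 1) * (h.c i)) + (p^2) • ((h.c i) * d (i + 1)) + (p * (p - 1)) • (h.ra (i + 3))
    - (p * (p - 1)) • (h.vb (i + 3)) + ((h.vz (i + 1)) * d i) - (p) • (d i * (h.vz (i + 1)))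
    - ((p - 1) * a (i + 1)) • (h.vz (i + 4)) - ((h.z i) * d (i + 2)) + (p) • (d (i + 2) * (h.z i))
    + ((p - 1) * a i) • (h.z (i + 2))
  simp only [smul_mul_assoc, mul_smul_comm, mul_add, add_mul, mul_sub, sub_mul, smul_add,
    smul_sub, mul_assoc, mul_one, one_mul, mul_neg, neg_mul,
    smul_neg, fin5_add, Fin.isValue, Fin.reduceAdd, add_zero]
  module

theorem exch_wd_succ (h : Pentagon p a d w v) (i : Fin 5) :
      ((p + 1)) • (w (i + 1) * d i) - ((p + 1)) • (v i * d (i + 2)) = - w (i + 3)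
      - ((p + 1) * a (i + 1)) • w (i + 4) + ((p + 1) * a i) • v (i + 2) + v (i + 3) := by
  refine h.cancel 0 2 0 ?_
  linear_combination (norm := skip)
    -(p) • ((h.c i) * d (i + 1)) + (p^3) • (d (i + 1) * (h.c i)) + ((p - 1)) • (h.rb (i + 3))
    - ((p - 1)) • (h.va (i + 3)) + (p) • (d (i + 2) * (h.vz i)) - (p^2) • ((h.vz i) * d (i + 2))
    - (p * (p - 1) * a i) • (h.vz (i + 2)) - (p) • (d i * (h.z (i + 1)))
    + (p^2) • ((h.z (i + 1)) * d i) + (p * (p - 1) * a (i + 1)) • (h.z (i + 4))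
  simp only [smul_mul_assoc, mul_smul_comm, mul_add, add_mul, mul_sub, sub_mul, smul_add,
    smul_sub, mul_assoc, mul_one, one_mul, mul_neg, neg_mul,
    smul_neg, fin5_add, Fin.isValue, Fin.reduceAdd, add_zero]
  module

theorem exch_dw_succ (h : Pentagon p a d w v) (i : Fin 5) :
      ((p + 1)) • (d i * w (i + 1)) - ((p + 1)) • (d (i + 2) * v i) = - (p) • w (i + 3)
      - ((p + 1) * a (i + 1)) • w (i + 4) + ((p + 1) * a i) • v (i + 2) + (p) • v (i + 3) := by
  refine h.cancel 0 2 0 ?_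
  linear_combination (norm := skip)
    -((h.c i) * d (i + 1)) + (p^2) • (d (i + 1) * (h.c i)) + (p * (p - 1)) • (h.rb (i + 3))
    - (p * (p - 1)) • (h.va (i + 3)) + (d (i + 2) * (h.vz i)) - (p) • ((h.vz i) * d (i + 2))
    - ((p - 1) * a i) • (h.vz (i + 2)) - (d i * (h.z (i + 1))) + (p) • ((h.z (i + 1)) * d i)
    + ((p - 1) * a (i + 1)) • (h.z (i + 4))
  simp only [smul_mul_assoc, mul_smul_comm, mul_add, add_mul, mul_sub, sub_mul, smul_add,
    smul_sub, mul_assoc, mul_one, one_mul, mul_neg, neg_mul,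
    smul_neg, fin5_add, Fin.isValue, Fin.reduceAdd, add_zero]
  module

/-- This and the next two identities replace a product of two resolved crossings by products that
contain at most one of them. -/
theorem vw_two (h : Pentagon p a d w v) (i : Fin 5) :
      (v i * w (i + 2)) = (p) • (d i * w (i + 4)) - ((p + 1) * a (i + 1)) • (d i * v (i + 3))
      + (d (i + 3) * v (i + 3)) + ((p + 1) * a (i + 1) * a (i + 4)) • w (i + 2)
      - (p * a (i + 1)) • v (i + 1) - (a (i + 2)) • d (i + 1) - (p * a i) • d (i + 2)
      + (p) • d (i + 4)
      + ((-p * a (i + 3) * a (i + 4) + (p + 1) * a i * a (i + 1) * a (i + 2))) • (1 : A) := by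
  refine h.cancel 0 1 1 ?_
  linear_combination (norm := skip)
    -((p + 1)) • ((h.c (i + 3)) * v (i + 1)) - (p * (p + 1)) • (d (i + 1) * (h.cw (i + 2)))
    - (p) • ((h.exch_dw_succ (i + 1)) * d i) + (d i * (h.exch_dw_succ (i + 1)))
    + (p * (p + 1) * a (i + 1)) • (h.va (i + 1)) - ((p + 1)) • (d (i + 3) * (h.vb (i + 3)))
    - (p) • (h.vx (i + 4)) + ((p + 1)) • ((h.vz i) * w (i + 2)) - (p^2) • (h.x (i + 4))
    + ((p + 1) * a (i + 2)) • (h.y i)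
  simp only [smul_mul_assoc, mul_smul_comm, mul_add, add_mul, mul_sub, sub_mul, smul_add,
    smul_sub, mul_assoc, mul_one, one_mul, mul_neg, neg_mul,
    smul_neg, fin5_add, Fin.isValue, Fin.reduceAdd, add_zero]
  module

theorem wv_two (h : Pentagon p a d w v) (i : Fin 5) :
      (w (i + 2) * v i) = (d i * w (i + 4)) - ((p + 1) * a (i + 1)) • (d i * v (i + 3))
      + (p) • (d (i + 3) * v (i + 3)) + ((p + 1) * a (i + 1) * a (i + 4)) • w (i + 2)
      - (p * a (i + 1)) • v (i + 1) - (p * a (i + 2)) • d (i + 1) - (a i) • d (i + 2)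
      + (p) • d (i + 4)
      + ((-p * a (i + 3) * a (i + 4) + (p + 1) * a i * a (i + 1) * a (i + 2))) • (1 : A) := by
  refine h.cancel 0 1 1 ?_
  linear_combination (norm := skip)
    -(p * (p + 1)) • (v (i + 1) * (h.c (i + 3))) - ((p + 1)) • ((h.cw (i + 2)) * d (i + 1))
    - (p) • ((h.exch_wd_succ (i + 1)) * d i) + (d i * (h.exch_wd_succ (i + 1)))
    + (p * (p + 1) * a (i + 1)) • (h.va (i + 1)) - ((p + 1)) • ((h.vb (i + 3)) * d (i + 3))
    - (h.vx (i + 4)) - ((p - 1) * (p + 1)) • (h.vy (i + 3)) + ((p + 1)) • (w (i + 2) * (h.vz i))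
    - (p) • (h.x (i + 4)) + ((p + 1) * a (i + 2)) • (h.y i)
  simp only [smul_mul_assoc, mul_smul_comm, mul_add, add_mul, mul_sub, sub_mul, smul_add,
    smul_sub, mul_assoc, mul_one, one_mul, mul_neg, neg_mul,
    smul_neg, fin5_add, Fin.isValue, Fin.reduceAdd, add_zero]
  module

theorem vw_three (h : Pentagon p a d w v) (i : Fin 5) :
      (p) • (v i * w (i + 3)) = (d (i + 1) * w (i + 1))
      - ((p + 1) * a (i + 4)) • (d (i + 1) * v (i + 2)) + (p) • (d (i + 3) * v (i + 2))
      + ((p + 1) * a (i + 1) * a (i + 4)) • w (i + 3) - (a (i + 4)) • v (i + 4)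
      - (p * a (i + 3)) • d i + d (i + 2) - (a i) • d (i + 4)
      + (((p + 1) * a i * a (i + 3) * a (i + 4) + -a (i + 1) * a (i + 2))) • (1 : A) := by
  refine h.cancel 0 1 1 ?_
  linear_combination (norm := skip)
    -(p^2 * (p + 1)) • ((h.c (i + 1)) * v (i + 4)) + (p * (p + 1)) • (d i * (h.cw (i + 3)))
    + (p) • ((h.exch_dw (i + 3)) * d (i + 1)) - (p^2) • (d (i + 1) * (h.exch_dw (i + 3)))
    - (p) • (d (i + 3) * (h.exch_wd_succ (i + 4))) + (p^2) • (d (i + 3) * (h.exch_dw_succ (i + 4)))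
    - (p * (p + 1)) • (d (i + 3) * (h.rb (i + 2))) + ((p + 1) * a (i + 4)) • (h.vb (i + 4))
    - (p) • (h.vy (i + 1)) + (p * (p + 1)) • ((h.vz i) * w (i + 3))
    + (p * (p + 1) * a (i + 3)) • (h.x i) - (h.y (i + 1))
  simp only [smul_mul_assoc, mul_smul_comm, mul_add, add_mul, mul_sub, sub_mul, smul_add,
    smul_sub, mul_assoc, mul_one, one_mul, mul_neg, neg_mul,
    smul_neg, fin5_add, Fin.isValue, Fin.reduceAdd, add_zero]
  module

theorem vv (h : Pentagon p a d w v) (i : Fin 5) :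
      (v (i + 1) * v i) = (w i * w (i + 1)) - (p) • (d (i + 1) * w (i + 3))
      + (p) • (d (i + 1) * v (i + 3)) + (a (i + 1)) • w (i + 2)
      + ((p + 1) * a i * a (i + 1)) • w (i + 3) + (a i) • w (i + 4) - (a (i + 1)) • v (i + 2)
      - ((p + 1) * a i * a (i + 1)) • v (i + 3) - (a i) • v (i + 4) := by
  refine h.cancel 1 1 0 ?_
  linear_combination (norm := skip)
    -(p^2 * (p - 1)) • (h.cwv i) - (p * (p - 1) * a i) • (h.exch_dw (i + 1))
    - (p * (p - 1) * a (i + 1)) • (h.exch_dw (i + 4)) + ((p - 1)) • (d (i + 1) * (h.exch_wd_succ i))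
    + ((p - 1) * (p + 1)) • (d (i + 1) * (h.rb (i + 3)))
    - ((p - 1) * (p + 1)) • (d (i + 1) * (h.va (i + 3))) - (p^2) • ((h.vz i) * w (i + 1))
    + (p) • ((h.vz (i + 1)) * v i) - (p) • ((h.z i) * w (i + 1)) + (p^2) • ((h.z (i + 1)) * v i)
  simp only [smul_mul_assoc, mul_smul_comm, mul_add, add_mul, mul_sub, sub_mul, smul_add,
    smul_sub, mul_assoc, mul_one, one_mul, mul_neg, neg_mul,
    smul_neg, fin5_add, Fin.isValue, Fin.reduceAdd, add_zero]
  module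

theorem wv (h : Pentagon p a d w v) (i : Fin 5) :
      (p) • (w i * v i) - (p) • (v i * w i) = - ((p - 1) * (p + 1)) • (d i * d i)
      + ((p - 1) * (p + 1) * a (i + 1)) • (d i * d (i + 3))
      + ((p - 1) * (p + 1)) • (d (i + 1) * d (i + 1))
      - ((p - 1) * (p + 1) * a (i + 4)) • (d (i + 1) * d (i + 3))
      + ((p - 1) * (p + 1) * a i * a (i + 4)) • d i
      - ((p - 1) * (p + 1) * a i * a (i + 1)) • d (i + 1) := by
  refine h.cancel 0 1 0 ?_
  linear_combination (norm := skip)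
    ((p - 1)^2 * (p + 1) * a (i + 1)) • (h.c (i + 3)) + (p * (p - 1) * (p + 1) * a i) • (h.cv i)
    + ((p - 1) * (p + 1)) • ((h.vx i) * d i) - ((p - 1) * (p + 1)) • (d (i + 1) * (h.vy i))
    + (p^2) • ((h.vz i) * v i) - (p^2) • (v i * (h.vz i)) + (p) • ((h.z i) * v i)
    - (p) • (v i * (h.z i))
  simp only [smul_mul_assoc, mul_smul_comm, mul_add, add_mul, mul_sub, sub_mul, smul_add,
    smul_sub, mul_assoc, mul_one, one_mul, mul_neg, neg_mul,
    smul_neg, fin5_add, Fin.isValue, Fin.reduceAdd, add_zero]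
  module

end Pentagon

end Pentagon

/-! ### Casimir elements in a pentagon -/

section Pentagon

variable {R A : Type*} [CommRing R] [Ring A] [Algebra R A] {p : R}

/-- The Casimir element of a quadrilateral with sides `s₁, …, s₄`, diagonals `x`, `y` and resolved
crossing `z`, multiplied by `p + 1`. -/
def quadCasimir (p : R) (x y z s₁ s₂ s₃ s₄ : A) : A :=
  (p * (p + 1)) • (x * y * z) + p ^ 2 • (x * x) + y * y + p ^ 2 • (z * z)
    + p • (s₁ * s₁ + s₂ * s₂ + s₃ * s₃ + s₄ * s₄)
    - (p * (p + 1)) • (x * (s₁ * s₂ + s₃ * s₄)) - (p + 1) • (y * (s₂ * s₃ + s₁ * s₄))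
    - (p * (p + 1)) • (z * (s₁ * s₃ + s₂ * s₄)) + (p + 1) ^ 2 • (s₁ * s₂ * s₃ * s₄) - p • 1

/-- The relations for the two resolutions together give `(p + 1) • (x * y) = p • (m - w) + (m - v)`,
where `m` is their common term. So the cubic term of the Casimir element can be replaced by the
quadratic term `v * w`. -/
theorem quadCasimir_eq {a b c : R} {x y w v s : A} (hm : IsUnit (p - 1))
    (hw : TriRel p x y w ((a * c) • 1 + b • s)) (hv : TriRel p y x v ((a * c) • 1 + b • s))
    (hs : s * w = w * s) :
    quadCasimir p x y w (a • 1) (b • 1) (c • 1) s =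
      -(p • (v * w)) + p ^ 2 • (x * x) + y * y
      - (p * (p + 1)) • (x * ((a * b) • 1 + c • s)) - (p + 1) • (y * ((b * c) • 1 + a • s))
      + p • (s * s) + ((p + 1) ^ 2 * (a * b * c)) • s
      + (p * (a ^ 2 + b ^ 2 + c ^ 2) - p) • 1 := by
  unfold quadCasimir
  refine hm.smul_left_cancel.mp ?_
  linear_combination (norm := skip)
    (p * (p - 1) * (p + 1) * b) • hs + (p) • (hv * w) + (p^2) • (hw * w)
  simp only [smul_mul_assoc, mul_smul_comm, mul_add, add_mul, mul_sub, sub_mul, smul_add,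
    smul_sub, mul_assoc, mul_one, one_mul, mul_neg, neg_mul,
    smul_neg]
  module

namespace Pentagon

variable {a : Fin 5 → R} {d w v : Fin 5 → A}

/-- The Casimir element of the quadrilateral obtained by omitting the vertex `i + 3`. -/
def casimir (p : R) (a : Fin 5 → R) (d w : Fin 5 → A) (i : Fin 5) : A :=
  quadCasimir p (d i) (d (i + 1)) (w i) (a (i + 4) • 1) (a i • 1) (a (i + 1) • 1) (d (i + 3))

theorem casimir_eq (h : Pentagon p a d w v) (i : Fin 5) :
    casimir p a d w i =
      -(p • (v i * w i)) + p ^ 2 • (d i * d i) + d (i + 1) * d (i + 1)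
      - (p * (p + 1)) • (d i * ((a (i + 4) * a i) • 1 + a (i + 1) • d (i + 3)))
      - (p + 1) • (d (i + 1) * ((a i * a (i + 1)) • 1 + a (i + 4) • d (i + 3)))
      + p • (d (i + 3) * d (i + 3)) + ((p + 1) ^ 2 * (a (i + 4) * a i * a (i + 1))) • d (i + 3)
      + (p * (a (i + 4) ^ 2 + a i ^ 2 + a (i + 1) ^ 2) - p) • 1 :=
  quadCasimir_eq h.unit_sub (h.z i) (h.vz i) (h.cw i)

/-- The Casimir element of a quadrilateral commutes with the chords that cross one side. -/
theorem casimir_commute (h : Pentagon p a d w v) (i : Fin 5) :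
    casimir p a d w (i + 2) * d (i + 4) = d (i + 4) * casimir p a d w (i + 2) := by
  rw [h.casimir_eq]
  refine h.cancel 1 0 0 ?_
  linear_combination (norm := skip)
    (p^2 * (p + 1) * a (i + 3)) • ((h.c i) * d (i + 4))
    - (p^2 * (p + 1) * a (i + 3)) • (d (i + 4) * (h.c i)) - (p^2 * (p - 1) * a (i + 4)) • (h.c i)
    - ((p - 1) * a (i + 3)) • (h.c (i + 1)) - (p^2 * (p + 1) * a (i + 3)) • (d i * (h.c (i + 2)))
    + (p^3) • ((h.c (i + 2)) * d (i + 2)) + (p^3) • (d (i + 2) * (h.c (i + 2)))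
    - (p^2 * (p + 1) * a (i + 1) * a (i + 2)) • (h.c (i + 2))
    - (p * (p + 1) * a (i + 1)) • ((h.c (i + 3)) * d (i + 4))
    + (p * (p + 1) * a (i + 1)) • (d (i + 4) * (h.c (i + 3)))
    - (p^2 * (p - 1) * a (i + 3)) • (h.cv (i + 4)) + (p^2 * (p - 1) * a (i + 3)) • (h.cw (i + 4))
    + ((p - 1) * a (i + 1)) • (h.exch_dw (i + 3)) - ((p - 1) * a (i + 1)) • (h.exch_wd_succ (i + 3))
    - (p * (p - 1) * a (i + 3)) • (h.vv (i + 1)) - (p * (p - 1)) • (h.vw_two i)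
    + ((p - 1)) • (h.vw_three (i + 2)) - (p) • (v (i + 2) * (h.ra i)) + (p) • ((h.va i) * w (i + 2))
    + ((p - 1) * (p + 1) * a (i + 1)) • (h.va (i + 1)) - (p * (p - 1)) • (h.vx (i + 4))
    - ((p - 1)) • (h.vy (i + 3)) - (a (i + 1) * a (i + 3)) • (h.vz i)
    + (a (i + 1) * a (i + 4)) • (h.vz (i + 2)) + (p * a (i + 2) * a (i + 3)) • (h.vz (i + 3))
    - ((h.vz (i + 3)) * d (i + 3)) - (p^2 * a (i + 3)) • ((h.vz (i + 4)) * d (i + 2))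
    + (p * (p + 1) * a (i + 1) * a (i + 2) * a (i + 3)) • (h.vz (i + 4))
    + (p^2) • ((h.vz (i + 4)) * d i) - (p * a (i + 1) * a (i + 3)) • (h.z i)
    + (p * a (i + 1) * a (i + 4)) • (h.z (i + 2)) - (p * a (i + 2) * a (i + 3)) • (h.z (i + 3))
    + (d (i + 3) * (h.z (i + 3))) - ((p + 1) * a (i + 1)) • (d i * (h.z (i + 3)))
    + (p^2 * a (i + 3)) • ((h.z (i + 4)) * d (i + 2))
    - (p * (p + 1) * a (i + 1) * a (i + 2) * a (i + 3)) • (h.z (i + 4))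
    + ((p + 1) * a (i + 1)) • ((h.z (i + 4)) * d (i + 3)) - (p^2) • (d i * (h.z (i + 4)))
  simp only [smul_mul_assoc, mul_smul_comm, mul_add, add_mul, mul_sub, sub_mul, smul_add,
    smul_sub, mul_assoc, mul_one, one_mul, mul_neg, neg_mul,
    smul_neg, fin5_add, Fin.isValue, Fin.reduceAdd, add_zero]
  module

/-- As `d i` and `d (i + 2)` commute, the q-commutator of `d i` with `[d (i + 2), d (i + 1)]_q` is
that of `d (i + 2)` with `[d i, d (i + 1)]_q`. -/
theorem twist_z (h : Pentagon p a d w v) (i : Fin 5) {e0 : A}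
    (he : TriRel p (d i) (v (i + 1)) e0 ((a (i + 4) * a (i + 2)) • 1 + a i • w (i + 2))) :
    TriRel p (d (i + 2)) (w i) e0 ((a (i + 4) * a (i + 2)) • 1 + a (i + 1) • v (i + 4)) := by
  refine h.cancel 0 1 0 ?_
  linear_combination (norm := skip)
    -(d (i + 1) * (h.c i)) + (p^2) • ((h.c i) * d (i + 1)) + ((p - 1)) • he + ((h.vz (i + 1)) * d i)
    - (p) • (d i * (h.vz (i + 1))) - ((p - 1) * a (i + 1)) • (h.vz (i + 4)) - ((h.z i) * d (i + 2))
    + (p) • (d (i + 2) * (h.z i)) + ((p - 1) * a i) • (h.z (i + 2))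
  simp only [smul_mul_assoc, mul_smul_comm, mul_add, add_mul, mul_sub, sub_mul, smul_add,
    smul_sub, mul_assoc, mul_one, one_mul, mul_neg, neg_mul,
    smul_neg, fin5_add, Fin.isValue, Fin.reduceAdd, add_zero]
  module

/-- An auxiliary identity for `twist_casimir`, where it is multiplied by `d (i + 2)` from both
sides. -/
theorem crossing_linear (h : Pentagon p a d w v) (i : Fin 5) :
      - (p) • (v (i + 3) * w i) + (p) • (w (i + 2) * d (i + 3)) + (v (i + 1) * d (i + 1)) - ((p + 1) * a (i + 4)) • (v (i + 1) * d (i + 3)) =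
      - ((p + 1) * a (i + 2) * a (i + 4)) • w i + (a (i + 4)) • v (i + 4) + (p * a (i + 3)) • d i
      - d (i + 2) + (a i) • d (i + 4)
      + ((-(p + 1) * a i * a (i + 3) * a (i + 4) + a (i + 1) * a (i + 2))) • (1 : A) := by
  refine h.cancel 0 1 1 ?_
  linear_combination (norm := skip)
    (p * (p + 1)) • ((h.c (i + 1)) * v (i + 4)) + (p^2 * (p + 1)) • (d (i + 4) * (h.cw i))
    - (p) • (d (i + 3) * (h.exch_dw_succ (i + 4))) + (p^2) • ((h.exch_dw_succ (i + 4)) * d (i + 3))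
    - ((p + 1) * a (i + 4)) • (h.va (i + 4)) + (p * (p + 1)) • (d (i + 1) * (h.vb (i + 1)))
    + (p^2) • (h.vx (i + 2)) - ((p - 1) * (p + 1)) • (h.vy (i + 1))
    - (p * (p + 1)) • ((h.vz (i + 3)) * w i) + (p) • (h.x (i + 2))
    - (p * (p + 1) * a i) • (h.y (i + 3))
  simp only [smul_mul_assoc, mul_smul_comm, mul_add, add_mul, mul_sub, sub_mul, smul_add,
    smul_sub, mul_assoc, mul_one, one_mul, mul_neg, neg_mul,
    smul_neg, fin5_add, Fin.isValue, Fin.reduceAdd, add_zero]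
  module

-- The second auxiliary identity for `twist_casimir`: a combination of products of two crossings is
-- expressed by products with at most one crossing.
set_option maxHeartbeats 4000000 in
theorem crossing_quadratic (h : Pentagon p a d w v) (i : Fin 5) :
      (p * a (i + 2)) • (w i * w (i + 4)) - (p) • (w i * v i) + (p) • (w (i + 1) * v (i + 1)) - (p * a (i + 4)) • (w (i + 2) * w (i + 1)) =
      (a (i + 2)) • (d i * w (i + 2)) - (a (i + 4)) • (d (i + 2) * w (i + 4)) - (d i * d i)
      + ((p + 1) * a (i + 1)) • (d i * d (i + 3)) - ((p - 1) * (p + 1)) • (d (i + 1) * d (i + 1))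
      + (p * a (i + 4)) • (d (i + 1) * d (i + 3))
      + ((-1 - p + p^2) * a (i + 2)) • (d (i + 1) * d (i + 4)) + (p^2) • (d (i + 2) * d (i + 2))
      - (p * (p + 1) * a i) • (d (i + 2) * d (i + 4)) - (p) • (d (i + 3) * d (i + 3))
      + (p) • (d (i + 4) * d (i + 4)) - ((p + 1) * a i * a (i + 2) * a (i + 4)) • w (i + 2)
      + ((p + 1) * a (i + 1) * a (i + 2) * a (i + 4)) • w (i + 4)
      - (p * a (i + 1) * a (i + 4)) • v i + (p * a i * a (i + 2)) • v (i + 1)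
      + ((-(p + 1) * a (i + 1) * a (i + 2) * a (i + 3) + a i * a (i + 4))) • d i
      + ((p - 1) * (p + 1) * a i * a (i + 1)) • d (i + 1)
      + (((p + 1) * a i * a (i + 3) * a (i + 4) + -p^2 * a (i + 1) * a (i + 2))) • d (i + 2)
      + ((-(p + 1) * a i * a (i + 1) * a (i + 4) + p * a (i + 2) * a (i + 3))) • d (i + 3)
      + ((-p * a (i + 3) * a (i + 4) + (p + 1) * a i * a (i + 1) * a (i + 2))) • d (i + 4) := by
  refine h.cancel 0 1 1 ?_
  linear_combination (norm := skip)
    -(p * (p - 1) * (p + 1) * a (i + 4)) • (h.c (i + 1))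
    + ((-1 + 2 * p^2 + 1 * p^4) * a i) • (h.c (i + 2)) - (p * (p + 1) * a (i + 1)) • (h.c (i + 3))
    + ((p - 1) * (1 - p - p^2) * a (i + 2)) • (h.c (i + 4))
    + (p^2 * (p - 1) * a (i + 1)) • (h.cv (i + 1)) + (p * a (i + 2)) • (h.cv (i + 2))
    + (p^2 * (p + 1) * a (i + 4)) • (h.cv (i + 4)) + (a (i + 2)) • (h.cw (i + 2))
    + ((p - 1) * (p + 1)^2 * a (i + 4)) • (h.cw (i + 4)) + ((p - 1)) • ((h.exch_dw i) * v (i + 3))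
    - ((p - 1) * (p + 1) * a (i + 2) * a (i + 4)) • (h.exch_dw i)
    + (p * (p - 1) * a (i + 1) * a (i + 4)) • (h.exch_dw (i + 2))
    - (p^2 * a (i + 2)) • (d i * (h.exch_dw (i + 4))) + (a (i + 2)) • ((h.exch_dw (i + 4)) * d i)
    + ((p - 1) * (-1 - 2 * p) * a (i + 1) * a (i + 4)) • (h.exch_wd (i + 2))
    + (p * (p - 1)) • ((h.exch_wd (i + 2)) * v i)
    + (p^2 * (p - 1)) • (w (i + 2) * (h.exch_wd (i + 4)))
    + ((p - 1) * a (i + 2) * a (i + 4)) • (h.exch_wd_succ i)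
    + ((-1 - p + p^2) * a (i + 4)) • ((h.exch_wd_succ (i + 1)) * d (i + 2))
    + ((p - 1) * a i * a (i + 2)) • (h.exch_wd_succ (i + 3))
    - (p * (p - 1)) • (v (i + 3) * (h.exch_dw_succ i))
    - (p^2 * (p - 1)) • ((h.exch_dw_succ (i + 1)) * w (i + 4))
    + (p^2 * a (i + 4)) • ((h.exch_dw_succ (i + 1)) * d (i + 2))
    - (p * (p - 1)) • (v (i + 1) * (h.exch_dw_succ (i + 3))) + ((p - 1)) • (h.wv (i + 1))
    + ((p - 1)) • (h.wv (i + 3)) + (p^2 * (p + 1)) • ((h.wv_two (i + 3)) * d (i + 2))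
    - (p * (p + 1)) • (d (i + 2) * (h.wv_two (i + 3)))
    - (p * (p + 1)) • (d i * (h.vw_three (i + 3))) + ((p + 1)) • ((h.vw_three (i + 3)) * d i)
    - (p * (p - 1) * (p + 1)) • (w (i + 2) * (h.ra (i + 2)))
    - ((p + 1)) • ((h.ra (i + 3)) * v (i + 3))
    + ((p + 1)^2 * a (i + 2) * a (i + 4)) • (h.ra (i + 3))
    + ((p - 1) * (p + 1) * a i * a (i + 2)) • (h.rb (i + 1))
    - ((p + 1) * a (i + 2) * a (i + 4)) • (h.rb (i + 3))
    + (p * (p + 1)) • (v (i + 3) * (h.rb (i + 3)))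
    + (p * (p - 1) * (p + 1)) • ((h.rb (i + 4)) * w (i + 4))
    - (p * (p + 1) * a (i + 4)) • (d (i + 2) * (h.rb (i + 4)))
    + (p * (p + 1)) • ((h.va (i + 1)) * w (i + 1))
    - (p * (p + 1) * a i * a (i + 2)) • (h.va (i + 1))
    - ((p - 1) * (p + 1) * a (i + 2) * a (i + 4)) • (h.va (i + 3))
    + ((p + 1) * (1 + p - p^2) * a (i + 4)) • ((h.va (i + 4)) * d (i + 2))
    - (p * (p - 1) * (p + 1)) • ((h.va (i + 4)) * w (i + 4)) - (p * (p + 1)) • (w i * (h.vb i))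
    + (p * (p - 1) * (p + 1)) • (w (i + 2) * (h.vb (i + 2)))
    - ((p - 1) * (p + 1)) • ((h.vb (i + 3)) * v (i + 3)) + (p^3) • (d (i + 1) * (h.vx (i + 1)))
    + (p^2) • ((h.vx (i + 1)) * d (i + 1)) - ((p + 1)^2 * a (i + 4)) • (d (i + 3) * (h.vx (i + 1)))
    + (p * (p + 1) * a (i + 2)) • (d (i + 4) * (h.vy i)) - (p * (p + 1)) • (d (i + 1) * (h.vy i))
    - (p^2) • (d (i + 2) * (h.vy (i + 1))) + (p^2) • ((h.vy (i + 1)) * d (i + 2))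
    + (p^2) • ((h.vz i) * v i) - (p * (p - 1) * a (i + 1) * a (i + 4)) • (h.vz i)
    + (a i * a (i + 2)) • (h.vz (i + 1)) - (p^2) • (v (i + 1) * (h.vz (i + 1)))
    + (p * (p + 1) * a (i + 4)) • ((h.vz (i + 1)) * w (i + 2))
    - ((p + 1)^2 * a (i + 4)) • (w (i + 2) * (h.vz (i + 1))) + (p) • (w (i + 2) * (h.vz (i + 2)))
    + ((-1 - p + p^2) * a (i + 2) * a (i + 4)) • (h.vz (i + 3)) - (p) • ((h.vz (i + 4)) * w (i + 4))
    + (p * (p + 1)) • ((h.x (i + 2)) * d (i + 2)) - ((p + 1)) • (d (i + 2) * (h.x (i + 2)))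
    + ((p + 1) * a (i + 2)) • (d (i + 1) * (h.x (i + 4))) - ((p + 1)) • (d (i + 4) * (h.x (i + 4)))
    + ((p + 1)) • ((h.y (i + 2)) * d (i + 3))
    - (p * (p + 1) * a (i + 4)) • (d (i + 1) * (h.y (i + 2)))
    + (p * (p + 1) * a (i + 4)) • ((h.y (i + 2)) * d (i + 1)) - (p^2) • ((h.z i) * v i)
    + (p * (p + 1) * a (i + 2)) • ((h.z i) * w (i + 4))
    + (p * (p - 1) * a (i + 1) * a (i + 4)) • (h.z i)
    - (p * (p + 1) * a (i + 4)) • (w (i + 2) * (h.z (i + 1))) + (p^2) • ((h.z (i + 1)) * v (i + 1))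
    + (p * a i * a (i + 2)) • (h.z (i + 1)) - (p) • (w (i + 2) * (h.z (i + 2)))
    + ((p + 1)^2 * a (i + 4)) • ((h.z (i + 2)) * v (i + 1))
    - (p^2 * a (i + 2) * a (i + 4)) • (h.z (i + 3)) + (p) • ((h.z (i + 4)) * w (i + 4))
    - (p * (p + 1) * a (i + 2)) • ((h.z (i + 4)) * v i)
  simp only [smul_mul_assoc, mul_smul_comm, mul_add, add_mul, mul_sub, sub_mul, smul_add,
    smul_sub, mul_assoc, mul_one, one_mul, mul_neg, neg_mul,
    smul_neg, fin5_add, Fin.isValue, Fin.reduceAdd, add_zero]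
  module

set_option maxHeartbeats 4000000 in
/-- The exchange of the vertices `i + 2` and `i + 3` of a Casimir element. -/
theorem twist_casimir (h : Pentagon p a d w v) (i : Fin 5) {e0 : A}
    (he : TriRel p (d i) (v (i + 1)) e0 ((a (i + 4) * a (i + 2)) • 1 + a i • w (i + 2))) :
    quadCasimir p (d i) (v (i + 1)) e0 (a (i + 4) • 1) (a i • 1) (a (i + 2) • 1) (w (i + 2)) =
      casimir p a d w (i + 1) - casimir p a d w (i + 2) + casimir p a d w (i + 3) := by
  have hQ := h.crossing_linear i
  -- The element `v (i + 3)` is the other resolution of the crossing whose first resolution is `e0`,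
  -- so that `quadCasimir_eq` applies to the twisted quadrilateral as well.
  have hv : TriRel p (v (i + 1)) (d i) (v (i + 3))
      ((a (i + 4) * a (i + 2)) • 1 + a i • w (i + 2)) := by
    have := h.vb (i + 3)
    simpa only [fin5_add, Fin.isValue, Fin.reduceAdd, add_zero] using this
  have hd : w (i + 2) * d i = d i * w (i + 2) := by
    have := h.cw (i + 2)
    simpa only [fin5_add, Fin.isValue, Fin.reduceAdd, add_zero] using this.symm
  have hvw : w (i + 2) * v (i + 1) = v (i + 1) * w (i + 2) := by
    have := h.cwv (i + 1)
    simpa only [fin5_add, Fin.isValue, Fin.reduceAdd, add_zero] using this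
  have hs : w (i + 2) * e0 = e0 * w (i + 2) := by
    refine h.unit_sub.smul_left_cancel.mp ?_
    linear_combination (norm := skip) w (i + 2) * he - he * w (i + 2) - p • (hd * v (i + 1))
      - p • (d i * hvw) + hvw * d i + v (i + 1) * hd
    simp only [smul_mul_assoc, mul_smul_comm, mul_add, add_mul, mul_sub, sub_mul, smul_add,
  smul_sub, mul_assoc, mul_one, one_mul, mul_neg, neg_mul,
  smul_neg]
    module
  rw [quadCasimir_eq h.unit_sub he hv hs, h.casimir_eq, h.casimir_eq, h.casimir_eq]
  refine h.cancel 1 1 0 ?_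
  linear_combination (norm := skip)
    -((p + 1)) • (d (i + 2) * hQ) + (p * (p + 1)) • (hQ * d (i + 2))
    + (p^3 * (p + 1) * a (i + 3)) • (h.c i) - ((p - 1)^2 * (p + 1)^2 * a (i + 4)) • (h.c (i + 1))
    + (p^2 * (-1 - p^2) * a i) • (h.c (i + 2))
    + ((p - 1) * (p + 1) * (-1 - p - p^2) * a (i + 1)) • (h.c (i + 3))
    + (p * (p - 1) * (2 - 1 * p^2) * a (i + 2)) • (h.c (i + 4))
    + (p^2 * (p + 1) * a (i + 4)) • (d i * (h.cwv (i + 2)))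
    - (p^3 * (p + 1) * a (i + 4)) • ((h.cwv (i + 2)) * d i)
    + (p * (p - 1) * (p + 1) * a i) • (h.cv i) - (p^2 * (p - 1) * a (i + 1)) • (h.cv (i + 1))
    + (p^2 * (p + 1) * a (i + 4)) • ((h.cv (i + 2)) * w (i + 3))
    - (p^3 * (p + 1) * a (i + 4)) • (w (i + 3) * (h.cv (i + 2)))
    - ((p + 1) * a (i + 4)) • (h.cv (i + 4)) + ((p - 1) * (p + 1) * a (i + 2)) • (h.cw (i + 2))
    - ((p - 1) * (p + 1) * a (i + 4)) • (h.cw (i + 4)) - (p^2) • (v (i + 3) * (h.twist_z i he))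
    - ((p - 1) * (p + 1) * a (i + 4)) • ((h.exch_dw (i + 1)) * d (i + 2))
    + ((p - 1) * (p + 1) * a (i + 2) * a (i + 4)) • (h.exch_wd_succ i)
    + ((p - 1) * (p + 1) * a (i + 1) * a (i + 4)) • (h.exch_wd_succ (i + 2))
    + ((p - 1)^2 * a i * a (i + 2)) • (h.exch_wd_succ (i + 3))
    + ((p - 1) * (p + 1)) • (h.crossing_quadratic i)
    - (p^2 * (p + 1) * a (i + 4)) • (v (i + 2) * (h.ra (i + 1)))
    + (p^2 * (p + 1) * a (i + 4)) • ((h.ra (i + 1)) * v (i + 2))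
    + ((p + 1) * a (i + 2)) • ((h.ra (i + 2)) * d i)
    - (p^2 * (p + 1) * a (i + 2)) • (d i * (h.ra (i + 2)))
    - ((p + 1)^2 * a (i + 2) * a (i + 4)) • (h.ra (i + 3)) + (p^2) • (v (i + 3) * (h.ra (i + 3)))
    - ((p - 1) * (p + 1) * a i * a (i + 2)) • (h.rb (i + 1))
    + ((p - 1) * (p + 1)^2 * a (i + 2) * a (i + 4)) • (h.rb (i + 3))
    - ((p - 1) * (p + 1)^2 * a (i + 1) * a (i + 4)) • (h.va i)
    - (p * (p - 1) * (p + 1) * a i * a (i + 2)) • (h.va (i + 1)) + (p * (p + 1)) • ((h.vb i) * w i)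
    + (p^2 * (p + 1)) • (d i * (h.vx i)) - ((p + 1)) • ((h.vx i) * d i)
    + ((p + 1)^2 * a (i + 4)) • ((h.vx (i + 1)) * d (i + 3))
    + (p * (-1 - p - p^2)) • (d (i + 1) * (h.vx (i + 1))) + (p) • ((h.vx (i + 1)) * d (i + 1))
    - (p^2 * (p + 1)) • ((h.vy i) * d (i + 1)) + ((p + 1)) • (d (i + 1) * (h.vy i))
    + (p * (1 + p + p^2)) • ((h.vy (i + 1)) * d (i + 2))
    + ((-1 - 2 * p)) • (d (i + 2) * (h.vy (i + 1)))
    + ((p - 1) * (p + 1)^2 * a (i + 4)) • (d (i + 1) * (h.vy (i + 2)))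
    + (p * (p - 1) * (p + 1) * a (i + 1) * a (i + 4)) • (h.vz i)
    + (p) • ((h.vz (i + 1)) * v (i + 1))
    + ((p - 1) * (1 + p + p^2) * a i * a (i + 2)) • (h.vz (i + 1))
    - (p * (p + 1) * a (i + 4)) • ((h.vz (i + 1)) * v (i + 2))
    + (p * (p + 1) * a (i + 4)) • (v (i + 1) * (h.vz (i + 2)))
    - (p^2) • ((h.vz (i + 2)) * w (i + 2))
    + (p^2 * (p + 1) * a (i + 4)) • ((h.vz (i + 2)) * w (i + 1))
    + ((p + 1) * a (i + 2) * a (i + 4)) • (h.vz (i + 3))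
    - ((p - 1) * (p + 1)^2 * a (i + 4)) • (d (i + 3) * (h.x (i + 1)))
    + (p^2 * (p + 1)) • ((h.x (i + 2)) * d (i + 2)) - (p * (p + 1)) • (d (i + 2) * (h.x (i + 2)))
    - ((p + 1) * a (i + 2)) • (d (i + 1) * (h.x (i + 4)))
    + (p^2 * (p + 1) * a (i + 2)) • ((h.x (i + 4)) * d (i + 1))
    - (p^2 * (p + 1)) • (d (i + 3) * (h.y (i + 2))) - (p * (p + 1)) • (v i * (h.z i))
    + (p * (p + 1)) • ((h.z i) * v i) - (p * (p + 1) * a (i + 2)) • ((h.z i) * w (i + 4))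
    + (p * (p + 1) * a (i + 2)) • (w (i + 4) * (h.z i))
    + ((p - 1) * (p + 1) * a (i + 1) * a (i + 4)) • (h.z i)
    + (p * (p - 1) * a i * a (i + 2)) • (h.z (i + 1)) - (p * (p + 1)) • ((h.z (i + 1)) * v (i + 1))
    - (p^2 * (p + 1) * a (i + 4)) • ((h.z (i + 1)) * v (i + 2))
    + (p^2) • (v (i + 1) * (h.z (i + 1))) + (p^2) • ((h.z (i + 2)) * w (i + 2))
    - (p * (p + 1) * a (i + 4)) • (v (i + 1) * (h.z (i + 2)))
    + (p * (p + 1) * a (i + 4)) • ((h.z (i + 2)) * w (i + 1))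
    + ((p + 1) * (1 + p - p^2) * a (i + 2) * a (i + 4)) • (h.z (i + 3))
  simp only [smul_mul_assoc, mul_smul_comm, mul_add, add_mul, mul_sub, sub_mul, smul_add,
    smul_sub, mul_assoc, mul_one, one_mul, mul_neg, neg_mul,
    smul_neg, fin5_add, Fin.isValue, Fin.reduceAdd, add_zero]
  module

end Pentagon

end Pentagon

/-! ### A pentagon with a missing relation -/

section Pentagon

variable {R A : Type*} [CommRing R] [Ring A] [Algebra R A] {p : R}

/-- The argument of `PrePentagon.y` uses a single quadrilateral. In this form it and its two
companions are available before all relations of a pentagon are known. -/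
theorem TriRel.y_of_vy {a b c : R} {x y w v s : A} (hm : IsUnit (p - 1))
    (hz : TriRel p x y w ((a * c) • 1 + b • s)) (hvz : TriRel p y x v ((a * c) • 1 + b • s))
    (hvy : TriRel p x v y ((b * c) • 1 + a • s))
    (hsx : s * x = x * s) :
    TriRel p w x y ((b * c) • 1 + a • s) := by
  refine (hm.pow 1).smul_left_cancel.mp ?_
  linear_combination (norm := skip)
    ((p - 1) * (p + 1) * b) • hsx + ((p - 1)) • hvy - (p) • (x * hvz) + (hvz * x) - (x * hz)
    + (p) • (hz * x)
  simp only [smul_mul_assoc, mul_smul_comm, mul_add, add_mul, mul_sub, sub_mul, smul_add,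
    smul_sub, mul_assoc, mul_one, one_mul, mul_neg, neg_mul,
    smul_neg]
  module

theorem TriRel.vx_of_x {a b c : R} {x y w v s : A} (hm : IsUnit (p - 1))
    (hz : TriRel p x y w ((a * c) • 1 + b • s)) (hvz : TriRel p y x v ((a * c) • 1 + b • s))
    (hx : TriRel p y w x ((a * b) • 1 + c • s))
    (hsy : y * s = s * y) :
    TriRel p v y x ((a * b) • 1 + c • s) := by
  refine (hm.pow 1).smul_left_cancel.mp ?_
  linear_combination (norm := skip)
    -((p - 1) * (p + 1) * b) • hsy + (p) • (hvz * y) - (y * hvz) + ((p - 1)) • hx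
    - (p) • (y * hz) + (hz * y)
  simp only [smul_mul_assoc, mul_smul_comm, mul_add, add_mul, mul_sub, sub_mul, smul_add,
    smul_sub, mul_assoc, mul_one, one_mul, mul_neg, neg_mul,
    smul_neg]
  module

theorem TriRel.vy_of_y {a b c : R} {x y w v s : A} (hm : IsUnit (p - 1))
    (hz : TriRel p x y w ((a * c) • 1 + b • s)) (hvz : TriRel p y x v ((a * c) • 1 + b • s))
    (hy : TriRel p w x y ((b * c) • 1 + a • s))
    (hsx : s * x = x * s) :
    TriRel p x v y ((b * c) • 1 + a • s) := by
  refine (hm.pow 1).smul_left_cancel.mp ?_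
  linear_combination (norm := skip)
    -((p - 1) * (p + 1) * b) • hsx + (p) • (x * hvz) - (hvz * x) + ((p - 1)) • hy + (x * hz)
    - (p) • (hz * x)
  simp only [smul_mul_assoc, mul_smul_comm, mul_add, add_mul, mul_sub, sub_mul, smul_add,
    smul_sub, mul_assoc, mul_one, one_mul, mul_neg, neg_mul,
    smul_neg]
  module

/-- A pentagon in which one relation with a square of chords at the vertex `0` is missing. -/
theorem PrePentagon.of_incomplete {a : Fin 5 → R} {d w v : Fin 5 → A} (hp : IsUnit p)
    (hm : IsUnit (p - 1)) (hq : IsUnit (p + 1))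
    (z : ∀ i, TriRel p (d i) (d (i + 1)) (w i) ((a (i + 4) * a (i + 1)) • 1 + a i • d (i + 3)))
    (vz : ∀ i, TriRel p (d (i + 1)) (d i) (v i) ((a (i + 4) * a (i + 1)) • 1 + a i • d (i + 3)))
    (x : ∀ i, i ≠ 3 →
      TriRel p (d (i + 1)) (w i) (d i) ((a (i + 4) * a i) • 1 + a (i + 1) • d (i + 3)))
    (vy : ∀ i, TriRel p (d i) (v i) (d (i + 1)) ((a i * a (i + 1)) • 1 + a (i + 4) • d (i + 3)))
    (c : ∀ i, d i * d (i + 2) = d (i + 2) * d i)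
    (ra0 : TriRel p (w 2) (d 4) (w 0) ((a 1 * a 4) • 1 + a 3 • v 1))
    (ra4 : TriRel p (w 1) (d 3) (w 4) ((a 0 * a 3) • 1 + a 2 • v 0))
    (va0 : TriRel p (d 4) (v 2) (v 0) ((a 1 * a 4) • 1 + a 3 • w 1))
    (va4 : TriRel p (d 3) (v 1) (v 4) ((a 0 * a 3) • 1 + a 2 • w 0)) :
    PrePentagon p a d w v := by
  have y : ∀ i, TriRel p (w i) (d i) (d (i + 1))
      ((a i * a (i + 1)) • 1 + a (i + 4) • d (i + 3)) := fun i => by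
    refine TriRel.y_of_vy hm (z i) (vz i) (vy i) ?_
    have := c (i + 3)
    simpa only [fin5_add, Fin.isValue, Fin.reduceAdd, add_zero] using this
  have vx0 : TriRel p (v 0) (d 1) (d 0) ((a 4 * a 0) • 1 + a 1 • d 3) :=
    TriRel.vx_of_x hm (z 0) (vz 0) (x 0 (by decide)) (c 1)
  have ra2 : TriRel p (w 4) (d 1) (w 2) ((a 3 * a 1) • 1 + a 0 • v 3) := by
    refine smul_cancel_units hp hm hq 0 1 0 ?_
    linear_combination (norm := skip)
      -((c 1) * w 1) + (p^2) • (w 1 * (c 1)) + (p) • (ra4 * d 1) - (d 1 * ra4)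
      + ((p - 1) * a 2) • vx0 - ((p - 1) * a 0) • (vz 3) + (d 3 * (y 1))
      - (p) • ((y 1) * d 3) + ((p - 1)) • (z 2)
    simp only [smul_mul_assoc, mul_smul_comm, mul_add, add_mul, mul_sub, sub_mul, smul_add,
      smul_sub, mul_assoc, mul_one, one_mul, mul_neg, neg_mul,
      smul_neg, Fin.isValue, Fin.reduceAdd]
    module
  have rb0 : TriRel p (d 2) (w 3) (w 0) ((a 1 * a 4) • 1 + a 2 • v 4) := by
    refine smul_cancel_units hp hm hq 0 1 0 ?_
    linear_combination (norm := skip)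
      (p) • ((c 2) * d 3) - (p) • (d 3 * (c 2)) + ((p - 1)) • ra0
      + ((p - 1) * a 3) • (vz 1) - ((p - 1) * a 2) • (vz 4) + (d 4 * (z 2))
      - (p) • ((z 2) * d 4) + (p) • (d 2 * (z 3)) - ((z 3) * d 2)
    simp only [smul_mul_assoc, mul_smul_comm, mul_add, add_mul, mul_sub, sub_mul, smul_add,
      smul_sub, mul_assoc, mul_one, one_mul, mul_neg, neg_mul,
      smul_neg, Fin.isValue, Fin.reduceAdd]
    module
  have rb2 : TriRel p (d 4) (w 0) (w 2) ((a 3 * a 1) • 1 + a 4 • v 1) := by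
    refine smul_cancel_units hp hm hq 0 1 0 ?_
    linear_combination (norm := skip)
      (p) • ((c 4) * d 0) - (p) • (d 0 * (c 4)) + ((p - 1)) • ra2 - ((p - 1) * a 4) • (vz 1)
      + ((p - 1) * a 0) • (vz 3) - ((z 0) * d 4) + (p) • (d 4 * (z 0))
      - (p) • ((z 4) * d 1) + (d 1 * (z 4))
    simp only [smul_mul_assoc, mul_smul_comm, mul_add, add_mul, mul_sub, sub_mul, smul_add,
      smul_sub, mul_assoc, mul_one, one_mul, mul_neg, neg_mul,
      smul_neg, Fin.isValue, Fin.reduceAdd]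
    module
  have va2 : TriRel p (d 1) (v 4) (v 2) ((a 3 * a 1) • 1 + a 0 • w 3) := by
    refine smul_cancel_units hp hm hq 0 1 0 ?_
    linear_combination (norm := skip)
      -(p^2) • ((c 1) * v 1) + (v 1 * (c 1)) - (va4 * d 1) + (p) • (d 1 * va4)
      - (p) • (d 3 * (vy 1)) + ((vy 1) * d 3) + ((p - 1)) • (vz 2)
      + ((p - 1) * a 2) • (x 0 (by decide)) - ((p - 1) * a 0) • (z 3)
    simp only [smul_mul_assoc, mul_smul_comm, mul_add, add_mul, mul_sub, sub_mul, smul_add,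
      smul_sub, mul_assoc, mul_one, one_mul, mul_neg, neg_mul,
      smul_neg, Fin.isValue, Fin.reduceAdd]
    module
  have vb2 : TriRel p (v 0) (d 4) (v 2) ((a 3 * a 1) • 1 + a 4 • w 1) := by
    refine smul_cancel_units hp hm hq 0 1 0 ?_
    linear_combination (norm := skip)
      (p) • ((c 4) * d 0) - (p) • (d 0 * (c 4)) + ((p - 1)) • va2 - (d 4 * (vz 0))
      + (p) • ((vz 0) * d 4) - (p) • (d 1 * (vz 4)) + ((vz 4) * d 1)
      - ((p - 1) * a 4) • (z 1) + ((p - 1) * a 0) • (z 3)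
    simp only [smul_mul_assoc, mul_smul_comm, mul_add, add_mul, mul_sub, sub_mul, smul_add,
      smul_sub, mul_assoc, mul_one, one_mul, mul_neg, neg_mul,
      smul_neg, Fin.isValue, Fin.reduceAdd]
    module
  have vb0 : TriRel p (v 3) (d 2) (v 0) ((a 1 * a 4) • 1 + a 2 • w 4) := by
    refine smul_cancel_units hp hm hq 0 1 0 ?_
    linear_combination (norm := skip)
      -(p) • (d 3 * (c 2)) + (p) • ((c 2) * d 3) + ((p - 1)) • va0 + ((vz 2) * d 4)
      - (p) • (d 4 * (vz 2)) - (d 2 * (vz 3)) + (p) • ((vz 3) * d 2)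
      + ((p - 1) * a 3) • (z 1) - ((p - 1) * a 2) • (z 4)
    simp only [smul_mul_assoc, mul_smul_comm, mul_add, add_mul, mul_sub, sub_mul, smul_add,
      smul_sub, mul_assoc, mul_one, one_mul, mul_neg, neg_mul,
      smul_neg, Fin.isValue, Fin.reduceAdd]
    module
  -- Cubic relations with `d 2` from quadrilaterals whose relations are known; they feed the cubic
  -- relation for the defect of the missing one.
  have s1 : p • (d 3 * d 2 * d 2) + p • (d 2 * d 2 * d 3)
      - (p ^ 2 + 1) • (d 2 * d 3 * d 2) + (p - 1) ^ 2 • d 3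
      = -((p - 1) ^ 2 • (d 2 * ((a 1 * a 3) • 1 + a 2 • d 0) - ((a 2 * a 3) • 1 + a 1 • d 0))) := by
    linear_combination (norm := skip)
      -(p * (p - 1) * a 2) • (c 0) + ((p - 1)) • (y 2) - (p) • ((z 2) * d 2)
      + (d 2 * (z 2))
    simp only [smul_mul_assoc, mul_smul_comm, mul_add, add_mul, mul_sub, sub_mul, smul_add,
      smul_sub, mul_assoc, mul_one, one_mul, mul_neg, neg_mul,
      smul_neg, Fin.isValue, Fin.reduceAdd]
    module
  have s2 : p • (d 1 * d 2 * d 2) + p • (d 2 * d 2 * d 1)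
      - (p ^ 2 + 1) • (d 2 * d 1 * d 2) + (p - 1) ^ 2 • d 1
      = -((p - 1) ^ 2 • (d 2 * ((a 0 * a 2) • 1 + a 1 • d 4) - ((a 0 * a 1) • 1 + a 2 • d 4))) := by
    linear_combination (norm := skip)
      -((p - 1) * a 1) • (c 2) + ((p - 1)) • (x 1 (by decide)) - (p) • (d 2 * (z 1))
      + ((z 1) * d 2)
    simp only [smul_mul_assoc, mul_smul_comm, mul_add, add_mul, mul_sub, sub_mul, smul_add,
      smul_sub, mul_assoc, mul_one, one_mul, mul_neg, neg_mul,
      smul_neg, Fin.isValue, Fin.reduceAdd]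
    module
  have x3 : TriRel p (d 4) (w 3) (d 3) ((a 2 * a 3) • 1 + a 4 • d 1) := by
    -- `Q` is the defect of the missing relation and `Q'` that of its counterpart for the other
    -- resolution. Associativity makes them equal, and `Q'` q-commutes with `d 2`.
    set Q := p • (d 4 * w 3) - w 3 * d 4 - (p - 1) • ((a 2 * a 3) • 1 + a 4 • d 1 - d 3) with hQ
    set Q' := p • (v 3 * d 4) - d 4 * v 3 - (p - 1) • ((a 2 * a 3) • 1 + a 4 • d 1 - d 3) with hQ'
    have e1 : p • (d 2 * Q) = Q * d 2 := by
      rw [hQ]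
      linear_combination (norm := skip)
        (p^2) • ((c 2) * w 3) - (w 3 * (c 2)) + (p) • (d 4 * rb0) - (rb0 * d 4)
        - ((p - 1)) • rb2 + ((p - 1) * a 2) • (vy 4) - ((p - 1) * a 4) • (vz 1)
        + ((p - 1)) • (z 2)
      simp only [smul_mul_assoc, mul_smul_comm, mul_add, add_mul, mul_sub, sub_mul, smul_add,
        smul_sub, mul_assoc, mul_one, one_mul, mul_neg, neg_mul,
        smul_neg, Fin.isValue, Fin.reduceAdd]
      module
    have e2 : p • (Q' * d 2) = d 2 * Q' := by
      rw [hQ']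
      linear_combination (norm := skip)
        -(p^2) • (v 3 * (c 2)) + ((c 2) * v 3) + (p) • (vb0 * d 4) - (d 4 * vb0)
        - ((p - 1)) • vb2 + ((p - 1)) • (vz 2) + ((p - 1) * a 2) • (y 4)
        - ((p - 1) * a 4) • (z 1)
      simp only [smul_mul_assoc, mul_smul_comm, mul_add, add_mul, mul_sub, sub_mul, smul_add,
        smul_sub, mul_assoc, mul_one, one_mul, mul_neg, neg_mul,
        smul_neg, Fin.isValue, Fin.reduceAdd]
      module
    have e3 : Q' = Q := by
      rw [hQ, hQ']
      refine smul_cancel_units hp hm hq 0 1 0 ?_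
      linear_combination (norm := skip)
        -((p - 1) * (p + 1) * a 3) • (c 4) + (p) • ((vz 3) * d 4) - (d 4 * (vz 3))
        - (p) • (d 4 * (z 3)) + ((z 3) * d 4)
      simp only [smul_mul_assoc, mul_smul_comm, mul_add, add_mul, mul_sub, sub_mul, smul_add,
        smul_sub, mul_assoc, mul_one, one_mul, mul_neg, neg_mul,
        smul_neg, Fin.isValue, Fin.reduceAdd]
      module
    rw [e3] at e2
    -- It remains to see that the defect satisfies the cubic relation with `d 2`.
    refine sub_eq_zero.mp (eq_zero_of_qcomm_of_cubic hm (y := d 2) (x := Q) e2 ?_)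
    have hc2 : d 4 * d 2 = d 2 * d 4 := (c 2).symm
    have hc2a : ∀ x, d 4 * (d 2 * x) = d 2 * (d 4 * x) := fun x => by
      rw [← mul_assoc, hc2, mul_assoc]
    rw [hQ]
    refine smul_cancel_units hp hm hq 0 1 0 ?_
    linear_combination (norm := skip)
      ((-1 - p^2)) • (d 4 * s1 * d 4) + (p) • (d 4 * d 4 * s1)
      + (p) • (s1 * d 4 * d 4) + ((p - 1)^2) • s1 - ((p - 1)^2 * a 4) • s2
      + (p * (p - 1) * a 3) • (d 4 * s2) - ((p - 1) * a 3) • (s2 * d 4)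
      + ((p - 1)^3 * a 1) • (y 4) - ((p - 1)^3 * a 2) • (d 2 * (y 4))
      + (p^2) • (d 4 * (z 3) * d 2 * d 2)
      + (p * (-1 - p^2)) • (d 2 * d 4 * (z 3) * d 2)
      + (p * (p - 1)^2) • (d 4 * (z 3)) + (p^2) • (d 2 * d 2 * d 4 * (z 3))
      + ((1 + p^2)) • (d 2 * (z 3) * d 2 * d 4)
      - (p) • ((z 3) * d 2 * d 2 * d 4)
      - (p) • (d 2 * d 2 * (z 3) * d 4) - ((p - 1)^2) • ((z 3) * d 4)
      + ((p - 1)^2 * a 1) • (d 4 * (z 4))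
      - (p * (p - 1)^2 * a 1) • ((z 4) * d 4)
      - ((p - 1)^2 * a 2) • (d 2 * d 4 * (z 4))
      + (p * (p - 1)^2 * a 2) • (d 2 * (z 4) * d 4)
    simp only [smul_mul_assoc, mul_smul_comm, mul_add, add_mul, mul_sub, sub_mul, smul_add,
      smul_sub, mul_assoc, mul_one, one_mul, mul_neg, neg_mul,
      smul_neg, hc2, hc2a, Fin.isValue, Fin.reduceAdd]
    module
  refine ⟨hp, hm, hq, z, vz, fun i => ?_, vy, c⟩
  by_cases hi : i = 3
  · subst hi; exact x3
  · exact x i hi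

end Pentagon

/-! ### Chords of a polygon and the scalars attached to a pentagon -/

section ChordSystem

/-- The centre of an algebra, as a ring of scalars. -/
def CentralScalars (K B : Type*) [Field K] [Ring B] [Algebra K B] : Type _ := Subalgebra.center K B

namespace CentralScalars

variable {K B : Type*} [Field K] [Ring B] [Algebra K B]

noncomputable instance : CommRing (CentralScalars K B) :=
  inferInstanceAs (CommRing (Subalgebra.center K B))

noncomputable instance : Algebra K (CentralScalars K B) :=
  inferInstanceAs (Algebra K (Subalgebra.center K B))

/-- The inclusion of the centre. -/
noncomputable def incl : CentralScalars K B →ₐ[K] B := (Subalgebra.center K B).val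

noncomputable instance : Algebra (CentralScalars K B) B :=
  RingHom.toAlgebra' (incl (K := K) (B := B)).toRingHom fun c x =>
    ((Subalgebra.mem_center_iff.mp c.2) x).symm

theorem smul_eq (c : CentralScalars K B) (x : B) : c • x = incl c * x := rfl

theorem algebraMap_smul_eq (k : K) (x : B) : algebraMap K (CentralScalars K B) k • x = k • x := by
  rw [smul_eq, AlgHom.commutes, ← Algebra.smul_def]

end CentralScalars

/-- `m - [x, y]_q` for `p = q ^ 2`. -/
def crossing {K A : Type*} [Field K] [Ring A] [Algebra K A] (p : K) (x y m : A) : A :=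
  m - (p - 1)⁻¹ • (p • (x * y) - y * x)

section Crossing

variable {K A : Type*} [Field K] [Ring A] [Algebra K A] {p : K}

theorem triRel_iff (hp : p - 1 ≠ 0) {x y z m : A} :
    TriRel p x y z m ↔ z = crossing p x y m := by
  unfold crossing TriRel
  constructor
  · intro h
    rw [h, smul_smul, inv_mul_cancel₀ hp, one_smul, sub_sub_cancel]
  · rintro rfl
    rw [sub_sub_cancel, smul_smul, mul_inv_cancel₀ hp, one_smul]

theorem triRel_crossing (hp : p - 1 ≠ 0) (x y m : A) : TriRel p x y (crossing p x y m) m :=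
  (triRel_iff hp).mpr rfl

theorem map_crossing {B : Type*} [Ring B] [Algebra K B] (f : A →ₐ[K] B) (x y m : A) :
    f (crossing p x y m) = crossing p (f x) (f y) (f m) := by
  simp [crossing, map_sub, map_smul, map_mul]

theorem commute_crossing {x y m t : A} (hx : Commute t x) (hy : Commute t y) (hm : Commute t m) :
    Commute t (crossing p x y m) :=
  hm.sub_right
    ((((hx.mul_right hy).smul_right p).sub_right (hy.mul_right hx)).smul_right _)

end Crossing

/-- The resolved crossing of the chords `{a, c}` and `{b, d}`. -/
def chordCrossing {K A : Type*} [Field K] [Ring A] [Algebra K A] (p : K) (C : ℕ → ℕ → A)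
    (a b c d : ℕ) : A :=
  crossing p (C a c) (C b d) (C a b * C c d + C b c * C a d)

/-- The sides and diagonals of a pentagon `x`, with the sides made into scalars. -/
structure PentagonModel {K : Type*} {A : Type*} [Field K] [Ring A] [Algebra K A] (p : K)
    (C : ℕ → ℕ → A) (x : Fin 5 → ℕ) where
  B : Subalgebra K A
  a : Fin 5 → CentralScalars K B
  d : Fin 5 → B
  w : Fin 5 → B
  v : Fin 5 → B
  val_smul : ∀ i (b : B), ((a i • b : B) : A) = C (x i) (x (i + 1)) * b
  val_d : ∀ i, (d i : A) = C (x (i + 4)) (x (i + 1))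
  val_w : ∀ i, (w i : A) = chordCrossing p C (x (i + 4)) (x i) (x (i + 1)) (x (i + 2))
  val_v : ∀ i, (v i : A) = chordCrossing p C (x i) (x (i + 1)) (x (i + 2)) (x (i + 4))

variable {K A : Type*} [Field K] [Ring A] [Algebra K A] {p : K}

namespace PentagonModel

variable {C : ℕ → ℕ → A} {x : Fin 5 → ℕ}

/-- The parameter as a scalar. -/
noncomputable def param (M : PentagonModel p C x) : CentralScalars K M.B := algebraMap K _ p

theorem triRel_iff (M : PentagonModel p C x) {r s t m : M.B} :
    TriRel M.param r s t m ↔ TriRel p (r : A) (s : A) (t : A) (m : A) := by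
  have h1 : M.param - 1 = algebraMap K _ (p - 1) := by simp [param]
  unfold TriRel
  rw [h1, CentralScalars.algebraMap_smul_eq, param, CentralScalars.algebraMap_smul_eq,
    Subtype.ext_iff]
  simp

theorem isUnit_algebraMap (M : PentagonModel p C x) {k : K} (hk : k ≠ 0) :
    IsUnit (algebraMap K (CentralScalars K M.B) k) :=
  (IsUnit.mk0 k hk).map _

theorem val_one_smul (M : PentagonModel p C x) (i : Fin 5) :
    ((M.a i • (1 : M.B) : M.B) : A) = C (x i) (x (i + 1)) := by simp [M.val_smul]

theorem val_mul_smul (M : PentagonModel p C x) (i j : Fin 5) :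
    (((M.a i * M.a j) • (1 : M.B) : M.B) : A) = C (x i) (x (i + 1)) * C (x j) (x (j + 1)) := by
  rw [mul_smul, M.val_smul, M.val_one_smul]

theorem val_quadCasimir (M : PentagonModel p C x) (r s t s₁ s₂ s₃ s₄ : M.B) :
    ((quadCasimir M.param r s t s₁ s₂ s₃ s₄ : M.B) : A) =
      quadCasimir p (r : A) s t s₁ s₂ s₃ s₄ := by
  have e : ∀ (k : K) (b : M.B),
      (((algebraMap K (CentralScalars K M.B) k • b : M.B)) : A) = k • (b : A) := fun k b => by
    rw [CentralScalars.algebraMap_smul_eq]; rfl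
  have e1 : M.param * (M.param + 1) = algebraMap K _ (p * (p + 1)) := by simp [param]
  have e2 : M.param ^ 2 = algebraMap K _ (p ^ 2) := by simp [param]
  have e3 : M.param + 1 = algebraMap K _ (p + 1) := by simp [param]
  have e4 : (M.param + 1) ^ 2 = algebraMap K _ ((p + 1) ^ 2) := by simp [param]
  unfold quadCasimir
  rw [e1, e2, e4, e3]
  unfold param
  simp only [Subalgebra.coe_add, Subalgebra.coe_sub, Subalgebra.coe_mul, Subalgebra.coe_one, e]

/-- The model inside the centralizer of the sides. -/
theorem nonempty_of_commute (p : K) {C : ℕ → ℕ → A} {x : Fin 5 → ℕ}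
    (symm : ∀ a b, C a b = C b a)
    (hs : ∀ i j, Commute (C (x i) (x (i + 1))) (C (x j) (x (j + 1))))
    (hd : ∀ i j, Commute (C (x i) (x (i + 1))) (C (x (j + 4)) (x (j + 1)))) :
    Nonempty (PentagonModel p C x) := by
  -- The sides of the pentagon commute with each other and with the diagonals. So all elements of
  -- the pentagon lie in the centralizer of the sides, where the sides are central and may serve as
  -- scalars.
  set B : Subalgebra K A :=
    Subalgebra.centralizer K (Set.range fun i => C (x i) (x (i + 1))) with hB
  have mem : ∀ {b : A}, (∀ i, Commute (C (x i) (x (i + 1))) b) → b ∈ B := by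
    rintro b hb _ ⟨i, rfl⟩
    exact hb i
  have hs' : ∀ k i, Commute (C (x k) (x (k + 1))) (C (x i) (x (i + 4))) := fun k i => by
    have := hs k (i + 4)
    rw [symm (x (i + 4))] at this
    simpa only [fin5_add, Fin.isValue, Fin.reduceAdd, add_zero] using this
  have hs2 : ∀ k i, Commute (C (x k) (x (k + 1))) (C (x (i + 1)) (x (i + 2))) := fun k i => by
    have := hs k (i + 1)
    simpa only [fin5_add, Fin.isValue, Fin.reduceAdd, add_zero] using this
  have hd2 : ∀ k i, Commute (C (x k) (x (k + 1))) (C (x i) (x (i + 2))) := fun k i => by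
    have := hd k (i + 1)
    simpa only [fin5_add, Fin.isValue, Fin.reduceAdd, add_zero] using this
  have hd3 : ∀ k i, Commute (C (x k) (x (k + 1))) (C (x (i + 4)) (x (i + 2))) := fun k i => by
    have := hd k (i + 3)
    rw [symm (x (i + 3 + 4))] at this
    simpa only [fin5_add, Fin.isValue, Fin.reduceAdd, add_zero] using this
  refine ⟨⟨B, fun i => ⟨⟨C (x i) (x (i + 1)), mem fun k => hs k i⟩, ?_⟩,
    fun j => ⟨C (x (j + 4)) (x (j + 1)), mem fun i => hd i j⟩,
    fun i => ⟨chordCrossing p C (x (i + 4)) (x i) (x (i + 1)) (x (i + 2)), mem fun k => ?_⟩,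
    fun i => ⟨chordCrossing p C (x i) (x (i + 1)) (x (i + 2)) (x (i + 4)), mem fun k => ?_⟩,
    fun i b => rfl, fun i => rfl, fun i => rfl, fun i => rfl⟩⟩
  · refine Subalgebra.mem_center_iff.mpr fun b => Subtype.ext ?_
    exact (b.2 _ ⟨i, rfl⟩).symm
  · refine commute_crossing (hd k i) (hd2 k i) (((?_ : Commute _ _).mul_right (hs2 k i)).add_right
      ((hs k i).mul_right (hd3 k i)))
    rw [symm (x (i + 4)) (x i)]; exact hs' k i
  · refine commute_crossing (hd2 k i) ?_ (((hs k i).mul_right ?_).add_right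
      ((hs2 k i).mul_right (hs' k i)))
    · rw [symm (x (i + 1)) (x (i + 4))]; exact hd k i
    · rw [symm (x (i + 2)) (x (i + 4))]; exact hd3 k i

theorem triRel_w (M : PentagonModel p C x) (symm : ∀ a b, C a b = C b a) (hp : p - 1 ≠ 0)
    (i : Fin 5) : TriRel M.param (M.d i) (M.d (i + 1)) (M.w i)
      ((M.a (i + 4) * M.a (i + 1)) • 1 + M.a i • M.d (i + 3)) := by
  rw [M.triRel_iff]
  simp only [Subalgebra.coe_add, val_mul_smul, M.val_smul, M.val_d, M.val_w, fin5_add, Fin.isValue,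
    Fin.reduceAdd, add_zero]
  rw [symm (x (i + 2)) (x (i + 4))]
  exact triRel_crossing hp _ _ _

theorem triRel_v (M : PentagonModel p C x) (symm : ∀ a b, C a b = C b a) (hp : p - 1 ≠ 0)
    (i : Fin 5) : TriRel M.param (M.d (i + 1)) (M.d i) (M.v i)
      ((M.a (i + 4) * M.a (i + 1)) • 1 + M.a i • M.d (i + 3)) := by
  rw [M.triRel_iff, mul_comm (M.a (i + 4)) (M.a (i + 1))]
  simp only [Subalgebra.coe_add, val_mul_smul, M.val_smul, M.val_d, M.val_v, fin5_add, Fin.isValue,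
    Fin.reduceAdd, add_zero]
  rw [symm (x (i + 4)) (x (i + 1)), symm (x (i + 4)) (x i),
    add_comm (C (x (i + 1)) (x (i + 2)) * C (x i) (x (i + 4)))]
  exact triRel_crossing hp _ _ _

end PentagonModel

/-- The relations of a quadrilateral which are not definitions of crossings. -/
structure QuadRel (p : K) (C : ℕ → ℕ → A) (a b c d : ℕ) : Prop where
  x : TriRel p (C b d) (chordCrossing p C a b c d) (C a c) (C a b * C b c + C c d * C a d)
  vy : TriRel p (C a c) (chordCrossing p C b c d a) (C b d) (C b c * C c d + C a b * C a d)

/-- Weak cyclic order. -/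
def Cyc4 (a b c d : ℕ) : Prop :=
  (a ≤ b ∧ b ≤ c ∧ c ≤ d) ∨ (b ≤ c ∧ c ≤ d ∧ d ≤ a) ∨ (c ≤ d ∧ d ≤ a ∧ a ≤ b) ∨
    (d ≤ a ∧ a ≤ b ∧ b ≤ c)

/-- Weak cyclic order. -/
def Cyc5 (a b c d e : ℕ) : Prop :=
  (a ≤ b ∧ b ≤ c ∧ c ≤ d ∧ d ≤ e) ∨ (b ≤ c ∧ c ≤ d ∧ d ≤ e ∧ e ≤ a) ∨
    (c ≤ d ∧ d ≤ e ∧ e ≤ a ∧ a ≤ b) ∨ (d ≤ e ∧ e ≤ a ∧ a ≤ b ∧ b ≤ c) ∨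
    (e ≤ a ∧ a ≤ b ∧ b ≤ c ∧ c ≤ d)

/-- Elements attached to the chords of a polygon with vertices `0, …, n`, which commute if the
chords do not cross. -/
structure ChordComm (n : ℕ) (C : ℕ → ℕ → A) : Prop where
  symm : ∀ a b, C a b = C b a
  diag : ∀ a, C a a = 1
  comm : ∀ a b c d, a ≤ b → b ≤ c → c ≤ d → d ≤ n →
    C a b * C c d = C c d * C a b ∧ C a d * C b c = C b c * C a d

/-- Elements attached to the chords of a polygon with vertices `0, …, n`, with the relations that
involve at most four vertices. -/
structure PreChordSystem (p : K) (n : ℕ) (C : ℕ → ℕ → A) : Prop extends ChordComm n C where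
  ne_zero : p ≠ 0
  sub_ne : p - 1 ≠ 0
  add_ne : p + 1 ≠ 0
  quad : ∀ a b c d, a < b → b < c → c < d → d ≤ n → QuadRel p C a b c d

/-- Elements attached to the chords of a polygon with vertices `0, …, n`, with the relations of
the Askey–Wilson algebra. -/
structure ChordSystem (p : K) (n : ℕ) (C : ℕ → ℕ → A) : Prop extends PreChordSystem p n C where
  ra : ∀ a b c d e, a < b → b < c → c < d → d < e → e ≤ n →
    TriRel p (chordCrossing p C b c d e) (C d a) (chordCrossing p C e a b c)
      (C b c * C e a + C d e * chordCrossing p C b c d a)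
  va : ∀ a b c d e, a < b → b < c → c < d → d < e → e ≤ n →
    TriRel p (C d a) (chordCrossing p C c d e b) (chordCrossing p C a b c e)
      (C b c * C e a + C d e * chordCrossing p C a b c d)

namespace ChordComm

variable {n : ℕ} {C : ℕ → ℕ → A}

theorem commute (h : ChordComm n C) {a b c d : ℕ} (H : Cyc4 a b c d) (ha : a ≤ n)
    (hb : b ≤ n) (hc : c ≤ n) (hd : d ≤ n) : Commute (C a b) (C c d) := by
  rcases H with ⟨h1, h2, h3⟩ | ⟨h1, h2, h3⟩ | ⟨h1, h2, h3⟩ | ⟨h1, h2, h3⟩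
  · exact (h.comm a b c d h1 h2 h3 hd).1
  · have := (h.comm b c d a h1 h2 h3 ha).2
    rw [h.symm b a] at this; exact this
  · exact ((h.comm c d a b h1 h2 h3 hb).1).symm
  · have := (h.comm d a b c h1 h2 h3 hc).2
    rw [h.symm d c] at this; exact this.symm

/-- A rotation by one vertex exchanges the two diagonals and with them the two relations; after a
half turn the crossing is the same. -/
theorem quadRel_rotate (h : ChordComm n C) {a b c d : ℕ} (H : Cyc4 a b c d)
    (ha : a ≤ n) (hb : b ≤ n) (hc : c ≤ n) (hd : d ≤ n) (hq : QuadRel p C a b c d) :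
    QuadRel p C b c d a := by
  have h1 : C a b * C a d = C a d * C a b := by
    rw [h.symm a d]
    exact (h.commute (by unfold Cyc4 at *; omega) hd ha ha hb).symm
  have h2 : C a b * C c d = C c d * C a b := h.commute H ha hb hc hd
  have h3 : C b c * C a d = C a d * C b c := by
    rw [h.symm a d]
    exact h.commute (by unfold Cyc4 at *; omega) hb hc hd ha
  refine ⟨?_, ?_⟩
  · have := hq.vy
    rw [h.symm c a, h.symm d a, h.symm b a, ← h1]; exact this
  · have := hq.x
    rw [add_comm, h.symm b a, h.symm d a]
    have e : chordCrossing p C c d a b = chordCrossing p C a b c d := by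
      unfold chordCrossing
      rw [h.symm c a, h.symm d b, h.symm d a, h.symm c b, h2, ← h3]
    have h4 : C b c * C a b = C a b * C b c :=
      h.commute (by unfold Cyc4 at *; omega) hb hc ha hb
    rw [e, h.symm c a, h4]
    exact this

end ChordComm

end ChordSystem

/-! ### Pentagon relations for chords in cyclic position -/

section ChordPentagon

variable {K A : Type*} [Field K] [Ring A] [Algebra K A] {p : K} {n : ℕ} {C : ℕ → ℕ → A}

/-- The q-commutator of commuting elements is their product. -/
theorem crossing_of_commute (hp : p - 1 ≠ 0) {x y : A} (h : x * y = y * x) (m : A) :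
    crossing p x y (x * y + m) = m := by
  rw [eq_comm, ← triRel_iff hp, TriRel, ← h, add_sub_cancel_right, sub_smul, one_smul]

theorem Cyc5.cyc4 {x : Fin 5 → ℕ} (H : Cyc5 (x 0) (x 1) (x 2) (x 3) (x 4)) (i : Fin 5) :
    Cyc4 (x i) (x (i + 1)) (x (i + 2)) (x (i + 3)) ∧
      Cyc4 (x i) (x (i + 1)) (x (i + 2)) (x (i + 4)) ∧
      Cyc4 (x i) (x (i + 1)) (x (i + 3)) (x (i + 4)) := by
  unfold Cyc5 at H
  unfold Cyc4
  fin_cases i <;> simp only [Fin.isValue, Fin.reduceAdd, Fin.reduceFinMk, Fin.mk_one, Fin.zero_eta, zero_add] <;> omega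

theorem Cyc5.cyc4' {x : Fin 5 → ℕ} (H : Cyc5 (x 0) (x 1) (x 2) (x 3) (x 4)) (i : Fin 5) :
    Cyc4 (x (i + 4)) (x i) (x (i + 1)) (x (i + 2)) := by
  have := (H.cyc4 i).2.1
  unfold Cyc4 at *
  omega

theorem PentagonModel.quadRel_iff {x : Fin 5 → ℕ} (M : PentagonModel p C x)
    (symm : ∀ a b, C a b = C b a) (i : Fin 5) :
    QuadRel p C (x (i + 4)) (x i) (x (i + 1)) (x (i + 2)) ↔
      TriRel M.param (M.d (i + 1)) (M.w i) (M.d i)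
        ((M.a (i + 4) * M.a i) • 1 + M.a (i + 1) • M.d (i + 3)) ∧
      TriRel M.param (M.d i) (M.v i) (M.d (i + 1))
        ((M.a i * M.a (i + 1)) • 1 + M.a (i + 4) • M.d (i + 3)) := by
  rw [M.triRel_iff, M.triRel_iff]
  simp only [Subalgebra.coe_add, M.val_mul_smul, M.val_smul, M.val_d, M.val_w, M.val_v, fin5_add,
    Fin.isValue, Fin.reduceAdd, add_zero]
  have e : ∀ y, y * C (x (i + 2)) (x (i + 4)) = y * C (x (i + 4)) (x (i + 2)) := fun y => by
    rw [symm (x (i + 2)) (x (i + 4))]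
  rw [e, e]
  exact ⟨fun h => ⟨h.x, h.vy⟩, fun h => ⟨h.1, h.2⟩⟩

namespace ChordComm

theorem nonempty_model (p : K) (h : ChordComm n C) {x : Fin 5 → ℕ}
    (H : Cyc5 (x 0) (x 1) (x 2) (x 3) (x 4)) (hx : ∀ i, x i ≤ n) :
    Nonempty (PentagonModel p C x) := by
  refine PentagonModel.nonempty_of_commute p h.symm (fun i j => ?_) fun i j => ?_
  · obtain ⟨t, rfl⟩ : ∃ t, j = i + t := ⟨j - i, by abel⟩
    obtain ⟨h1, h2, h3⟩ := H.cyc4 i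
    unfold Cyc4 at h1 h2 h3
    fin_cases t <;> simp only [Fin.isValue, Fin.reduceFinMk, Fin.mk_one, Fin.zero_eta, fin5_add, Fin.reduceAdd, add_zero]
    · exact Commute.refl _
    · exact h.commute (by unfold Cyc4; omega) (hx _) (hx _) (hx _) (hx _)
    · exact h.commute (by unfold Cyc4; omega) (hx _) (hx _) (hx _) (hx _)
    · exact h.commute (by unfold Cyc4; omega) (hx _) (hx _) (hx _) (hx _)
    · exact h.commute (by unfold Cyc4; omega) (hx _) (hx _) (hx _) (hx _)
  · obtain ⟨t, rfl⟩ : ∃ t, j = i + t := ⟨j - i, by abel⟩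
    obtain ⟨h1, h2, h3⟩ := H.cyc4 i
    unfold Cyc4 at h1 h2 h3
    fin_cases t <;> simp only [Fin.isValue, Fin.reduceFinMk, Fin.mk_one, Fin.zero_eta, fin5_add, Fin.reduceAdd, add_zero]
    · rw [h.symm (x (i + 4))]
      exact h.commute (by unfold Cyc4; omega) (hx _) (hx _) (hx _) (hx _)
    · rw [h.symm (x i) (x (i + 2))]
      exact h.commute (by unfold Cyc4; omega) (hx _) (hx _) (hx _) (hx _)
    · exact h.commute (by unfold Cyc4; omega) (hx _) (hx _) (hx _) (hx _)
    · exact h.commute (by unfold Cyc4; omega) (hx _) (hx _) (hx _) (hx _)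
    · exact h.commute (by unfold Cyc4; omega) (hx _) (hx _) (hx _) (hx _)

theorem model_comm (h : ChordComm n C) {x : Fin 5 → ℕ}
    (H : Cyc5 (x 0) (x 1) (x 2) (x 3) (x 4)) (hx : ∀ i, x i ≤ n) (M : PentagonModel p C x)
    (i : Fin 5) : M.d i * M.d (i + 2) = M.d (i + 2) * M.d i := by
  have h3 := (H.cyc4 i).2.2
  apply Subtype.ext
  simp only [Subalgebra.coe_mul, M.val_d, fin5_add, Fin.isValue, Fin.reduceAdd, add_zero]
  exact h.commute (by unfold Cyc4 at *; omega) (hx _) (hx _) (hx _) (hx _)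

end ChordComm

namespace PreChordSystem

/-- With two equal vertices the diagonals coincide with sides and commute, and both resolutions are
`C c d`. Weak cyclic order is thus enough in all later statements, and empty intervals and shared
end points need no separate treatment. -/
theorem quadRel_degenerate (h : PreChordSystem p n C) {b c d : ℕ} (H : Cyc4 b b c d)
    (hb : b ≤ n) (hc : c ≤ n) (hd : d ≤ n) : QuadRel p C b b c d := by
  have h1 : C b c * C b d = C b d * C b c := by
    rw [h.symm b d]
    exact (h.commute (by unfold Cyc4 at *; omega) hd hb hb hc).symm
  have h2 : C b c * C c d = C c d * C b c :=
    h.commute (by unfold Cyc4 at *; omega) hb hc hc hd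
  have h3 : C b d * C c d = C c d * C b d :=
    by
      rw [h.symm b d]
      exact (h.commute (by unfold Cyc4 at *; omega) hc hd hd hb).symm
  have e1 : chordCrossing p C b b c d = C c d := by
    rw [chordCrossing, h.diag, one_mul, add_comm]
    exact crossing_of_commute h.sub_ne h1 _
  have e2 : chordCrossing p C b c d b = C c d := by
    rw [chordCrossing, h.diag, mul_one, h.symm c b, h.symm d b, h1]
    exact crossing_of_commute h.sub_ne h1.symm _
  refine ⟨?_, ?_⟩
  · rw [e1, h.diag, TriRel, one_mul, add_sub_cancel_left, h3, sub_smul, one_smul]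
  · rw [e2, h.diag, TriRel, one_mul, add_sub_cancel_right, h2, sub_smul, one_smul]

/-- The relations are postulated for strictly increasing vertices only. Rotations give the other
cyclic orders, and the degenerate case gives equal vertices. -/
theorem quadRel (h : PreChordSystem p n C) {a b c d : ℕ} (H : Cyc4 a b c d)
    (ha : a ≤ n) (hb : b ≤ n) (hc : c ≤ n) (hd : d ≤ n) : QuadRel p C a b c d := by
  have rot : ∀ {a b c d : ℕ}, Cyc4 a b c d → Cyc4 b c d a := fun H => by unfold Cyc4 at *; omega
  have lin : ∀ {a b c d : ℕ}, a ≤ b → b ≤ c → c ≤ d → d ≤ n → QuadRel p C a b c d := by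
    intro a b c d h1 h2 h3 h4
    have H : Cyc4 a b c d := Or.inl ⟨h1, h2, h3⟩
    rcases h1.eq_or_lt with rfl | h1
    · exact h.quadRel_degenerate H (by omega) (by omega) (by omega)
    rcases h2.eq_or_lt with rfl | h2
    · have q := h.quadRel_degenerate (rot H) (by omega) (by omega) (by omega)
      have q1 := h.quadRel_rotate (rot H) (by omega) (by omega) (by omega) (by omega) q
      have q2 := h.quadRel_rotate (rot (rot H)) (by omega) (by omega) (by omega) (by omega) q1
      exact h.quadRel_rotate (rot (rot (rot H))) (by omega) (by omega) (by omega) (by omega) q2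
    rcases h3.eq_or_lt with rfl | h3
    · have q := h.quadRel_degenerate (rot (rot H)) (by omega) (by omega) (by omega)
      have q1 := h.quadRel_rotate (rot (rot H)) (by omega) (by omega) (by omega) (by omega) q
      exact h.quadRel_rotate (rot (rot (rot H))) (by omega) (by omega) (by omega) (by omega) q1
    exact h.quad a b c d h1 h2 h3 h4
  rcases H with ⟨h1, h2, h3⟩ | ⟨h1, h2, h3⟩ | ⟨h1, h2, h3⟩ | ⟨h1, h2, h3⟩
  · exact lin h1 h2 h3 hd
  · have H : Cyc4 b c d a := Or.inl ⟨h1, h2, h3⟩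
    have q1 := h.quadRel_rotate H (by omega) (by omega) (by omega) (by omega) (lin h1 h2 h3 ha)
    have q2 := h.quadRel_rotate (rot H) (by omega) (by omega) (by omega) (by omega) q1
    exact h.quadRel_rotate (rot (rot H)) (by omega) (by omega) (by omega) (by omega) q2
  · have H : Cyc4 c d a b := Or.inl ⟨h1, h2, h3⟩
    have q1 := h.quadRel_rotate H (by omega) (by omega) (by omega) (by omega) (lin h1 h2 h3 hb)
    exact h.quadRel_rotate (rot H) (by omega) (by omega) (by omega) (by omega) q1
  · have H : Cyc4 d a b c := Or.inl ⟨h1, h2, h3⟩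
    exact h.quadRel_rotate H (by omega) (by omega) (by omega) (by omega) (lin h1 h2 h3 hc)

theorem prePentagon (h : PreChordSystem p n C) {x : Fin 5 → ℕ}
    (H : Cyc5 (x 0) (x 1) (x 2) (x 3) (x 4)) (hx : ∀ i, x i ≤ n) (M : PentagonModel p C x) :
    PrePentagon M.param M.a M.d M.w M.v where
  unit := M.isUnit_algebraMap h.ne_zero
  unit_sub := by
    have := M.isUnit_algebraMap h.sub_ne
    rwa [map_sub, map_one] at this
  unit_add := by
    have := M.isUnit_algebraMap h.add_ne
    rwa [map_add, map_one] at this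
  z := M.triRel_w h.symm h.sub_ne
  vz := M.triRel_v h.symm h.sub_ne
  x i := (M.quadRel_iff h.symm i).mp (h.quadRel (H.cyc4' i) (hx _) (hx _) (hx _) (hx _)) |>.1
  vy i := (M.quadRel_iff h.symm i).mp (h.quadRel (H.cyc4' i) (hx _) (hx _) (hx _) (hx _)) |>.2
  c := h.model_comm H hx M

end PreChordSystem

namespace ChordSystem

/-- The postulated relations concern increasing vertices, that is one starting vertex of the
pentagon; `PrePentagon.toPentagon` supplies the other four. -/
theorem exists_pentagon (h : ChordSystem p n C) {x : Fin 5 → ℕ}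
    (H : Cyc5 (x 0) (x 1) (x 2) (x 3) (x 4)) (hx : ∀ i, x i ≤ n) :
    ∃ M : PentagonModel p C x, Pentagon M.param M.a M.d M.w M.v := by
  obtain ⟨M⟩ := h.nonempty_model p H hx
  have P := h.prePentagon H hx M
  refine ⟨M, ?_⟩
  by_cases hdeg : ∃ i, x i = x (i + 1)
  · obtain ⟨i, hi⟩ := hdeg
    refine P.toPentagon_of_degenerate i ?_ ?_ ?_ ?_
    · apply Subtype.ext; apply Subtype.ext
      have := M.val_one_smul i
      rw [CentralScalars.smul_eq, mul_one, ← hi, h.diag] at this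
      exact this
    · apply Subtype.ext
      rw [M.val_one_smul, M.val_d, ← hi, fin5_add]
      simp only [Fin.isValue, Fin.reduceAdd, add_zero]
    · apply Subtype.ext
      rw [M.val_one_smul, M.val_d]
      simp only [fin5_add, Fin.isValue, Fin.reduceAdd, add_zero]
      rw [hi]
    · apply Subtype.ext
      rw [M.val_d, M.val_d]
      simp only [fin5_add, Fin.isValue, Fin.reduceAdd, add_zero]
      rw [hi, h.symm]
  · push Not at hdeg
    -- In weak cyclic order with distinct neighbours the vertices increase strictly from some
    -- starting vertex on.
    have : ∃ k, x k < x (k + 1) ∧ x (k + 1) < x (k + 2) ∧ x (k + 2) < x (k + 3) ∧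
        x (k + 3) < x (k + 4) := by
      have h0 := hdeg 0
      have h1 := hdeg 1
      have h2 := hdeg 2
      have h3 := hdeg 3
      have h4 := hdeg 4
      simp only [Fin.isValue, Fin.reduceAdd, zero_add] at h0 h1 h2 h3 h4
      rcases H with H | H | H | H | H
      · exact ⟨0, by simp only [Fin.isValue, Fin.reduceAdd, zero_add]; omega⟩
      · exact ⟨1, by simp only [Fin.isValue, Fin.reduceAdd, zero_add]; omega⟩
      · exact ⟨2, by simp only [Fin.isValue, Fin.reduceAdd, zero_add]; omega⟩
      · exact ⟨3, by simp only [Fin.isValue, Fin.reduceAdd, zero_add]; omega⟩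
      · exact ⟨4, by simp only [Fin.isValue, Fin.reduceAdd, zero_add]; omega⟩
    obtain ⟨k, h1, h2, h3, h4⟩ := this
    refine P.toPentagon (j := k) (k := k) ?_ ?_
    · have := h.ra _ _ _ _ _ h1 h2 h3 h4 (hx _)
      rw [M.triRel_iff]
      simp only [Subalgebra.coe_add, M.val_mul_smul, M.val_smul, M.val_d, M.val_w, M.val_v,
        fin5_add, Fin.isValue, Fin.reduceAdd, add_zero]
      exact this
    · have := h.va _ _ _ _ _ h1 h2 h3 h4 (hx _)
      rw [M.triRel_iff]
      simp only [Subalgebra.coe_add, M.val_mul_smul, M.val_smul, M.val_d, M.val_w, M.val_v,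
        fin5_add, Fin.isValue, Fin.reduceAdd, add_zero]
      exact this

section Relations

variable {a b c d e : ℕ}

theorem exists_pentagon_vec (h : ChordSystem p n C) (H : Cyc5 a b c d e) (ha : a ≤ n)
    (hb : b ≤ n) (hc : c ≤ n) (hd : d ≤ n) (he : e ≤ n) :
    ∃ M : PentagonModel p C ![a, b, c, d, e], Pentagon M.param M.a M.d M.w M.v :=
  h.exists_pentagon H fun i => by fin_cases i <;> assumption

theorem triRel_ra (h : ChordSystem p n C) (H : Cyc5 a b c d e) (ha : a ≤ n)
    (hb : b ≤ n) (hc : c ≤ n) (hd : d ≤ n) (he : e ≤ n) :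
    TriRel p (chordCrossing p C b c d e) (C d a) (chordCrossing p C e a b c)
      (C b c * C e a + C d e * chordCrossing p C b c d a) := by
  obtain ⟨M, P⟩ := h.exists_pentagon_vec H ha hb hc hd he
  have := M.triRel_iff.mp (P.ra 0)
  simp only [Subalgebra.coe_add, M.val_mul_smul, M.val_smul, M.val_d, M.val_w, M.val_v,
    Fin.isValue, Fin.reduceAdd, zero_add] at this
  exact this

theorem triRel_va (h : ChordSystem p n C) (H : Cyc5 a b c d e) (ha : a ≤ n)
    (hb : b ≤ n) (hc : c ≤ n) (hd : d ≤ n) (he : e ≤ n) :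
    TriRel p (C d a) (chordCrossing p C c d e b) (chordCrossing p C a b c e)
      (C b c * C e a + C d e * chordCrossing p C a b c d) := by
  obtain ⟨M, P⟩ := h.exists_pentagon_vec H ha hb hc hd he
  have := M.triRel_iff.mp (P.va 0)
  simp only [Subalgebra.coe_add, M.val_mul_smul, M.val_smul, M.val_d, M.val_w, M.val_v,
    Fin.isValue, Fin.reduceAdd, zero_add] at this
  exact this

theorem triRel_rb (h : ChordSystem p n C) (H : Cyc5 a b c d e) (ha : a ≤ n)
    (hb : b ≤ n) (hc : c ≤ n) (hd : d ≤ n) (he : e ≤ n) :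
    TriRel p (C b d) (chordCrossing p C c d e a) (chordCrossing p C e a b c)
      (C b c * C e a + C c d * chordCrossing p C e a b d) := by
  obtain ⟨M, P⟩ := h.exists_pentagon_vec H ha hb hc hd he
  have := M.triRel_iff.mp (P.rb 0)
  simp only [Subalgebra.coe_add, M.val_mul_smul, M.val_smul, M.val_d, M.val_w, M.val_v,
    Fin.isValue, Fin.reduceAdd, zero_add] at this
  exact this

theorem triRel_vb (h : ChordSystem p n C) (H : Cyc5 a b c d e) (ha : a ≤ n)
    (hb : b ≤ n) (hc : c ≤ n) (hd : d ≤ n) (he : e ≤ n) :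
    TriRel p (chordCrossing p C d e a c) (C b d) (chordCrossing p C a b c e)
      (C b c * C e a + C c d * chordCrossing p C d e a b) := by
  obtain ⟨M, P⟩ := h.exists_pentagon_vec H ha hb hc hd he
  have := M.triRel_iff.mp (P.vb 0)
  simp only [Subalgebra.coe_add, M.val_mul_smul, M.val_smul, M.val_d, M.val_w, M.val_v,
    Fin.isValue, Fin.reduceAdd, zero_add] at this
  exact this

theorem triRel_crossing_crossing (h : ChordSystem p n C) (H : Cyc5 a b c d e) (ha : a ≤ n)
    (hb : b ≤ n) (hc : c ≤ n) (hd : d ≤ n) (he : e ≤ n) :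
    TriRel p (chordCrossing p C e a b c) (chordCrossing p C b c d e) (C d a)
      (C d e * C e a + C b c * chordCrossing p C b c d a) := by
  obtain ⟨M, P⟩ := h.exists_pentagon_vec H ha hb hc hd he
  have := M.triRel_iff.mp (P.w_w_two 0)
  simp only [Subalgebra.coe_add, M.val_mul_smul, M.val_smul, M.val_d, M.val_w, M.val_v,
    Fin.isValue, Fin.reduceAdd, zero_add] at this
  exact this

theorem commute_chordCrossing (h : ChordSystem p n C) (H : Cyc5 a b c d e) (ha : a ≤ n)
    (hb : b ≤ n) (hc : c ≤ n) (hd : d ≤ n) (he : e ≤ n) :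
    Commute (chordCrossing p C a b c d) (chordCrossing p C a b c e) := by
  obtain ⟨M, P⟩ := h.exists_pentagon_vec H ha hb hc hd he
  have := congrArg Subtype.val (P.cwv 0)
  simp only [Subalgebra.coe_mul, M.val_w, M.val_v, Fin.isValue, Fin.reduceAdd, zero_add] at this
  exact this

end Relations

end ChordSystem

end ChordPentagon

/-! ### The half twist of the two sides at a vertex -/

section Twist

variable {K A : Type*} [Field K] [Ring A] [Algebra K A] {p : K} {n : ℕ} {C : ℕ → ℕ → A}

/-- `F` is linear for the operation which twists the chords of a vertex. -/
def VertexLinear (p : K) (s t₁ t₂ : A) (F : (ℕ → A) → A) : Prop :=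
  ∀ f g h : ℕ → A, F (fun x => crossing p s (f x) (t₁ * g x + t₂ * h x)) =
    crossing p s (F f) (t₁ * F g + t₂ * F h)

namespace VertexLinear

variable {s t₁ t₂ : A} {F G : (ℕ → A) → A}

theorem eval (x : ℕ) : VertexLinear p s t₁ t₂ fun φ => φ x := fun _ _ _ => rfl

theorem add (hF : VertexLinear p s t₁ t₂ F) (hG : VertexLinear p s t₁ t₂ G) :
    VertexLinear p s t₁ t₂ fun φ => F φ + G φ := fun f g h => by
  change F _ + G _ = _
  rw [hF f g h, hG f g h]
  simp only [crossing, mul_add, add_mul, smul_add]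
  module

theorem sub (hF : VertexLinear p s t₁ t₂ F) (hG : VertexLinear p s t₁ t₂ G) :
    VertexLinear p s t₁ t₂ fun φ => F φ - G φ := fun f g h => by
  change F _ - G _ = _
  rw [hF f g h, hG f g h]
  simp only [crossing, mul_sub, sub_mul, smul_sub]
  module

theorem smul (k : K) (hF : VertexLinear p s t₁ t₂ F) :
    VertexLinear p s t₁ t₂ fun φ => k • F φ := fun f g h => by
  change k • F _ = _
  rw [hF f g h]
  simp only [crossing, mul_smul_comm, smul_mul_assoc]
  module

theorem mul_left {r : A} (hr : r ∈ Subalgebra.centralizer K {s, t₁, t₂})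
    (hF : VertexLinear p s t₁ t₂ F) : VertexLinear p s t₁ t₂ fun φ => r * F φ := fun f g h => by
  have h0 : s * r = r * s := hr s (by simp)
  have h1 : t₁ * r = r * t₁ := hr t₁ (by simp)
  have h2 : t₂ * r = r * t₂ := hr t₂ (by simp)
  change r * F _ = _
  rw [hF f g h]
  simp only [crossing, mul_sub, mul_add, mul_smul_comm]
  simp only [← mul_assoc, h0, h1, h2]

theorem mul_right {r : A} (hr : r ∈ Subalgebra.centralizer K {s, t₁, t₂})
    (hF : VertexLinear p s t₁ t₂ F) : VertexLinear p s t₁ t₂ fun φ => F φ * r := fun f g h => by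
  have h0 : s * r = r * s := hr s (by simp)
  change F _ * r = _
  rw [hF f g h]
  simp only [crossing, sub_mul, add_mul, smul_mul_assoc]
  simp only [mul_assoc, h0]

theorem crossing_left {r : A} (hr : r ∈ Subalgebra.centralizer K {s, t₁, t₂})
    (hF : VertexLinear p s t₁ t₂ F) (hG : VertexLinear p s t₁ t₂ G) :
    VertexLinear p s t₁ t₂ fun φ => crossing p r (F φ) (G φ) :=
  hG.sub ((((hF.mul_left hr).smul p).sub (hF.mul_right hr)).smul (p - 1)⁻¹)

theorem crossing_right {r : A} (hr : r ∈ Subalgebra.centralizer K {s, t₁, t₂})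
    (hF : VertexLinear p s t₁ t₂ F) (hG : VertexLinear p s t₁ t₂ G) :
    VertexLinear p s t₁ t₂ fun φ => crossing p (F φ) r (G φ) :=
  hG.sub ((((hF.mul_right hr).smul p).sub (hF.mul_left hr)).smul (p - 1)⁻¹)

/-- The row of twisted chords is the operation of `VertexLinear` applied to the rows `C o`, `C v`
and `C u`. An identity that is linear in the chords at a vertex therefore passes from `u`, `o`, `v`
to the twisted chords. -/
theorem transfer {u o v : ℕ} (hF : VertexLinear p (C u v) (C u o) (C o v) F)
    (hG : VertexLinear p (C u v) (C u o) (C o v) G) (hu : F (C u) = G (C u))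
    (ho : F (C o) = G (C o)) (hv : F (C v) = G (C v)) :
    F (chordCrossing p C u o v) = G (chordCrossing p C u o v) := by
  have h1 := hF (C o) (C v) (C u)
  have h2 := hG (C o) (C v) (C u)
  rw [hu, ho, hv, ← h2] at h1
  exact h1

end VertexLinear

/-- Consecutive vertices of the polygon with vertices `0, …, n`, the last one not being `0`. -/
def PolygonCorner (n u o v : ℕ) : Prop := v = o + 1 ∧ o < n ∧ (u + 1 = o ∨ (o = 0 ∧ u = n))

/-- The elements attached to the chords after the half twist of the vertices `o` and `v`. -/
def twist (p : K) (C : ℕ → ℕ → A) (u o v x y : ℕ) : A :=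
  if x = o then (if y = o then 1 else chordCrossing p C u o v y)
  else if y = o then chordCrossing p C u o v x else C x y

variable {u o v : ℕ}

theorem twist_left {y : ℕ} (hy : y ≠ o) : twist p C u o v o y = chordCrossing p C u o v y := by
  simp [twist, hy]

theorem twist_right {x : ℕ} (hx : x ≠ o) : twist p C u o v x o = chordCrossing p C u o v x := by
  simp [twist, hx]

theorem twist_self : twist p C u o v o o = 1 := by simp [twist]

theorem twist_of_ne {x y : ℕ} (hx : x ≠ o) (hy : y ≠ o) : twist p C u o v x y = C x y := by
  simp [twist, hx, hy]

theorem twist_symm (h : ∀ a b, C a b = C b a) (x y : ℕ) :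
    twist p C u o v x y = twist p C u o v y x := by
  unfold twist
  split_ifs <;> first | rfl | exact h _ _

theorem chordCrossing_twist_of_ne {a b c d : ℕ} (ha : a ≠ o) (hb : b ≠ o) (hc : c ≠ o)
    (hd : d ≠ o) :
    chordCrossing p (twist p C u o v) a b c d = chordCrossing p C a b c d := by
  simp only [chordCrossing, twist_of_ne, ha, hb, hc, hd, ne_eq, not_false_eq_true]

theorem PolygonCorner.cyc5 (H : PolygonCorner n u o v) {x y : ℕ} (hx : x ≤ n) (hy : y ≤ n)
    (hxo : x ≠ o) (hyo : y ≠ o) : Cyc5 u o v x y ∨ Cyc5 u o v y x := by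
  have key : ∀ {x y : ℕ}, x ≤ n → y ≤ n → x ≠ o → y ≠ o → x ≤ y →
      Cyc5 u o v x y ∨ Cyc5 u o v y x := by
    intro x y hx hy hxo hyo hxy
    obtain ⟨rfl, ho, hu⟩ := H
    rcases lt_or_gt_of_ne hxo with h1 | h1
    · rcases lt_or_gt_of_ne hyo with h2 | h2
      · exact Or.inl (Or.inr (Or.inr (Or.inr (Or.inl (by omega)))))
      · exact Or.inr (Or.inr (Or.inr (Or.inr (Or.inr (by omega)))))
    · rcases hu with hu | ⟨rfl, rfl⟩
      · exact Or.inl (Or.inl (by omega))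
      · exact Or.inl (Or.inr (Or.inl (by omega)))
  rcases le_total x y with h | h
  · exact key hx hy hxo hyo h
  · exact (key hy hx hyo hxo h).symm

theorem Cyc4.rotate {a b c d : ℕ} (H : Cyc4 a b c d) : Cyc4 b c d a := by
  unfold Cyc4 at *
  omega

namespace ChordSystem

/-- The vertices `u`, `o`, `v` are consecutive, so a chord that does not end at `o` crosses no side
of their triangle. -/
theorem chord_mem_centralizer (h : ChordSystem p n C) (H : PolygonCorner n u o v) {x y : ℕ}
    (hx : x ≤ n) (hy : y ≤ n) (hxo : x ≠ o) (hyo : y ≠ o) :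
    C x y ∈ Subalgebra.centralizer K {C u v, C u o, C o v} := by
  have key : ∀ s t, s ≤ n → t ≤ n → (Cyc4 s t x y ∨ Cyc4 s t y x) → Commute (C s t) (C x y) := by
    rintro s t hs ht (h1 | h1)
    · exact h.commute h1 hs ht hx hy
    · rw [h.symm x y]
      exact h.commute h1 hs ht hy hx
  unfold PolygonCorner at H
  rintro _ (rfl | rfl | rfl)
  · exact key u v (by omega) (by omega) (by unfold Cyc4; omega)
  · exact key u o (by omega) (by omega) (by unfold Cyc4; omega)
  · exact key o v (by omega) (by omega) (by unfold Cyc4; omega)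

theorem crossing_mem {s : Set A} {x y m : A} (hx : x ∈ Subalgebra.centralizer K s)
    (hy : y ∈ Subalgebra.centralizer K s) (hm : m ∈ Subalgebra.centralizer K s) :
    crossing p x y m ∈ Subalgebra.centralizer K s :=
  sub_mem hm (Subalgebra.smul_mem _
    (sub_mem (Subalgebra.smul_mem _ (mul_mem hx hy) _) (mul_mem hy hx)) _)

theorem commute_chordCrossing_chord (h : ChordSystem p n C) (H : PolygonCorner n u o v) {b c d : ℕ}
    (hb : b ≤ n) (hc : c ≤ n) (hd : d ≤ n) (hbo : b ≠ o) (hco : c ≠ o) (hdo : d ≠ o)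
    (hcyc : Cyc4 o b c d ∨ Cyc4 o c d b) : Commute (chordCrossing p C u o v b) (C c d) := by
  have hm := h.chord_mem_centralizer H hc hd hco hdo
  unfold PolygonCorner at H
  have key : ∀ t, t ≤ n → (Cyc4 t b c d ∨ Cyc4 t c d b) → C t b * C c d = C c d * C t b := by
    rintro t ht (ht' | ht')
    · exact h.commute ht' ht hb hc hd
    · rw [h.symm t b]
      exact h.commute ht'.rotate.rotate.rotate hb ht hc hd
  exact ((VertexLinear.eval b).mul_right hm).transfer ((VertexLinear.eval b).mul_left hm)
    (key u (by omega) (by unfold Cyc4 at *; omega)) (key o (by omega) hcyc)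
    (key v (by omega) (by unfold Cyc4 at *; omega))

/-- A twisted chord commutes with a suitable untwisted one because this condition is linear at `o`.
That two twisted chords commute is the pentagon identity `Pentagon.cwv`. -/
theorem chordComm_twist (h : ChordSystem p n C) (H : PolygonCorner n u o v) :
    ChordComm n (twist p C u o v) := by
  have symm := twist_symm (p := p) (u := u) (o := o) (v := v) h.symm
  have key1 : ∀ x y z, x ≤ n → y ≤ n → z ≤ n → x ≠ o → (Cyc4 o x y z ∨ Cyc4 o y z x) →
      Commute (twist p C u o v o x) (twist p C u o v y z) := by
    intro x y z hx hy hz hxo hcyc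
    rw [twist_left hxo]
    have hcr : ∀ w, w ≤ n → w ≠ o →
        Commute (chordCrossing p C u o v x) (chordCrossing p C u o v w) := by
      intro w hw hwo
      have hu : u ≤ n ∧ o ≤ n ∧ v ≤ n := by
        unfold PolygonCorner at H
        omega
      rcases H.cyc5 hx hw hxo hwo with h1 | h1
      · exact h.commute_chordCrossing h1 hu.1 hu.2.1 hu.2.2 hx hw
      · exact (h.commute_chordCrossing h1 hu.1 hu.2.1 hu.2.2 hw hx).symm
    by_cases hyo : y = o
    · by_cases hzo : z = o
      · rw [hyo, hzo, twist_self]; exact Commute.one_right _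
      · rw [hyo, twist_left hzo]; exact hcr z hz hzo
    · by_cases hzo : z = o
      · rw [hzo, twist_right hyo]; exact hcr y hy hyo
      · rw [twist_of_ne hyo hzo]
        exact h.commute_chordCrossing_chord H hx hy hz hxo hyo hzo hcyc
  have key : ∀ a b c d, a ≤ n → b ≤ n → c ≤ n → d ≤ n → Cyc4 a b c d →
      Commute (twist p C u o v a b) (twist p C u o v c d) := by
    intro a b c d ha hb hc hd hcyc
    by_cases hao : a = o
    · by_cases hbo : b = o
      · rw [hao, hbo, twist_self]; exact Commute.one_left _
      · rw [hao]
        exact key1 b c d hb hc hd hbo (Or.inl (hao ▸ hcyc))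
    by_cases hbo : b = o
    · rw [symm a b, hbo]
      exact key1 a c d ha hc hd hao (Or.inr (hbo ▸ Cyc4.rotate hcyc))
    by_cases hco : c = o
    · by_cases hdo : d = o
      · rw [hco, hdo, twist_self]; exact Commute.one_right _
      · rw [hco]
        exact (key1 d a b hd ha hb hdo (Or.inl (hco ▸ hcyc.rotate.rotate))).symm
    by_cases hdo : d = o
    · rw [symm c d, hdo]
      exact (key1 c a b hc ha hb hco (Or.inr (hdo ▸ hcyc.rotate.rotate.rotate))).symm
    rw [twist_of_ne hao hbo, twist_of_ne hco hdo]
    exact h.commute hcyc ha hb hc hd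
  refine ⟨symm, fun a => ?_, fun a b c d h1 h2 h3 h4 => ⟨?_, ?_⟩⟩
  · by_cases ha : a = o
    · rw [ha, twist_self]
    · rw [twist_of_ne ha ha, h.diag]
  · exact key a b c d (by omega) (by omega) (by omega) h4 (Or.inl ⟨h1, h2, h3⟩)
  · rw [symm a d]
    exact key d a b c h4 (by omega) (by omega) (by omega) (by unfold Cyc4; omega)

theorem quadRel_twist_of_ne (h : ChordSystem p n C) {a b c d : ℕ} (hcyc : Cyc4 a b c d)
    (ha : a ≤ n) (hb : b ≤ n) (hc : c ≤ n) (hd : d ≤ n) (hao : a ≠ o) (hbo : b ≠ o) (hco : c ≠ o)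
    (hdo : d ≠ o) : QuadRel p (twist p C u o v) a b c d := by
  have := h.quadRel hcyc ha hb hc hd
  refine ⟨?_, ?_⟩
  · simp only [chordCrossing_twist_of_ne hao hbo hco hdo, twist_of_ne, ne_eq, hao, hbo, hco, hdo,
      not_false_eq_true]
    exact this.x
  · simp only [chordCrossing_twist_of_ne hbo hco hdo hao, twist_of_ne, ne_eq, hao, hbo, hco, hdo,
      not_false_eq_true]
    exact this.vy

/-- With its companion below: the half twist exchanges the two sides that meet at `o`. -/
theorem chordCrossing_corner_left (h : ChordSystem p n C) (H : PolygonCorner n u o v) :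
    chordCrossing p C u o v u = C o v := by
  unfold PolygonCorner at H
  rw [chordCrossing, h.diag, mul_one, h.symm v u, h.symm o u]
  have : Commute (C u o) (C u v) := by
    rw [h.symm u v]
    exact (h.commute (by unfold Cyc4; omega) (by omega) (by omega) (by omega) (by omega)).symm
  rw [this.eq]
  exact crossing_of_commute h.sub_ne this.eq.symm _

theorem chordCrossing_corner_right (h : ChordSystem p n C) (H : PolygonCorner n u o v) :
    chordCrossing p C u o v v = C u o := by
  unfold PolygonCorner at H
  rw [chordCrossing, h.diag, mul_one]
  have : Commute (C o v) (C u v) := by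
    rw [h.symm u v]
    exact h.commute (by unfold Cyc4; omega) (by omega) (by omega) (by omega) (by omega)
  rw [this.eq, add_comm]
  exact crossing_of_commute h.sub_ne this.eq.symm _

/-- The relations of a quadrilateral which contains the two twisted vertices. -/
theorem quadRel_twist_corner (h : ChordSystem p n C) (H : PolygonCorner n u o v) {c d : ℕ}
    (hcyc : Cyc4 o v c d) (hc : c ≤ n) (hd : d ≤ n) (hco : c ≠ o) (hdo : d ≠ o) :
    QuadRel p (twist p C u o v) o v c d := by
  have H' := H
  unfold PolygonCorner at H'
  have hvo : v ≠ o := by omega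
  have hcyc5 : Cyc5 d u o v c := by unfold Cyc4 Cyc5 at *; omega
  have hcyc5' : Cyc5 o v c d u := by unfold Cyc4 Cyc5 at *; omega
  have hra := h.triRel_ra hcyc5 hd (by omega) (by omega) (by omega) hc
  have hrb := h.triRel_rb hcyc5' (by omega) (by omega) hc hd (by omega)
  have e := (_root_.triRel_iff h.sub_ne).mp hra
  have eDv := h.chordCrossing_corner_right H
  have eDv' : twist p C u o v o v = C u o := by rw [twist_left hvo, eDv]
  -- The pentagon relation `ra` says that the resolved crossing of the twisted quadrilateral is an
  -- ordinary resolved crossing with the vertex `u` in place of `v`; `rb` is then the relation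
  -- wanted.
  have eZ : chordCrossing p (twist p C u o v) o v c d = chordCrossing p C c d u o := by
    rw [e, chordCrossing, eDv', twist_left hco, twist_left hdo, twist_of_ne hvo hdo,
      twist_of_ne hco hdo, twist_of_ne hvo hco]
  have e1 : C u o * C v c = C v c * C u o :=
    h.commute (by unfold Cyc4; omega) (by omega) (by omega) (by omega) hc
  have e2 : C u o * C c d = C c d * C u o :=
    h.commute (by unfold Cyc4 Cyc5 at *; omega) (by omega) (by omega) hc hd
  refine ⟨?_, ?_⟩
  · rw [eZ, eDv', twist_left hco, twist_left hdo, twist_of_ne hvo hdo,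
      twist_of_ne hco hdo, twist_of_ne hvo hco, e1]
    exact hrb
  · obtain ⟨M, P⟩ := h.exists_pentagon_vec hcyc5 hd (by omega) (by omega) (by omega) hc
    -- The identity `w_w_two` is the relation for one resolution, and `TriRel.vy_of_y` transfers it
    -- to the other one.
    set m : M.B := (M.a 1 * M.a 4) • 1 + M.a 3 • M.v 1 with hm
    have hvz : TriRel M.param (M.d 4) (M.w 2) (crossing p (M.d 4) (M.w 2) m) m := by
      rw [M.triRel_iff]
      exact (_root_.triRel_iff h.sub_ne).mpr (map_crossing M.B.val _ _ _)
    have := M.triRel_iff.mp (TriRel.vy_of_y P.unit_sub (P.ra 0) hvz (P.w_w_two 0) (P.cwv 1).symm)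
    rw [show ((crossing p (M.d 4) (M.w 2) m : M.B) : A) =
      crossing p (M.d 4 : A) (M.w 2 : A) (m : A) from map_crossing M.B.val _ _ _, hm] at this
    simp only [Subalgebra.coe_add, M.val_mul_smul, M.val_smul, M.val_d, M.val_w, M.val_v,
      Fin.isValue, Fin.reduceAdd, zero_add] at this
    have eZ' : chordCrossing p (twist p C u o v) v c d o =
        crossing p (C v d) (chordCrossing p C u o v c)
          (C u o * C c d + C v c * chordCrossing p C u o v d) := by
      rw [chordCrossing, twist_right hco, twist_right hdo, twist_right hvo, eDv,
        twist_of_ne hvo hdo, twist_of_ne hco hdo, twist_of_ne hvo hco, e2, add_comm (C c d * _)]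
    rw [eZ', eDv', twist_left hco, twist_left hdo, twist_of_ne hvo hdo,
      twist_of_ne hco hdo, twist_of_ne hvo hco]
    exact this

end ChordSystem

end Twist

/-! ### The twisted chords form a chord system -/

section TwistSystem

variable {K A : Type*} [Field K] [Ring A] [Algebra K A] {p : K} {n : ℕ} {C : ℕ → ℕ → A}
  {u o v : ℕ}

theorem Cyc5.replace (H : PolygonCorner n u o v) {b c d e : ℕ} (hcyc : Cyc5 o b c d e)
    (hb : b ≤ n) (hc : c ≤ n) (hd : d ≤ n) (he : e ≤ n) (hbo : b ≠ o) (hco : c ≠ o) (hdo : d ≠ o)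
    (heo : e ≠ o) : Cyc5 u b c d e ∧ Cyc5 v b c d e := by
  obtain ⟨rfl, ho, hu⟩ := H
  unfold Cyc5 at *
  rcases hcyc with h | h | h | h | h
  · rcases hu with hu | ⟨rfl, rfl⟩
    · exact ⟨Or.inl (by omega), Or.inl (by omega)⟩
    · exact ⟨Or.inr (Or.inl (by omega)), Or.inl (by omega)⟩
  · exact ⟨Or.inr (Or.inl (by omega)), Or.inr (Or.inl (by omega))⟩
  · exact ⟨Or.inr (Or.inr (Or.inl (by omega))), Or.inr (Or.inr (Or.inl (by omega)))⟩
  · exact ⟨Or.inr (Or.inr (Or.inr (Or.inl (by omega)))),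
      Or.inr (Or.inr (Or.inr (Or.inl (by omega))))⟩
  · exact ⟨Or.inr (Or.inr (Or.inr (Or.inr (by omega)))),
      Or.inr (Or.inr (Or.inr (Or.inr (by omega))))⟩

theorem Cyc5.rotate {a b c d e : ℕ} (H : Cyc5 a b c d e) : Cyc5 b c d e a := by
  unfold Cyc5 at *
  tauto

theorem Cyc5.drop {a b c d e : ℕ} (H : Cyc5 a b c d e) : Cyc4 a b c d := by
  unfold Cyc5 at H
  unfold Cyc4
  rcases H with h | h | h | h | h <;> omega

namespace ChordSystem

/-- A family of relations which are linear at a vertex is preserved by the twist. -/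
theorem triRel_transfer (h : ChordSystem p n C) {F G : (ℕ → A) → A} {s : A}
    (hs : s ∈ Subalgebra.centralizer K {C u v, C u o, C o v})
    {Z : (ℕ → A) → A} (hF : VertexLinear p (C u v) (C u o) (C o v) F)
    (hG : VertexLinear p (C u v) (C u o) (C o v) G)
    (hZ : VertexLinear p (C u v) (C u o) (C o v) Z)
    (H : ∀ t, t = u ∨ t = o ∨ t = v → TriRel p s (F (C t)) (Z (C t)) (G (C t))) :
    TriRel p s (F (chordCrossing p C u o v)) (Z (chordCrossing p C u o v))
      (G (chordCrossing p C u o v)) := by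
  rw [_root_.triRel_iff h.sub_ne]
  exact hZ.transfer (hF.crossing_left hs hG) ((_root_.triRel_iff h.sub_ne).mp (H u (by simp)))
    ((_root_.triRel_iff h.sub_ne).mp (H o (by simp))) ((_root_.triRel_iff h.sub_ne).mp (H v (by simp)))

theorem triRel_transfer' (h : ChordSystem p n C) {F G : (ℕ → A) → A} {s : A}
    (hs : s ∈ Subalgebra.centralizer K {C u v, C u o, C o v})
    {Z : (ℕ → A) → A} (hF : VertexLinear p (C u v) (C u o) (C o v) F)
    (hG : VertexLinear p (C u v) (C u o) (C o v) G)
    (hZ : VertexLinear p (C u v) (C u o) (C o v) Z)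
    (H : ∀ t, t = u ∨ t = o ∨ t = v → TriRel p (F (C t)) s (Z (C t)) (G (C t))) :
    TriRel p (F (chordCrossing p C u o v)) s (Z (chordCrossing p C u o v))
      (G (chordCrossing p C u o v)) := by
  rw [_root_.triRel_iff h.sub_ne]
  exact hZ.transfer (hF.crossing_right hs hG) ((_root_.triRel_iff h.sub_ne).mp (H u (by simp)))
    ((_root_.triRel_iff h.sub_ne).mp (H o (by simp))) ((_root_.triRel_iff h.sub_ne).mp (H v (by simp)))

section Linear

variable {b c d e : ℕ}

/-- This relation and the next four are linear in the chords at the twisted vertex, so they are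
transferred from `u`, `o` and `v`. The functionals `F`, `Z`, `G` are obtained from the relation by
treating the row of chords at the vertex as a variable `φ`. -/
theorem triRel_vy_twist (h : ChordSystem p n C) (H : PolygonCorner n u o v)
    (hcyc : ∀ t, t = u ∨ t = o ∨ t = v → t ≤ n ∧ Cyc4 b c d t) (hb : b ≤ n) (hc : c ≤ n) (hd : d ≤ n)
    (hbo : b ≠ o) (hco : c ≠ o) (hdo : d ≠ o) :
    TriRel p (twist p C u o v b d) (chordCrossing p (twist p C u o v) c d o b) (twist p C u o v c o)
      (twist p C u o v c d * twist p C u o v d o + twist p C u o v b c * twist p C u o v b o) := by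
  have m := fun {x y} => h.chord_mem_centralizer H (x := x) (y := y)
  have key := h.triRel_transfer (u := u) (o := o) (v := v) (m hb hd hbo hdo)
    (F := fun φ => crossing p (φ c) (C d b) (C c d * φ b + φ d * C c b))
    (G := fun φ => C c d * φ d + C b c * φ b) (Z := fun φ => φ c)
    ((VertexLinear.eval c).crossing_right (m hd hb hdo hbo)
      (((VertexLinear.eval b).mul_left (m hc hd hco hdo)).add
        ((VertexLinear.eval d).mul_right (m hc hb hco hbo))))
    (((VertexLinear.eval d).mul_left (m hc hd hco hdo)).add
      ((VertexLinear.eval b).mul_left (m hb hc hbo hco)))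
    (VertexLinear.eval c) ?_
  · simp only [chordCrossing, twist_left, twist_right, twist_of_ne, ne_eq, hbo, hco, hdo,
      not_false_eq_true] at key ⊢
    exact key
  · intro t ht
    obtain ⟨htn, ht'⟩ := hcyc t ht
    have := (h.quadRel ht' hb hc hd htn).vy
    simp only [chordCrossing, h.symm _ t] at this
    exact this

theorem triRel_ra_twist (h : ChordSystem p n C) (H : PolygonCorner n u o v)
    (hcyc : ∀ t, t = u ∨ t = o ∨ t = v → t ≤ n ∧ Cyc5 t b c d e) (hb : b ≤ n) (hc : c ≤ n)
    (hd : d ≤ n) (he : e ≤ n) (hbo : b ≠ o) (hco : c ≠ o) (hdo : d ≠ o) (heo : e ≠ o) :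
    TriRel p (chordCrossing p (twist p C u o v) b c d e) (twist p C u o v d o)
      (chordCrossing p (twist p C u o v) e o b c)
      (twist p C u o v b c * twist p C u o v e o +
        twist p C u o v d e * chordCrossing p (twist p C u o v) b c d o) := by
  have m := fun {x y} => h.chord_mem_centralizer H (x := x) (y := y)
  have key := h.triRel_transfer (u := u) (o := o) (v := v) (s := chordCrossing p C b c d e)
    (crossing_mem (m hb hd hbo hdo) (m hc he hco heo) (add_mem
      (mul_mem (m hb hc hbo hco) (m hd he hdo heo)) (mul_mem (m hc hd hco hdo) (m hb he hbo heo))))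
    (F := fun φ => φ d)
    (Z := fun φ => crossing p (C e b) (φ c) (φ e * C b c + φ b * C e c))
    (G := fun φ => C b c * φ e +
      C d e * crossing p (C b d) (φ c) (C b c * φ d + C c d * φ b))
    (VertexLinear.eval d)
    (((VertexLinear.eval e).mul_left (m hb hc hbo hco)).add
      (((VertexLinear.eval c).crossing_left (m hb hd hbo hdo)
        (((VertexLinear.eval d).mul_left (m hb hc hbo hco)).add
        ((VertexLinear.eval b).mul_left (m hc hd hco hdo)))).mul_left (m hd he hdo heo)))
    ((VertexLinear.eval c).crossing_left (m he hb heo hbo)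
      (((VertexLinear.eval e).mul_right (m hb hc hbo hco)).add
        ((VertexLinear.eval b).mul_right (m he hc heo hco)))) ?_
  · simp only [chordCrossing, twist_left, twist_right, twist_of_ne, ne_eq, hbo, hco, hdo, heo,
      not_false_eq_true] at key ⊢
    exact key
  · intro t ht
    obtain ⟨htn, ht'⟩ := hcyc t ht
    have := h.triRel_ra ht' htn hb hc hd he
    simp only [chordCrossing, h.symm _ t] at this
    exact this

theorem triRel_va_twist (h : ChordSystem p n C) (H : PolygonCorner n u o v)
    (hcyc : ∀ t, t = u ∨ t = o ∨ t = v → t ≤ n ∧ Cyc5 t b c d e) (hb : b ≤ n) (hc : c ≤ n)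
    (hd : d ≤ n) (he : e ≤ n) (hbo : b ≠ o) (hco : c ≠ o) (hdo : d ≠ o) (heo : e ≠ o) :
    TriRel p (twist p C u o v d o) (chordCrossing p (twist p C u o v) c d e b)
      (chordCrossing p (twist p C u o v) o b c e)
      (twist p C u o v b c * twist p C u o v e o +
        twist p C u o v d e * chordCrossing p (twist p C u o v) o b c d) := by
  have m := fun {x y} => h.chord_mem_centralizer H (x := x) (y := y)
  have key := h.triRel_transfer' (u := u) (o := o) (v := v) (s := chordCrossing p C c d e b)
    (crossing_mem (m hc he hco heo) (m hd hb hdo hbo) (add_mem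
      (mul_mem (m hc hd hco hdo) (m he hb heo hbo)) (mul_mem (m hd he hdo heo) (m hc hb hco hbo))))
    (F := fun φ => φ d)
    (Z := fun φ => crossing p (φ c) (C b e) (φ b * C c e + C b c * φ e))
    (G := fun φ => C b c * φ e +
      C d e * crossing p (φ c) (C b d) (φ b * C c d + C b c * φ d))
    (VertexLinear.eval d)
    (((VertexLinear.eval e).mul_left (m hb hc hbo hco)).add
      (((VertexLinear.eval c).crossing_right (m hb hd hbo hdo)
        (((VertexLinear.eval b).mul_right (m hc hd hco hdo)).add
        ((VertexLinear.eval d).mul_left (m hb hc hbo hco)))).mul_left (m hd he hdo heo)))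
    ((VertexLinear.eval c).crossing_right (m hb he hbo heo)
      (((VertexLinear.eval b).mul_right (m hc he hco heo)).add
        ((VertexLinear.eval e).mul_left (m hb hc hbo hco)))) ?_
  · simp only [chordCrossing, twist_left, twist_right, twist_of_ne, ne_eq, hbo, hco, hdo, heo,
      not_false_eq_true] at key ⊢
    exact key
  · intro t ht
    obtain ⟨htn, ht'⟩ := hcyc t ht
    have := h.triRel_va ht' htn hb hc hd he
    simp only [chordCrossing, h.symm _ t] at this
    exact this

theorem triRel_ra_last_twist (h : ChordSystem p n C) (H : PolygonCorner n u o v)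
    (hcyc : ∀ t, t = u ∨ t = o ∨ t = v → t ≤ n ∧ Cyc5 t b c d e) (hb : b ≤ n) (hc : c ≤ n)
    (hd : d ≤ n) (he : e ≤ n) (hbo : b ≠ o) (hco : c ≠ o) (hdo : d ≠ o) (heo : e ≠ o) :
    TriRel p (chordCrossing p (twist p C u o v) o b c d) (twist p C u o v c e)
      (chordCrossing p (twist p C u o v) d e o b)
      (twist p C u o v o b * twist p C u o v d e +
        twist p C u o v c d * chordCrossing p (twist p C u o v) o b c e) := by
  have m := fun {x y} => h.chord_mem_centralizer H (x := x) (y := y)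
  have key := h.triRel_transfer' (u := u) (o := o) (v := v) (m hc he hco heo)
    (F := fun φ => crossing p (φ c) (C b d) (φ b * C c d + C b c * φ d))
    (Z := fun φ => crossing p (φ d) (C e b) (C d e * φ b + φ e * C d b))
    (G := fun φ => φ b * C d e +
      C c d * crossing p (φ c) (C b e) (φ b * C c e + C b c * φ e))
    ((VertexLinear.eval c).crossing_right (m hb hd hbo hdo)
      (((VertexLinear.eval b).mul_right (m hc hd hco hdo)).add
        ((VertexLinear.eval d).mul_left (m hb hc hbo hco))))
    (((VertexLinear.eval b).mul_right (m hd he hdo heo)).add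
      (((VertexLinear.eval c).crossing_right (m hb he hbo heo)
        (((VertexLinear.eval b).mul_right (m hc he hco heo)).add
        ((VertexLinear.eval e).mul_left (m hb hc hbo hco)))).mul_left (m hc hd hco hdo)))
    ((VertexLinear.eval d).crossing_right (m he hb heo hbo)
      (((VertexLinear.eval b).mul_left (m hd he hdo heo)).add
        ((VertexLinear.eval e).mul_right (m hd hb hdo hbo)))) ?_
  · simp only [chordCrossing, twist_left, twist_right, twist_of_ne, ne_eq, hbo, hco, hdo, heo,
      not_false_eq_true] at key ⊢
    exact key
  · intro t ht
    obtain ⟨htn, ht'⟩ := hcyc t ht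
    have := h.triRel_ra ht'.rotate.rotate.rotate.rotate he htn hb hc hd
    simp only [chordCrossing, h.symm _ t] at this
    exact this

theorem triRel_va_last_twist (h : ChordSystem p n C) (H : PolygonCorner n u o v)
    (hcyc : ∀ t, t = u ∨ t = o ∨ t = v → t ≤ n ∧ Cyc5 t b c d e) (hb : b ≤ n) (hc : c ≤ n)
    (hd : d ≤ n) (he : e ≤ n) (hbo : b ≠ o) (hco : c ≠ o) (hdo : d ≠ o) (heo : e ≠ o) :
    TriRel p (twist p C u o v c e) (chordCrossing p (twist p C u o v) b c d o)
      (chordCrossing p (twist p C u o v) e o b d)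
      (twist p C u o v o b * twist p C u o v d e +
        twist p C u o v c d * chordCrossing p (twist p C u o v) e o b c) := by
  have m := fun {x y} => h.chord_mem_centralizer H (x := x) (y := y)
  have key := h.triRel_transfer (u := u) (o := o) (v := v) (m hc he hco heo)
    (F := fun φ => crossing p (C b d) (φ c) (C b c * φ d + C c d * φ b))
    (Z := fun φ => crossing p (C e b) (φ d) (φ e * C b d + φ b * C e d))
    (G := fun φ => φ b * C d e +
      C c d * crossing p (C e b) (φ c) (φ e * C b c + φ b * C e c))
    ((VertexLinear.eval c).crossing_left (m hb hd hbo hdo)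
      (((VertexLinear.eval d).mul_left (m hb hc hbo hco)).add
        ((VertexLinear.eval b).mul_left (m hc hd hco hdo))))
    (((VertexLinear.eval b).mul_right (m hd he hdo heo)).add
      (((VertexLinear.eval c).crossing_left (m he hb heo hbo)
        (((VertexLinear.eval e).mul_right (m hb hc hbo hco)).add
        ((VertexLinear.eval b).mul_right (m he hc heo hco)))).mul_left (m hc hd hco hdo)))
    ((VertexLinear.eval d).crossing_left (m he hb heo hbo)
      (((VertexLinear.eval e).mul_right (m hb hd hbo hdo)).add
        ((VertexLinear.eval b).mul_right (m he hd heo hdo)))) ?_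
  · simp only [chordCrossing, twist_left, twist_right, twist_of_ne, ne_eq, hbo, hco, hdo, heo,
      not_false_eq_true] at key ⊢
    exact key
  · intro t ht
    obtain ⟨htn, ht'⟩ := hcyc t ht
    have := h.triRel_va ht'.rotate.rotate.rotate.rotate he htn hb hc hd
    simp only [chordCrossing, h.symm _ t] at this
    exact this

/-- One of the two relations is quadratic in the chords at `o` and cannot be transferred. The vertex
`v` is added, and in the pentagon `o, v, b, c, d` of twisted chords every other relation is known:
those with `o` and `v` by `quadRel_twist_corner`, that of `v, b, c, d` because it is not affected,
and the remaining ones by linearity. Then `PrePentagon.of_incomplete` yields the missing one. -/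
theorem quadRel_twist (h : ChordSystem p n C) (H : PolygonCorner n u o v) (hcyc : Cyc4 o b c d)
    (hb : b ≤ n) (hc : c ≤ n) (hd : d ≤ n) (hbo : b ≠ o) (hco : c ≠ o) (hdo : d ≠ o) :
    QuadRel p (twist p C u o v) o b c d := by
  have H' := H
  unfold PolygonCorner at H'
  have hvo : v ≠ o := by omega
  have hun : u ≤ n := by omega
  have hon : o ≤ n := by omega
  have hvn : v ≤ n := by omega
  have Hc := h.chordComm_twist H
  have h5 : Cyc5 o v b c d := by
    unfold Cyc4 Cyc5 at *
    omega
  have hvbcd : Cyc4 v b c d := (h5.rotate).drop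
  have hbcd : ∀ t, t = u ∨ t = o ∨ t = v → t ≤ n ∧ Cyc4 b c d t := by
    rintro t (rfl | rfl | rfl)
    · refine ⟨hun, ?_⟩
      unfold Cyc4 at *
      omega
    · exact ⟨hon, hcyc.rotate⟩
    · exact ⟨hvn, hvbcd.rotate⟩
  have h5t : ∀ t, t = u ∨ t = o ∨ t = v → t ≤ n ∧ Cyc5 t v b c d := by
    have := h5.replace H hvn hb hc hd hvo hbo hco hdo
    rintro t (rfl | rfl | rfl)
    · exact ⟨hun, this.1⟩
    · exact ⟨hon, h5⟩
    · exact ⟨hvn, this.2⟩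
  have hx : ∀ i, ![o, v, b, c, d] i ≤ n := fun i => by fin_cases i <;> assumption
  have hcorner : ∀ {x y}, Cyc4 o v x y → x ≤ n → y ≤ n → x ≠ o → y ≠ o →
    QuadRel p (twist p C u o v) o v x y := fun h1 h2 h3 h4 h5 =>
      h.quadRel_twist_corner H h1 h2 h3 h4 h5
  obtain ⟨M⟩ := Hc.nonempty_model p (x := ![o, v, b, c, d]) h5 hx
  have Q0 : QuadRel p (twist p C u o v) o v b d :=
    hcorner (h5.cyc4 (x := ![o, v, b, c, d]) 0).2.1 hb hd hbo hdo
  have Q1 : QuadRel p (twist p C u o v) o v b c := hcorner h5.drop hb hc hbo hco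
  have Q4 : QuadRel p (twist p C u o v) o v c d :=
    hcorner (h5.cyc4 (x := ![o, v, b, c, d]) 0).2.2 hc hd hco hdo
  have Q2 : QuadRel p (twist p C u o v) v b c d :=
    h.quadRel_twist_of_ne hvbcd hvn hb hc hd hvo hbo hco hdo
  have c0 : Cyc4 o v b d := (h5.cyc4 (x := ![o, v, b, c, d]) 0).2.1
  have c4 : Cyc4 o v c d := (h5.cyc4 (x := ![o, v, b, c, d]) 0).2.2
  have Q0' : QuadRel p (twist p C u o v) d o v b :=
    Hc.quadRel_rotate c0.rotate.rotate hb hd hon hvn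
      (Hc.quadRel_rotate c0.rotate hvn hb hd hon (Hc.quadRel_rotate c0 hon hvn hb hd Q0))
  have Q4' : QuadRel p (twist p C u o v) c d o v :=
    Hc.quadRel_rotate c4.rotate hvn hc hd hon (Hc.quadRel_rotate c4 hon hvn hc hd Q4)
  have R0 := (M.quadRel_iff Hc.symm 0).mp Q0'
  have R1 := (M.quadRel_iff Hc.symm 1).mp Q1
  have R2 := (M.quadRel_iff Hc.symm 2).mp Q2
  have R4 := (M.quadRel_iff Hc.symm 4).mp Q4'
  have hvy3 : TriRel M.param (M.d 3) (M.v 3) (M.d (3 + 1))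
      ((M.a 3 * M.a (3 + 1)) • 1 + M.a (3 + 4) • M.d (3 + 3)) := by
    rw [M.triRel_iff]
    simp only [Subalgebra.coe_add, M.val_mul_smul, M.val_smul, M.val_d, M.val_v,
      Fin.isValue, Fin.reduceAdd]
    have := h.triRel_vy_twist H hbcd hb hc hd hbo hco hdo
    rw [Hc.symm b o] at this
    exact this
  have P : PrePentagon M.param M.a M.d M.w M.v := by
    refine PrePentagon.of_incomplete (M.isUnit_algebraMap h.ne_zero) ?_ ?_
      (M.triRel_w Hc.symm h.sub_ne) (M.triRel_v Hc.symm h.sub_ne) ?_ ?_ (Hc.model_comm h5 hx M)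
      ?_ ?_ ?_ ?_
    · have := M.isUnit_algebraMap h.sub_ne
      rwa [map_sub, map_one] at this
    · have := M.isUnit_algebraMap h.add_ne
      rwa [map_add, map_one] at this
    · intro i hi
      fin_cases i
      exacts [R0.1, R1.1, R2.1, absurd rfl hi, R4.1]
    · intro i
      fin_cases i
      exacts [R0.2, R1.2, R2.2, hvy3, R4.2]
    all_goals
      rw [M.triRel_iff]
      simp only [Subalgebra.coe_add, M.val_mul_smul, M.val_smul, M.val_d, M.val_w, M.val_v,
        Fin.isValue, Fin.reduceAdd]
    · exact h.triRel_ra_twist H h5t hvn hb hc hd hvo hbo hco hdo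
    · exact h.triRel_ra_last_twist H h5t hvn hb hc hd hvo hbo hco hdo
    · exact h.triRel_va_twist H h5t hvn hb hc hd hvo hbo hco hdo
    · exact h.triRel_va_last_twist H h5t hvn hb hc hd hvo hbo hco hdo
  have Q3 : QuadRel p (twist p C u o v) b c d o := (M.quadRel_iff Hc.symm 3).mpr ⟨P.x 3, P.vy 3⟩
  exact Hc.quadRel_rotate hcyc.rotate.rotate.rotate hd hon hb hc
    (Hc.quadRel_rotate hcyc.rotate.rotate hc hd hon hb
      (Hc.quadRel_rotate hcyc.rotate hb hc hd hon Q3))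

end Linear

theorem preChordSystem_twist (h : ChordSystem p n C) (H : PolygonCorner n u o v) :
    PreChordSystem p n (twist p C u o v) where
  toChordComm := h.chordComm_twist H
  ne_zero := h.ne_zero
  sub_ne := h.sub_ne
  add_ne := h.add_ne
  quad a b c d hab hbc hcd hd := by
    have Hc := h.chordComm_twist H
    have q : Cyc4 a b c d := Or.inl ⟨hab.le, hbc.le, hcd.le⟩
    have ha : a ≤ n := by omega
    have hb : b ≤ n := by omega
    have hc : c ≤ n := by omega
    by_cases hao : a = o
    · subst hao
      exact h.quadRel_twist H q hb hc hd (by omega) (by omega) (by omega)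
    by_cases hbo : b = o
    · subst hbo
      have q' := q.rotate
      exact Hc.quadRel_rotate q'.rotate.rotate hd ha hb hc
        (Hc.quadRel_rotate q'.rotate hc hd ha hb (Hc.quadRel_rotate q' hb hc hd ha
          (h.quadRel_twist H q' hc hd ha (by omega) (by omega) (by omega))))
    by_cases hco : c = o
    · subst hco
      have q' := q.rotate.rotate
      exact Hc.quadRel_rotate q'.rotate hd ha hb hc (Hc.quadRel_rotate q' hc hd ha hb
        (h.quadRel_twist H q' hd ha hb (by omega) (by omega) (by omega)))
    by_cases hdo : d = o
    · subst hdo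
      have q' := q.rotate.rotate.rotate
      exact Hc.quadRel_rotate q' hd ha hb hc
        (h.quadRel_twist H q' ha hb hc (by omega) (by omega) (by omega))
    exact h.quadRel_twist_of_ne q ha hb hc hd hao hbo hco hdo

/-- With the twisted vertex in the first position both relations needed by `PrePentagon.toPentagon`
are linear at that vertex. -/
theorem exists_pentagon_twist (h : ChordSystem p n C) (H : PolygonCorner n u o v) {b c d e : ℕ}
    (hcyc : Cyc5 o b c d e) (hb : b ≤ n) (hc : c ≤ n) (hd : d ≤ n) (he : e ≤ n) (hbo : b ≠ o)
    (hco : c ≠ o) (hdo : d ≠ o) (heo : e ≠ o) :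
    ∃ M : PentagonModel p (twist p C u o v) ![o, b, c, d, e],
      Pentagon M.param M.a M.d M.w M.v := by
  have Hp := h.preChordSystem_twist H
  have hon : o ≤ n ∧ u ≤ n ∧ v ≤ n := by
    unfold PolygonCorner at H
    omega
  have hx : ∀ i, ![o, b, c, d, e] i ≤ n := fun i => by
    fin_cases i
    exacts [hon.1, hb, hc, hd, he]
  have h5t : ∀ t, t = u ∨ t = o ∨ t = v → t ≤ n ∧ Cyc5 t b c d e := by
    have := hcyc.replace H hb hc hd he hbo hco hdo heo
    rintro t (rfl | rfl | rfl)
    · exact ⟨hon.2.1, this.1⟩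
    · exact ⟨hon.1, hcyc⟩
    · exact ⟨hon.2.2, this.2⟩
  obtain ⟨M⟩ := Hp.nonempty_model p (x := ![o, b, c, d, e]) hcyc hx
  refine ⟨M, (Hp.prePentagon hcyc hx M).toPentagon (j := 0) (k := 0) ?_ ?_⟩
  all_goals
    rw [M.triRel_iff]
    simp only [Subalgebra.coe_add, M.val_mul_smul, M.val_smul, M.val_d, M.val_w, M.val_v,
      Fin.isValue, Fin.reduceAdd, zero_add]
  · exact h.triRel_ra_twist H h5t hb hc hd he hbo hco hdo heo
  · exact h.triRel_va_twist H h5t hb hc hd he hbo hco hdo heo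

theorem five_twist (h : ChordSystem p n C) (H : PolygonCorner n u o v) {a b c d e : ℕ}
    (hab : a < b) (hbc : b < c) (hcd : c < d) (hde : d < e) (he : e ≤ n) :
    TriRel p (chordCrossing p (twist p C u o v) b c d e) (twist p C u o v d a)
      (chordCrossing p (twist p C u o v) e a b c)
      (twist p C u o v b c * twist p C u o v e a +
        twist p C u o v d e * chordCrossing p (twist p C u o v) b c d a) ∧
    TriRel p (twist p C u o v d a) (chordCrossing p (twist p C u o v) c d e b)
      (chordCrossing p (twist p C u o v) a b c e)
      (twist p C u o v b c * twist p C u o v e a +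
        twist p C u o v d e * chordCrossing p (twist p C u o v) a b c d) := by
  have q : Cyc5 a b c d e := Or.inl (by omega)
  by_cases hao : a = o
  · subst hao
    obtain ⟨M, P⟩ := h.exists_pentagon_twist H q (by omega) (by omega) (by omega) he
      (by omega) (by omega) (by omega) (by omega)
    have h1 := M.triRel_iff.mp (P.ra 0)
    have h2 := M.triRel_iff.mp (P.va 0)
    simp only [Subalgebra.coe_add, M.val_mul_smul, M.val_smul, M.val_d, M.val_w, M.val_v,
      Fin.isValue, Fin.reduceAdd, zero_add] at h1 h2
    exact ⟨h1, h2⟩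
  by_cases hbo : b = o
  · subst hbo
    obtain ⟨M, P⟩ := h.exists_pentagon_twist H q.rotate (by omega) (by omega) he (by omega)
      (by omega) (by omega) (by omega) (by omega)
    have h1 := M.triRel_iff.mp (P.ra 4)
    have h2 := M.triRel_iff.mp (P.va 4)
    simp only [Subalgebra.coe_add, M.val_mul_smul, M.val_smul, M.val_d, M.val_w, M.val_v,
      Fin.isValue, Fin.reduceAdd, zero_add] at h1 h2
    exact ⟨h1, h2⟩
  by_cases hco : c = o
  · subst hco
    obtain ⟨M, P⟩ := h.exists_pentagon_twist H q.rotate.rotate (by omega) he (by omega) (by omega)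
      (by omega) (by omega) (by omega) (by omega)
    have h1 := M.triRel_iff.mp (P.ra 3)
    have h2 := M.triRel_iff.mp (P.va 3)
    simp only [Subalgebra.coe_add, M.val_mul_smul, M.val_smul, M.val_d, M.val_w, M.val_v,
      Fin.isValue, Fin.reduceAdd, zero_add] at h1 h2
    exact ⟨h1, h2⟩
  by_cases hdo : d = o
  · subst hdo
    obtain ⟨M, P⟩ := h.exists_pentagon_twist H q.rotate.rotate.rotate he (by omega) (by omega)
      (by omega) (by omega) (by omega) (by omega) (by omega)
    have h1 := M.triRel_iff.mp (P.ra 2)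
    have h2 := M.triRel_iff.mp (P.va 2)
    simp only [Subalgebra.coe_add, M.val_mul_smul, M.val_smul, M.val_d, M.val_w, M.val_v,
      Fin.isValue, Fin.reduceAdd, zero_add] at h1 h2
    exact ⟨h1, h2⟩
  by_cases heo : e = o
  · subst heo
    obtain ⟨M, P⟩ := h.exists_pentagon_twist H q.rotate.rotate.rotate.rotate (by omega) (by omega)
      (by omega) (by omega) (by omega) (by omega) (by omega) (by omega)
    have h1 := M.triRel_iff.mp (P.ra 1)
    have h2 := M.triRel_iff.mp (P.va 1)
    simp only [Subalgebra.coe_add, M.val_mul_smul, M.val_smul, M.val_d, M.val_w, M.val_v,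
      Fin.isValue, Fin.reduceAdd, zero_add] at h1 h2
    exact ⟨h1, h2⟩
  rw [chordCrossing_twist_of_ne hbo hco hdo heo, chordCrossing_twist_of_ne heo hao hbo hco,
    chordCrossing_twist_of_ne hbo hco hdo hao, chordCrossing_twist_of_ne hco hdo heo hbo,
    chordCrossing_twist_of_ne hao hbo hco heo, chordCrossing_twist_of_ne hao hbo hco hdo,
    twist_of_ne hdo hao, twist_of_ne hbo hco, twist_of_ne heo hao, twist_of_ne hdo heo]
  exact ⟨h.ra a b c d e hab hbc hcd hde he, h.va a b c d e hab hbc hcd hde he⟩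

/-- The relations are preserved by the half twist of two consecutive vertices. -/
theorem chordSystem_twist (h : ChordSystem p n C) (H : PolygonCorner n u o v) :
    ChordSystem p n (twist p C u o v) where
  toPreChordSystem := h.preChordSystem_twist H
  ra _ _ _ _ _ hab hbc hcd hde he := (h.five_twist H hab hbc hcd hde he).1
  va _ _ _ _ _ hab hbc hcd hde he := (h.five_twist H hab hbc hcd hde he).2

end ChordSystem

end TwistSystem

/-! ### Connected sets as half-open intervals -/

section IntervalSets

theorem mem_awHull {S : Finset ℕ} {x : ℕ} : x ∈ awHull S ↔ ∃ a ∈ S, ∃ b ∈ S, a ≤ x ∧ x ≤ b := by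
  unfold awHull
  rw [Finset.mem_filter, Finset.mem_range]
  refine ⟨fun h => h.2, fun h => ⟨?_, h⟩⟩
  obtain ⟨a, -, b, hb, -, hxb⟩ := h
  exact Nat.lt_succ_of_le (hxb.trans (Finset.le_sup (f := id) hb))

theorem awHole_Ioc {a b c d : ℕ} (hab : a < b) (hbc : b ≤ c) (hcd : c < d) :
    awHole (Finset.Ioc a b) (Finset.Ioc c d) = Finset.Ioc b c := by
  ext x
  simp only [awHole, Finset.mem_sdiff, mem_awHull, Finset.mem_union, Finset.mem_Ioc]
  constructor
  · rintro ⟨⟨y, hy, z, hz, h1, h2⟩, h3⟩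
    omega
  · intro h
    exact ⟨⟨b, by omega, d, by omega, by omega, by omega⟩, by omega⟩

theorem awHole_comm (I J : Finset ℕ) : awHole I J = awHole J I := by
  rw [awHole, awHole, Finset.union_comm]

/-- Half-open intervals make adjacency the equality of end points, and `(a, b)` are the end points
of the chord. -/
theorem awConn_iff {n : ℕ} {I : Finset ℕ} :
    AWConn n I ↔ ∃ a b, a < b ∧ b ≤ n ∧ I = Finset.Ioc a b := by
  constructor
  · rintro ⟨h1, h2, h3⟩
    have hmin := Finset.min'_mem I h2
    have hmax := Finset.max'_mem I h2
    have h4 := Finset.mem_Icc.mp (h1 hmin)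
    have h5 := Finset.mem_Icc.mp (h1 hmax)
    have h6 := Finset.min'_le I _ hmax
    refine ⟨I.min' h2 - 1, I.max' h2, by omega, h5.2, ?_⟩
    ext x
    rw [Finset.mem_Ioc]
    refine ⟨fun hx => ?_, fun hx => ?_⟩
    · have h7 := Finset.min'_le I x hx
      have h8 := Finset.le_max' I x hx
      omega
    · exact h3.out hmin hmax ⟨by omega, hx.2⟩
  · rintro ⟨a, b, hab, hb, rfl⟩
    refine ⟨fun x hx => ?_, ⟨b, by simp [hab]⟩, ?_⟩
    · rw [Finset.mem_Ioc] at hx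
      rw [Finset.mem_Icc]
      omega
    · rw [Finset.coe_Ioc]
      exact Set.ordConnected_Ioc

theorem awConn_Ioc {n a b : ℕ} (hab : a < b) (hb : b ≤ n) : AWConn n (Finset.Ioc a b) :=
  awConn_iff.mpr ⟨a, b, hab, hb, rfl⟩

theorem Ioc_union_Ioc {a b c : ℕ} (hab : a ≤ b) (hbc : b ≤ c) :
    Finset.Ioc a b ∪ Finset.Ioc b c = Finset.Ioc a c := Finset.Ioc_union_Ioc_eq_Ioc hab hbc

/-- The common end point of two adjacent intervals. -/
theorem adjacent_of_awConn {n a b c d : ℕ} (hab : a < b) (hcd : c < d)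
    (h : AWLt (Finset.Ioc a b) (Finset.Ioc c d))
    (hc : AWConn n (Finset.Ioc a b ∪ Finset.Ioc c d)) : b = c := by
  have h1 : b < c + 1 := h b (by simp [hab]) (c + 1) (by simp; omega)
  by_contra hne
  have h2 : b + 1 ∈ ((Finset.Ioc a b ∪ Finset.Ioc c d : Finset ℕ) : Set ℕ) :=
    hc.2.2.out (x := b) (y := c + 1) (by simp [hab]) (by simp; omega) ⟨by omega, by omega⟩
  simp at h2
  omega

theorem awMonoAdj_three {n : ℕ} {I J L : Finset ℕ} (h : AWMonoAdj n [I, J, L]) :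
    ∃ a b c d, a < b ∧ b < c ∧ c < d ∧ d ≤ n ∧
      ((I = Finset.Ioc a b ∧ J = Finset.Ioc b c ∧ L = Finset.Ioc c d) ∨
        (I = Finset.Ioc c d ∧ J = Finset.Ioc b c ∧ L = Finset.Ioc a b)) := by
  obtain ⟨h1, h2, h3⟩ := h
  obtain ⟨a, b, hab, hb, rfl⟩ := awConn_iff.mp (h1 I (by simp))
  obtain ⟨c, d, hcd, hd, rfl⟩ := awConn_iff.mp (h1 J (by simp))
  obtain ⟨e, f, hef, hf, rfl⟩ := awConn_iff.mp (h1 L (by simp))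
  simp only [List.isChain_cons_cons, List.isChain_singleton, and_true] at h3
  rcases h2 with h2 | h2 <;> simp only [List.pairwise_cons, List.mem_cons, List.not_mem_nil,
    or_false, forall_eq_or_imp, forall_eq] at h2
  · obtain rfl := adjacent_of_awConn hab hcd h2.1.1 h3.1
    obtain rfl := adjacent_of_awConn hcd hef h2.2.1 h3.2
    exact ⟨_, _, _, _, hab, hcd, hef, hf, Or.inl ⟨rfl, rfl, rfl⟩⟩
  · obtain rfl := adjacent_of_awConn hcd hab h2.1.1 (by rw [Finset.union_comm]; exact h3.1)
    obtain rfl := adjacent_of_awConn hef hcd h2.2.1 (by rw [Finset.union_comm]; exact h3.2)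
    exact ⟨_, _, _, _, hef, hcd, hab, hb, Or.inr ⟨rfl, rfl, rfl⟩⟩

theorem awMonoAdj_four {n : ℕ} {I J L M : Finset ℕ} (h : AWMonoAdj n [I, J, L, M]) :
    ∃ a b c d e, a < b ∧ b < c ∧ c < d ∧ d < e ∧ e ≤ n ∧
      ((I = Finset.Ioc a b ∧ J = Finset.Ioc b c ∧ L = Finset.Ioc c d ∧ M = Finset.Ioc d e) ∨
        (I = Finset.Ioc d e ∧ J = Finset.Ioc c d ∧ L = Finset.Ioc b c ∧ M = Finset.Ioc a b)) := by
  obtain ⟨h1, h2, h3⟩ := h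
  obtain ⟨a, b, hab, hb, rfl⟩ := awConn_iff.mp (h1 I (by simp))
  obtain ⟨c, d, hcd, hd, rfl⟩ := awConn_iff.mp (h1 J (by simp))
  obtain ⟨e, f, hef, hf, rfl⟩ := awConn_iff.mp (h1 L (by simp))
  obtain ⟨g, k, hgk, hk, rfl⟩ := awConn_iff.mp (h1 M (by simp))
  simp only [List.isChain_cons_cons, List.isChain_singleton, and_true] at h3
  rcases h2 with h2 | h2 <;> simp only [List.pairwise_cons, List.mem_cons, List.not_mem_nil,
    or_false, forall_eq_or_imp, forall_eq] at h2
  · obtain rfl := adjacent_of_awConn hab hcd h2.1.1 h3.1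
    obtain rfl := adjacent_of_awConn hcd hef h2.2.1.1 h3.2.1
    obtain rfl := adjacent_of_awConn hef hgk h2.2.2.1 h3.2.2
    exact ⟨_, _, _, _, _, hab, hcd, hef, hgk, hk, Or.inl ⟨rfl, rfl, rfl, rfl⟩⟩
  · obtain rfl := adjacent_of_awConn hcd hab h2.1.1 (by rw [Finset.union_comm]; exact h3.1)
    obtain rfl := adjacent_of_awConn hef hcd h2.2.1.1 (by rw [Finset.union_comm]; exact h3.2.1)
    obtain rfl := adjacent_of_awConn hgk hef h2.2.2.1 (by rw [Finset.union_comm]; exact h3.2.2)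
    exact ⟨_, _, _, _, _, hgk, hef, hcd, hab, hb, Or.inr ⟨rfl, rfl, rfl, rfl⟩⟩

theorem isChain_awConn_three {n a b c d : ℕ} (hab : a < b) (hbc : b < c) (hcd : c < d)
    (hd : d ≤ n) : AWMonoAdj n [Finset.Ioc a b, Finset.Ioc b c, Finset.Ioc c d] ∧
      AWMonoAdj n [Finset.Ioc c d, Finset.Ioc b c, Finset.Ioc a b] := by
  have u1 : AWConn n (Finset.Ioc a b ∪ Finset.Ioc b c) := by
    rw [Ioc_union_Ioc hab.le hbc.le]
    exact awConn_Ioc (by omega) (by omega)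
  have u2 : AWConn n (Finset.Ioc b c ∪ Finset.Ioc c d) := by
    rw [Ioc_union_Ioc hbc.le hcd.le]
    exact awConn_Ioc (by omega) (by omega)
  have c1 := awConn_Ioc hab (n := n) (by omega)
  have c2 := awConn_Ioc hbc (n := n) (by omega)
  have c3 := awConn_Ioc hcd hd
  have lt : ∀ {a b c d : ℕ}, b ≤ c → AWLt (Finset.Ioc a b) (Finset.Ioc c d) := by
    intro a b c d h x hx y hy
    rw [Finset.mem_Ioc] at hx hy
    omega
  refine ⟨⟨by simp [c1, c2, c3], Or.inl ?_, ?_⟩, ⟨by simp [c1, c2, c3], Or.inr ?_, ?_⟩⟩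
  · simp [lt le_rfl, lt hbc.le]
  · simp [u1, u2]
  · simp [lt le_rfl, lt hbc.le]
  · rw [Finset.union_comm] at u1 u2
    simp [u1, u2]

theorem isChain_awConn_four {n a b c d e : ℕ} (hab : a < b) (hbc : b < c) (hcd : c < d)
    (hde : d < e) (he : e ≤ n) :
    AWMonoAdj n [Finset.Ioc a b, Finset.Ioc b c, Finset.Ioc c d, Finset.Ioc d e] ∧
      AWMonoAdj n [Finset.Ioc d e, Finset.Ioc c d, Finset.Ioc b c, Finset.Ioc a b] := by
  have u1 : AWConn n (Finset.Ioc a b ∪ Finset.Ioc b c) := by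
    rw [Ioc_union_Ioc hab.le hbc.le]
    exact awConn_Ioc (by omega) (by omega)
  have u2 : AWConn n (Finset.Ioc b c ∪ Finset.Ioc c d) := by
    rw [Ioc_union_Ioc hbc.le hcd.le]
    exact awConn_Ioc (by omega) (by omega)
  have u3 : AWConn n (Finset.Ioc c d ∪ Finset.Ioc d e) := by
    rw [Ioc_union_Ioc hcd.le hde.le]
    exact awConn_Ioc (by omega) (by omega)
  have c1 := awConn_Ioc hab (n := n) (by omega)
  have c2 := awConn_Ioc hbc (n := n) (by omega)
  have c3 := awConn_Ioc hcd (n := n) (by omega)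
  have c4 := awConn_Ioc hde he
  have lt : ∀ {a b c d : ℕ}, b ≤ c → AWLt (Finset.Ioc a b) (Finset.Ioc c d) := by
    intro a b c d h x hx y hy
    rw [Finset.mem_Ioc] at hx hy
    omega
  refine ⟨⟨by simp [c1, c2, c3, c4], Or.inl ?_, ?_⟩, ⟨by simp [c1, c2, c3, c4], Or.inr ?_, ?_⟩⟩
  · simp [lt le_rfl, lt hbc.le, lt hcd.le, lt (hbc.trans hcd).le]
  · simp [u1, u2, u3]
  · simp [lt le_rfl, lt hbc.le, lt hcd.le, lt (hbc.trans hcd).le]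
  · rw [Finset.union_comm] at u1 u2 u3
    simp [u1, u2, u3]

end IntervalSets

/-! ### Sequences of two intervals as resolved crossings -/

section Sequences

variable {K A : Type*} [Field K] [Ring A] [Algebra K A] {q : K}

theorem crossing_sq (hq : q ≠ 0) (x y m : A) : crossing (q ^ 2) x y m = -qComm q x y + m := by
  unfold crossing qComm
  have h : (q - q⁻¹)⁻¹ = (q ^ 2 - 1)⁻¹ * q := by
    rw [show q - q⁻¹ = (q ^ 2 - 1) * q⁻¹ by field_simp, mul_inv, inv_inv]
  rw [h, mul_smul, smul_sub q, smul_smul, smul_smul, mul_inv_cancel₀ hq, one_smul, pow_two,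
    sub_eq_add_neg, add_comm]

theorem awSeq_single (c : Finset ℕ → A) (I : Finset ℕ) : awSeq q c [I] = c I := by
  rw [awSeq]

theorem awSeq_cons_of_empty (c : Finset ℕ → A) {I J : Finset ℕ} (L : List (Finset ℕ))
    (h : awHole I J = ∅) : awSeq q c (I :: J :: L) = awSeq q c ((I ∪ J) :: L) := by
  rw [awSeq, if_pos h]

theorem awSeq_cons_of_ne (hq : q ≠ 0) (c : Finset ℕ → A) {I J : Finset ℕ} (L : List (Finset ℕ))
    (h : awHole I J ≠ ∅) : awSeq q c (I :: J :: L) =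
      crossing (q ^ 2) (c (I ∪ awHole I J)) (awSeq q c ((awHole I J ∪ J) :: L))
        (c I * awSeq q c (J :: L) + c (awHole I J) * awSeq q c ((I ∪ awHole I J ∪ J) :: L)) := by
  rw [awSeq, if_neg h, crossing_sq hq, add_assoc]

theorem map_awSeq {B : Type*} [Ring B] [Algebra K B] (f : A →ₐ[K] B) (hq : q ≠ 0)
    (c : Finset ℕ → A) (L : List (Finset ℕ)) :
    f (awSeq q c L) = awSeq q (fun I => f (c I)) L := by
  induction hk : L.length using Nat.strong_induction_on generalizing L with
  | _ k ih =>
    match L with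
    | [] => rw [awSeq, awSeq, map_one]
    | [I] => rw [awSeq_single, awSeq_single]
    | I :: J :: L =>
      have e : ∀ M : Finset ℕ, f (awSeq q c (M :: L)) = awSeq q (fun I => f (c I)) (M :: L) :=
        fun M => ih _ (by rw [← hk]; simp) _ rfl
      by_cases h : awHole I J = ∅
      · rw [awSeq_cons_of_empty _ _ h, awSeq_cons_of_empty _ _ h, e]
      · rw [awSeq_cons_of_ne hq _ _ h, awSeq_cons_of_ne hq _ _ h, map_crossing, map_add, map_mul,
          map_mul, e, e, e]

variable {n : ℕ} {c : Finset ℕ → A} {C : ℕ → ℕ → A}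

theorem awSeq_increasing (hq : q ≠ 0)
    (hC : ∀ x y, x < y → y ≤ n → c (Finset.Ioc x y) = C x y) {x y z t : ℕ} (hxy : x < y)
    (hyz : y < z) (hzt : z < t) (ht : t ≤ n) :
    awSeq q c [Finset.Ioc x y, Finset.Ioc z t] = chordCrossing (q ^ 2) C x y z t := by
  have h := awHole_Ioc hxy hyz.le hzt
  rw [awSeq_cons_of_ne hq _ _ (by rw [h, ← Finset.nonempty_iff_ne_empty]; simpa using hyz), h,
    awSeq_single, awSeq_single, awSeq_single, Ioc_union_Ioc hxy.le hyz.le,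
    Ioc_union_Ioc hyz.le hzt.le, Ioc_union_Ioc (hxy.trans hyz).le hzt.le, chordCrossing,
    hC _ _ (hxy.trans hyz) (by omega), hC _ _ (hyz.trans hzt) (by omega),
    hC _ _ hxy (by omega), hC _ _ hyz (by omega), hC _ _ hzt (by omega), hC x t (by omega) ht]

/-- Reading the two intervals from right to left reverses the order in the q-commutator, so the
other resolution of the same crossing appears. -/
theorem awSeq_decreasing (hq : q ≠ 0) (symm : ∀ x y, C x y = C y x)
    (hC : ∀ x y, x < y → y ≤ n → c (Finset.Ioc x y) = C x y) {x y z t : ℕ} (hxy : x < y)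
    (hyz : y < z) (hzt : z < t) (ht : t ≤ n) :
    awSeq q c [Finset.Ioc z t, Finset.Ioc x y] = chordCrossing (q ^ 2) C y z t x := by
  have h := awHole_Ioc hxy hyz.le hzt
  rw [awHole_comm] at h
  rw [awSeq_cons_of_ne hq _ _ (by rw [h, ← Finset.nonempty_iff_ne_empty]; simpa using hyz), h,
    awSeq_single, awSeq_single, awSeq_single, Finset.union_comm (Finset.Ioc z t),
    Ioc_union_Ioc hyz.le hzt.le, Finset.union_comm _ (Finset.Ioc x y),
    Finset.union_comm _ (Finset.Ioc x y), Ioc_union_Ioc hxy.le hyz.le,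
    Ioc_union_Ioc hxy.le (hyz.trans hzt).le, chordCrossing,
    hC _ _ (hxy.trans hyz) (by omega), hC _ _ (hyz.trans hzt) (by omega),
    hC _ _ hxy (by omega), hC _ _ hyz (by omega), hC _ _ hzt (by omega), hC x t (by omega) ht,
    symm z x, symm t x, symm y x, add_comm]

end Sequences

namespace PrePentagon

theorem va_of_vb {R A : Type*} [CommRing R] [Ring A] [Algebra R A] {p : R} {a : Fin 5 → R}
    {d w v : Fin 5 → A} (h : PrePentagon p a d w v) (i : Fin 5)
    (vb : TriRel p (v (i + 3)) (d (i + 2)) (v i)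
      ((a (i + 1) * a (i + 4)) • 1 + a (i + 2) • w (i + 4))) :
    TriRel p (d (i + 4)) (v (i + 2)) (v i)
      ((a (i + 1) * a (i + 4)) • 1 + a (i + 3) • w (i + 1)) := by
  have n1 : (-1 : Fin 5) = 4 := rfl
  have n2 : (-2 : Fin 5) = 3 := rfl
  have n3 : (-3 : Fin 5) = 2 := rfl
  have n4 : (-4 : Fin 5) = 1 := rfl
  have H := h.reflect.rb_of_ra (4 - i) (by
    fin_cases i <;> simpa [mul_comm, n1, n2, n3, n4] using vb)
  fin_cases i <;> simpa [mul_comm, n1, n2, n3, n4] using H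

end PrePentagon

/-- A half turn of the quadrilateral preserves the order of the two diagonals; only commuting
factors change places. -/
theorem ChordComm.chordCrossing_rotate {K A : Type*} [Field K] [Ring A] [Algebra K A] {p : K}
    {n : ℕ} {C : ℕ → ℕ → A} (h : ChordComm n C) {a b c d : ℕ} (H : Cyc4 a b c d) (ha : a ≤ n)
    (hb : b ≤ n) (hc : c ≤ n) (hd : d ≤ n) :
    chordCrossing p C a b c d = chordCrossing p C c d a b := by
  have h2 : C a b * C c d = C c d * C a b := h.commute H ha hb hc hd
  have h3 : C b c * C d a = C d a * C b c := h.commute H.rotate hb hc hd ha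
  unfold chordCrossing
  rw [h.symm c a, h.symm d b, h.symm a d, h.symm c b, h2, h3]

/-! ### The Askey–Wilson algebra as the universal chord system -/

section Presentation

variable {K : Type*} [Field K] {q : K} {n : ℕ}

/-- The element of `𝔞𝔴(n)` attached to a chord. -/
noncomputable def awChord (q : K) (n x y : ℕ) : AW K q n :=
  awC q n (Finset.Ioc (min x y) (max x y))

theorem awFreeC_empty : awFreeC K n ∅ = 1 := by
  have : ¬ AWConn n ∅ := fun h => Finset.not_nonempty_empty h.2.1
  rw [awFreeC, dif_neg this, if_pos rfl]

theorem awC_empty : awC q n ∅ = 1 := by rw [awC, awFreeC_empty, map_one]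

theorem awC_Ioc {x y : ℕ} (h : x ≤ y) : awC q n (Finset.Ioc x y) = awChord q n x y := by
  rw [awChord, min_eq_left h, max_eq_right h]

theorem awChord_symm (x y : ℕ) : awChord q n x y = awChord q n y x := by
  rw [awChord, awChord, min_comm, max_comm]

theorem awChord_self (x : ℕ) : awChord q n x x = 1 := by
  rw [awChord, min_self, max_self, Finset.Ioc_self, awC_empty]

theorem awC_rel {x y : FreeAlgebra K (AWIndex n)} (h : AWRel K q n x y) :
    RingQuot.mkAlgHom K (AWRel K q n) x = RingQuot.mkAlgHom K (AWRel K q n) y :=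
  RingQuot.mkAlgHom_rel K h

theorem awC_comm {a b c d : ℕ} (hab : a ≤ b) (hcd : c ≤ d) (hb : b ≤ n) (hd : d ≤ n)
    (h : b ≤ c ∨ (c ≤ a ∧ b ≤ d)) :
    awChord q n a b * awChord q n c d = awChord q n c d * awChord q n a b := by
  rcases hab.eq_or_lt with rfl | hab
  · rw [awChord_self, one_mul, mul_one]
  rcases hcd.eq_or_lt with rfl | hcd
  · rw [awChord_self, one_mul, mul_one]
  have := awC_rel (AWRel.comm (K := K) (q := q) (Finset.Ioc a b) (Finset.Ioc c d)
    (awConn_Ioc hab hb) (awConn_Ioc hcd hd) (by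
      rcases h with h | h
      · left
        rw [Finset.disjoint_left]
        intro x hx hx'
        rw [Finset.mem_Ioc] at hx hx'
        omega
      · right
        exact Finset.Ioc_subset_Ioc h.1 h.2))
  rw [map_mul, map_mul] at this
  rw [← awC_Ioc hab.le, ← awC_Ioc hcd.le]
  exact this

theorem mk_awSeq (hq : q ≠ 0) (L : List (Finset ℕ)) :
    RingQuot.mkAlgHom K (AWRel K q n) (awSeq q (awFreeC K n) L) = awSeq q (awC q n) L :=
  map_awSeq _ hq _ L

theorem awSeq_increasing_awC (hq : q ≠ 0) {x y z t : ℕ} (hxy : x < y)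
    (hyz : y < z) (hzt : z < t) (ht : t ≤ n) :
    awSeq q (awC q n) [Finset.Ioc x y, Finset.Ioc z t] =
      chordCrossing (q ^ 2) (awChord q n) x y z t :=
  awSeq_increasing (n := n) hq (fun _ _ h _ => awC_Ioc h.le) hxy hyz hzt ht

theorem awSeq_decreasing_awC (hq : q ≠ 0) {x y z t : ℕ} (hxy : x < y)
    (hyz : y < z) (hzt : z < t) (ht : t ≤ n) :
    awSeq q (awC q n) [Finset.Ioc z t, Finset.Ioc x y] =
      chordCrossing (q ^ 2) (awChord q n) y z t x :=
  awSeq_decreasing (n := n) hq awChord_symm (fun _ _ h _ => awC_Ioc h.le) hxy hyz hzt ht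

theorem sq_sub_one_ne (hq1 : q ^ 2 ≠ 1) : q ^ 2 - 1 ≠ 0 := sub_ne_zero.mpr hq1

theorem sq_add_one_ne (hq2 : q ^ 2 ≠ -1) : q ^ 2 + 1 ≠ 0 := fun h => hq2 (eq_neg_of_add_eq_zero_left h)

theorem aw_chordComm : ChordComm n (awChord q n) where
  symm := awChord_symm
  diag := awChord_self
  comm a b c d hab hbc hcd hd :=
    ⟨awC_comm hab hcd (by omega) hd (Or.inl hbc),
      (awC_comm hbc (by omega) (by omega) hd (Or.inr ⟨hab, hcd⟩)).symm⟩

/-- The relation `three` for an increasing sequence is the first relation of a quadrilateral, and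
for a decreasing sequence it is the second. -/
theorem aw_preChordSystem (hq0 : q ≠ 0) (hq1 : q ^ 2 ≠ 1) (hq2 : q ^ 2 ≠ -1) :
    PreChordSystem (q ^ 2) n (awChord q n) where
  toChordComm := aw_chordComm
  ne_zero := pow_ne_zero 2 hq0
  sub_ne := sq_sub_one_ne hq1
  add_ne := sq_add_one_ne hq2
  quad a b c d hab hbc hcd hd := by
    obtain ⟨m1, m2⟩ := isChain_awConn_three hab hbc hcd hd
    have h1 := awC_rel (AWRel.three (K := K) (q := q) _ _ _ m1)
    have h2 := awC_rel (AWRel.three (K := K) (q := q) _ _ _ m2)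
    rw [Ioc_union_Ioc hab.le hbc.le, Ioc_union_Ioc hbc.le hcd.le,
      Ioc_union_Ioc (hab.trans hbc).le hcd.le, add_assoc, ← crossing_sq hq0, map_crossing,
      mk_awSeq hq0, map_add, map_mul, map_mul, awSeq_increasing_awC hq0 hab hbc hcd hd] at h1
    rw [Finset.union_comm (Finset.Ioc c d), Finset.union_comm (Finset.Ioc b c) (Finset.Ioc a b),
      Ioc_union_Ioc hab.le hbc.le, Ioc_union_Ioc hbc.le hcd.le, Finset.union_comm _ (Finset.Ioc a b),
      Ioc_union_Ioc hab.le (hbc.trans hcd).le, add_assoc, ← crossing_sq hq0, map_crossing,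
      mk_awSeq hq0, map_add, map_mul, map_mul, awSeq_decreasing_awC hq0 hab hbc hcd hd] at h2
    change awC q n _ = crossing _ (awC q n _) _ (awC q n _ * awC q n _ + awC q n _ * awC q n _) at h1 h2
    rw [awC_Ioc (hab.trans hbc).le, awC_Ioc (hbc.trans hcd).le, awC_Ioc hab.le, awC_Ioc hbc.le,
      awC_Ioc hcd.le, awC_Ioc (hab.trans (hbc.trans hcd)).le] at h1 h2
    refine ⟨(triRel_iff (sq_sub_one_ne hq1)).mpr h1, (triRel_iff (sq_sub_one_ne hq1)).mpr ?_⟩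
    rw [awC_comm hbc.le hcd.le (by omega) hd (Or.inl le_rfl)]
    exact h2

/-- The relation `four` for the two kinds of monotonic sequences is the pentagon relation `ra`,
respectively `vb`, with index `4`. The symmetry of the pentagon converts these into the relations
with index `0`. -/
theorem aw_chordSystem (hq0 : q ≠ 0) (hq1 : q ^ 2 ≠ 1) (hq2 : q ^ 2 ≠ -1) :
    ChordSystem (q ^ 2) n (awChord q n) := by
  have hp := aw_preChordSystem (q := q) (n := n) hq0 hq1 hq2
  have key : ∀ a b c d e, a < b → b < c → c < d → d < e → e ≤ n →
      ∃ M : PentagonModel (q ^ 2) (awChord q n) ![a, b, c, d, e],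
        Pentagon M.param M.a M.d M.w M.v := by
    intro a b c d e hab hbc hcd hde he
    have H : Cyc5 a b c d e := Or.inl (by omega)
    have hx : ∀ i, ![a, b, c, d, e] i ≤ n := fun i => by
      fin_cases i <;> simp <;> omega
    obtain ⟨M⟩ := hp.nonempty_model (q ^ 2) (x := ![a, b, c, d, e]) H hx
    have P := hp.prePentagon H hx M
    obtain ⟨m1, m2⟩ := isChain_awConn_four hab hbc hcd hde he
    have h1 := awC_rel (AWRel.four (K := K) (q := q) _ _ _ _ m1)
    have h2 := awC_rel (AWRel.four (K := K) (q := q) _ _ _ _ m2)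
    rw [Ioc_union_Ioc hcd.le hde.le, add_assoc, ← crossing_sq hq0, map_crossing, mk_awSeq hq0,
      mk_awSeq hq0, map_add, map_mul, map_mul, mk_awSeq hq0,
      awSeq_increasing_awC hq0 hab (hbc.trans hcd) hde he,
      awSeq_increasing_awC hq0 hab hbc hcd (by omega),
      awSeq_increasing_awC hq0 hab hbc (hcd.trans hde) he] at h1
    rw [Finset.union_comm, Ioc_union_Ioc hab.le hbc.le, add_assoc, ← crossing_sq hq0, map_crossing,
      mk_awSeq hq0, mk_awSeq hq0, map_add, map_mul, map_mul, mk_awSeq hq0,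
      awSeq_decreasing_awC hq0 hab (hbc.trans hcd) hde he,
      awSeq_decreasing_awC hq0 hbc hcd hde he,
      awSeq_decreasing_awC hq0 (hab.trans hbc) hcd hde he] at h2
    change _ = crossing _ _ (awC q n _) (awC q n _ * awC q n _ + awC q n _ * _) at h1 h2
    rw [awC_Ioc (hcd.trans hde).le, awC_Ioc hab.le, awC_Ioc hde.le, awC_Ioc hcd.le] at h1
    rw [awC_Ioc (hab.trans hbc).le, awC_Ioc hab.le, awC_Ioc hde.le, awC_Ioc hbc.le] at h2
    refine ⟨M, P.toPentagon (j := 4) (k := 4) ?_ (P.va_of_vb 4 ?_)⟩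
    all_goals
      rw [M.triRel_iff]
      simp only [Subalgebra.coe_add, M.val_mul_smul, M.val_smul, M.val_d, M.val_w, M.val_v,
        Fin.isValue, Fin.reduceAdd, zero_add]
      rw [triRel_iff (sq_sub_one_ne hq1)]
    · change chordCrossing _ _ d e a b = _
      rw [hp.chordCrossing_rotate (by unfold Cyc4; omega) (by omega) he (by omega) (by omega), h1]
      rfl
    · change chordCrossing _ _ e a b d = _
      rw [hp.chordCrossing_rotate (by unfold Cyc4; omega) he (by omega) (by omega) (by omega), h2,
        ← awC_comm hab.le hde.le (by omega) he (Or.inl (by omega))]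
      rfl
  refine ⟨hp, ?_, ?_⟩
  · intro a b c d e hab hbc hcd hde he
    obtain ⟨M, P⟩ := key a b c d e hab hbc hcd hde he
    have h1 := M.triRel_iff.mp (P.ra 0)
    simp only [Subalgebra.coe_add, M.val_mul_smul, M.val_smul, M.val_d, M.val_w, M.val_v,
      Fin.isValue, Fin.reduceAdd, zero_add] at h1
    exact h1
  · intro a b c d e hab hbc hcd hde he
    obtain ⟨M, P⟩ := key a b c d e hab hbc hcd hde he
    have h1 := M.triRel_iff.mp (P.va 0)
    simp only [Subalgebra.coe_add, M.val_mul_smul, M.val_smul, M.val_d, M.val_w, M.val_v,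
      Fin.isValue, Fin.reduceAdd, zero_add] at h1
    exact h1

variable {A : Type*} [Ring A] [Algebra K A]

theorem awHom_ext {f g : AW K q n →ₐ[K] A}
    (h : ∀ x y, x < y → y ≤ n → f (awChord q n x y) = g (awChord q n x y)) : f = g := by
  refine RingQuot.ringQuot_ext' _ _ _ (FreeAlgebra.hom_ext (funext fun I => ?_))
  obtain ⟨I, hI⟩ := I
  obtain ⟨a, b, hab, hb, rfl⟩ := awConn_iff.mp hI
  have := h a b hab hb
  rw [← awC_Ioc hab.le, awC, awFreeC, dif_pos hI] at this
  exact this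

/-- The algebra of a chord system receives a morphism from the Askey–Wilson algebra. -/
theorem exists_awHom (hq0 : q ≠ 0) {C : ℕ → ℕ → A} (h : ChordSystem (q ^ 2) n C) :
    ∃ f : AW K q n →ₐ[K] A, ∀ x y, x ≤ n → y ≤ n → f (awChord q n x y) = C x y := by
  set φ : FreeAlgebra K (AWIndex n) →ₐ[K] A :=
    -- The end points of `Ioc x y` are recovered from its maximum `y` and its cardinality `y - x`.
    FreeAlgebra.lift K fun I => C (I.1.sup id - I.1.card) (I.1.sup id) with hφ
  have hC : ∀ x y, x < y → y ≤ n → φ (awFreeC K n (Finset.Ioc x y)) = C x y := by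
    intro x y hxy hy
    have h1 : (Finset.Ioc x y).sup id = y :=
      le_antisymm (Finset.sup_le fun z hz => (Finset.mem_Ioc.mp hz).2)
        (Finset.le_sup (f := id) (Finset.mem_Ioc.mpr ⟨hxy, le_rfl⟩))
    rw [awFreeC, dif_pos (awConn_Ioc hxy hy), hφ, FreeAlgebra.lift_ι_apply, h1, Nat.card_Ioc,
      Nat.sub_sub_self hxy.le]
  have hm : ∀ L, φ (awSeq q (awFreeC K n) L) = awSeq q (fun I => φ (awFreeC K n I)) L :=
    map_awSeq φ hq0 _
  have inc : ∀ {x y z t : ℕ}, x < y → y < z → z < t → t ≤ n →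
      φ (awSeq q (awFreeC K n) [Finset.Ioc x y, Finset.Ioc z t]) =
        chordCrossing (q ^ 2) C x y z t := fun h1 h2 h3 h4 => by
    rw [hm]
    exact awSeq_increasing (n := n) hq0 hC h1 h2 h3 h4
  have dec : ∀ {x y z t : ℕ}, x < y → y < z → z < t → t ≤ n →
      φ (awSeq q (awFreeC K n) [Finset.Ioc z t, Finset.Ioc x y]) =
        chordCrossing (q ^ 2) C y z t x := fun h1 h2 h3 h4 => by
    rw [hm]
    exact awSeq_decreasing (n := n) hq0 h.symm hC h1 h2 h3 h4
  have key : ∀ ⦃x y⦄, AWRel K q n x y → φ x = φ y := by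
    rintro _ _ (⟨I, J, hI, hJ, hIJ⟩ | ⟨I₁, I₂, I₃, hI⟩ | ⟨I₁, I₂, I₃, I₄, hI⟩)
    · obtain ⟨a, b, hab, hb, rfl⟩ := awConn_iff.mp hI
      obtain ⟨c, d, hcd, hd, rfl⟩ := awConn_iff.mp hJ
      rw [map_mul, map_mul, hC _ _ hab hb, hC _ _ hcd hd]
      have : Cyc4 a b c d ∨ Cyc4 a b d c := by
        unfold Cyc4
        rcases hIJ with hIJ | hIJ
        · rw [Finset.disjoint_left] at hIJ
          have h1 := @hIJ b
          have h2 := @hIJ d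
          simp only [Finset.mem_Ioc] at h1 h2
          omega
        · have h1 := @hIJ b
          have h2 := @hIJ (a + 1)
          simp only [Finset.mem_Ioc] at h1 h2
          omega
      rcases this with H | H
      · exact h.commute H (by omega) hb (by omega) hd
      · rw [h.symm c d]
        exact h.commute H (by omega) hb hd (by omega)
    · obtain ⟨a, b, c, d, hab, hbc, hcd, hd, ⟨rfl, rfl, rfl⟩ | ⟨rfl, rfl, rfl⟩⟩ :=
        awMonoAdj_three hI
      · rw [Ioc_union_Ioc hab.le hbc.le, Ioc_union_Ioc hbc.le hcd.le,
          Ioc_union_Ioc (hab.trans hbc).le hcd.le, add_assoc, ← crossing_sq hq0, map_crossing,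
          map_add, map_mul, map_mul, inc hab hbc hcd hd, hC _ _ (hab.trans hbc) (by omega),
          hC _ _ (hbc.trans hcd) hd, hC _ _ hab (by omega), hC _ _ hbc (by omega), hC _ _ hcd hd,
          hC a d (by omega) hd]
        exact (triRel_iff h.sub_ne).mp (h.quad a b c d hab hbc hcd hd).x
      · rw [Finset.union_comm (Finset.Ioc c d), Finset.union_comm (Finset.Ioc b c) (Finset.Ioc a b),
          Ioc_union_Ioc hab.le hbc.le, Ioc_union_Ioc hbc.le hcd.le,
          Finset.union_comm _ (Finset.Ioc a b), Ioc_union_Ioc hab.le (hbc.trans hcd).le, add_assoc,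
          ← crossing_sq hq0, map_crossing, map_add, map_mul, map_mul, dec hab hbc hcd hd,
          hC _ _ (hab.trans hbc) (by omega),
          hC _ _ (hbc.trans hcd) hd, hC _ _ hab (by omega), hC _ _ hbc (by omega), hC _ _ hcd hd,
          hC a d (by omega) hd]
        have e : C c d * C b c = C b c * C c d :=
          (h.commute (Or.inl ⟨hbc.le, le_rfl, hcd.le⟩) (by omega) (by omega) (by omega) hd).symm
        rw [e]
        exact (triRel_iff h.sub_ne).mp (h.quad a b c d hab hbc hcd hd).vy
    · obtain ⟨a, b, c, d, e, hab, hbc, hcd, hde, he, ⟨rfl, rfl, rfl, rfl⟩ | ⟨rfl, rfl, rfl, rfl⟩⟩ :=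
        awMonoAdj_four hI
      · have r := h.triRel_ra (a := e) (b := a) (c := b) (d := c) (e := d)
          (by unfold Cyc5; omega) he (by omega) (by omega) (by omega) (by omega)
        rw [h.chordCrossing_rotate (a := d) (by unfold Cyc4; omega) (by omega) he (by omega)
          (by omega)] at r
        rw [Ioc_union_Ioc hcd.le hde.le, add_assoc, ← crossing_sq hq0, map_crossing, map_add,
          map_mul, map_mul, inc hab (hbc.trans hcd) hde he, inc hab hbc hcd (by omega),
          inc hab hbc (hcd.trans hde) he, hC _ _ (hcd.trans hde) he, hC _ _ hab (by omega),
          hC _ _ hde he, hC _ _ hcd (by omega)]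
        exact (triRel_iff h.sub_ne).mp r
      · have r := h.triRel_vb (a := e) (b := a) (c := b) (d := c) (e := d)
          (by unfold Cyc5; omega) he (by omega) (by omega) (by omega) (by omega)
        rw [h.chordCrossing_rotate (a := e) (by unfold Cyc4; omega) he (by omega) (by omega)
          (by omega)] at r
        have e1 : C d e * C a b = C a b * C d e :=
          (h.commute (Or.inl ⟨hab.le, (hbc.trans hcd).le, hde.le⟩) (by omega) (by omega)
            (by omega) he).symm
        rw [Finset.union_comm, Ioc_union_Ioc hab.le hbc.le, add_assoc, ← crossing_sq hq0,
          map_crossing, map_add, map_mul, map_mul, dec hab (hbc.trans hcd) hde he,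
          dec hbc hcd hde he, dec (hab.trans hbc) hcd hde he, hC _ _ (hab.trans hbc) (by omega),
          hC _ _ hab (by omega), hC _ _ hde he, hC _ _ hbc (by omega), e1]
        exact (triRel_iff h.sub_ne).mp r
  refine ⟨RingQuot.liftAlgHom K ⟨φ, key⟩, fun x y hx hy => ?_⟩
  have main : ∀ x y, x < y → y ≤ n →
      RingQuot.liftAlgHom K ⟨φ, key⟩ (awChord q n x y) = C x y := by
    intro x y hxy hy
    rw [← awC_Ioc hxy.le, awC, RingQuot.liftAlgHom_mkAlgHom_apply, hC x y hxy hy]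
  rcases lt_trichotomy x y with hxy | rfl | hxy
  · exact main x y hxy hy
  · rw [awChord_self, map_one, h.diag]
  · rw [awChord_symm, main y x hxy hx, h.symm]

end Presentation

/-! ### The opposite chord system -/

section Opposite

open MulOpposite

variable {K A : Type*} [Field K] [Ring A] [Algebra K A] {p : K} {n : ℕ} {C : ℕ → ℕ → A}

theorem triRel_op {x y z m : A} : TriRel p (op x) (op y) (op z) (op m) ↔ TriRel p y x z m := by
  unfold TriRel
  rw [← op_mul, ← op_mul, ← op_smul, ← op_sub, ← op_sub, ← op_smul, op_inj]

theorem crossing_op (x y m : A) : crossing p (op x) (op y) (op m) = op (crossing p y x m) := by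
  unfold crossing
  rw [← op_mul, ← op_mul, ← op_smul, ← op_sub, ← op_smul, ← op_sub]

/-- The remaining relations of a quadrilateral. -/
theorem PreChordSystem.quadRel_opposite (h : PreChordSystem p n C) {a b c d : ℕ}
    (H : Cyc4 a b c d) (ha : a ≤ n) (hb : b ≤ n) (hc : c ≤ n) (hd : d ≤ n) :
    TriRel p (chordCrossing p C a b c d) (C a c) (C b d) (C b c * C c d + C a b * C a d) ∧
      TriRel p (chordCrossing p C b c d a) (C b d) (C a c) (C a b * C b c + C c d * C a d) := by
  -- The pentagon with the vertex `d` repeated makes `PrePentagon.y` and `PrePentagon.vx` available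
  -- for a single quadrilateral.
  have H5 : Cyc5 b c d d a := by
    unfold Cyc4 at H
    unfold Cyc5
    rcases H with H | H | H | H <;> omega
  have hx : ∀ i, ![b, c, d, d, a] i ≤ n := fun i => by fin_cases i <;> assumption
  obtain ⟨M⟩ := h.nonempty_model p (x := ![b, c, d, d, a]) H5 hx
  have P := h.prePentagon H5 hx M
  have h1 := M.triRel_iff.mp (P.y 0)
  have h2 := M.triRel_iff.mp (P.vx 0)
  simp only [Subalgebra.coe_add, M.val_mul_smul, M.val_smul, M.val_d, M.val_w, M.val_v,
    Fin.isValue, Fin.reduceAdd, zero_add] at h1 h2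
  rw [h.symm a d]
  exact ⟨h1, h2⟩

theorem ChordComm.opposite (h : ChordComm n C) : ChordComm n fun x y => op (C x y) where
  symm a b := congrArg op (h.symm a b)
  diag a := by rw [h.diag, op_one]
  comm a b c d hab hbc hcd hd := by
    have := h.comm a b c d hab hbc hcd hd
    exact ⟨by rw [← op_mul, ← op_mul, this.1], by rw [← op_mul, ← op_mul, this.2]⟩

theorem ChordComm.chordCrossing_op (h : ChordComm n C) {a b c d : ℕ} (H : Cyc4 a b c d)
    (ha : a ≤ n) (hb : b ≤ n) (hc : c ≤ n) (hd : d ≤ n) :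
    chordCrossing p (fun x y => op (C x y)) a b c d = op (chordCrossing p C b c d a) := by
  have h2 : C a b * C c d = C c d * C a b := h.commute H ha hb hc hd
  have h3 : C b c * C d a = C d a * C b c := h.commute H.rotate hb hc hd ha
  unfold chordCrossing
  rw [← op_mul, ← op_mul, ← op_add, crossing_op, h.symm a c, h.symm a d, h3, ← h3, h.symm b a,
    add_comm]

/-- The sides of a pentagon commute with its resolved crossings. -/
theorem ChordComm.commute_side (h : ChordComm n C) {a b c d e : ℕ} (H : Cyc5 a b c d e)
    (ha : a ≤ n) (hb : b ≤ n) (hc : c ≤ n) (hd : d ≤ n) (he : e ≤ n) :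
    Commute (C d e) (chordCrossing p C a b c d) ∧ Commute (C d e) (chordCrossing p C b c d a) := by
  have h1 : Commute (C d e) (C a c) :=
    h.commute (by unfold Cyc5 Cyc4 at *; omega) hd he ha hc
  have h2 : Commute (C d e) (C b d) :=
    h.commute (by unfold Cyc5 Cyc4 at *; omega) hd he hb hd
  have h3 : Commute (C d e) (C a b) :=
    h.commute (by unfold Cyc5 Cyc4 at *; omega) hd he ha hb
  have h4 : Commute (C d e) (C c d) :=
    (h.commute (by unfold Cyc5 Cyc4 at *; omega) hc hd hd he).symm
  have h5 : Commute (C d e) (C b c) :=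
    h.commute (by unfold Cyc5 Cyc4 at *; omega) hd he hb hc
  have h6 : Commute (C d e) (C a d) :=
    (h.commute (by unfold Cyc5 Cyc4 at *; omega) ha hd hd he).symm
  refine ⟨commute_crossing h1 h2 ((h3.mul_right h4).add_right (h5.mul_right h6)), ?_⟩
  unfold chordCrossing
  rw [h.symm d a, h.symm b a, h.symm c a]
  exact commute_crossing h2 h1 ((h5.mul_right h6).add_right (h4.mul_right h3))

/-- Reversal of the multiplication exchanges the two resolutions and thereby the relations `ra` and
`va`. By the universal property, `𝔞𝔴(n)` has an anti-automorphism that fixes all chords. -/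
theorem ChordSystem.opposite (h : ChordSystem p n C) :
    ChordSystem p n fun x y => op (C x y) where
  toChordComm := h.toChordComm.opposite
  ne_zero := h.ne_zero
  sub_ne := h.sub_ne
  add_ne := h.add_ne
  quad a b c d hab hbc hcd hd := by
    have H : Cyc4 a b c d := Or.inl (by omega)
    obtain ⟨h1, h2⟩ := h.quadRel_opposite H (by omega) (by omega) (by omega) hd
    have hc := fun {x y z t} => h.commute (a := x) (b := y) (c := z) (d := t)
    refine ⟨?_, ?_⟩
    · rw [h.chordCrossing_op H (by omega) (by omega) (by omega) hd, ← op_mul, ← op_mul, ← op_add,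
        triRel_op, (hc (by unfold Cyc4; omega) (by omega) (by omega) (by omega) (by omega) :
          Commute (C b c) (C a b)).eq, h.symm a d, (hc (by unfold Cyc4; omega) (by omega)
          (by omega) (by omega) (by omega) : Commute (C d a) (C c d)).eq, h.symm d a]
      exact h2
    · rw [h.chordCrossing_op H.rotate (by omega) (by omega) hd (by omega), ← op_mul, ← op_mul,
        ← op_add, triRel_op, (hc (by unfold Cyc4; omega) (by omega) (by omega) (by omega)
          (by omega) : Commute (C c d) (C b c)).eq, h.symm a d, (hc (by unfold Cyc4; omega)
          (by omega) (by omega) (by omega) (by omega) : Commute (C d a) (C a b)).eq, h.symm d a,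
        ← h.chordCrossing_rotate H (by omega) (by omega) (by omega) (by omega)]
      exact h1
  ra a b c d e hab hbc hcd hde he := by
    have := h.va a b c d e hab hbc hcd hde he
    have hs := (h.commute_side (p := p) (a := a) (b := b) (c := c) (d := d) (e := e)
      (Or.inl (by omega)) (by omega) (by omega) (by omega) (by omega) he).1
    rw [h.chordCrossing_op (a := b) (by unfold Cyc4; omega) (by omega) (by omega) (by omega) he,
      h.chordCrossing_op (a := e) (by unfold Cyc4; omega) he (by omega) (by omega) (by omega),
      h.chordCrossing_op (a := b) (by unfold Cyc4; omega) (by omega) (by omega) (by omega)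
        (by omega), ← op_mul, ← op_mul, ← op_add, triRel_op,
      ← h.chordCrossing_rotate (a := a) (by unfold Cyc4; omega) (by omega) (by omega) (by omega)
        (by omega), ← hs.eq, (h.commute (a := e) (b := a) (c := b) (d := c) (by unfold Cyc4; omega)
        he (by omega) (by omega) (by omega)).eq]
    exact this
  va a b c d e hab hbc hcd hde he := by
    have := h.ra a b c d e hab hbc hcd hde he
    have hs := (h.commute_side (p := p) (a := a) (b := b) (c := c) (d := d) (e := e)
      (Or.inl (by omega)) (by omega) (by omega) (by omega) (by omega) he).2
    rw [h.chordCrossing_op (a := c) (by unfold Cyc4; omega) (by omega) (by omega) he (by omega),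
      h.chordCrossing_op (a := a) (by unfold Cyc4; omega) (by omega) (by omega) (by omega) he,
      h.chordCrossing_op (a := a) (by unfold Cyc4; omega) (by omega) (by omega) (by omega)
        (by omega), ← op_mul, ← op_mul, ← op_add, triRel_op,
      ← h.chordCrossing_rotate (a := b) (by unfold Cyc4; omega) (by omega) (by omega) (by omega)
        he, ← h.chordCrossing_rotate (a := e) (by unfold Cyc4; omega) he (by omega) (by omega)
        (by omega), ← hs.eq, (h.commute (a := e) (b := a) (c := b) (d := c) (by unfold Cyc4; omega)
        he (by omega) (by omega) (by omega)).eq]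
    exact this

end Opposite

/-! ### The automorphisms `r_a` and the braid relations -/

section BraidAction

variable {K : Type*} [Field K] {q : K} {n : ℕ}

/-- The vertex that precedes `a` on the polygon with vertices `0, …, n`. -/
def prevVertex (n a : ℕ) : ℕ := if a = 0 then n else a - 1

theorem polygonCorner {a : ℕ} (ha : a < n) : PolygonCorner n (prevVertex n a) a (a + 1) := by
  unfold PolygonCorner prevVertex
  split_ifs <;> omega

/-- The image of the chords under the half twist with index `a`. -/
noncomputable def awTwist (q : K) (n a x y : ℕ) : AW K q n :=
  twist (q ^ 2) (awChord q n) (prevVertex n a) a (a + 1) x y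

/-- The universal property gives the endomorphism. Its inverse is the half twist in the opposite
direction, that is, its conjugate by the anti-automorphism that fixes the chords. -/
theorem exists_half_twist (hq0 : q ≠ 0) (hq1 : q ^ 2 ≠ 1) (hq2 : q ^ 2 ≠ -1) {a : ℕ} (ha : a < n) :
    ∃ e : AW K q n ≃ₐ[K] AW K q n, ∀ x y, x ≤ n → y ≤ n →
      e (awChord q n x y) = awTwist q n a x y := by
  have S := aw_chordSystem (n := n) hq0 hq1 hq2
  have H := polygonCorner ha
  obtain ⟨r, hr⟩ := exists_awHom hq0 (S.chordSystem_twist H)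
  obtain ⟨j, hj⟩ := exists_awHom hq0 S.opposite
  -- The map `j` is the anti-automorphism with values in the opposite algebra; `g` is `r` conjugated
  -- by it.
  set g : AW K q n →ₐ[K] AW K q n := ((AlgHom.opComm j).comp (AlgHom.op r)).comp j with hg
  have g_apply : ∀ x, g x = MulOpposite.unop (j (r (MulOpposite.unop (j x)))) := fun x => rfl
  have jj : ∀ x, MulOpposite.unop (j (MulOpposite.unop (j x))) = x := by
    have : (AlgHom.opComm j).comp j = AlgHom.id K _ := awHom_ext fun x y hxy hy => by
      rw [AlgHom.comp_apply, hj x y (by omega) hy]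
      exact congrArg MulOpposite.unop (hj x y (by omega) hy)
    exact fun x => DFunLike.congr_fun this x
  have hu : prevVertex n a ≤ n := by
    unfold prevVertex
    split_ifs <;> omega
  have huo : prevVertex n a ≠ a := by
    unfold prevVertex
    split_ifs <;> omega
  have hr' : ∀ x y, x ≤ n → y ≤ n → x ≠ a → y ≠ a → r (awChord q n x y) = awChord q n x y :=
    fun x y hx hy hxa hya => by rw [hr x y hx hy, twist_of_ne hxa hya]
  -- The relation `quadRel_opposite` recovers the chord `{a, x}` from its resolved crossing with the
  -- chord of the two neighbours of `a`.
  have rg1 : ∀ x, x ≤ n → x ≠ a → r (g (awChord q n a x)) = awChord q n a x := by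
    intro x hx hxa
    have Hc : Cyc4 (prevVertex n a) a (a + 1) x := by
      unfold PolygonCorner at H
      unfold Cyc4
      omega
    have h1 := (S.quadRel_opposite Hc hu ha.le ha hx).1
    rw [triRel_iff S.sub_ne] at h1
    rw [g_apply, hj a x ha.le hx, MulOpposite.unop_op, hr a x ha.le hx, twist_left hxa,
      chordCrossing, map_crossing, map_add, map_mul, map_mul, hj _ _ hu ha, hj _ _ ha.le hx,
      hj _ _ hu ha.le, hj _ _ ha hx, hj _ _ ha.le ha, hj _ _ hu hx, ← MulOpposite.op_mul,
      ← MulOpposite.op_mul, ← MulOpposite.op_add, crossing_op, MulOpposite.unop_op, map_crossing,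
      map_add, map_mul, map_mul, hr' _ _ ha hx (by omega) hxa, hr' _ _ hu hx huo hxa,
      hr' _ _ hu ha huo (by omega), hr a x ha.le hx, twist_left hxa, hr _ _ hu ha.le,
      twist_right huo, S.chordCrossing_corner_left H, hr _ _ ha.le ha, twist_left (by omega),
      S.chordCrossing_corner_right H, h1]
    have e1 : Commute (awChord q n a (a + 1)) (awChord q n (a + 1) x) :=
      S.commute (by unfold Cyc4 at *; omega) ha.le ha ha hx
    have e2 : Commute (awChord q n x (prevVertex n a)) (awChord q n (prevVertex n a) a) :=
      S.commute (by unfold Cyc4 at *; omega) hx hu hu ha.le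
    rw [S.symm x] at e2
    rw [e1.eq, ← e2.eq]
  have rg : ∀ x, r (g x) = x := by
    have : r.comp g = AlgHom.id K _ := awHom_ext fun x y hxy hy => by
      rw [AlgHom.comp_apply, AlgHom.id_apply]
      by_cases hx : x = a
      · rw [hx]
        exact rg1 y hy (by omega)
      by_cases hya : y = a
      · rw [hya, awChord_symm]
        exact rg1 x (by omega) hx
      rw [g_apply, hj x y (by omega) hy, MulOpposite.unop_op, hr' x y (by omega) hy hx hya,
        hj x y (by omega) hy, MulOpposite.unop_op, hr' x y (by omega) hy hx hya]
    exact fun x => DFunLike.congr_fun this x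
  -- Since `j` is an involution and `g = j r j`, the identity `r g = 1` conjugated by `j` is `g r =
  -- 1`.
  have gr : ∀ x, g (r x) = x := fun x => by
    have := rg (MulOpposite.unop (j x))
    rw [g_apply, jj] at this
    have h2 := congrArg (fun z => MulOpposite.unop (j z)) this
    simp only [jj] at h2
    rw [g_apply]
    exact h2
  exact ⟨AlgEquiv.ofAlgHom r g (AlgHom.ext rg) (AlgHom.ext gr), hr⟩

theorem awEquiv_ext {e f : AW K q n ≃ₐ[K] AW K q n}
    (h : ∀ x y, x < y → y ≤ n → e (awChord q n x y) = f (awChord q n x y)) : e = f := by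
  have : e.toAlgHom = f.toAlgHom := awHom_ext h
  exact AlgEquiv.ext fun x => DFunLike.congr_fun this x

section Relations

variable {a b : ℕ} {e f : AW K q n ≃ₐ[K] AW K q n}

theorem prevVertex_le (ha : a < n) : prevVertex n a ≤ n := by
  unfold prevVertex
  split_ifs <;> omega

theorem prevVertex_ne (ha : a < n) : prevVertex n a ≠ a := by
  unfold prevVertex
  split_ifs <;> omega

theorem half_twist_of_ne (he : ∀ x y, x ≤ n → y ≤ n → e (awChord q n x y) = awTwist q n a x y)
    {x y : ℕ} (hx : x ≤ n) (hy : y ≤ n) (hxa : x ≠ a) (hya : y ≠ a) :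
    e (awChord q n x y) = awChord q n x y := by
  rw [he x y hx hy, awTwist, twist_of_ne hxa hya]

theorem half_twist_left (he : ∀ x y, x ≤ n → y ≤ n → e (awChord q n x y) = awTwist q n a x y)
    (ha : a < n) {y : ℕ} (hy : y ≤ n) (hya : y ≠ a) :
    e (awChord q n a y) =
      chordCrossing (q ^ 2) (awChord q n) (prevVertex n a) a (a + 1) y := by
  rw [he a y ha.le hy, awTwist, twist_left hya]

theorem map_chordCrossing {A B : Type*} [Ring A] [Ring B] [Algebra K A] [Algebra K B]
    (f : A →ₐ[K] B) (p : K) (C : ℕ → ℕ → A) (a b c d : ℕ) :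
    f (chordCrossing p C a b c d) = chordCrossing p (fun x y => f (C x y)) a b c d := by
  simp only [chordCrossing, map_crossing, map_add, map_mul]

theorem half_twist_crossing (e : AW K q n ≃ₐ[K] AW K q n) (s t z w : ℕ) :
    e (chordCrossing (q ^ 2) (awChord q n) s t z w) =
      crossing (q ^ 2) (e (awChord q n s z)) (e (awChord q n t w))
        (e (awChord q n s t) * e (awChord q n z w) + e (awChord q n t z) * e (awChord q n s w)) :=
  map_chordCrossing e.toAlgHom _ _ _ _ _ _

theorem half_twist_crossing_of_ne
    (he : ∀ x y, x ≤ n → y ≤ n → e (awChord q n x y) = awTwist q n a x y) {s t z w : ℕ}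
    (hs : s ≤ n) (ht : t ≤ n) (hz : z ≤ n) (hw : w ≤ n)
    (hsa : s ≠ a) (hta : t ≠ a) (hza : z ≠ a) (hwa : w ≠ a) :
    e (chordCrossing (q ^ 2) (awChord q n) s t z w) =
      chordCrossing (q ^ 2) (awChord q n) s t z w := by
  rw [half_twist_crossing e, half_twist_of_ne he hs hz hsa hza,
    half_twist_of_ne he ht hw hta hwa, half_twist_of_ne he hs ht hsa hta,
    half_twist_of_ne he hz hw hza hwa, half_twist_of_ne he ht hz hta hza,
    half_twist_of_ne he hs hw hsa hwa, chordCrossing]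

/-- Both sides are compared on chords. Only chords that end at `a` or `a + 1` move, and for these
the relations `ra` and `vb` of a pentagon apply. -/
theorem half_twist_braid (S : ChordSystem (q ^ 2) n (awChord q n)) (ha : a + 1 < n)
    (he : ∀ x y, x ≤ n → y ≤ n → e (awChord q n x y) = awTwist q n a x y)
    (hf : ∀ x y, x ≤ n → y ≤ n → f (awChord q n x y) = awTwist q n (a + 1) x y) :
    e * f * e = f * e * f := by
  have ha' : a < n := by omega
  have H := polygonCorner ha'
  have Hf := polygonCorner ha
  have hu := prevVertex_le ha'
  have huo := prevVertex_ne ha'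
  have hpf : prevVertex n (a + 1) = a := by simp [prevVertex]
  rw [hpf] at Hf
  have huv : prevVertex n a ≠ a + 1 := by
    unfold PolygonCorner at H
    omega
  have fl : ∀ y, y ≤ n → y ≠ a + 1 → f (awChord q n (a + 1) y) =
      chordCrossing (q ^ 2) (awChord q n) a (a + 1) (a + 1 + 1) y := fun y hy hya => by
    rw [half_twist_left hf ha hy hya, hpf]
  have el := fun y => half_twist_left he ha' (y := y)
  have e1 : e (awChord q n a (a + 1)) = awChord q n (prevVertex n a) a := by
    rw [el _ (by omega) (by omega), S.chordCrossing_corner_right H]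
  have e2 : e (awChord q n (prevVertex n a) a) = awChord q n a (a + 1) := by
    rw [S.symm, el _ hu huo, S.chordCrossing_corner_left H]
  have f1 : f (awChord q n a (a + 1)) = awChord q n (a + 1) (a + 1 + 1) := by
    rw [S.symm, fl _ (by omega) (by omega), S.chordCrossing_corner_left Hf]
  have f2 : f (awChord q n (a + 1) (a + 1 + 1)) = awChord q n a (a + 1) := by
    rw [fl _ (by omega) (by omega), S.chordCrossing_corner_right Hf]
  have hov : e (f (e (awChord q n a (a + 1)))) = f (e (f (awChord q n a (a + 1)))) := by
    rw [e1, half_twist_of_ne hf hu (by omega) huv (by omega), e2, f1,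
      half_twist_of_ne he (by omega) (by omega) (by omega) (by omega), f2]
  have hv : ∀ x, x ≤ n → x ≠ a → x ≠ a + 1 →
      e (f (e (awChord q n (a + 1) x))) = f (e (f (awChord q n (a + 1) x))) := by
    intro x hx hxa hxv
    have H5 : Cyc5 x (prevVertex n a) a (a + 1) (a + 1 + 1) := by
      unfold PolygonCorner at H
      unfold Cyc5
      omega
    have r := S.triRel_ra H5 hx hu (by omega) (by omega) (by omega)
    rw [triRel_iff S.sub_ne] at r
    -- After two twists a chord at `a + 1` is a resolved crossing that avoids the vertex `a + 1`, so
    -- a further twist there fixes it.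
    have E : e (f (awChord q n (a + 1) x)) =
        chordCrossing (q ^ 2) (awChord q n) (a + 1 + 1) x (prevVertex n a) a := by
      rw [fl x hx hxv, half_twist_crossing e, el _ (by omega) (by omega), e1, el x hx hxa,
        half_twist_of_ne he (by omega) hx (by omega) hxa,
        half_twist_of_ne he (by omega) hx (by omega) hxa,
        half_twist_of_ne he (by omega) (by omega) (by omega) (by omega), r]
    rw [half_twist_of_ne he (by omega) hx (by omega) hxa, E, half_twist_crossing_of_ne hf (by omega)
      hx hu (by omega) (by omega) hxv huv (by omega)]
  have ho : ∀ x, x ≤ n → x ≠ a → x ≠ a + 1 →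
      e (f (e (awChord q n a x))) = f (e (f (awChord q n a x))) := by
    intro x hx hxa hxv
    have H5 : Cyc5 (a + 1 + 1) x (prevVertex n a) a (a + 1) := by
      unfold PolygonCorner at H
      unfold Cyc5
      omega
    have r := S.triRel_vb H5 (by omega) hx hu (by omega) (by omega)
    rw [triRel_iff S.sub_ne, S.symm x a, S.symm x (prevVertex n a)] at r
    have c : awChord q n (a + 1) (a + 1 + 1) * awChord q n (prevVertex n a) x =
        awChord q n (prevVertex n a) x * awChord q n (a + 1) (a + 1 + 1) := by
      rw [S.symm _ x]
      exact S.commute (by unfold Cyc5 Cyc4 at *; omega) (by omega) (by omega) hx hu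
    -- Likewise a chord at `a` becomes a resolved crossing that avoids the vertex `a`.
    have E : f (e (awChord q n a x)) =
        chordCrossing (q ^ 2) (awChord q n) (a + 1 + 1) x (prevVertex n a) (a + 1) := by
      rw [el x hx hxa, half_twist_crossing f, S.symm (prevVertex n a) (a + 1), fl _ hu huv,
        half_twist_of_ne hf (by omega) hx (by omega) hxv,
        half_twist_of_ne hf hu (by omega) huv (by omega), fl x hx hxv, f1,
        half_twist_of_ne hf hu hx huv hxv, c,
        add_comm (awChord q n (prevVertex n a) a * _), r]
    rw [half_twist_of_ne hf (by omega) hx (by omega) hxv, E, half_twist_crossing_of_ne he (by omega)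
      hx hu (by omega) (by omega) hxa huo (by omega)]
  refine awEquiv_ext fun x y hxy hy => ?_
  simp only [AlgEquiv.mul_apply]
  by_cases hxa : x = a
  · subst hxa
    by_cases hyv : y = x + 1
    · subst hyv
      exact hov
    · exact ho y hy (by omega) hyv
  by_cases hxv : x = a + 1
  · subst hxv
    exact hv y hy (by omega) (by omega)
  by_cases hya : y = a
  · subst hya
    rw [S.symm]
    exact ho x (by omega) hxa hxv
  by_cases hyv : y = a + 1
  · subst hyv
    rw [S.symm]
    exact hv x (by omega) hxa hxv
  have hx : x ≤ n := by omega
  rw [half_twist_of_ne he hx hy hxa hya, half_twist_of_ne hf hx hy hxv hyv,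
    half_twist_of_ne he hx hy hxa hya, half_twist_of_ne hf hx hy hxv hyv]

theorem half_twist_far (S : ChordSystem (q ^ 2) n (awChord q n)) (hab : a + 1 < b) (hb : b < n)
    (he : ∀ x y, x ≤ n → y ≤ n → e (awChord q n x y) = awTwist q n a x y)
    (hf : ∀ x y, x ≤ n → y ≤ n → f (awChord q n x y) = awTwist q n b x y) :
    e * f = f * e := by
  have ha : a < n := by omega
  have H := polygonCorner ha
  have hu := prevVertex_le ha
  have hu' := prevVertex_le hb
  have huo := prevVertex_ne ha
  have huo' := prevVertex_ne hb
  have h1 : prevVertex n a ≠ b := by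
    unfold prevVertex
    split_ifs <;> omega
  have h2 : prevVertex n b ≠ a := by
    unfold prevVertex
    split_ifs <;> omega
  have el := fun y => half_twist_left he ha (y := y)
  have fl := fun y => half_twist_left hf hb (y := y)
  have ha1 : ∀ x, x ≤ n → x ≠ a → x ≠ b → e (f (awChord q n a x)) = f (e (awChord q n a x)) := by
    intro x hx hxa hxb
    rw [half_twist_of_ne hf (by omega) hx (by omega) hxb, el x hx hxa,
      half_twist_crossing_of_ne hf hu (by omega) (by omega) hx h1 (by omega) (by omega) hxb]
  have hb1 : ∀ x, x ≤ n → x ≠ a → x ≠ b → e (f (awChord q n b x)) = f (e (awChord q n b x)) := by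
    intro x hx hxa hxb
    rw [half_twist_of_ne he (by omega) hx (by omega) hxa, fl x hx hxb,
      half_twist_crossing_of_ne he hu' (by omega) (by omega) hx h2 (by omega) (by omega) hxa]
  -- The chord `{a, b}` is moved by both twists. The twist at `b` is linear in the chords at `a`, so
  -- the order does not matter.
  have hab1 : e (f (awChord q n a b)) = f (e (awChord q n a b)) := by
    have m := fun {x y} => S.chord_mem_centralizer H (x := x) (y := y)
    have key := ((VertexLinear.eval b).crossing_left (p := q ^ 2)
      (m hu' (by omega : b + 1 ≤ n) h2 (by omega))
      (((VertexLinear.eval (b + 1)).mul_left (m hu' hb.le h2 (by omega))).add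
        ((VertexLinear.eval (prevVertex n b)).mul_left (m hb.le (by omega : b + 1 ≤ n) (by omega)
          (by omega))))) (awChord q n a) (awChord q n (a + 1)) (awChord q n (prevVertex n a))
    have fr : ∀ t, t ≤ n → t ≠ b → f (awChord q n t b) =
        crossing (q ^ 2) (awChord q n (prevVertex n b) (b + 1)) (awChord q n t b)
          (awChord q n (prevVertex n b) b * awChord q n t (b + 1) +
            awChord q n b (b + 1) * awChord q n t (prevVertex n b)) := by
      intro t ht htb
      rw [S.symm t b, fl t ht htb, chordCrossing, S.symm (b + 1) t, S.symm (prevVertex n b) t]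
    refine Eq.trans ?_ (key.trans ?_)
    · rw [S.symm a b, fl a ha.le (by omega), half_twist_crossing e,
        half_twist_of_ne he hu' (by omega) h2 (by omega), S.symm b a, el b hb.le (by omega),
        half_twist_of_ne he hu' (by omega) h2 (by omega), S.symm (b + 1) a,
        el (b + 1) (by omega) (by omega), half_twist_of_ne he (by omega) (by omega) (by omega)
        (by omega), S.symm (prevVertex n b) a, el _ hu' h2]
      rfl
    · rw [el b hb.le (by omega), half_twist_crossing f,
      half_twist_of_ne hf hu (by omega) h1 (by omega), fr a (by omega) (by omega),
      half_twist_of_ne hf hu (by omega) h1 (by omega), fr (a + 1) (by omega) (by omega),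
      half_twist_of_ne hf (by omega) (by omega) (by omega) (by omega), fr _ hu h1]
  refine awEquiv_ext fun x y hxy hy => ?_
  simp only [AlgEquiv.mul_apply]
  have hx : x ≤ n := by omega
  by_cases hxa : x = a
  · subst hxa
    by_cases hyb : y = b
    · subst hyb
      exact hab1
    · exact ha1 y hy (by omega) hyb
  by_cases hxb : x = b
  · subst hxb
    exact hb1 y hy (by omega) (by omega)
  by_cases hya : y = a
  · subst hya
    rw [S.symm]
    exact ha1 x hx hxa hxb
  by_cases hyb : y = b
  · subst hyb
    rw [S.symm]
    exact hb1 x hx hxa hxb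
  rw [half_twist_of_ne he hx hy hxa hya, half_twist_of_ne hf hx hy hxb hyb,
    half_twist_of_ne he hx hy hxa hya]

theorem awHole_empty_left (J : Finset ℕ) (hJ : AWConn n J) : awHole ∅ J = ∅ := by
  obtain ⟨a, b, hab, hb, rfl⟩ := awConn_iff.mp hJ
  ext x
  simp only [awHole, Finset.mem_sdiff, mem_awHull, Finset.mem_union, Finset.mem_Ioc,
    Finset.notMem_empty, false_or, iff_false]
  rintro ⟨⟨y, hy, z, hz, h1, h2⟩, h3⟩
  omega

theorem awSeq_empty_left (c : Finset ℕ → AW K q n) {J : Finset ℕ} (hJ : AWConn n J) :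
    awSeq q c [∅, J] = c J := by
  rw [awSeq_cons_of_empty _ _ (awHole_empty_left J hJ), Finset.empty_union, awSeq_single]

theorem awSeq_empty_right (c : Finset ℕ → AW K q n) {J : Finset ℕ} (hJ : AWConn n J) :
    awSeq q c [J, ∅] = c J := by
  rw [awSeq_cons_of_empty _ _ (by rw [awHole_comm, awHole_empty_left J hJ]), Finset.union_empty,
    awSeq_single]

/-- The generic value of `r_a` is a sequence of two intervals with a hole. The cases with an empty
or adjacent interval are the exchange of the two sides at the twisted vertex. -/
theorem half_twist_awC (S : ChordSystem (q ^ 2) n (awChord q n)) (hq0 : q ≠ 0) (ha : a < n)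
    (he : ∀ x y, x ≤ n → y ≤ n → e (awChord q n x y) = awTwist q n a x y) {I : Finset ℕ}
    (hI : AWConn n I) : e (awC q n I) = awR q n a I := by
  obtain ⟨x, y, hxy, hy, rfl⟩ := awConn_iff.mp hI
  have H := polygonCorner ha
  have hu := prevVertex_le ha
  have huo := prevVertex_ne ha
  have hx : x ≤ n := by omega
  have single : ∀ k, 1 ≤ k → ({k} : Finset ℕ) = Finset.Ioc (k - 1) k := fun k hk => by
    ext z
    rw [Finset.mem_singleton, Finset.mem_Ioc]
    omega
  rw [awC_Ioc hxy.le, awR]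
  by_cases ha0 : a = 0
  · subst ha0
    have hp : prevVertex n 0 = n := by simp [prevVertex]
    rw [hp] at H huo
    rw [if_pos rfl]
    by_cases hx0 : x = 0
    · subst hx0
      rw [if_pos (by simp; omega), half_twist_left he ha hy (by omega), hp]
      have hs : Finset.Icc 1 n \ Finset.Ioc 0 y = Finset.Ioc y n := by
        ext z
        simp only [Finset.mem_sdiff, Finset.mem_Icc, Finset.mem_Ioc]
        omega
      rw [hs, single 1 le_rfl]
      rcases hy.eq_or_lt with rfl | hyn
      · rw [Finset.Ioc_self, awSeq_empty_left _ (awConn_Ioc (by omega) (by omega)),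
          S.chordCrossing_corner_left H, awC_Ioc (by omega)]
      rcases (by omega : y = 1 ∨ 1 < y) with rfl | hy1
      · have : awHole (Finset.Ioc 1 n) (Finset.Ioc (1 - 1) 1) = ∅ := by
          rw [awHole_comm, awHole_Ioc (by omega) le_rfl hyn, Finset.Ioc_self]
        rw [awSeq_cons_of_empty _ _ this, awSeq_single, Finset.union_comm,
          Ioc_union_Ioc (by omega) hyn.le, S.chordCrossing_corner_right H, awC_Ioc (by omega),
          S.symm]
      · rw [awSeq_decreasing_awC hq0 (by omega) hy1 hyn le_rfl,
          S.chordCrossing_rotate (a := n) (by unfold Cyc4; omega) le_rfl (by omega) (by omega) hy]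
    · rw [if_neg (by simp; omega), half_twist_of_ne he hx hy hx0 (by omega), awC_Ioc hxy.le]
  have hp : prevVertex n a = a - 1 := by simp [prevVertex, ha0]
  rw [hp] at H huo
  rw [if_neg ha0]
  by_cases hxa : x = a
  · subst hxa
    have hs : Finset.Ioc x y \ {x + 1} = Finset.Ioc (x + 1) y := by
      ext z
      simp only [Finset.mem_sdiff, Finset.mem_singleton, Finset.mem_Ioc]
      omega
    rw [if_pos (by simp; omega), half_twist_left he ha hy (by omega), hp, hs, single x (by omega)]
    rcases (by omega : y = x + 1 ∨ x + 1 < y) with rfl | hyx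
    · rw [Finset.Ioc_self, awSeq_empty_right _ (awConn_Ioc (by omega) hx),
        S.chordCrossing_corner_right H, awC_Ioc (by omega)]
    · rw [awSeq_increasing_awC hq0 (by omega) (by omega) hyx hy]
  by_cases hya : y = a
  · subst hya
    have hs : Finset.Ioc x y \ {y} = Finset.Ioc x (y - 1) := by
      ext z
      simp only [Finset.mem_sdiff, Finset.mem_singleton, Finset.mem_Ioc]
      omega
    rw [if_neg (by simp), if_pos (by simp; omega), S.symm, half_twist_left he ha hx hxa, hp, hs,
      single (y + 1) (by omega), Nat.add_sub_cancel]
    rcases (by omega : x = y - 1 ∨ x < y - 1) with rfl | hyx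
    · rw [Finset.Ioc_self, awSeq_empty_right _ (awConn_Ioc (by omega) ha),
        S.chordCrossing_corner_left H, awC_Ioc (by omega)]
    · rw [awSeq_decreasing_awC hq0 hyx (by omega) (by omega) ha]
  rw [if_neg (by simp; omega), if_neg (by simp; omega), half_twist_of_ne he hx hy hxa hya,
    awC_Ioc hxy.le]

end Relations

end BraidAction

/-! ### Symmetries of the Casimir element of a quadrilateral -/

section Casimir

variable {R A : Type*} [CommRing R] [Ring A] [Algebra R A] {p : R}

/-- In the difference of the relation for `z` multiplied by `z` on the right and the relation for
`y` multiplied by `y` on the left the word `y * x * z` cancels. This compares `x * y * z` with `y *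
z * x`, and the squares of `y` and `z` exchange their coefficients. -/
theorem quadCasimir_cycle {x y z s₁ s₂ s₃ s₄ : A} (hz : TriRel p x y z (s₁ * s₃ + s₂ * s₄))
    (hy : TriRel p z x y (s₂ * s₃ + s₁ * s₄)) (h₁₂ : s₁ * s₂ = s₂ * s₁) (h₁₃ : s₁ * s₃ = s₃ * s₁)
    (hc : (s₁ * s₃ + s₂ * s₄) * z = z * (s₁ * s₃ + s₂ * s₄)) :
    quadCasimir p x y z s₁ s₂ s₃ s₄ = quadCasimir p y z x s₂ s₃ s₁ s₄ := by
  unfold quadCasimir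
  have h4 : s₁ * s₂ * s₃ * s₄ = s₂ * s₃ * s₁ * s₄ := by
    rw [h₁₂, mul_assoc s₂, h₁₃, mul_assoc s₂ s₃]
  rw [h4, ← h₁₂, ← h₁₃]
  set m₃ := s₁ * s₃ + s₂ * s₄
  set m₂ := s₂ * s₃ + s₁ * s₄
  linear_combination (norm := skip) (p + 1) • (hz * z) - (p + 1) • (y * hy)
    + ((p - 1) * (p + 1)) • hc
  simp only [smul_mul_assoc, mul_smul_comm, mul_add, mul_sub, sub_mul, smul_add,
    smul_sub, mul_assoc]
  module

theorem quadCasimir_twist (hm : IsUnit (p - 1)) {x y z e s₁ s₂ s₃ s₄ : A}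
    (hy : TriRel p z x y (s₂ * s₃ + s₁ * s₄)) (he : TriRel p x z e (s₂ * s₃ + s₁ * s₄))
    (h₁₃ : s₁ * s₃ = s₃ * s₁)
    (hc : (s₂ * s₃ + s₁ * s₄) * e = e * (s₂ * s₃ + s₁ * s₄)) :
    quadCasimir p x z e s₂ s₁ s₃ s₄ = quadCasimir p y z x s₂ s₃ s₁ s₄ := by
  refine hm.smul_left_cancel.mp ?_
  unfold quadCasimir
  have h4 : s₂ * s₁ * s₃ * s₄ = s₂ * s₃ * s₁ * s₄ := by
    rw [mul_assoc s₂, h₁₃, mul_assoc s₂ s₃]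
  rw [h4, ← h₁₃]
  set m₃ := s₁ * s₃ + s₂ * s₄
  set m₂ := s₂ * s₃ + s₁ * s₄
  linear_combination (norm := skip) p • ((p • he + hy) * e) - p • (y * (he + p • hy))
    + ((p - 1) * p * (p + 1)) • hc
  simp only [smul_mul_assoc, mul_smul_comm, mul_add, add_mul, mul_sub, sub_mul, smul_add,
    smul_sub, mul_assoc]
  module

end Casimir

section CasimirSymmetry

variable {R A : Type*} [CommRing R] [Ring A] [Algebra R A] {p : R}

/-- Double transpositions of the sides permute the two terms in each of the three sums attached to
`x`, `y`, `z`. -/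
theorem quadCasimir_klein {x y z s₁ s₂ s₃ s₄ : A} (h₁₂ : Commute s₁ s₂) (h₁₃ : Commute s₁ s₃)
    (h₁₄ : Commute s₁ s₄) (h₂₃ : Commute s₂ s₃) (h₂₄ : Commute s₂ s₄) (h₃₄ : Commute s₃ s₄) :
    quadCasimir p x y z s₂ s₁ s₄ s₃ = quadCasimir p x y z s₁ s₂ s₃ s₄ ∧
      quadCasimir p x y z s₄ s₃ s₂ s₁ = quadCasimir p x y z s₁ s₂ s₃ s₄ := by
  have e1 : s₂ * s₁ * s₄ * s₃ = s₁ * s₂ * s₃ * s₄ := by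
    rw [h₁₂.symm.eq, mul_assoc (s₁ * s₂), h₃₄.symm.eq, ← mul_assoc]
  have e2 : s₄ * s₃ * s₂ * s₁ = s₁ * s₂ * s₃ * s₄ := by
    rw [h₃₄.symm.eq, mul_assoc (s₃ * s₄), h₁₂.symm.eq,
      ((h₁₃.symm.mul_left h₁₄.symm).mul_right (h₂₃.symm.mul_left h₂₄.symm)).eq, ← mul_assoc]
  constructor
  · unfold quadCasimir
    rw [e1, h₁₂.symm.eq, h₃₄.symm.eq, add_comm (s₁ * s₄), add_comm (s₂ * s₄)]
    module
  · unfold quadCasimir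
    rw [e2, h₁₂.symm.eq, h₃₄.symm.eq, h₂₃.symm.eq, h₁₄.symm.eq, h₁₃.symm.eq, h₂₄.symm.eq,
      add_comm (s₃ * s₄), add_comm (s₂ * s₄)]
    module

/-- The Casimir element is unchanged when the third argument is moved across the first. -/
theorem quadCasimir_swap (hm : IsUnit (p - 1)) {x y z e s₁ s₂ s₃ s₄ : A}
    (h₁₂ : Commute s₁ s₂) (h₁₃ : Commute s₁ s₃) (hx₁ : Commute s₁ x) (hx₂ : Commute s₂ x)
    (hx₃ : Commute s₃ x) (hx₄ : Commute s₄ x) (hz₁ : Commute s₁ z) (hz₂ : Commute s₂ z)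
    (hz₃ : Commute s₃ z) (hz₄ : Commute s₄ z) (hz : TriRel p x y z (s₁ * s₃ + s₂ * s₄))
    (hy : TriRel p z x y (s₂ * s₃ + s₁ * s₄)) (he : TriRel p x z e (s₂ * s₃ + s₁ * s₄)) :
    quadCasimir p x z e s₂ s₁ s₃ s₄ = quadCasimir p x y z s₁ s₂ s₃ s₄ := by
  have hcz : Commute (s₁ * s₃ + s₂ * s₄) z := (hz₁.mul_left hz₃).add_left (hz₂.mul_left hz₄)
  have hm2x : Commute (s₂ * s₃ + s₁ * s₄) x := (hx₂.mul_left hx₃).add_left (hx₁.mul_left hx₄)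
  have hm2z : Commute (s₂ * s₃ + s₁ * s₄) z := (hz₂.mul_left hz₃).add_left (hz₁.mul_left hz₄)
  have hce : Commute (s₂ * s₃ + s₁ * s₄) e := by
    have h1 : (p - 1) • e = (p - 1) • (s₂ * s₃ + s₁ * s₄) - (p • (x * z) - z * x) := by
      rw [show p • (x * z) - z * x = _ from he]; module
    have h2 : Commute (s₂ * s₃ + s₁ * s₄) ((p - 1) • e) := by
      rw [h1]
      exact ((Commute.refl _).smul_right _).sub_right
        (((hm2x.mul_right hm2z).smul_right _).sub_right (hm2z.mul_right hm2x))
    refine hm.smul_left_cancel.mp ?_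
    rw [← mul_smul_comm, h2.eq, smul_mul_assoc]
  rw [quadCasimir_cycle hz hy h₁₂ h₁₃ hcz, quadCasimir_twist hm hy he h₁₃ hce]

end CasimirSymmetry

theorem Pentagon.reflect {R A : Type*} [CommRing R] [Ring A] [Algebra R A] {p : R}
    {a : Fin 5 → R} {d w v : Fin 5 → A} (h : Pentagon p a d w v) :
    Pentagon p (fun i => a (4 - i)) (fun i => d (-i)) (fun i => v (4 - i))
      (fun i => w (4 - i)) := by
  refine h.toPrePentagon.reflect.toPentagon (j := 4) (k := 4) ?_ ?_
  · have := h.vb 0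
    have n2 : (-3 : Fin 5) = 2 := rfl
    simpa [mul_comm, n2] using this
  · have := h.rb 0
    have n2 : (-3 : Fin 5) = 2 := rfl
    simpa [mul_comm, n2] using this

/-! ### Casimir elements of chords under rotations and twists -/

section ChordCasimir

variable {K A : Type*} [Field K] [Ring A] [Algebra K A] {p : K} {n : ℕ} {C : ℕ → ℕ → A}

/-- The Casimir element of a quadrilateral. -/
def chordCasimir (p : K) (C : ℕ → ℕ → A) (a b c d : ℕ) : A :=
  quadCasimir p (C a c) (C b d) (chordCrossing p C a b c d) (C a b) (C b c) (C c d) (C a d)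

theorem PentagonModel.exists_crossing {x : Fin 5 → ℕ} (M : PentagonModel p C x) (hp : p - 1 ≠ 0)
    (r s m : M.B) : ∃ e : M.B, TriRel M.param r s e m ∧ (e : A) = crossing p (r : A) s m := by
  refine ⟨crossing p r s m, ?_, map_crossing M.B.val _ _ _⟩
  rw [M.triRel_iff, _root_.triRel_iff hp]
  exact map_crossing M.B.val _ _ _

theorem Cyc5.rotate' {a b c d e : ℕ} (H : Cyc5 a b c d e) : Cyc5 b c d e a := by
  unfold Cyc5 at *; omega

theorem Cyc5.quads {a b c d e : ℕ} (H : Cyc5 a b c d e) :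
    Cyc4 a b c d ∧ Cyc4 a b c e ∧ Cyc4 a b d e ∧ Cyc4 a c d e ∧ Cyc4 b c d e := by
  unfold Cyc5 at H
  unfold Cyc4
  omega

/-- The sides of a quadrilateral commute with each other, with the diagonals and with the
resolved crossings. -/
theorem ChordComm.sides (h : ChordComm n C) {a b c d : ℕ} (H : Cyc4 a b c d) (ha : a ≤ n)
    (hb : b ≤ n) (hc : c ≤ n) (hd : d ≤ n) :
    ∀ s, s = C a b ∨ s = C b c ∨ s = C c d ∨ s = C a d →
      ∀ t, t = C a b ∨ t = C b c ∨ t = C c d ∨ t = C a d ∨ t = C a c ∨ t = C b d ∨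
        t = chordCrossing p C a b c d → Commute s t := by
  have key : ∀ {w x y z}, Cyc4 w x y z → w ≤ n → x ≤ n → y ≤ n → z ≤ n →
      Commute (C w x) (C w x) ∧ Commute (C w x) (C x y) ∧ Commute (C w x) (C y z) ∧
      Commute (C w x) (C w z) ∧ Commute (C w x) (C w y) ∧ Commute (C w x) (C x z) := by
    intro w x y z H hw hx hy hz
    refine ⟨Commute.refl _, h.commute ?_ hw hx hx hy, h.commute ?_ hw hx hy hz, ?_, ?_,
      h.commute ?_ hw hx hx hz⟩
    · unfold Cyc4 at *; omega
    · exact H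
    · rw [h.symm w z]; refine h.commute ?_ hw hx hz hw
      unfold Cyc4 at *; omega
    · rw [h.symm w y]; refine h.commute ?_ hw hx hy hw
      unfold Cyc4 at *; omega
    · unfold Cyc4 at *; omega
  obtain ⟨-, a2, a3, a4, a5, a6⟩ := key H ha hb hc hd
  obtain ⟨-, b2, b3, b4, b5, b6⟩ := key H.rotate hb hc hd ha
  obtain ⟨-, c2, c3, c4, c5, c6⟩ := key H.rotate.rotate hc hd ha hb
  obtain ⟨-, d2, d3, d4, d5, d6⟩ := key H.rotate.rotate.rotate hd ha hb hc
  rw [h.symm c a] at c5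
  rw [h.symm b a] at b4
  rw [h.symm c a] at b6
  rw [h.symm d a] at b3
  rw [h.symm d b] at c6
  rw [h.symm c b] at c4
  rw [h.symm d a] at d2 d3 d4 d5 d6
  rw [h.symm d c] at d4
  rw [h.symm d b] at d5
  have base : ∀ s, s = C a b ∨ s = C b c ∨ s = C c d ∨ s = C a d →
      ∀ t, t = C a b ∨ t = C b c ∨ t = C c d ∨ t = C a d ∨ t = C a c ∨ t = C b d →
        Commute s t := by
    rintro s (rfl | rfl | rfl | rfl) t (rfl | rfl | rfl | rfl | rfl | rfl) <;>
      first | exact Commute.refl _ | assumption | (apply Commute.symm; assumption)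
  intro s hs t ht
  rcases ht with ht | ht | ht | ht | ht | ht | rfl
  any_goals exact base s hs t (by tauto)
  exact commute_crossing (base s hs _ (by tauto)) (base s hs _ (by tauto))
    (((base s hs _ (by tauto)).mul_right (base s hs _ (by tauto))).add_right
      ((base s hs _ (by tauto)).mul_right (base s hs _ (by tauto))))

namespace ChordSystem

variable {a b c d e : ℕ}

theorem isUnit_sub (h : ChordSystem p n C) : IsUnit (p - 1) := (isUnit_iff_ne_zero).mpr h.sub_ne

/-- A rotation replaces the resolved crossing by the other resolution. Both forms are compared by
`quadCasimir_cycle` and `quadCasimir_swap`, and the sides are then relabelled by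
`quadCasimir_klein`. -/
theorem chordCasimir_rotate (h : ChordSystem p n C) (H : Cyc4 a b c d) (ha : a ≤ n) (hb : b ≤ n)
    (hc : c ≤ n) (hd : d ≤ n) : chordCasimir p C b c d a = chordCasimir p C a b c d := by
  have S := h.sides (p := p) H ha hb hc hd
  have S' := h.sides (p := p) H.rotate hb hc hd ha
  have q := h.quadRel H ha hb hc hd
  have q' := h.quadRel_opposite H ha hb hc hd
  have hz : TriRel p (C a c) (C b d) (chordCrossing p C a b c d) (C a b * C c d + C b c * C a d) :=
    (triRel_iff h.sub_ne).mpr rfl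
  have hv : TriRel p (C b d) (C a c) (chordCrossing p C b c d a)
      (C b c * C a d + C c d * C a b) := by
    rw [triRel_iff h.sub_ne, chordCrossing, h.symm c a, h.symm d a, h.symm b a]
  rw [h.symm b a, h.symm d a] at S'
  unfold chordCasimir
  rw [h.symm c a, h.symm d a, h.symm b a]
  rw [quadCasimir_cycle (s₁ := C b c) (s₂ := C c d) (s₃ := C a d) (s₄ := C a b) hv
    (by convert q'.2 using 1
        rw [add_comm, (S (C b c) (by tauto) (C a b) (by tauto)).eq])
    (S _ (by tauto) _ (by tauto)).eq (S _ (by tauto) _ (by tauto)).eq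
    (((S' _ (by tauto) _ (by tauto)).mul_left (S' _ (by tauto) _ (by tauto))).add_left
      ((S' _ (by tauto) _ (by tauto)).mul_left (S' _ (by tauto) _ (by tauto)))).eq]
  rw [← quadCasimir_swap h.isUnit_sub (S _ (by tauto) _ (by tauto)) (S _ (by tauto) _ (by tauto))
    (S _ (by tauto) _ (by tauto)) (S _ (by tauto) _ (by tauto)) (S _ (by tauto) _ (by tauto))
    (S _ (by tauto) _ (by tauto)) (S _ (by tauto) _ (by tauto)) (S _ (by tauto) _ (by tauto))
    (S _ (by tauto) _ (by tauto)) (S _ (by tauto) _ (by tauto))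
    (e := chordCrossing p C a b c d)
    (by convert q.vy using 1
        rw [(S (C c d) (by tauto) (C b c) (by tauto)).eq, (S (C a d) (by tauto) (C a b) (by tauto)).eq])
    (by convert hv using 1
        rw [(S (C a d) (by tauto) (C b c) (by tauto)).eq])
    (by convert hz using 1
        rw [(S (C a d) (by tauto) (C b c) (by tauto)).eq, add_comm, (S (C c d) (by tauto) (C a b) (by tauto)).eq])]
  exact (quadCasimir_klein (S _ (by tauto) _ (by tauto)) (S _ (by tauto) _ (by tauto))
    (S _ (by tauto) _ (by tauto)) (S _ (by tauto) _ (by tauto)) (S _ (by tauto) _ (by tauto))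
    (S _ (by tauto) _ (by tauto))).2

/-- The Casimir element of a quadrilateral is fixed by the half twist of two of its vertices. -/
theorem chordCasimir_swap (h : ChordSystem p n C) (H : Cyc4 a b c d) (ha : a ≤ n) (hb : b ≤ n)
    (hc : c ≤ n) (hd : d ≤ n) :
    quadCasimir p (C a c) (chordCrossing p C a b c d)
      (crossing p (C a c) (chordCrossing p C a b c d) (C b c * C c d + C a b * C a d))
      (C b c) (C a b) (C c d) (C a d) = chordCasimir p C a b c d := by
  have S := h.sides (p := p) H ha hb hc hd
  have q' := h.quadRel_opposite H ha hb hc hd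
  exact quadCasimir_swap h.isUnit_sub (S _ (by tauto) _ (by tauto)) (S _ (by tauto) _ (by tauto))
    (S _ (by tauto) _ (by tauto)) (S _ (by tauto) _ (by tauto)) (S _ (by tauto) _ (by tauto))
    (S _ (by tauto) _ (by tauto)) (S _ (by tauto) _ (by tauto)) (S _ (by tauto) _ (by tauto))
    (S _ (by tauto) _ (by tauto)) (S _ (by tauto) _ (by tauto))
    ((triRel_iff h.sub_ne).mpr rfl) q'.1 ((triRel_iff h.sub_ne).mpr rfl)

/-- The image of a Casimir element under the half twist of `c` and `d`, where `d`, `e` are the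
vertices next to `c`. -/
theorem quadCasimir_twist_right (h : ChordSystem p n C) (H : Cyc5 a b c d e) (ha : a ≤ n)
    (hb : b ≤ n) (hc : c ≤ n) (hd : d ≤ n) (he : e ≤ n) :
    quadCasimir p (C a c) (chordCrossing p C c d e b)
      (crossing p (C a c) (chordCrossing p C c d e b)
        (C a b * C d e + C b c * chordCrossing p C c d e a))
      (C a b) (C b c) (C d e) (chordCrossing p C c d e a) =
    chordCasimir p C b c d e - chordCasimir p C c d e a + chordCasimir p C d e a b := by
  obtain ⟨M, P⟩ := h.exists_pentagon_vec H.rotate' hb hc hd he ha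
  obtain ⟨e0, h1, h2⟩ := M.exists_crossing h.sub_ne (M.d 0) (M.v 1)
    ((M.a 4 * M.a 2) • 1 + M.a 0 • M.w 2)
  have := congrArg Subtype.val (P.twist_casimir 0 (e0 := e0) h1)
  simp only [Pentagon.casimir, Subalgebra.coe_add, Subalgebra.coe_sub, M.val_quadCasimir, M.val_one_smul,
    M.val_mul_smul, M.val_smul, M.val_d, M.val_w, M.val_v, h2,
    Fin.isValue, Fin.reduceAdd, zero_add] at this
  unfold chordCasimir
  rw [h.symm b e, h.symm c a, h.symm d b]
  exact this

/-- The mirror image of `quadCasimir_twist_right`, from the reflected pentagon; the sides of the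
reflected quadrilaterals are reordered at the end. -/
theorem quadCasimir_twist_left (h : ChordSystem p n C) (H : Cyc5 a b c d e) (ha : a ≤ n)
    (hb : b ≤ n) (hc : c ≤ n) (hd : d ≤ n) (he : e ≤ n) :
    quadCasimir p (C a c) (chordCrossing p C d e a b)
      (crossing p (C a c) (chordCrossing p C d e a b)
        (C b c * C d e + C a b * chordCrossing p C d e a c))
      (C b c) (C a b) (C d e) (chordCrossing p C d e a c) =
    chordCasimir p C a b d e - chordCasimir p C a c d e + chordCasimir p C b c d e := by
  obtain ⟨M, P⟩ := h.exists_pentagon_vec H.rotate' hb hc hd he ha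
  have n1 : (-1 : Fin 5) = 4 := rfl
  have n2 : (-2 : Fin 5) = 3 := rfl
  have n3 : (-3 : Fin 5) = 2 := rfl
  have n4 : (-4 : Fin 5) = 1 := rfl
  obtain ⟨e0, h1, h2⟩ := M.exists_crossing h.sub_ne (M.d 0) (M.w 3)
    ((M.a 0 * M.a 2) • 1 + M.a 4 • M.v 2)
  have := congrArg Subtype.val (P.reflect.twist_casimir 0 (e0 := e0) h1)
  simp only [Pentagon.casimir, Subalgebra.coe_add, Subalgebra.coe_sub, M.val_quadCasimir,
    M.val_one_smul, M.val_mul_smul, M.val_smul, M.val_d, M.val_w, M.val_v, h2, n1, n2, n3, n4,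
    Fin.isValue, Fin.reduceAdd, Fin.reduceSub, neg_zero, zero_add] at this
  have key : ∀ {w x y z}, Cyc4 w x y z → w ≤ n → x ≤ n → y ≤ n → z ≤ n →
      quadCasimir p (C w y) (C z x) (chordCrossing p C w x y z) (C x y) (C w x) (C z w) (C y z) =
        chordCasimir p C x y z w := by
    intro w x y z H hw hx hy hz
    have S := h.sides (p := p) H hw hx hy hz
    rw [h.chordCasimir_rotate H hw hx hy hz, h.symm z x, h.symm z w]
    exact (quadCasimir_klein (S _ (by tauto) _ (by tauto)) (S _ (by tauto) _ (by tauto))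
      (S _ (by tauto) _ (by tauto)) (S _ (by tauto) _ (by tauto)) (S _ (by tauto) _ (by tauto))
      (S _ (by tauto) _ (by tauto))).1
  obtain ⟨H1, -, H3, H4, H5⟩ := H.quads
  have k1 := key H3.rotate.rotate.rotate he ha hb hd
  have k2 := key H4.rotate.rotate hd he ha hc
  have k3 := key H5.rotate hc hd he hb
  rw [h.chordCasimir_rotate H4.rotate.rotate hd he ha hc,
    h.chordCasimir_rotate H4.rotate hc hd he ha, h.chordCasimir_rotate H4 ha hc hd he] at k2
  rw [h.chordCasimir_rotate H5.rotate hc hd he hb, h.chordCasimir_rotate H5 hb hc hd he] at k3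
  rw [← k1, ← k2, ← k3]
  exact this

end ChordSystem

end ChordCasimir

/-! ### Casimir elements of intervals with a hole -/

section ChordCasimir

variable {K A : Type*} [Field K] [Ring A] [Algebra K A] {p : K} {n : ℕ} {C : ℕ → ℕ → A}

namespace ChordSystem

variable {a b c d e u o v : ℕ}

/-- The chord `{c, e}` starts at a vertex of the quadrilateral and leaves it through the side `{a,
d}`. -/
theorem chordCasimir_commute (h : ChordSystem p n C) (H : Cyc5 a b c d e) (ha : a ≤ n)
    (hb : b ≤ n) (hc : c ≤ n) (hd : d ≤ n) (he : e ≤ n) :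
    Commute (chordCasimir p C a b c d) (C c e) := by
  obtain ⟨M, P⟩ := h.exists_pentagon_vec H ha hb hc hd he
  have := congrArg Subtype.val (P.casimir_commute 4)
  simp only [Pentagon.casimir, Subalgebra.coe_mul, M.val_quadCasimir,
    M.val_one_smul, M.val_mul_smul, M.val_smul, M.val_d, M.val_w, M.val_v,
    Fin.isValue, Fin.reduceAdd, zero_add] at this
  unfold chordCasimir
  rw [h.symm a d]
  exact this

theorem commute_quadCasimir {x y z s₁ s₂ s₃ s₄ t : A} (hx : Commute t x) (hy : Commute t y)
    (hz : Commute t z) (h₁ : Commute t s₁) (h₂ : Commute t s₂) (h₃ : Commute t s₃)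
    (h₄ : Commute t s₄) : Commute t (quadCasimir p x y z s₁ s₂ s₃ s₄) := by
  have key : ∀ s : A, Commute t s ↔ s ∈ Subalgebra.centralizer K {t} := fun s => by
    simp [Subalgebra.mem_centralizer_iff, Commute, SemiconjBy]
  rw [key] at *
  unfold quadCasimir
  repeat' first
    | assumption
    | apply sub_mem
    | apply add_mem
    | apply Subalgebra.smul_mem
    | apply mul_mem
    | exact one_mem _

theorem commute_chordCrossing' (h : ChordSystem p n C) (H : Cyc5 a b c d e) (ha : a ≤ n)
    (hb : b ≤ n) (hc : c ≤ n) (hd : d ≤ n) (he : e ≤ n) :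
    Commute (chordCrossing p C b c d a) (chordCrossing p C b c e a) := by
  have := h.opposite.commute_chordCrossing H ha hb hc hd he
  rw [h.chordCrossing_op H.quads.1 ha hb hc hd, h.chordCrossing_op H.quads.2.1 ha hb hc he] at this
  exact this.unop

/-- The Casimir element of three intervals with a hole before the last one. -/
theorem quadCasimir_hole_right (h : ChordSystem p n C) (H : Cyc5 a b c d e) (ha : a ≤ n)
    (hb : b ≤ n) (hc : c ≤ n) (hd : d ≤ n) (he : e ≤ n) :
    quadCasimir p (C a c) (chordCrossing p C b c d e) (chordCrossing p C a b d e) (C a b) (C b c)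
      (C d e) (chordCrossing p C a c d e) =
    chordCasimir p C a b d e - chordCasimir p C a c d e + chordCasimir p C b c d e := by
  obtain ⟨H1, H2, H3, H4, H5⟩ := H.quads
  have S1 := h.sides (p := p) H1 ha hb hc hd
  have S3 := h.sides (p := p) H3 ha hb hd he
  have S4 := h.sides (p := p) H4 ha hc hd he
  have H' := H.rotate'.rotate'.rotate'
  have r3 := h.chordCrossing_rotate (p := p) H3 ha hb hd he
  have r4 := h.chordCrossing_rotate (p := p) H4 ha hc hd he
  have ra := h.triRel_ra H'.rotate'.rotate'.rotate'.rotate' hc hd he ha hb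
  have rb := h.triRel_rb H'.rotate' he ha hb hc hd
  -- Up to `quadCasimir_swap`, the Casimir element with a hole is the twisted one evaluated in
  -- `quadCasimir_twist_left`.
  rw [← h.quadCasimir_twist_left H ha hb hc hd he, ← r3, ← r4]
  rw [← r3, ← r4] at ra rb
  refine (quadCasimir_swap h.isUnit_sub (S1 _ (by tauto) _ (by tauto)) (S3 _ (by tauto) _ (by tauto))
    (S1 _ (by tauto) _ (by tauto)) (S1 _ (by tauto) _ (by tauto))
    (S4 _ (by tauto) _ (by tauto)) ?_ (S3 _ (by tauto) _ (by tauto)) ?_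
    (S3 _ (by tauto) _ (by tauto)) ?_ rb ?_ ((triRel_iff h.sub_ne).mpr rfl)).symm
  · exact (commute_crossing (S4 _ (by tauto) _ (by tauto)) ((S4 _ (by tauto) _ (by tauto)))
      (((S4 _ (by tauto) _ (by tauto)).mul_right (S4 _ (by tauto) _ (by tauto))).add_right
      ((S4 _ (by tauto) _ (by tauto)).mul_right (S4 _ (by tauto) _ (by tauto))))).symm
  · rw [r3]
    exact (h.commute_side H' hd he ha hb hc).1
  · rw [r3, r4]
    exact (h.commute_chordCrossing H' hd he ha hb hc).symm
  · convert ra using 1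
    rw [(h.commute H5 hb hc hd he).eq]

/-- The Casimir element of three intervals with a hole after the first one. -/
theorem quadCasimir_hole_left (h : ChordSystem p n C) (H : Cyc5 a b c d e) (ha : a ≤ n)
    (hb : b ≤ n) (hc : c ≤ n) (hd : d ≤ n) (he : e ≤ n) :
    quadCasimir p (chordCrossing p C a b c d) (C c e) (chordCrossing p C a b d e) (C a b) (C c d)
      (C d e) (chordCrossing p C a b c e) =
    chordCasimir p C a b c d - chordCasimir p C a b c e + chordCasimir p C a b d e := by
  obtain ⟨H1, H2, H3, H4, H5⟩ := H.quads
  have S1 := h.sides (p := p) H1 ha hb hc hd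
  have S2 := h.sides (p := p) H2 ha hb hc he
  have S3 := h.sides (p := p) H3 ha hb hd he
  have S4 := h.sides (p := p) H4 ha hc hd he
  have S5 := h.sides (p := p) H5 hb hc hd he
  have H' := H.rotate'.rotate'.rotate'.rotate'
  have r1 := h.chordCrossing_rotate (p := p) H1 ha hb hc hd
  have r2 := h.chordCrossing_rotate (p := p) H2 ha hb hc he
  have r3 := h.chordCrossing_rotate (p := p) H3 ha hb hd he
  have ra := h.triRel_ra H' he ha hb hc hd
  have rc := h.triRel_crossing_crossing H' he ha hb hc hd
  -- The hole after the first interval is a hole before the last one for the pentagon read from `c`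
  -- on; `quadCasimir_cycle` restores the order.
  have N := h.quadCasimir_hole_right H.rotate'.rotate' hc hd he ha hb
  rw [← r1, ← r2, ← r3, h.chordCasimir_rotate H1.rotate hb hc hd ha,
    h.chordCasimir_rotate H1 ha hb hc hd, h.chordCasimir_rotate H2.rotate hb hc he ha,
    h.chordCasimir_rotate H2 ha hb hc he, h.chordCasimir_rotate H3.rotate hb hd he ha,
    h.chordCasimir_rotate H3 ha hb hd he] at N
  rw [← N]
  rw [← r3] at ra rc
  refine quadCasimir_cycle ?_ rc (S1 _ (by tauto) _ (by tauto)).eq (S3 _ (by tauto) _ (by tauto)).eq ?_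
  · exact ra
  · refine (((S3 _ (by tauto) _ (by tauto)).mul_left (S3 _ (by tauto) _ (by tauto))).add_left
      (Commute.mul_left ?_ ?_)).eq
    · have t1 : Commute (C c d) (C a e) := by
        rw [h.symm a e]; exact h.commute H4.rotate hc hd he ha
      have t2 : Commute (C c d) (C a b) := S1 _ (by tauto) _ (by tauto)
      exact commute_crossing (S4 _ (by tauto) _ (by tauto)) (S5 _ (by tauto) _ (by tauto))
        ((t2.mul_right (S4 _ (by tauto) _ (by tauto))).add_right
          ((S1 _ (by tauto) _ (by tauto)).mul_right t1))
    · exact h.commute_chordCrossing' H' he ha hb hc hd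

/-- Three positions of the twisted vertex `o` matter: the quadrilateral contains both neighbours of
`o` and is fixed, or it contains only `u`, or only `v`, as in the two lemmas below. -/
theorem chordCasimir_twist_self (h : ChordSystem p n C) (H : PolygonCorner n u o v) (hu : u ≠ o)
    (hv : v ≠ o) (hc : c ≠ o) (H4 : Cyc4 u o v c) (hun : u ≤ n) (hon : o ≤ n) (hvn : v ≤ n)
    (hcn : c ≤ n) : chordCasimir p (twist p C u o v) u o v c = chordCasimir p C u o v c := by
  rw [← h.chordCasimir_swap H4 hun hon hvn hcn]
  unfold chordCasimir
  rw [chordCrossing, twist_left hc, twist_left hv, twist_right hu, twist_of_ne hu hv,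
    twist_of_ne hv hc, twist_of_ne hu hc, h.chordCrossing_corner_left H, h.chordCrossing_corner_right H]

theorem chordCasimir_twist_right (h : ChordSystem p n C) (H : PolygonCorner n u o v) (hu : u ≠ o)
    (hao : a ≠ o) (hbo : b ≠ o) (H5 : Cyc5 a b u o v) (hun : u ≤ n) (hon : o ≤ n) (hvn : v ≤ n)
    (ha : a ≤ n) (hb : b ≤ n) : chordCasimir p (twist p C u o v) a b u o =
      chordCasimir p C b u o v - chordCasimir p C u o v a + chordCasimir p C o v a b := by
  rw [← h.quadCasimir_twist_right H5 ha hb hun hon hvn]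
  unfold chordCasimir
  rw [chordCrossing, twist_right hao, twist_right hbo, twist_right hu, twist_of_ne hao hu,
    twist_of_ne hao hbo, twist_of_ne hbo hu, h.chordCrossing_corner_left H]

theorem chordCasimir_twist_left (h : ChordSystem p n C) (H : PolygonCorner n u o v)
    (hv : v ≠ o) (hao : a ≠ o) (hbo : b ≠ o) (H5 : Cyc5 v a b u o) (hun : u ≤ n) (hon : o ≤ n)
    (hvn : v ≤ n) (ha : a ≤ n) (hb : b ≤ n) : chordCasimir p (twist p C u o v) v a b o =
      chordCasimir p C v a u o - chordCasimir p C v b u o + chordCasimir p C a b u o := by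
  rw [← h.quadCasimir_twist_left H5 hvn ha hb hun hon]
  unfold chordCasimir
  rw [chordCrossing, twist_right hao, twist_right hbo, twist_right hv, twist_of_ne hv hao,
    twist_of_ne hao hbo, twist_of_ne hv hbo, h.chordCrossing_corner_right H, add_comm (_ * C u o)]
  have S := h.sides (p := p) (a := u) (b := o) (c := v) (d := b)
    (by unfold Cyc4 Cyc5 at *; omega) hun hon hvn hb
  have S' := h.sides (p := p) (a := v) (b := a) (c := b) (d := u)
    H5.quads.1 hvn ha hb hun
  have S'' := h.sides (p := p) (a := v) (b := a) (c := u) (d := o)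
    H5.quads.2.2.1 hvn ha hun hon
  have S3 := h.sides (p := p) H5.quads.2.2.2.2 ha hb hun hon
  refine (quadCasimir_klein (S' _ (by tauto) _ (by tauto)) ?_ ?_ ?_ ?_ ?_).1.symm
  · exact (h.commute_chordCrossing_chord H hb hvn ha hbo hv hao (by unfold Cyc4 Cyc5 at *; omega)).symm
  · exact (S'' _ (by tauto) _ (by tauto))
  · exact (h.commute_chordCrossing_chord H hb ha hb hbo hao hbo (by unfold Cyc4 Cyc5 at *; omega)).symm
  · exact (S3 _ (by tauto) _ (by tauto))
  · exact (S _ (by tauto) _ (by tauto)).symm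

end ChordSystem

end ChordCasimir

/-! ### Rows: sets with a variable left end point -/

section Rows

variable {K A : Type*} [Field K] [Ring A] [Algebra K A] {p : K} {n : ℕ} {C : ℕ → ℕ → A}

/-- The resolution of the crossings of the chords `{x, h}` with the chords from `t` in the
row `F`. -/
def resolve (p : K) (C : ℕ → ℕ → A) (t h : ℕ) (F : ℕ → A) (x : ℕ) : A :=
  crossing p (C x h) (F t) (C x t * F h + C t h * F x)

/-- The row attached to an increasing list of integers. -/
def row (p : K) (C : ℕ → ℕ → A) : List ℕ → ℕ → A
  | [], _ => 1
  | [t], x => C x t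
  | t :: h :: L, x => resolve p C t (h - 1) (row p C (h :: L)) x

theorem row_cons_cons (t h : ℕ) (L : List ℕ) :
    row p C (t :: h :: L) = resolve p C t (h - 1) (row p C (h :: L)) := by
  funext x; rw [row]

theorem row_single (t : ℕ) : row p C [t] = fun x => C x t := by
  funext x; rw [row]

/-- The subalgebra generated by the chords with end points between `h` and `n`. -/
def rowCoeff (K : Type*) {A : Type*} [Field K] [Ring A] [Algebra K A] (n : ℕ) (C : ℕ → ℕ → A)
    (h : ℕ) : Subalgebra K A :=
  Algebra.adjoin K {s | ∃ x y, h ≤ x ∧ x ≤ n ∧ h ≤ y ∧ y ≤ n ∧ s = C x y}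

theorem chord_mem_rowCoeff {h x y : ℕ} (hx : h ≤ x) (hxn : x ≤ n) (hy : h ≤ y) (hyn : y ≤ n) :
    C x y ∈ rowCoeff K n C h := Algebra.subset_adjoin ⟨x, y, hx, hxn, hy, hyn, rfl⟩

theorem rowCoeff_anti {t h : ℕ} (hth : t ≤ h) : rowCoeff K n C h ≤ rowCoeff K n C t :=
  Algebra.adjoin_mono fun _ ⟨x, y, hx, hxn, hy, hyn, e⟩ =>
    ⟨x, y, hth.trans hx, hxn, hth.trans hy, hyn, e⟩

theorem ChordComm.commute_rowCoeff (hC : ChordComm n C) {h x y : ℕ} (hx : x ≤ h) (hy : y ≤ h)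
    {r : A} (hr : r ∈ rowCoeff K n C h) : Commute (C x y) r := by
  have : rowCoeff K n C h ≤ Subalgebra.centralizer K {C x y} := by
    refine Algebra.adjoin_le ?_
    rintro _ ⟨s, t, hs, hsn, ht, htn, rfl⟩
    rw [SetLike.mem_coe, Subalgebra.mem_centralizer_iff]
    rintro _ rfl
    have key : ∀ x y s t, x ≤ y → s ≤ t → x ≤ h → y ≤ h → h ≤ s → s ≤ n → h ≤ t → t ≤ n →
        C x y * C s t = C s t * C x y := fun x y s t hxy hst _ _ _ _ _ _ =>
      (hC.commute (Or.inl ⟨hxy, by omega, hst⟩) (by omega) (by omega) (by omega) (by omega)).eq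
    rcases le_total x y with h1 | h1 <;> rcases le_total s t with h2 | h2
    · exact key x y s t h1 h2 hx hy hs hsn ht htn
    · rw [hC.symm s t]; exact key x y t s h1 h2 hx hy ht htn hs hsn
    · rw [hC.symm x y]; exact key y x s t h1 h2 hy hx hs hsn ht htn
    · rw [hC.symm s t, hC.symm x y]; exact key y x t s h1 h2 hy hx ht htn hs hsn
  exact Subalgebra.mem_centralizer_iff K |>.mp (this hr) _ rfl

/-- The rows that are combinations, on the vertices up to `h`, of the chords to the vertices
between `h` and `n`. -/
inductive RowSpan (K : Type*) {A : Type*} [Field K] [Ring A] [Algebra K A] (n : ℕ)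
    (C : ℕ → ℕ → A) (h : ℕ) : (ℕ → A) → Prop
  | chord (d : ℕ) (hd : h ≤ d) (hdn : d ≤ n) : RowSpan K n C h fun x => C x d
  | add {F G : ℕ → A} : RowSpan K n C h F → RowSpan K n C h G → RowSpan K n C h fun x => F x + G x
  | smul (k : K) {F : ℕ → A} : RowSpan K n C h F → RowSpan K n C h fun x => k • F x
  | mul_left {r : A} {F : ℕ → A} : r ∈ rowCoeff K n C h → RowSpan K n C h F →
      RowSpan K n C h fun x => r * F x
  | mul_right {r : A} {F : ℕ → A} : r ∈ rowCoeff K n C h → RowSpan K n C h F →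
      RowSpan K n C h fun x => F x * r
  | congr {F G : ℕ → A} : (∀ x, x ≤ h → F x = G x) → RowSpan K n C h F → RowSpan K n C h G

theorem RowSpan.sub {h : ℕ} {F G : ℕ → A} (hF : RowSpan K n C h F) (hG : RowSpan K n C h G) :
    RowSpan K n C h fun x => F x - G x :=
  .congr (fun x _ => by rw [neg_one_smul, sub_eq_add_neg]) (hF.add (hG.smul (-1)))

theorem RowSpan.mono {t h : ℕ} (hth : t ≤ h) {F : ℕ → A} (hF : RowSpan K n C h F) :
    RowSpan K n C t F := by
  induction hF with
  | chord d hd hdn => exact .chord d (hth.trans hd) hdn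
  | add _ _ h1 h2 => exact .add h1 h2
  | smul k _ h1 => exact .smul k h1
  | mul_left hr _ h1 => exact .mul_left (rowCoeff_anti hth hr) h1
  | mul_right hr _ h1 => exact .mul_right (rowCoeff_anti hth hr) h1
  | congr hFG _ h1 => exact .congr (fun x hx => hFG x (hx.trans hth)) h1

/-- Functionals on the rows that commute with the coefficients. -/
structure RowLinear (K : Type*) {A : Type*} [Field K] [Ring A] [Algebra K A] (n : ℕ)
    (C : ℕ → ℕ → A) (h : ℕ) (Φ : (ℕ → A) → A) : Prop where
  congr : ∀ F G, (∀ x, x ≤ h → F x = G x) → Φ F = Φ G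
  add : ∀ F G, Φ (fun x => F x + G x) = Φ F + Φ G
  smul : ∀ (k : K) F, Φ (fun x => k • F x) = k • Φ F
  mul_left : ∀ r ∈ rowCoeff K n C h, ∀ F, Φ (fun x => r * F x) = r * Φ F
  mul_right : ∀ r ∈ rowCoeff K n C h, ∀ F, Φ (fun x => F x * r) = Φ F * r

namespace RowLinear

variable {h : ℕ} {Φ Φ₁ Φ₂ Φ₃ : (ℕ → A) → A}

/-- A functional that is compatible with the coefficients is determined by its values on single
chords. This reduces identities for arbitrary subsets to pentagon relations. -/
theorem ext (h₁ : RowLinear K n C h Φ₁) (h₂ : RowLinear K n C h Φ₂)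
    (H : ∀ d, h ≤ d → d ≤ n → Φ₁ (fun x => C x d) = Φ₂ fun x => C x d) {F : ℕ → A}
    (hF : RowSpan K n C h F) : Φ₁ F = Φ₂ F := by
  induction hF with
  | chord d hd hdn => exact H d hd hdn
  | add _ _ e1 e2 => rw [h₁.add, h₂.add, e1, e2]
  | smul k _ e1 => rw [h₁.smul, h₂.smul, e1]
  | mul_left hr _ e1 => rw [h₁.mul_left _ hr, h₂.mul_left _ hr, e1]
  | mul_right hr _ e1 => rw [h₁.mul_right _ hr, h₂.mul_right _ hr, e1]
  | congr hFG _ e1 => rw [← h₁.congr _ _ hFG, ← h₂.congr _ _ hFG, e1]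

theorem eval {x : ℕ} (hx : x ≤ h) : RowLinear K n C h fun F => F x :=
  ⟨fun _ _ H => H x hx, fun _ _ => rfl, fun _ _ => rfl, fun _ _ _ => rfl, fun _ _ _ => rfl⟩

theorem crossing {c c₁ c₂ : A} (hc : ∀ r ∈ rowCoeff K n C h, Commute c r)
    (hc₁ : ∀ r ∈ rowCoeff K n C h, Commute c₁ r) (hc₂ : ∀ r ∈ rowCoeff K n C h, Commute c₂ r)
    (h₁ : RowLinear K n C h Φ₁) (h₂ : RowLinear K n C h Φ₂) (h₃ : RowLinear K n C h Φ₃) :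
    RowLinear K n C h fun F => crossing p c (Φ₁ F) (c₁ * Φ₂ F + c₂ * Φ₃ F) := by
  constructor
  · intro F G H
    simp only [h₁.congr F G H, h₂.congr F G H, h₃.congr F G H]
  · intro F G
    simp only [h₁.add, h₂.add, h₃.add, _root_.crossing, mul_add, add_mul]
    module
  · intro k F
    simp only [h₁.smul, h₂.smul, h₃.smul, _root_.crossing, mul_smul_comm, smul_mul_assoc]
    module
  · intro r hr F
    simp only [h₁.mul_left r hr, h₂.mul_left r hr, h₃.mul_left r hr, _root_.crossing]
    simp only [← mul_assoc, (hc r hr).eq, (hc₁ r hr).eq, (hc₂ r hr).eq]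
    simp only [mul_sub, mul_add, mul_smul_comm, mul_assoc]
  · intro r hr F
    simp only [h₁.mul_right r hr, h₂.mul_right r hr, h₃.mul_right r hr, _root_.crossing]
    simp only [sub_mul, add_mul, smul_mul_assoc, mul_assoc, (hc r hr).eq]

theorem resolve (hC : ChordComm n C) {t x s : ℕ} (hx : x ≤ h) (ht : t ≤ h) (hs : s ≤ h) :
    RowLinear K n C h fun F => resolve p C t s F x :=
  crossing (fun _ hr => hC.commute_rowCoeff hx hs hr) (fun _ hr => hC.commute_rowCoeff hx ht hr)
    (fun _ hr => hC.commute_rowCoeff ht hs hr) (eval ht) (eval hs) (eval hx)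

theorem map (e : A →ₐ[K] A) (he : ∀ r ∈ rowCoeff K n C h, e r = r) (hΦ : RowLinear K n C h Φ) :
    RowLinear K n C h fun F => e (Φ F) where
  congr F G H := by rw [hΦ.congr F G H]
  add F G := by rw [hΦ.add, map_add]
  smul k F := by rw [hΦ.smul, map_smul]
  mul_left r hr F := by rw [hΦ.mul_left r hr, map_mul, he r hr]
  mul_right r hr F := by rw [hΦ.mul_right r hr, map_mul, he r hr]

end RowLinear

theorem RowSpan.resolve (hC : ChordComm n C) {t h : ℕ} (hth : t ≤ h) (hn : h ≤ n) {F : ℕ → A}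
    (hF : RowSpan K n C h F) : RowSpan K n C t (resolve p C t h F) := by
  have L := fun x (hx : x ≤ t) =>
    RowLinear.resolve (p := p) hC (hx.trans hth) hth le_rfl
  have low : ∀ {r}, r ∈ rowCoeff K n C h → r ∈ rowCoeff K n C t := fun hr => rowCoeff_anti hth hr
  induction hF with
  | chord d hd hdn =>
    refine .sub (.add (.mul_right (F := fun x => C x t) ?_ (.chord t le_rfl (by omega)))
      (.mul_left ?_ (.chord d (by omega) hdn)))
      (.smul _ (.sub (.smul _ (.mul_right (F := fun x => C x h) ?_ (.chord h hth hn)))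
        (.mul_left ?_ (.chord h hth hn)))) <;>
    exact chord_mem_rowCoeff (by omega) (by omega) (by omega) (by omega)
  | add _ _ h1 h2 => exact .congr (fun x hx => ((L x hx).add _ _).symm) (h1.add h2)
  | smul k _ h1 => exact .congr (fun x hx => ((L x hx).smul k _).symm) (h1.smul k)
  | mul_left hr _ h1 =>
    exact .congr (fun x hx => ((L x hx).mul_left _ hr _).symm) (h1.mul_left (low hr))
  | mul_right hr _ h1 =>
    exact .congr (fun x hx => ((L x hx).mul_right _ hr _).symm) (h1.mul_right (low hr))
  | congr hFG _ h1 => exact .congr (fun x hx => (L x hx).congr _ _ hFG) h1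

theorem RowSpan.commute (hC : ChordComm n C) {x t h : ℕ} (hx : x ≤ t) (ht : t ≤ h) (hn : h ≤ n)
    {F : ℕ → A} (hF : RowSpan K n C h F) : Commute (C x t) (F t) := by
  induction hF with
  | chord d hd hdn =>
    exact hC.commute (Or.inl ⟨hx, le_rfl, by omega⟩) (by omega) (by omega) (by omega) hdn
  | add _ _ h1 h2 => exact h1.add_right h2
  | smul k _ h1 => exact h1.smul_right k
  | mul_left hr _ h1 => exact (hC.commute_rowCoeff (hx.trans ht) ht hr).mul_right h1
  | mul_right hr _ h1 => exact h1.mul_right (hC.commute_rowCoeff (hx.trans ht) ht hr)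
  | congr hFG _ h1 => rwa [← hFG t ht]

/-- A hole of length zero changes nothing, because the two factors of the q-commutator commute. -/
theorem resolve_self_right (hC : ChordComm n C) (hp : p - 1 ≠ 0) {x t h : ℕ} (hx : x ≤ t)
    (ht : t ≤ h) (hn : h ≤ n) {F : ℕ → A} (hF : RowSpan K n C h F) : resolve p C t t F x = F x := by
  rw [resolve, hC.diag, one_mul]
  exact crossing_of_commute hp (hF.commute hC hx ht hn).eq _

theorem resolve_self_left (hC : ChordComm n C) (hp : p - 1 ≠ 0) {t s h : ℕ} (hts : t ≤ s)
    (hs : s ≤ h) (hn : h ≤ n) {F : ℕ → A} (hF : RowSpan K n C h F) :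
    resolve p C t s F t = F s := by
  have h1 : Commute (C t s) (F t) := by
    induction hF with
    | chord d hd hdn =>
      change Commute (C t s) (C t d)
      rw [hC.symm t d]
      exact (hC.commute (a := d) (b := t) (c := t) (d := s) (Or.inr (Or.inl (by omega))) hdn
        (by omega) (by omega) (by omega)).symm
    | add _ _ h1 h2 => exact h1.add_right h2
    | smul k _ h1 => exact h1.smul_right k
    | mul_left hr _ h1 => exact (hC.commute_rowCoeff (hts.trans hs) hs hr).mul_right h1
    | mul_right hr _ h1 => exact h1.mul_right (hC.commute_rowCoeff (hts.trans hs) hs hr)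
    | congr hFG _ h1 => rwa [← hFG t (by omega)]
  rw [resolve, hC.diag, one_mul, add_comm]
  exact crossing_of_commute hp h1.eq _

namespace ChordSystem

variable {u o v : ℕ}

/-- Two successive resolutions. -/
theorem resolve_resolve (S : ChordSystem p n C) {x t s h : ℕ} (hx : x ≤ t) (hts : t ≤ s) (hsh : s ≤ h)
    (hn : h ≤ n) {F : ℕ → A} (hF : RowSpan K n C h F) :
    resolve p C t s (resolve p C s h F) x = resolve p C t h F x := by
  have hC := S.toChordComm
  refine RowLinear.ext (Φ₁ := fun F => resolve p C t s (resolve p C s h F) x)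
    (Φ₂ := fun F => resolve p C t h F x) ?_
    (RowLinear.resolve hC (by omega) (by omega) le_rfl) ?_ hF
  · exact RowLinear.crossing (fun _ hr => hC.commute_rowCoeff (by omega) (by omega) hr)
      (fun _ hr => hC.commute_rowCoeff (by omega) (by omega) hr)
      (fun _ hr => hC.commute_rowCoeff (by omega) (by omega) hr)
      (RowLinear.resolve hC (by omega) (by omega) le_rfl)
      (RowLinear.resolve hC (by omega) (by omega) le_rfl)
      (RowLinear.resolve hC (by omega) (by omega) le_rfl)
  · intro d hd hdn
    -- On a single chord the claim is the relation `rb` of the pentagon `d, x, t, s, h`.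
    have H : Cyc5 d x t s h := Or.inr (Or.inl (by omega))
    have rb := S.triRel_rb H hdn (by omega) (by omega) (by omega) hn
    rw [← S.chordCrossing_rotate (Or.inl (by omega)) (by omega) (by omega) hn hdn,
      ← S.chordCrossing_rotate (Or.inl (by omega)) (by omega) (by omega) hn hdn,
      _root_.triRel_iff S.sub_ne] at rb
    change crossing p (C x s) (chordCrossing p C t s h d)
      (C x t * resolve p C s h (fun x => C x d) s + C t s * chordCrossing p C x s h d) =
        chordCrossing p C x t h d
    rw [resolve_self_left hC S.sub_ne hsh le_rfl hn (.chord d hd hdn), rb]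

/-- The effect of a half twist on a resolution. -/
theorem map_resolve (S : ChordSystem p n C) (H : PolygonCorner n u o v) (hu : u + 1 = o)
    (e : A →ₐ[K] A) (he : ∀ x y, x ≤ n → y ≤ n → e (C x y) = twist p C u o v x y) {x : ℕ} (hx : x ≤ u)
    {F : ℕ → A} (hF : RowSpan K n C v F) : e (resolve p C u o F x) = resolve p C o v F x := by
  have hC := S.toChordComm
  obtain ⟨hv, hon, -⟩ := id H
  have hvn : v ≤ n := by omega
  -- The coefficients involve only vertices from `v` on, hence no chord at the twisted vertex `o <
  -- v`.
  have fix : ∀ r ∈ rowCoeff K n C v, e r = r := by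
    intro r hr
    refine Algebra.adjoin_induction (p := fun r _ => e r = r) ?_ ?_ ?_ ?_ hr
    · rintro _ ⟨x, y, hx, hxn, hy, hyn, rfl⟩
      rw [he x y hxn hyn, twist_of_ne (by omega) (by omega)]
    · exact fun k => e.commutes k
    · intro x y _ _ h1 h2; rw [map_add, h1, h2]
    · intro x y _ _ h1 h2; rw [map_mul, h1, h2]
  refine RowLinear.ext (Φ₁ := fun F => e (resolve p C u o F x))
    (Φ₂ := fun F => resolve p C o v F x) (RowLinear.map e fix
      (RowLinear.resolve hC (by omega) (by omega) (by omega)))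
    (RowLinear.resolve hC (by omega) (by omega) le_rfl) ?_ hF
  intro d hd hdn
  have H5 : Cyc5 v d x u o := Or.inr (Or.inr (Or.inl (by omega)))
  -- On a single chord the claim is `vb` for the pentagon `v, d, x, u, o`.
  have vb := S.triRel_vb H5 hvn hdn (by omega) (by omega) (by omega)
  rw [S.chordCrossing_rotate (Or.inr (Or.inr (Or.inl (by omega)))) hvn hdn (by omega) (by omega),
    _root_.triRel_iff S.sub_ne, S.symm d u, add_comm,
    (S.commute (a := d) (b := x) (c := o) (d := v) (Or.inr (Or.inl (by omega)))
      hdn (by omega) (by omega) hvn).eq, S.symm d x] at vb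
  change e (chordCrossing p C x u o d) = chordCrossing p C x o v d
  rw [vb, map_chordCrossing, chordCrossing, he _ _ (by omega) (by omega), he _ _ (by omega) (by omega),
    he _ _ (by omega) (by omega), he _ _ (by omega) (by omega), he _ _ (by omega) (by omega),
    he _ _ (by omega) (by omega), twist_right (by omega), twist_of_ne (by omega) (by omega),
    twist_of_ne (by omega) (by omega), twist_left (by omega), twist_right (by omega),
    twist_of_ne (by omega) (by omega), S.chordCrossing_corner_left H]

end ChordSystem

end Rows

/-! ### Rows of increasing lists and their images under a half twist -/

section RowLists

variable {K A : Type*} [Field K] [Ring A] [Algebra K A] {p : K} {n : ℕ} {C : ℕ → ℕ → A}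

theorem resolve_congr {t h x : ℕ} {F G : ℕ → A} (ht : F t = G t) (hh : F h = G h) (hx : F x = G x) :
    resolve p C t h F x = resolve p C t h G x := by
  rw [resolve, resolve, ht, hh, hx]

theorem map_resolve_eq (e : A →ₐ[K] A) {t h x : ℕ} {F G : ℕ → A} (ht : e (F t) = G t)
    (hh : e (F h) = G h) (hx : e (F x) = G x) (h1 : e (C x h) = C x h) (h2 : e (C x t) = C x t)
    (h3 : e (C t h) = C t h) : e (resolve p C t h F x) = resolve p C t h G x := by
  simp only [resolve, map_crossing, map_add, map_mul, ht, hh, hx, h1, h2, h3]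

/-- Increasing lists of integers between `1` and `n`. -/
def IncList (n : ℕ) (L : List ℕ) : Prop := L.Pairwise (· < ·) ∧ ∀ s ∈ L, 1 ≤ s ∧ s ≤ n

theorem incList_cons {t : ℕ} {L : List ℕ} :
    IncList n (t :: L) ↔ (1 ≤ t ∧ t ≤ n) ∧ (∀ s ∈ L, t < s) ∧ IncList n L := by
  simp only [IncList, List.pairwise_cons, List.forall_mem_cons]
  tauto

theorem incList_append {L M : List ℕ} :
    IncList n (L ++ M) ↔ IncList n L ∧ IncList n M ∧ ∀ s ∈ L, ∀ t ∈ M, s < t := by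
  simp only [IncList, List.pairwise_append, List.forall_mem_append]
  tauto

theorem incList_range' {t k : ℕ} (ht : 1 ≤ t) (hn : t + k ≤ n + 1) :
    IncList n (List.range' t k) := by
  refine ⟨List.pairwise_lt_range', fun s hs => ?_⟩
  rw [List.mem_range'_1] at hs
  omega

theorem rowSpan_row (hC : ChordComm n C) : ∀ (L : List ℕ) (t : ℕ), IncList n (t :: L) →
    RowSpan K n C t (row p C (t :: L))
  | [], t, h => by
    rw [row_single]
    exact .chord t le_rfl (incList_cons.mp h).1.2
  | s :: L, t, h => by
    obtain ⟨h1, h2, h3⟩ := incList_cons.mp h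
    have hs := (incList_cons.mp h3).1
    have hts := h2 s (by simp)
    rw [row_cons_cons]
    exact RowSpan.resolve hC (by omega) (by omega) ((rowSpan_row hC L s h3).mono (by omega))

/-- Between consecutive integers the hole is empty, so of a run of consecutive integers only the
last one matters. -/
theorem row_run (hC : ChordComm n C) (hp : p - 1 ≠ 0) (L : List ℕ) : ∀ (k t x : ℕ), x ≤ t → 1 ≤ t →
    IncList n ((t + k) :: L) → row p C (List.range' t (k + 1) ++ L) x = row p C ((t + k) :: L) x
  | 0, t, x, hx, ht, h => rfl
  | k + 1, t, x, hx, ht, h => by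
    have e1 : t + (k + 1) = t + 1 + k := by omega
    rw [e1] at h ⊢
    have ih := fun y (hy : y ≤ t + 1) => row_run hC hp L k (t + 1) y hy (by omega) h
    have e2 : List.range' t (k + 1 + 1) ++ L =
        t :: (t + 1) :: (List.range' (t + 1 + 1) k ++ L) := rfl
    rw [e2, row_cons_cons, Nat.add_sub_cancel]
    exact (resolve_congr (ih t (by omega)) (ih t (by omega)) (ih x (by omega))).trans
      (resolve_self_right hC hp hx (by omega) (incList_cons.mp h).1.2 (rowSpan_row hC L _ h))

section Map

variable {u o v : ℕ} {e : A →ₐ[K] A}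

/-- The chords in a row end at members `s` of the list and at the right ends `s - 1` of the holes.
This is why the tail must avoid both `o` and `o + 1`, while the first member has only to avoid `o`.
-/
theorem map_row (he : ∀ x y, x ≤ n → y ≤ n → e (C x y) = twist p C u o v x y) :
    ∀ (L : List ℕ) (t x : ℕ), IncList n (t :: L) → (t ≠ o) → (∀ s ∈ L, s ≠ o ∧ s ≠ o + 1) →
      x ≠ o → x ≤ n → e (row p C (t :: L) x) = row p C (t :: L) x
  | [], t, x, h, ht, hL, hx, hxn => by
    rw [row_single]
    change e (C x t) = C x t
    rw [he x t hxn (incList_cons.mp h).1.2, twist_of_ne hx ht]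
  | s :: L, t, x, h, ht, hL, hx, hxn => by
    obtain ⟨h1, h2, h3⟩ := incList_cons.mp h
    have hs := (incList_cons.mp h3).1
    have hso := hL s (by simp)
    have ih := fun y (hy : y ≠ o) (hyn : y ≤ n) => map_row he L s y h3 hso.1
      (fun r hr => hL r (by simp [hr])) hy hyn
    rw [row_cons_cons]
    refine map_resolve_eq e (ih t ht h1.2) (ih _ (by omega) (by omega)) (ih x hx hxn) ?_ ?_ ?_
    · rw [he _ _ hxn (by omega), twist_of_ne hx (by omega)]
    · rw [he _ _ hxn (by omega), twist_of_ne hx (by omega)]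
    · rw [he _ _ h1.2 (by omega), twist_of_ne ht (by omega)]

/-- Members of the list below the twisted pair contribute only chords that the half twist fixes, so
the claim for the tails is enough. -/
theorem map_row_append (he : ∀ x y, x ≤ n → y ≤ n → e (C x y) = twist p C u o v x y) (hu : u + 1 = o)
    (hun : u ≤ n) {M N : List ℕ}
    (hMN : ∀ a x, x ≤ a → a ≤ u → e (row p C (a :: M) x) = row p C (a :: N) x) :
    ∀ (L : List ℕ) (t x : ℕ), IncList n (t :: L) → (∀ s ∈ t :: L, s ≤ u) → x ≤ t →
      e (row p C (t :: L ++ M) x) = row p C (t :: L ++ N) x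
  | [], t, x, h, hL, hx => hMN t x hx (hL t (by simp))
  | s :: L, t, x, h, hL, hx => by
    obtain ⟨h1, h2, h3⟩ := incList_cons.mp h
    have hts := h2 s (by simp)
    have hsu := hL s (by simp)
    have ih := fun y (hy : y ≤ s) => map_row_append he hu hun hMN L s y h3
      (fun r hr => hL r (by rw [List.mem_cons]; exact Or.inr hr)) hy
    have fix : ∀ y z, y ≤ u → z ≤ u → e (C y z) = C y z := fun y z hy hz => by
      rw [he _ _ (by omega) (by omega), twist_of_ne (by omega) (by omega)]
    simp only [List.cons_append] at ih ⊢
    rw [row_cons_cons, row_cons_cons]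
    exact map_resolve_eq e (ih t (by omega)) (ih _ (by omega)) (ih x (by omega))
      (fix _ _ (by omega) (by omega)) (fix _ _ (by omega) (by omega)) (fix _ _ (by omega) (by omega))

namespace ChordSystem

/-- The interval that ends at `o` is obtained from the one that ends at `o + 1` by making `o + 1`
part of the hole. -/
theorem row_eq_resolve (S : ChordSystem p n C) {B : List ℕ} (hB : IncList n ((o + 1) :: B))
    {x : ℕ} (hx : x ≤ o) :
    row p C (o :: B) x = resolve p C o (o + 1) (row p C ((o + 1) :: B)) x := by
  obtain ⟨h1, h2, h3⟩ := incList_cons.mp hB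
  match B with
  | [] =>
    rw [row_single, row_single]
    change C x o = crossing p (C x (o + 1)) (C o (o + 1)) (C x o * C (o + 1) (o + 1) +
      C o (o + 1) * C x (o + 1))
    have h4 : Commute (C x (o + 1)) (C o (o + 1)) := by
      rw [S.symm x]
      exact S.commute (Or.inr (Or.inl (by omega))) h1.2 (by omega) (by omega) h1.2
    rw [S.diag, mul_one, add_comm (C x o), ← h4.eq]
    exact (crossing_of_commute S.sub_ne h4.eq _).symm
  | b :: B =>
    have hb := (incList_cons.mp h3).1
    have hob := h2 b (by simp)
    rw [row_cons_cons, row_cons_cons]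
    exact (S.resolve_resolve hx (by omega) (by omega) (by omega)
      ((rowSpan_row S.toChordComm B b h3).mono (by omega))).symm

theorem map_row_cons (S : ChordSystem p n C) (H : PolygonCorner n u o v) (hu : u + 1 = o)
    (he : ∀ x y, x ≤ n → y ≤ n → e (C x y) = twist p C u o v x y) {B : List ℕ}
    (hB : IncList n ((o + 1) :: B)) {a x : ℕ} (hx : x ≤ a) (ha : a ≤ u) :
    e (row p C (a :: (o + 1) :: B) x) = row p C (a :: o :: B) x := by
  obtain ⟨hv, hon, -⟩ := id H
  have hR := rowSpan_row (p := p) S.toChordComm B (o + 1) hB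
  have fix : ∀ y z, y ≤ u → z ≤ u → e (C y z) = C y z := fun y z hy hz => by
    rw [he _ _ (by omega) (by omega), twist_of_ne (by omega) (by omega)]
  rw [row_cons_cons, row_cons_cons, Nat.add_sub_cancel, show o - 1 = u by omega,
    ← S.resolve_resolve (s := u) hx ha (by omega) (by omega) (hR.mono (by omega))]
  have key : ∀ y, y ≤ u → e (resolve p C u o (row p C ((o + 1) :: B)) y) = row p C (o :: B) y := by
    intro y hy
    rw [S.map_resolve H hu e he hy (hv ▸ hR), S.row_eq_resolve hB (by omega), hv]
  exact map_resolve_eq e (key _ (by omega)) (key _ le_rfl) (key _ (by omega))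
    (fix _ _ (by omega) (by omega)) (fix _ _ (by omega) (by omega)) (fix _ _ (by omega) (by omega))

theorem map_row_start (S : ChordSystem p n C) (H : PolygonCorner n u o v) (hu : u + 1 = o)
    (he : ∀ x y, x ≤ n → y ≤ n → e (C x y) = twist p C u o v x y) {B : List ℕ}
    (hB : IncList n ((o + 1) :: B)) :
    e (row p C ((o + 1) :: B) o) = row p C (o :: B) u := by
  obtain ⟨hv, hon, -⟩ := id H
  subst hv
  have hR := rowSpan_row (p := p) S.toChordComm B (o + 1) hB
  have key := S.map_resolve H hu e he le_rfl hR
  rw [resolve_self_left S.toChordComm S.sub_ne (by omega) (h := o) le_rfl (by omega)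
      (hR.mono (by omega))] at key
  rw [key, S.row_eq_resolve hB (by omega)]

end ChordSystem

end Map

end RowLists

/-! ### The elements `C_S` as rows and the action of the half twists on them -/

section Sets

variable {K : Type*} [Field K] {q : K} {n : ℕ}

/-- The recursion of `awSeq` at the first hole is the recursion of `row`; a merge of adjacent sets
is a resolution with an empty hole. -/
theorem awSeq_singles (S : ChordSystem (q ^ 2) n (awChord q n)) (hq0 : q ≠ 0) :
    ∀ (L : List ℕ) (t x : ℕ), x < t → IncList n (t :: L) →
      awSeq q (awC q n) (Finset.Ioc x t :: L.map fun i => {i}) = row (q ^ 2) (awChord q n) (t :: L) x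
  | [], t, x, hx, _ => by
    rw [List.map_nil, awSeq_single, awC_Ioc hx.le, row_single]
  | s :: L, t, x, hx, h => by
    obtain ⟨h1, h2, h3⟩ := incList_cons.mp h
    have hs := (incList_cons.mp h3).1
    have hts := h2 s (by simp)
    have e1 : ({s} : Finset ℕ) = Finset.Ioc (s - 1) s := by
      ext y; simp only [Finset.mem_singleton, Finset.mem_Ioc]; omega
    have hh : awHole (Finset.Ioc x t) {s} = Finset.Ioc t (s - 1) := by
      rw [e1]; exact awHole_Ioc hx (by omega) (by omega)
    have ih := fun y (hy : y < s) => awSeq_singles S hq0 L s y hy h3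
    rw [List.map_cons]
    by_cases hc : t + 1 = s
    · rw [awSeq_cons_of_empty _ _ (by rw [hh, Finset.Ioc_eq_empty (by omega)]), e1,
        show s - 1 = t by omega, Ioc_union_Ioc hx.le (by omega), ih x (by omega)]
      rw [row_cons_cons, show s - 1 = t by omega]
      exact (resolve_self_right S.toChordComm S.sub_ne hx.le hts.le hs.2
        (rowSpan_row S.toChordComm L s h3)).symm
    · rw [awSeq_cons_of_ne hq0 _ _ (by
          rw [hh, ← Finset.nonempty_iff_ne_empty, Finset.nonempty_Ioc]; omega), hh, e1,
        Ioc_union_Ioc hx.le (by omega), Ioc_union_Ioc (by omega) (by omega),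
        Ioc_union_Ioc (by omega) (by omega), ih _ (by omega), ih _ (by omega), ih _ (by omega),
        awC_Ioc (by omega), awC_Ioc hx.le, awC_Ioc (by omega), row_cons_cons, resolve]

theorem awCinc_toFinset (S : ChordSystem (q ^ 2) n (awChord q n)) (hq0 : q ≠ 0) {t : ℕ} {L : List ℕ}
    (h : IncList n (t :: L)) :
    awCinc q n (t :: L).toFinset = row (q ^ 2) (awChord q n) (t :: L) (t - 1) := by
  have h1 : ((t :: L).toFinset.sort (· ≤ ·)) = t :: L :=
    (List.toFinset_sort _ (h.1.imp (fun h => h.ne))).mpr (h.1.imp fun h => h.le)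
  have h0 := (incList_cons.mp h).1
  rw [awCinc, h1, List.map_cons, ← awSeq_singles S hq0 L t (t - 1) (by omega) h]
  congr 2
  ext y; simp only [Finset.mem_singleton, Finset.mem_Ioc]; omega

theorem awCinc_empty : awCinc q n ∅ = 1 := by
  rw [awCinc, Finset.sort_empty, List.map_nil, awSeq]

theorem incList_sort {T : Finset ℕ} (hT : T ⊆ Finset.Icc 1 n) : IncList n (T.sort (· ≤ ·)) :=
  ⟨(Finset.sortedLT_sort T).pairwise, fun _ hs =>
    Finset.mem_Icc.mp (hT ((Finset.mem_sort _).mp hs))⟩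

theorem awCinc_Ioc (S : ChordSystem (q ^ 2) n (awChord q n)) (hq0 : q ≠ 0) {a b : ℕ} (hab : a ≤ b)
    (hb : b ≤ n) : awCinc q n (Finset.Ioc a b) = awChord q n a b := by
  rcases hab.eq_or_lt with rfl | hab
  · rw [Finset.Ioc_self, awCinc_empty, awChord_self]
  have e1 : Finset.Ioc a b = (List.range' (a + 1) (b - a - 1 + 1) ++ []).toFinset := by
    ext y; simp only [Finset.mem_Ioc, List.append_nil, List.mem_toFinset, List.mem_range'_1]; omega
  have h2 : IncList n (List.range' (a + 1) (b - a - 1 + 1)) := incList_range' (by omega) (by omega)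
  have h3 := row_run (p := q ^ 2) S.toChordComm S.sub_ne [] (b - a - 1) (a + 1) a (by omega) (by omega)
    (incList_cons.mpr ⟨by omega, by simp, by simp [IncList]⟩)
  rw [e1]
  rw [List.append_nil] at h3 ⊢
  rw [List.range'_succ] at h2 h3 ⊢
  rw [awCinc_toFinset S hq0 h2, Nat.add_sub_cancel, h3, row_single, show a + 1 + (b - a - 1) = b by omega]

theorem awCinc_Ioc_union (S : ChordSystem (q ^ 2) n (awChord q n)) (hq0 : q ≠ 0) {a b c d : ℕ}
    (hab : a < b) (hbc : b ≤ c) (hcd : c < d) (hd : d ≤ n) :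
    awCinc q n (Finset.Ioc a b ∪ Finset.Ioc c d) = chordCrossing (q ^ 2) (awChord q n) a b c d := by
  have e1 : Finset.Ioc a b ∪ Finset.Ioc c d =
      (List.range' (a + 1) (b - a - 1 + 1) ++ List.range' (c + 1) (d - c - 1 + 1)).toFinset := by
    ext y
    simp only [Finset.mem_union, Finset.mem_Ioc, List.mem_toFinset, List.mem_append,
      List.mem_range'_1]
    omega
  have hL : IncList n (List.range' (c + 1) (d - c - 1 + 1)) := incList_range' (by omega) (by omega)
  have hL' : IncList n (List.range' (a + 1) (b - a - 1 + 1) ++ List.range' (c + 1) (d - c - 1 + 1)) := by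
    refine incList_append.mpr ⟨incList_range' (by omega) (by omega), hL, ?_⟩
    intro s hs t ht
    rw [List.mem_range'_1] at hs ht
    omega
  have h3 := row_run (p := q ^ 2) S.toChordComm S.sub_ne (List.range' (c + 1) (d - c - 1 + 1))
    (b - a - 1) (a + 1) a (by omega) (by omega) (incList_cons.mpr ⟨by omega, by
      intro s hs; rw [List.mem_range'_1] at hs; omega, hL⟩)
  have h4 := fun y (hy : y ≤ c + 1) => row_run (p := q ^ 2) S.toChordComm S.sub_ne []
    (d - c - 1) (c + 1) y hy (by omega) (incList_cons.mpr ⟨by omega, by simp, by simp [IncList]⟩)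
  rw [e1]
  rw [List.range'_succ, List.cons_append] at hL' h3 ⊢
  rw [awCinc_toFinset S hq0 hL', Nat.add_sub_cancel, h3]
  rw [List.range'_succ] at h4 ⊢
  rw [row_cons_cons, Nat.add_sub_cancel, show a + 1 + (b - a - 1) = b by omega]
  have e5 : c + 1 + (d - c - 1) = d := by omega
  simp only [List.append_nil, row_single, e5] at h4
  exact resolve_congr (G := fun y => awChord q n y d) (h4 b (by omega)) (h4 c (by omega))
    (h4 a (by omega))

variable {a : ℕ} {e : AW K q n ≃ₐ[K] AW K q n}

theorem half_twist_awCinc_of_notMem (S : ChordSystem (q ^ 2) n (awChord q n)) (hq0 : q ≠ 0)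
    (he : ∀ x y, x ≤ n → y ≤ n → e (awChord q n x y) = awTwist q n a x y) {T : Finset ℕ}
    (hT : T ⊆ Finset.Icc 1 n) (h0 : a ∉ T) (h1 : a + 1 ∉ T) : e (awCinc q n T) = awCinc q n T := by
  have hL := incList_sort hT
  have hm : ∀ s, s ∈ T.sort (· ≤ ·) ↔ s ∈ T := fun s => Finset.mem_sort _
  rw [← T.sort_toFinset (· ≤ ·)]
  match h : T.sort (· ≤ ·) with
  | [] => rw [List.toFinset_nil, awCinc_empty, map_one]
  | t :: L =>
    rw [h] at hL hm
    have hne : ∀ s ∈ t :: L, s ≠ a ∧ s ≠ a + 1 := fun s hs =>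
      ⟨fun h => h0 (h ▸ (hm s).mp hs), fun h => h1 (h ▸ (hm s).mp hs)⟩
    have ht := hne t (by simp)
    have ht1 := (incList_cons.mp hL).1
    rw [awCinc_toFinset S hq0 hL]
    exact map_row (e := e.toAlgHom) he L t (t - 1) hL ht.1 (fun s hs => hne s (by simp [hs]))
      (by omega) (by omega)

/-- The half twist moves the letter `a + 1` down to a free position `a`. A set that contains `a` but
not `a + 1` is excluded: for it the inverse half twist has this effect. -/
theorem half_twist_awCinc (S : ChordSystem (q ^ 2) n (awChord q n)) (hq0 : q ≠ 0) (ha : a < n)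
    (he : ∀ x y, x ≤ n → y ≤ n → e (awChord q n x y) = awTwist q n a x y) (ha1 : 1 ≤ a)
    {T : Finset ℕ} (hT : T ⊆ Finset.Icc 1 n) (h0 : a ∈ T → a + 1 ∈ T) :
    e (awCinc q n T) = awCinc q n (T.image (Equiv.swap a (a + 1))) := by
  have H := polygonCorner ha
  have hu : prevVertex n a + 1 = a := by unfold prevVertex; split_ifs <;> omega
  by_cases hv : a + 1 ∈ T
  swap
  · have hi : T.image (Equiv.swap a (a + 1)) = T := by
      rw [Finset.image_congr (g := id), Finset.image_id]
      intro x hx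
      exact Equiv.swap_apply_of_ne_of_ne (fun h => hv (h0 (h ▸ hx))) (fun h => hv (h ▸ hx))
    rw [hi, half_twist_awCinc_of_notMem S hq0 he hT (fun h => hv (h0 h)) hv]
  set A := (T.filter (· < a)).sort (· ≤ ·) with hA
  set B := (T.filter (a + 1 < ·)).sort (· ≤ ·) with hB
  have lA : IncList n A := incList_sort ((Finset.filter_subset _ _).trans hT)
  have lB : IncList n B := incList_sort ((Finset.filter_subset _ _).trans hT)
  have mA : ∀ s, s ∈ A ↔ s ∈ T ∧ s < a := fun s => by rw [hA, Finset.mem_sort, Finset.mem_filter]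
  have mB : ∀ s, s ∈ B ↔ s ∈ T ∧ a + 1 < s := fun s => by rw [hB, Finset.mem_sort, Finset.mem_filter]
  have lvB : IncList n ((a + 1) :: B) :=
    incList_cons.mpr ⟨by omega, fun s hs => ((mB s).mp hs).2, lB⟩
  have loB : IncList n (a :: B) :=
    incList_cons.mpr ⟨by omega, fun s hs => by have := ((mB s).mp hs).2; omega, lB⟩
  have loM : IncList n (a :: (a + 1) :: B) :=
    incList_cons.mpr ⟨by omega, fun s hs => by
      have := lvB.1; rw [List.mem_cons] at hs
      rcases hs with rfl | hs
      · omega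
      · have := ((mB s).mp hs).2; omega, lvB⟩
  -- reduction to lists
  have main : ∀ M N : List ℕ, IncList n M → IncList n N → M ≠ [] → N ≠ [] → (∀ s ∈ M, a ≤ s) →
      (∀ s ∈ N, a ≤ s) →
      e (row (q ^ 2) (awChord q n) M (M.head! - 1)) = row (q ^ 2) (awChord q n) N (N.head! - 1) →
      (∀ b x, x ≤ b → b ≤ prevVertex n a → e (row (q ^ 2) (awChord q n) (b :: M) x) =
        row (q ^ 2) (awChord q n) (b :: N) x) →
      e (awCinc q n (A ++ M).toFinset) = awCinc q n (A ++ N).toFinset := by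
    intro M N hM hN hM0 hN0 hMa hNa h1 h2
    obtain ⟨m, M, rfl⟩ := List.exists_cons_of_ne_nil hM0
    obtain ⟨k, N, rfl⟩ := List.exists_cons_of_ne_nil hN0
    have lM : IncList n (A ++ m :: M) :=
      incList_append.mpr ⟨lA, hM, fun s hs t ht => ((mA s).mp hs).2.trans_le (hMa t ht)⟩
    have lN : IncList n (A ++ k :: N) :=
      incList_append.mpr ⟨lA, hN, fun s hs t ht => ((mA s).mp hs).2.trans_le (hNa t ht)⟩
    match hA' : A with
    | [] =>
      rw [List.nil_append, List.nil_append, awCinc_toFinset S hq0 hM, awCinc_toFinset S hq0 hN]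
      exact h1
    | t :: L =>
      rw [List.cons_append] at lM lN ⊢
      rw [List.cons_append, awCinc_toFinset S hq0 lM, awCinc_toFinset S hq0 lN]
      exact map_row_append (e := e.toAlgHom) he hu (by omega) h2 L t (t - 1) lA
        (fun s hs => by have := ((mA s).mp hs).2; omega) (by omega)
  by_cases ho : a ∈ T
  · have e1 : T = (A ++ (a :: (a + 1) :: B)).toFinset := by
      ext s
      simp only [List.mem_toFinset, List.mem_append, List.mem_cons, mA, mB]
      constructor
      · intro hs
        rcases lt_trichotomy s a with h | h | h
        · exact Or.inl ⟨hs, h⟩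
        · exact Or.inr (Or.inl h)
        · rcases (Nat.succ_le_of_lt h).eq_or_lt with h | h
          · exact Or.inr (Or.inr (Or.inl h.symm))
          · exact Or.inr (Or.inr (Or.inr ⟨hs, h⟩))
      · rintro (h | rfl | rfl | h)
        exacts [h.1, ho, hv, h.1]
    have hi : T.image (Equiv.swap a (a + 1)) = T := by
      have h1 : T.image (Equiv.swap a (a + 1)) ⊆ T := by
        intro x hx
        obtain ⟨y, hy, rfl⟩ := Finset.mem_image.mp hx
        rw [Equiv.swap_apply_def]
        split_ifs <;> assumption
      exact Finset.eq_of_subset_of_card_le h1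
        (Finset.card_image_of_injective _ (Equiv.injective _)).ge
    -- When both letters are present, the member `a` can be omitted and no chord at the vertex `a`
    -- remains.
    have run : ∀ x, x ≤ a → row (q ^ 2) (awChord q n) (a :: (a + 1) :: B) x =
        row (q ^ 2) (awChord q n) ((a + 1) :: B) x := fun x hx =>
      row_run S.toChordComm S.sub_ne B 1 a x hx ha1 lvB
    have hfix : ∀ x, x < a → e (row (q ^ 2) (awChord q n) (a :: (a + 1) :: B) x) =
        row (q ^ 2) (awChord q n) (a :: (a + 1) :: B) x := by
      intro x hx
      rw [run x hx.le]
      exact map_row (e := e.toAlgHom) he B (a + 1) x lvB (by omega)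
        (fun s hs => by have := ((mB s).mp hs).2; omega) (by omega) (by omega)
    have fix : ∀ y z, y < a → z < a → e (awChord q n y z) = awChord q n y z := fun y z hy hz => by
      rw [he _ _ (by omega) (by omega), awTwist, twist_of_ne (by omega) (by omega)]
    rw [hi, e1]
    refine main _ _ loM loM (by simp) (by simp) (fun s hs => ?_) (fun s hs => ?_) (hfix _ ?_) ?_
    · have := loM.1
      rcases List.mem_cons.mp hs with rfl | hs
      · exact le_rfl
      · exact ((incList_cons.mp loM).2.1 s hs).le
    · rcases List.mem_cons.mp hs with rfl | hs
      · exact le_rfl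
      · exact ((incList_cons.mp loM).2.1 s hs).le
    · rw [List.head!_cons]; omega
    · intro b x hx hb
      rw [row_cons_cons]
      exact map_resolve_eq e.toAlgHom (hfix _ (by omega)) (hfix _ (by omega)) (hfix _ (by omega))
        (fix _ _ (by omega) (by omega)) (fix _ _ (by omega) (by omega)) (fix _ _ (by omega) (by omega))
  · have e1 : T = (A ++ ((a + 1) :: B)).toFinset := by
      ext s
      simp only [List.mem_toFinset, List.mem_append, List.mem_cons, mA, mB]
      constructor
      · intro hs
        rcases lt_trichotomy s a with h | h | h
        · exact Or.inl ⟨hs, h⟩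
        · exact absurd (h ▸ hs) ho
        · rcases (Nat.succ_le_of_lt h).eq_or_lt with h | h
          · exact Or.inr (Or.inl h.symm)
          · exact Or.inr (Or.inr ⟨hs, h⟩)
      · rintro (h | rfl | h)
        exacts [h.1, hv, h.1]
    have e2 : T.image (Equiv.swap a (a + 1)) = (A ++ (a :: B)).toFinset := by
      ext s
      simp only [List.mem_toFinset, List.mem_append, List.mem_cons, mA, mB, Finset.mem_image]
      constructor
      · rintro ⟨y, hy, rfl⟩
        have hya : y ≠ a := fun h => ho (h ▸ hy)
        rw [Equiv.swap_apply_def, if_neg hya]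
        split_ifs with h
        · exact Or.inr (Or.inl rfl)
        · rcases lt_or_gt_of_ne hya with h2 | h2
          · exact Or.inl ⟨hy, h2⟩
          · exact Or.inr (Or.inr ⟨hy, by omega⟩)
      · rintro (h | rfl | h)
        · exact ⟨s, h.1, Equiv.swap_apply_of_ne_of_ne (by omega) (by omega)⟩
        · exact ⟨s + 1, hv, Equiv.swap_apply_right _ _⟩
        · exact ⟨s, h.1, Equiv.swap_apply_of_ne_of_ne (by omega) (by omega)⟩
    rw [e2]
    nth_rewrite 1 [e1]
    refine main _ _ lvB loB (by simp) (by simp) (fun s hs => ?_) (fun s hs => ?_) ?_ ?_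
    · rcases List.mem_cons.mp hs with rfl | hs
      · omega
      · have := ((mB s).mp hs).2; omega
    · rcases List.mem_cons.mp hs with rfl | hs
      · omega
      · have := ((mB s).mp hs).2; omega
    · have := S.map_row_start (e := e.toAlgHom) H hu he lvB
      rw [List.head!_cons, List.head!_cons, Nat.add_sub_cancel, show a - 1 = prevVertex n a by omega]
      exact this
    · intro b x hx hb
      exact S.map_row_cons (e := e.toAlgHom) H hu he lvB hx hb

end Sets

/-! ### Images of Casimir elements under a half twist -/

section ChordTwist

variable {K A : Type*} [Field K] [Ring A] [Algebra K A] {p : K} {n : ℕ} {C : ℕ → ℕ → A}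
  {u o v : ℕ} {e : A →ₐ[K] A}

theorem map_quadCasimir {B : Type*} [Ring B] [Algebra K B] (e : A →ₐ[K] B) (x y z s₁ s₂ s₃ s₄ : A) :
    e (quadCasimir p x y z s₁ s₂ s₃ s₄) =
      quadCasimir p (e x) (e y) (e z) (e s₁) (e s₂) (e s₃) (e s₄) := by
  simp only [quadCasimir, map_add, map_sub, map_mul, map_smul, map_one]

theorem map_chordCasimir (he : ∀ x y, x ≤ n → y ≤ n → e (C x y) = twist p C u o v x y)
    {a b c d : ℕ} (ha : a ≤ n) (hb : b ≤ n) (hc : c ≤ n) (hd : d ≤ n) :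
    e (chordCasimir p C a b c d) = chordCasimir p (twist p C u o v) a b c d := by
  simp only [chordCasimir, chordCrossing, map_quadCasimir, map_crossing, map_add, map_mul, he, ha, hb,
    hc, hd]

theorem chordCasimir_twist_of_ne {a b c d : ℕ} (ha : a ≠ o) (hb : b ≠ o) (hc : c ≠ o) (hd : d ≠ o) :
    chordCasimir p (twist p C u o v) a b c d = chordCasimir p C a b c d := by
  simp only [chordCasimir, chordCrossing_twist_of_ne ha hb hc hd, twist_of_ne, ha, hb, hc, hd, ne_eq,
    not_false_eq_true]

namespace ChordSystem

variable {a b c d : ℕ}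

theorem chordCasimir_rotate_two (h : ChordSystem p n C) (H : Cyc4 a b c d) (ha : a ≤ n) (hb : b ≤ n)
    (hc : c ≤ n) (hd : d ≤ n) : chordCasimir p C c d a b = chordCasimir p C a b c d := by
  rw [h.chordCasimir_rotate H.rotate hb hc hd ha, h.chordCasimir_rotate H ha hb hc hd]

theorem chordCasimir_rotate_three (h : ChordSystem p n C) (H : Cyc4 a b c d) (ha : a ≤ n) (hb : b ≤ n)
    (hc : c ≤ n) (hd : d ≤ n) : chordCasimir p C d a b c = chordCasimir p C a b c d := by
  rw [h.chordCasimir_rotate H.rotate.rotate hc hd ha hb, h.chordCasimir_rotate_two H ha hb hc hd]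

/-- The Casimir element of three intervals with a hole after the first one. -/
def holeLeft (p : K) (C : ℕ → ℕ → A) (a b c d e : ℕ) : A :=
  chordCasimir p C a b c d - chordCasimir p C a b c e + chordCasimir p C a b d e

/-- The Casimir element of three intervals with a hole before the last one. -/
def holeRight (p : K) (C : ℕ → ℕ → A) (a b c d e : ℕ) : A :=
  chordCasimir p C a b d e - chordCasimir p C a c d e + chordCasimir p C b c d e

section

variable (S : ChordSystem p n C) (H : PolygonCorner n u o v)
  (he : ∀ x y, x ≤ n → y ≤ n → e (C x y) = twist p C u o v x y)
include S H he

theorem map_chordCasimir_self (hu : u ≠ o) (hc : c ≠ o) (H4 : Cyc4 u o v c) (hun : u ≤ n)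
    (hcn : c ≤ n) : e (chordCasimir p C u o v c) = chordCasimir p C u o v c := by
  obtain ⟨hv, hon, -⟩ := id H
  rw [map_chordCasimir he hun (by omega) (by omega) hcn,
    S.chordCasimir_twist_self H hu (by omega) hc H4 hun (by omega) (by omega) hcn]

theorem map_chordCasimir_right (hu : u ≠ o) (hao : a ≠ o) (hbo : b ≠ o) (H5 : Cyc5 a b u o v)
    (hun : u ≤ n) (ha : a ≤ n) (hb : b ≤ n) : e (chordCasimir p C a b u o) =
      chordCasimir p C b u o v - chordCasimir p C u o v a + chordCasimir p C o v a b := by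
  obtain ⟨hv, hon, -⟩ := id H
  rw [map_chordCasimir he ha hb hun (by omega),
    S.chordCasimir_twist_right H hu hao hbo H5 hun (by omega) (by omega) ha hb]

theorem map_chordCasimir_left (hao : a ≠ o) (hbo : b ≠ o) (H5 : Cyc5 v a b u o) (hun : u ≤ n)
    (ha : a ≤ n) (hb : b ≤ n) : e (chordCasimir p C v a b o) =
      chordCasimir p C v a u o - chordCasimir p C v b u o + chordCasimir p C a b u o := by
  obtain ⟨hv, hon, -⟩ := id H
  rw [map_chordCasimir he (by omega) ha hb (by omega),
    S.chordCasimir_twist_left H (by omega) hao hbo H5 hun (by omega) (by omega) ha hb]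

/-- Together with the next two lemmas: the half twist moves the one-letter block `(u, o]` to `(o,
v]`, when this block is the first, the middle or the last argument of a Casimir element. -/
theorem map_holeLeft (hu : u + 1 = o) (hvb : v < b) (hbc : b < c) (hc : c ≤ n) :
    e (holeLeft p C u o v b c) = chordCasimir p C o v b c := by
  obtain ⟨hv, hon, -⟩ := id H
  rw [holeLeft, map_add, map_sub, S.map_chordCasimir_self H he (by omega) (by omega) (Or.inl (by omega))
    (by omega) (by omega), S.map_chordCasimir_self H he (by omega) (by omega) (Or.inl (by omega))
    (by omega) (by omega), ← S.chordCasimir_rotate_two (a := u) (b := o) (c := b) (d := c)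
    (Or.inl (by omega)) (by omega) (by omega) (by omega) (by omega),
    S.map_chordCasimir_right H he (by omega) (by omega) (by omega)
      (Or.inr (Or.inr (Or.inl (by omega)))) (by omega) (by omega) (by omega),
    S.chordCasimir_rotate_three (a := u) (b := o) (c := v) (d := c)
    (Or.inl (by omega)) (by omega) (by omega) (by omega) (by omega)]
  abel

theorem map_holeRight (hu : u + 1 = o) (hau : a < u) (hvb : v < b) (hb : b ≤ n) :
    e (holeRight p C a u o v b) = holeLeft p C a u o v b := by
  obtain ⟨hv, hon, -⟩ := id H
  rw [holeRight, holeLeft, map_add, map_sub, S.map_chordCasimir_self H he (by omega) (by omega)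
      (Or.inl (by omega)) (by omega) (by omega),
    map_chordCasimir he (by omega) (by omega) (by omega) hb,
    chordCasimir_twist_of_ne (by omega) (by omega) (by omega) (by omega),
    ← S.chordCasimir_rotate_two (a := a) (b := o) (c := v) (d := b)
    (Or.inl (by omega)) (by omega) (by omega) (by omega) (by omega)]
  rw [S.map_chordCasimir_left H he (by omega) (by omega)
      (Or.inr (Or.inr (Or.inl (by omega)))) (by omega) (by omega) (by omega),
    S.chordCasimir_rotate_two (a := u) (b := o) (c := v) (d := b)
    (Or.inl (by omega)) (by omega) (by omega) (by omega) (by omega),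
    S.chordCasimir_rotate_three (a := a) (b := u) (c := o) (d := v)
    (Or.inl (by omega)) (by omega) (by omega) (by omega) (by omega),
    S.chordCasimir_rotate_three (a := a) (b := u) (c := o) (d := b)
    (Or.inl (by omega)) (by omega) (by omega) (by omega) (by omega)]
  abel

theorem map_chordCasimir_last (hu : u + 1 = o) (hab : a < b) (hbu : b < u) :
    e (chordCasimir p C a b u o) = holeRight p C a b u o v := by
  obtain ⟨hv, hon, -⟩ := id H
  rw [S.map_chordCasimir_right H he (by omega) (by omega) (by omega) (Or.inl (by omega)) (by omega)
    (by omega) (by omega), holeRight, S.chordCasimir_rotate (a := a) (b := u) (c := o) (d := v)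
    (Or.inl (by omega)) (by omega) (by omega) (by omega) (by omega),
    S.chordCasimir_rotate_two (a := a) (b := b) (c := o) (d := v)
    (Or.inl (by omega)) (by omega) (by omega) (by omega) (by omega)]
  abel

end

end ChordSystem

end ChordTwist

/-! ### Casimir elements with an empty block -/

section CommutingCasimir

variable {R A : Type*} [CommRing R] [Ring A] [Algebra R A] {p : R}

/-- If the first, second or third block is empty, the other two pairs of opposite sides and
diagonals coincide, everything commutes, and the terms cancel. -/
theorem quadCasimir_one {x y z : A} (hxy : Commute x y) (hxz : Commute x z) (hyz : Commute y z) :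
    quadCasimir p x y z 1 x z y = 0 ∧ quadCasimir p x y z x 1 y z = 0 ∧
      quadCasimir p x y z z y 1 x = 0 := by
  refine ⟨?_, ?_, ?_⟩
  all_goals
    simp only [quadCasimir, one_mul, mul_one, mul_add, mul_assoc, hxy.eq, hxz.eq, hyz.eq,
      hxy.left_comm, hxz.left_comm, hyz.left_comm]
    module

end CommutingCasimir

/-! ### Casimir elements of sets and of quadrilaterals -/

section SetCasimir

variable {K : Type*} [Field K] {q : K} {n : ℕ}

/-- The factor `q * (q ^ 2 + 1) = q ^ 2 * (q + q⁻¹)` clears all denominators and leaves coefficients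
that are polynomials in `q ^ 2`. -/
theorem smul_awCasimir (hq0 : q ≠ 0) (hq2 : q ^ 2 ≠ -1) (I J L : Finset ℕ) :
    (q * (q ^ 2 + 1)) • awCasimir q n I J L = quadCasimir (q ^ 2) (awCinc q n (I ∪ J))
      (awCinc q n (J ∪ L)) (awCinc q n (I ∪ L)) (awCinc q n I) (awCinc q n J) (awCinc q n L)
      (awCinc q n (I ∪ J ∪ L)) := by
  have h2 : q ^ 2 + 1 ≠ 0 := sq_add_one_ne hq2
  have h3 : q + q⁻¹ = (q ^ 2 + 1) * q⁻¹ := by field_simp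
  simp only [awCasimir, quadCasimir, smul_add, smul_sub, smul_smul, h3, pow_two (awCinc q n _)]
  have e1 : q * (q ^ 2 + 1) * q = q ^ 2 * (q ^ 2 + 1) := by ring
  have e2 : q * (q ^ 2 + 1) * ((q ^ 2 + 1) * q⁻¹)⁻¹ = q ^ 2 := by field_simp
  have e3 : q * (q ^ 2 + 1) * q⁻¹ = q ^ 2 + 1 := by field_simp
  have e4 : q * (q ^ 2 + 1) * ((q ^ 2 + 1) * q⁻¹) = (q ^ 2 + 1) ^ 2 := by field_simp
  have e5 : q ^ 2 * q⁻¹ ^ 2 = 1 := by field_simp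
  have e6 : q * (q ^ 2 + 1) * (((q ^ 2 + 1) * q⁻¹)⁻¹ * q ^ 2) = q ^ 2 * q ^ 2 := by
    rw [← mul_assoc, e2]
  have e7 : q * (q ^ 2 + 1) * (((q ^ 2 + 1) * q⁻¹)⁻¹ * q⁻¹ ^ 2) = 1 := by rw [← mul_assoc, e2, e5]
  simp only [e1, e2, e3, e4, e6, e7, one_smul]
  rw [show (q ^ 2) ^ 2 = q ^ 2 * q ^ 2 by ring]
  abel

section

variable (S : ChordSystem (q ^ 2) n (awChord q n)) (hq0 : q ≠ 0) (hq2 : q ^ 2 ≠ -1) {a b c d e : ℕ}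
include S hq0 hq2

theorem smul_awCasimir_Ioc (hab : a < b) (hbc : b < c) (hcd : c < d) (hd : d ≤ n) :
    (q * (q ^ 2 + 1)) • awCasimir q n (Finset.Ioc a b) (Finset.Ioc b c) (Finset.Ioc c d) =
      chordCasimir (q ^ 2) (awChord q n) a b c d := by
  rw [smul_awCasimir hq0 hq2, Ioc_union_Ioc hab.le hbc.le, Ioc_union_Ioc hbc.le hcd.le,
    Ioc_union_Ioc (hab.trans hbc).le hcd.le, awCinc_Ioc_union S hq0 hab hbc.le hcd hd, chordCasimir,
    awCinc_Ioc S hq0 (by omega) (by omega), awCinc_Ioc S hq0 (by omega) (by omega),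
    awCinc_Ioc S hq0 (by omega) (by omega), awCinc_Ioc S hq0 (by omega) (by omega),
    awCinc_Ioc S hq0 (by omega) (by omega), awCinc_Ioc S hq0 (by omega) (by omega)]

theorem smul_awCasimir_holeRight (hab : a < b) (hbc : b < c) (hcd : c < d) (hde : d < e) (he : e ≤ n) :
    (q * (q ^ 2 + 1)) • awCasimir q n (Finset.Ioc a b) (Finset.Ioc b c) (Finset.Ioc d e) =
      ChordSystem.holeRight (q ^ 2) (awChord q n) a b c d e := by
  rw [ChordSystem.holeRight, ← S.quadCasimir_hole_right (Or.inl (by omega)) (by omega) (by omega)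
    (by omega) (by omega) he, smul_awCasimir hq0 hq2, Ioc_union_Ioc hab.le hbc.le,
    awCinc_Ioc_union S hq0 hab (by omega) hde he, awCinc_Ioc_union S hq0 hbc hcd.le hde he,
    awCinc_Ioc_union S hq0 (by omega) (by omega) hde he,
    awCinc_Ioc S hq0 (by omega) (by omega), awCinc_Ioc S hq0 (by omega) (by omega),
    awCinc_Ioc S hq0 (by omega) (by omega), awCinc_Ioc S hq0 (by omega) (by omega)]

theorem smul_awCasimir_holeLeft (hab : a < b) (hbc : b < c) (hcd : c < d) (hde : d < e) (he : e ≤ n) :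
    (q * (q ^ 2 + 1)) • awCasimir q n (Finset.Ioc a b) (Finset.Ioc c d) (Finset.Ioc d e) =
      ChordSystem.holeLeft (q ^ 2) (awChord q n) a b c d e := by
  rw [ChordSystem.holeLeft, ← S.quadCasimir_hole_left (Or.inl (by omega)) (by omega) (by omega)
    (by omega) (by omega) he, smul_awCasimir hq0 hq2, Finset.union_assoc (Finset.Ioc a b),
    Ioc_union_Ioc hcd.le hde.le,
    awCinc_Ioc_union S hq0 hab (by omega) hcd (by omega), awCinc_Ioc_union S hq0 hab (by omega) hde he,
    awCinc_Ioc_union S hq0 hab (by omega) (by omega) he,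
    awCinc_Ioc S hq0 (by omega) (by omega), awCinc_Ioc S hq0 (by omega) (by omega),
    awCinc_Ioc S hq0 (by omega) (by omega), awCinc_Ioc S hq0 (by omega) (by omega)]

end

end SetCasimir

/-! ### Sets that are intervals above or below a given point -/

section Intervals

theorem AWLt.mono {I J I' J' : Finset ℕ} (h : AWLt I J) (hI : I' ⊆ I) (hJ : J' ⊆ J) : AWLt I' J' :=
  fun a ha b hb => h a (hI ha) b (hJ hb)

theorem exists_eq_Ioc_of_union {J L : Finset ℕ} {a b : ℕ} (hab : a ≤ b) (h : J ∪ L = Finset.Ioc a b)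
    (hJL : AWLt J L) : ∃ c, a ≤ c ∧ c ≤ b ∧ J = Finset.Ioc a c ∧ L = Finset.Ioc c b := by
  have hm : ∀ x, (x ∈ J ∨ x ∈ L) ↔ a < x ∧ x ≤ b := fun x => by
    rw [← Finset.mem_union, h, Finset.mem_Ioc]
  rcases J.eq_empty_or_nonempty with rfl | hJ
  · exact ⟨a, le_rfl, hab, by simp, by rw [← h, Finset.empty_union]⟩
  · have hc := Finset.max'_mem J hJ
    have hc' := (hm _).mp (Or.inl hc)
    refine ⟨J.max' hJ, hc'.1.le, hc'.2, ?_, ?_⟩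
    · ext x
      rw [Finset.mem_Ioc]
      refine ⟨fun hx => ⟨((hm x).mp (Or.inl hx)).1, Finset.le_max' _ _ hx⟩, fun hx => ?_⟩
      exact ((hm x).mpr ⟨hx.1, hx.2.trans hc'.2⟩).resolve_right
        fun hxL => absurd (hJL _ hc _ hxL) (by omega)
    · ext x
      rw [Finset.mem_Ioc]
      refine ⟨fun hx => ⟨hJL _ hc _ hx, ((hm x).mp (Or.inr hx)).2⟩, fun hx => ?_⟩
      exact ((hm x).mpr ⟨hc'.1.trans hx.1, hx.2⟩).resolve_left
        fun hxJ => absurd (Finset.le_max' _ _ hxJ) (by omega)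

theorem exists_filter_eq_Ioc_right {V : Finset ℕ} {m : ℕ} (h : ∀ j, m < j → j + 1 ∈ V → j ∈ V) :
    ∃ b, m ≤ b ∧ (b = m ∨ b ∈ V) ∧ V.filter (m < ·) = Finset.Ioc m b := by
  rcases (V.filter (m < ·)).eq_empty_or_nonempty with hV | hV
  · exact ⟨m, le_rfl, Or.inl rfl, by rw [hV, Finset.Ioc_self]⟩
  · have hb := Finset.max'_mem _ hV
    set b := (V.filter (m < ·)).max' hV
    have hb' := Finset.mem_filter.mp hb
    refine ⟨b, hb'.2.le, Or.inr hb'.1, ?_⟩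
    have key : ∀ k, m < b - k → b - k ∈ V := by
      intro k
      induction k with
      | zero => exact fun _ => hb'.1
      | succ k ih =>
        intro hk
        exact h _ hk (by rw [show b - (k + 1) + 1 = b - k by omega]; exact ih (by omega))
    ext x
    rw [Finset.mem_Ioc]
    refine ⟨fun hx => ⟨(Finset.mem_filter.mp hx).2, Finset.le_max' _ _ hx⟩, fun hx => ?_⟩
    refine Finset.mem_filter.mpr ⟨?_, hx.1⟩
    have := key (b - x) (by omega)
    rwa [show b - (b - x) = x by omega] at this

theorem exists_filter_eq_Ioc_left {V : Finset ℕ} {m : ℕ} (hV0 : 0 ∉ V)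
    (h : ∀ j, 1 ≤ j → j < m → j ∈ V → j + 1 ∈ V) :
    ∃ a, a ≤ m ∧ V.filter (· ≤ m) = Finset.Ioc a m := by
  rcases (V.filter (· ≤ m)).eq_empty_or_nonempty with hV | hV
  · exact ⟨m, le_rfl, by rw [hV, Finset.Ioc_self]⟩
  · have hb := Finset.min'_mem _ hV
    set b := (V.filter (· ≤ m)).min' hV
    have hb' := Finset.mem_filter.mp hb
    have hb1 : b ≠ 0 := fun h0 => hV0 (h0 ▸ hb'.1)
    refine ⟨b - 1, by omega, ?_⟩
    have key : ∀ k, b + k ≤ m → b + k ∈ V := by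
      intro k
      induction k with
      | zero => exact fun _ => hb'.1
      | succ k ih =>
        intro hk
        change b + k + 1 ∈ V
        exact h (b + k) (by omega) (by omega) (ih (by omega))
    ext x
    rw [Finset.mem_Ioc]
    refine ⟨fun hx => ⟨?_, (Finset.mem_filter.mp hx).2⟩, fun hx => ?_⟩
    · have := Finset.min'_le _ _ hx
      change b ≤ x at this
      omega
    · refine Finset.mem_filter.mpr ⟨?_, hx.2⟩
      have := key (x - b) (by omega)
      rwa [show b + (x - b) = x by omega] at this

end Intervals

/-! ### Compression of subsets to intervals by half twists -/

section Transport

variable {K : Type*} [Field K] {q : K} {n : ℕ}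

/-- A family of automorphisms that act on the chords by half twists. -/
structure HalfTwists (q : K) (n : ℕ) (r : ℕ → (AW K q n ≃ₐ[K] AW K q n)) : Prop where
  ne_zero : q ≠ 0
  sq_ne_one : q ^ 2 ≠ 1
  sq_ne_neg_one : q ^ 2 ≠ -1
  twist : ∀ a, a < n → ∀ x y, x ≤ n → y ≤ n → r a (awChord q n x y) = awTwist q n a x y

/-- The automorphism `g` acts on the elements attached to the subsets of `U` by the map `φ`. -/
structure Transport (q : K) (n : ℕ) (g : AW K q n ≃ₐ[K] AW K q n) (φ : ℕ → ℕ) (U : Finset ℕ) :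
    Prop where
  mono : StrictMonoOn φ U
  mem : U.image φ ⊆ Finset.Icc 1 n
  map : ∀ T, T ⊆ U → g (awCinc q n T) = awCinc q n (T.image φ)

variable {r : ℕ → (AW K q n ≃ₐ[K] AW K q n)} {g g' : AW K q n ≃ₐ[K] AW K q n} {φ φ' : ℕ → ℕ}
  {U : Finset ℕ}

namespace Transport

theorem one (hU : U ⊆ Finset.Icc 1 n) : Transport q n 1 id U :=
  ⟨strictMono_id.strictMonoOn _, by rwa [Finset.image_id], fun T _ => by rw [Finset.image_id]; rfl⟩

theorem mul (h' : Transport q n g' φ' (U.image φ)) (h : Transport q n g φ U) :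
    Transport q n (g' * g) (φ' ∘ φ) U where
  mono x hx y hy hxy := h'.mono (Finset.mem_coe.mpr (Finset.mem_image_of_mem φ hx))
    (Finset.mem_coe.mpr (Finset.mem_image_of_mem φ hy)) (h.mono hx hy hxy)
  mem := by rw [← Finset.image_image]; exact h'.mem
  map T hT := by
    rw [AlgEquiv.mul_apply, h.map T hT, h'.map _ (Finset.image_subset_image hT), Finset.image_image]

theorem awLt (h : Transport q n g φ U) {I J : Finset ℕ} (hI : I ⊆ U) (hJ : J ⊆ U) (hIJ : AWLt I J) :
    AWLt (I.image φ) (J.image φ) := by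
  intro a ha b hb
  obtain ⟨x, hx, rfl⟩ := Finset.mem_image.mp ha
  obtain ⟨y, hy, rfl⟩ := Finset.mem_image.mp hb
  exact h.mono (hI hx) (hJ hy) (hIJ x hx y hy)

theorem casimir (h : Transport q n g φ U) {I J L : Finset ℕ} (hI : I ⊆ U) (hJ : J ⊆ U) (hL : L ⊆ U) :
    g (awCasimir q n I J L) = awCasimir q n (I.image φ) (J.image φ) (L.image φ) := by
  simp only [awCasimir, map_add, map_sub, map_mul, map_smul, map_one, map_pow, ← Finset.image_union,
    h.map _ hI, h.map _ hJ, h.map _ hL, h.map _ (Finset.union_subset hI hJ),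
    h.map _ (Finset.union_subset hJ hL), h.map _ (Finset.union_subset hI hL),
    h.map _ (Finset.union_subset (Finset.union_subset hI hJ) hL)]

end Transport

theorem image_swap_subset {j : ℕ} (hj : 1 ≤ j) (hjn : j < n) (hU : U ⊆ Finset.Icc 1 n) :
    U.image (Equiv.swap j (j + 1)) ⊆ Finset.Icc 1 n := by
  intro x hx
  obtain ⟨y, hy, rfl⟩ := Finset.mem_image.mp hx
  have := Finset.mem_Icc.mp (hU hy)
  rw [Equiv.swap_apply_def, Finset.mem_Icc]
  split_ifs <;> omega

namespace HalfTwists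

variable (D : HalfTwists q n r)
include D

theorem chordSystem : ChordSystem (q ^ 2) n (awChord q n) :=
  aw_chordSystem D.ne_zero D.sq_ne_one D.sq_ne_neg_one

/-- The half twist moves `j + 1` down to the free position `j`, for all subsets of `U` at once; the
inverse half twist moves `j` up to a free position `j + 1`. -/
theorem transport_down {j : ℕ} (hj : 1 ≤ j) (hjn : j < n) (hU : U ⊆ Finset.Icc 1 n) (h0 : j ∉ U) :
    Transport q n (r j) (Equiv.swap j (j + 1)) U where
  mono x hx y hy hxy := by
    have h1 : x ≠ j := fun h => h0 (h ▸ hx)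
    have h2 : y ≠ j := fun h => h0 (h ▸ hy)
    rw [Equiv.swap_apply_def, Equiv.swap_apply_def]
    split_ifs <;> omega
  mem := image_swap_subset hj hjn hU
  map T hT := half_twist_awCinc D.chordSystem D.ne_zero hjn (D.twist j hjn) hj (hT.trans hU)
    fun h => absurd (hT h) h0

theorem transport_up {j : ℕ} (hj : 1 ≤ j) (hjn : j < n) (hU : U ⊆ Finset.Icc 1 n) (h0 : j + 1 ∉ U) :
    Transport q n (r j)⁻¹ (Equiv.swap j (j + 1)) U where
  mono x hx y hy hxy := by
    have h1 : x ≠ j + 1 := fun h => h0 (h ▸ hx)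
    have h2 : y ≠ j + 1 := fun h => h0 (h ▸ hy)
    rw [Equiv.swap_apply_def, Equiv.swap_apply_def]
    split_ifs <;> omega
  mem := image_swap_subset hj hjn hU
  map T hT := by
    have h1 := half_twist_awCinc D.chordSystem D.ne_zero hjn (D.twist j hjn) hj
      (image_swap_subset hj hjn (hT.trans hU)) (fun h => by
        obtain ⟨y, hy, hyj⟩ := Finset.mem_image.mp h
        rw [Equiv.swap_apply_eq_iff, Equiv.swap_apply_left] at hyj
        exact absurd (hT (hyj ▸ hy)) h0)
    have hs : Equiv.swap j (j + 1) ∘ Equiv.swap j (j + 1) = id := funext fun x => by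
      rw [Function.comp_apply, ← Equiv.Perm.mul_apply, Equiv.swap_mul_self]; rfl
    rw [Finset.image_image, hs, Finset.image_id] at h1
    rw [← h1]
    exact (r j).symm_apply_apply _

/-- Letters above `m` are moved down as long as there is a gap; the sum of the letters decreases.
The subgroup `H` keeps track of properties of the automorphism, such as commuting with a given half
twist. -/
theorem compress_down (H : Subgroup (AW K q n ≃ₐ[K] AW K q n)) (m : ℕ)
    (hH : ∀ j, m < j → j < n → r j ∈ H) : ∀ U : Finset ℕ, U ⊆ Finset.Icc 1 n →
      ∃ g ∈ H, ∃ φ, Transport q n g φ U ∧ (∀ x ∈ U, x ≤ m → φ x = x) ∧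
        ∀ j, m < j → j + 1 ∈ U.image φ → j ∈ U.image φ := by
  intro U hU
  induction hk : ∑ x ∈ U, x using Nat.strong_induction_on generalizing U with
  | _ k ih =>
    by_cases hc : ∀ j, m < j → j + 1 ∈ U → j ∈ U
    · exact ⟨1, H.one_mem, id, Transport.one hU, fun _ _ _ => rfl, by rwa [Finset.image_id]⟩
    · push Not at hc
      obtain ⟨j, hmj, hj1, hj0⟩ := hc
      have hjn := (Finset.mem_Icc.mp (hU hj1)).2
      have ht := D.transport_down (by omega) hjn hU hj0
      have hlt : ∑ x ∈ U.image (Equiv.swap j (j + 1)), x < k := by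
        rw [Finset.sum_image (fun x _ y _ h => Equiv.injective _ h), ← hk]
        refine Finset.sum_lt_sum (fun x hx => ?_) ⟨j + 1, hj1, by simp⟩
        have h1 : x ≠ j := fun h => hj0 (h ▸ hx)
        rw [Equiv.swap_apply_def]
        split_ifs <;> omega
      obtain ⟨g, hg, φ, h1, h2, h3⟩ := ih _ hlt _ ht.mem rfl
      refine ⟨g * r j, H.mul_mem hg (hH j hmj hjn), _, h1.mul ht, fun x hx hxm => ?_, ?_⟩
      · have hs : Equiv.swap j (j + 1) x = x :=
          Equiv.swap_apply_of_ne_of_ne (by omega) (by omega)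
        rw [Function.comp_apply, hs]
        exact h2 x (Finset.mem_image.mpr ⟨x, hx, hs⟩) hxm
      · rwa [← Finset.image_image]

theorem compress_up (H : Subgroup (AW K q n ≃ₐ[K] AW K q n)) (m : ℕ)
    (hH : ∀ j, 1 ≤ j → j + 1 < m → j < n → r j ∈ H) : ∀ U : Finset ℕ, U ⊆ Finset.Icc 1 n → m ≤ n →
      ∃ g ∈ H, ∃ φ, Transport q n g φ U ∧ (∀ x ∈ U, m ≤ x → φ x = x) ∧
        ∀ j, 1 ≤ j → j + 1 < m → j ∈ U.image φ → j + 1 ∈ U.image φ := by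
  intro U hU hmn
  induction hk : ∑ x ∈ U, (n - x) using Nat.strong_induction_on generalizing U with
  | _ k ih =>
    by_cases hc : ∀ j, 1 ≤ j → j + 1 < m → j ∈ U → j + 1 ∈ U
    · exact ⟨1, H.one_mem, id, Transport.one hU, fun _ _ _ => rfl, by rwa [Finset.image_id]⟩
    · push Not at hc
      obtain ⟨j, hj, hmj, hj0, hj1⟩ := hc
      have ht := D.transport_up hj (by omega) hU hj1
      have hlt : ∑ x ∈ U.image (Equiv.swap j (j + 1)), (n - x) < k := by
        rw [Finset.sum_image (fun x _ y _ h => Equiv.injective _ h), ← hk]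
        refine Finset.sum_lt_sum (fun x hx => ?_) ⟨j, hj0, by rw [Equiv.swap_apply_left]; omega⟩
        have h1 : x ≠ j + 1 := fun h => hj1 (h ▸ hx)
        rw [Equiv.swap_apply_def]
        split_ifs <;> omega
      obtain ⟨g, hg, φ, h1, h2, h3⟩ := ih _ hlt _ ht.mem rfl
      refine ⟨g * (r j)⁻¹, H.mul_mem hg (H.inv_mem (hH j hj hmj (by omega))), _, h1.mul ht,
        fun x hx hxm => ?_, ?_⟩
      · have hs : Equiv.swap j (j + 1) x = x :=
          Equiv.swap_apply_of_ne_of_ne (by omega) (by omega)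
        rw [Function.comp_apply, hs]
        exact h2 x (Finset.mem_image.mpr ⟨x, hx, hs⟩) hxm
      · rwa [← Finset.image_image]

theorem exists_transport_Ioc (hU : U ⊆ Finset.Icc 1 n) :
    ∃ g φ b, Transport q n g φ U ∧ b ≤ n ∧ U.image φ = Finset.Ioc 0 b := by
  obtain ⟨g, -, φ, h1, -, h3⟩ := D.compress_down ⊤ 0 (fun _ _ _ => Subgroup.mem_top _) U hU
  obtain ⟨b, -, hb, h4⟩ := exists_filter_eq_Ioc_right h3
  refine ⟨g, φ, b, h1, ?_, ?_⟩
  · rcases hb with rfl | hb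
    · exact Nat.zero_le _
    · exact (Finset.mem_Icc.mp (h1.mem hb)).2
  · rw [← h4]
    exact (Finset.filter_true_of_mem fun x hx => (Finset.mem_Icc.mp (h1.mem hx)).1).symm

/-- Only half twists far from `p` are used. They commute with `r p` and fix `p` and `p + 1`, yet
they suffice to push the letters below `p` up to `p - 1` and the letters above `p + 1` down to `p +
2`. -/
theorem exists_transport_corner {p : ℕ} (hp : 1 ≤ p) (hpn : p < n) (hU : U ⊆ Finset.Icc 1 n)
    (h0 : p ∈ U) (h1 : p + 1 ∈ U) :
    ∃ g φ a b, Transport q n g φ U ∧ Commute g (r p) ∧ φ p = p ∧ φ (p + 1) = p + 1 ∧ b ≤ n ∧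
      a < p ∧ p < b ∧ U.image φ = Finset.Ioc a b := by
  have comm : ∀ f, f ∈ Subgroup.centralizer {r p} ↔ Commute f (r p) := fun f => by
    rw [Subgroup.mem_centralizer_singleton_iff]; rfl
  obtain ⟨f, hf, ψ, f1, f2, f3⟩ := D.compress_up (Subgroup.centralizer {r p}) p
    (fun j hj hjp hjn => (comm _).mpr
      (half_twist_far D.chordSystem hjp hpn (D.twist j hjn) (D.twist p hpn))) U hU hpn.le
  have p0 : p ∈ U.image ψ := Finset.mem_image.mpr ⟨p, h0, f2 p h0 le_rfl⟩
  have p1 : p + 1 ∈ U.image ψ := Finset.mem_image.mpr ⟨p + 1, h1, f2 _ h1 (by omega)⟩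
  obtain ⟨g, hg, φ, g1, g2, g3⟩ := D.compress_down (Subgroup.centralizer {r p}) (p + 1)
    (fun j hj hjn => (comm _).mpr
      (half_twist_far D.chordSystem hj hjn (D.twist p hpn) (D.twist j hjn)).symm) _ f1.mem
  have e0 : φ p = p := g2 p p0 (by omega)
  have e1 : φ (p + 1) = p + 1 := g2 _ p1 le_rfl
  obtain ⟨b, hb, hb', hb2⟩ := exists_filter_eq_Ioc_right g3
  obtain ⟨a, ha, ha2⟩ := exists_filter_eq_Ioc_left (V := U.image ψ) (m := p - 1)
    (fun h => absurd (Finset.mem_Icc.mp (f1.mem h)).1 (by omega))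
    (fun j hj hjp => f3 j hj (by omega))
  refine ⟨g * f, φ ∘ ψ, a, b, g1.mul f1, (comm _).mp (mul_mem hg hf),
    by rw [Function.comp_apply, f2 p h0 le_rfl, e0],
    by rw [Function.comp_apply, f2 _ h1 (by omega), e1], ?_, by omega, by omega, ?_⟩
  · rcases hb' with rfl | hb'
    · exact hpn
    · exact (Finset.mem_Icc.mp (g1.mem hb')).2
  · rw [← Finset.image_image]
    ext x
    rw [Finset.mem_Ioc]
    constructor
    · intro hx
      by_cases hxp : p + 1 < x
      · have : x ∈ Finset.Ioc (p + 1) b := hb2 ▸ Finset.mem_filter.mpr ⟨hx, hxp⟩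
        rw [Finset.mem_Ioc] at this
        omega
      · refine ⟨?_, by omega⟩
        obtain ⟨y, hy, rfl⟩ := Finset.mem_image.mp hx
        have hyp : y ≤ p + 1 := by
          by_contra hyp
          have := g1.mono p1 hy (not_le.mp hyp)
          omega
        rw [g2 y hy hyp]
        by_cases hyp' : y ≤ p - 1
        · have : y ∈ Finset.Ioc a (p - 1) := ha2 ▸ Finset.mem_filter.mpr ⟨hy, hyp'⟩
          rw [Finset.mem_Ioc] at this
          omega
        · omega
    · intro hx
      by_cases hxp : p + 1 < x
      · have : x ∈ Finset.Ioc (p + 1) b := Finset.mem_Ioc.mpr ⟨hxp, hx.2⟩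
        rw [← hb2] at this
        exact (Finset.mem_filter.mp this).1
      · by_cases hxp' : x ≤ p - 1
        · have : x ∈ Finset.Ioc a (p - 1) := Finset.mem_Ioc.mpr ⟨hx.1, hxp'⟩
          rw [← ha2] at this
          have := (Finset.mem_filter.mp this).1
          exact Finset.mem_image.mpr ⟨x, this, g2 x this (by omega)⟩
        · obtain rfl | rfl : x = p ∨ x = p + 1 := by omega
          · exact Finset.mem_image.mpr ⟨x, p0, e0⟩
          · exact Finset.mem_image.mpr ⟨_, p1, e1⟩

end HalfTwists

end Transport

/-! ### Cocycle identities and half twists for Casimir elements of sets -/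

section SetCasimirs

theorem AWLt.union_left {I J L : Finset ℕ} (h : AWLt I L) (h' : AWLt J L) : AWLt (I ∪ J) L :=
  fun a ha b hb => (Finset.mem_union.mp ha).elim (fun h1 => h a h1 b hb) fun h1 => h' a h1 b hb

theorem image_swap_eq_self {p : ℕ} {J : Finset ℕ} (h : p ∈ J ↔ p + 1 ∈ J) :
    J.image (Equiv.swap p (p + 1)) = J := by
  refine Finset.eq_of_subset_of_card_le (fun x hx => ?_)
    (Finset.card_image_of_injective _ (Equiv.injective _)).ge
  obtain ⟨y, hy, rfl⟩ := Finset.mem_image.mp hx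
  rw [Equiv.swap_apply_def]
  split_ifs with h2 h3
  · exact h.mp (h2 ▸ hy)
  · exact h.mpr (h3 ▸ hy)
  · exact hy

theorem singleton_eq_Ioc {p a c : ℕ} (h : ({p} : Finset ℕ) = Finset.Ioc a c) : a + 1 = p ∧ c = p := by
  have h1 : ∀ x, x = p ↔ a < x ∧ x ≤ c := fun x => by
    rw [← Finset.mem_Ioc, ← h, Finset.mem_singleton]
  have h2 := (h1 p).mp rfl
  exact ⟨(h1 _).mpr (by omega), (h1 c).mpr (by omega)⟩

theorem pair_subset_Icc {p n : ℕ} (hp : 1 ≤ p) (hpn : p < n) :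
    ({p} : Finset ℕ) ⊆ Finset.Icc 1 n ∧ ({p + 1} : Finset ℕ) ⊆ Finset.Icc 1 n := by
  simp only [Finset.singleton_subset_iff, Finset.mem_Icc]
  omega

theorem polygonCorner_pred {p n : ℕ} (hp : 1 ≤ p) (hpn : p < n) :
    PolygonCorner n (prevVertex n p) p (p + 1) ∧ prevVertex n p = p - 1 :=
  ⟨polygonCorner hpn, by unfold prevVertex; split_ifs <;> omega⟩

variable {K : Type*} [Field K] {q : K} {n : ℕ} {r : ℕ → (AW K q n ≃ₐ[K] AW K q n)}
  {g : AW K q n ≃ₐ[K] AW K q n} {φ : ℕ → ℕ} {U I J L M : Finset ℕ}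

/-- Because the transport commutes with `f`, a formula for `f` may be checked after the transport,
where the blocks are intervals. -/
theorem Transport.twist_casimir (T : Transport q n g φ U) {f : AW K q n ≃ₐ[K] AW K q n}
    (hc : Commute g f) {I' J' L' : Finset ℕ} (hI : I ⊆ U) (hJ : J ⊆ U) (hL : L ⊆ U) (hI' : I' ⊆ U)
    (hJ' : J' ⊆ U) (hL' : L' ⊆ U)
    (h : f (awCasimir q n (I.image φ) (J.image φ) (L.image φ)) =
      awCasimir q n (I'.image φ) (J'.image φ) (L'.image φ)) :
    f (awCasimir q n I J L) = awCasimir q n I' J' L' := by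
  rw [← T.casimir hI hJ hL, ← T.casimir hI' hJ' hL'] at h
  apply g.injective
  rw [← h]
  exact DFunLike.congr_fun hc.eq _

theorem commute_of_map {A : Type*} [Ring A] [Algebra K A] (g : A ≃ₐ[K] A) {x y : A}
    (h : Commute (g x) (g y)) : Commute x y := g.injective (by rw [map_mul, map_mul, h.eq])

namespace HalfTwists

variable (D : HalfTwists q n r)
include D

theorem scalar_ne : q * (q ^ 2 + 1) ≠ 0 := mul_ne_zero D.ne_zero (sq_add_one_ne D.sq_ne_neg_one)

theorem smul_inj {x y : AW K q n} (h : (q * (q ^ 2 + 1)) • x = (q * (q ^ 2 + 1)) • y) : x = y :=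
  smul_right_injective _ D.scalar_ne h

/-- After transport to adjacent intervals the three elements are the sides of a triangle. -/
theorem awCinc_commute (hJ : J ⊆ Finset.Icc 1 n) (hL : L ⊆ Finset.Icc 1 n) (h : AWLt J L) :
    Commute (awCinc q n J) (awCinc q n L) ∧ Commute (awCinc q n J) (awCinc q n (J ∪ L)) ∧
      Commute (awCinc q n L) (awCinc q n (J ∪ L)) := by
  have S := D.chordSystem
  obtain ⟨g, φ, b, T, hb, hV⟩ := D.exists_transport_Ioc (Finset.union_subset hJ hL)
  have hJU : J ⊆ J ∪ L := Finset.subset_union_left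
  have hLU : L ⊆ J ∪ L := Finset.subset_union_right
  have e1 := T.map J hJU
  have e2 := T.map L hLU
  have e3 := T.map (J ∪ L) subset_rfl
  have hV' := hV
  rw [Finset.image_union] at hV'
  obtain ⟨c, -, hcb, e4, e5⟩ := exists_eq_Ioc_of_union (Nat.zero_le b) hV' (T.awLt hJU hLU h)
  rw [e4, awCinc_Ioc S D.ne_zero (Nat.zero_le _) (by omega)] at e1
  rw [e5, awCinc_Ioc S D.ne_zero hcb (by omega)] at e2
  rw [hV, awCinc_Ioc S D.ne_zero (Nat.zero_le _) (by omega)] at e3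
  refine ⟨commute_of_map g ?_, commute_of_map g ?_, commute_of_map g ?_⟩
  · rw [e1, e2]
    exact S.commute (Or.inl (by omega)) (by omega) (by omega) (by omega) hb
  · rw [e1, e3, S.symm 0 b]
    exact ((S.commute (a := b) (b := 0) (c := 0) (d := c) (Or.inr (Or.inl (by omega))) (by omega)
      (by omega) (by omega) (by omega)).symm)
  · rw [e2, e3, S.symm 0 b]
    exact S.commute (a := c) (b := b) (c := b) (d := 0) (Or.inr (Or.inr (Or.inr (by omega)))) (by omega)
      (by omega) (by omega) (by omega)

theorem awCasimir_empty_left (hJ : J ⊆ Finset.Icc 1 n) (hL : L ⊆ Finset.Icc 1 n) (h : AWLt J L) :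
    awCasimir q n ∅ J L = 0 := by
  obtain ⟨h1, h2, h3⟩ := D.awCinc_commute hJ hL h
  apply D.smul_inj
  rw [smul_awCasimir D.ne_zero D.sq_ne_neg_one, smul_zero, Finset.empty_union, Finset.empty_union,
    awCinc_empty]
  exact (quadCasimir_one h2 h1 h3.symm).1

theorem awCasimir_empty_middle (hI : I ⊆ Finset.Icc 1 n) (hL : L ⊆ Finset.Icc 1 n) (h : AWLt I L) :
    awCasimir q n I ∅ L = 0 := by
  obtain ⟨h1, h2, h3⟩ := D.awCinc_commute hI hL h
  apply D.smul_inj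
  rw [smul_awCasimir D.ne_zero D.sq_ne_neg_one, smul_zero, Finset.empty_union, Finset.union_empty,
    awCinc_empty]
  exact (quadCasimir_one h1 h2 h3).2.1

theorem awCasimir_empty_right (hI : I ⊆ Finset.Icc 1 n) (hJ : J ⊆ Finset.Icc 1 n) (h : AWLt I J) :
    awCasimir q n I J ∅ = 0 := by
  obtain ⟨h1, h2, h3⟩ := D.awCinc_commute hI hJ h
  apply D.smul_inj
  rw [smul_awCasimir D.ne_zero D.sq_ne_neg_one, smul_zero, Finset.union_empty, Finset.union_empty,
    Finset.union_empty, awCinc_empty]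
  exact (quadCasimir_one h3.symm h2.symm h1.symm).2.2

theorem exists_transport_four (hI : I ⊆ Finset.Icc 1 n) (hJ : J ⊆ Finset.Icc 1 n)
    (hL : L ⊆ Finset.Icc 1 n) (hM : M ⊆ Finset.Icc 1 n) (hIJ : AWLt I J) (hIL : AWLt I L)
    (hIM : AWLt I M) (hJL : AWLt J L) (hJM : AWLt J M) (hLM : AWLt L M) :
    ∃ g φ b c d e, Transport q n g φ (I ∪ J ∪ L ∪ M) ∧ b ≤ c ∧ c ≤ d ∧ d ≤ e ∧ e ≤ n ∧
      I.image φ = Finset.Ioc 0 b ∧ J.image φ = Finset.Ioc b c ∧ L.image φ = Finset.Ioc c d ∧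
      M.image φ = Finset.Ioc d e := by
  obtain ⟨g, φ, e, T, he, hV⟩ := D.exists_transport_Ioc
    (Finset.union_subset (Finset.union_subset (Finset.union_subset hI hJ) hL) hM)
  rw [Finset.image_union] at hV
  obtain ⟨d, -, hde, e1, e2⟩ := exists_eq_Ioc_of_union (Nat.zero_le _) hV
    (T.awLt (by grind) (by grind) ((hIM.union_left hJM).union_left hLM))
  rw [Finset.image_union] at e1
  obtain ⟨c, -, hcd, e3, e4⟩ := exists_eq_Ioc_of_union (Nat.zero_le _) e1
    (T.awLt (by grind) (by grind) (hIL.union_left hJL))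
  rw [Finset.image_union] at e3
  obtain ⟨b, -, hbc, e5, e6⟩ := exists_eq_Ioc_of_union (Nat.zero_le _) e3
    (T.awLt (by grind) (by grind) hIJ)
  exact ⟨g, φ, b, c, d, e, T, hbc, hcd, hde, he, e5, e6, e4, e2⟩

/-- After transport the four blocks are adjacent intervals, and the identity is the formula for the
Casimir element with a hole before the last block. Empty blocks are settled beforehand, where
Casimir elements with an empty argument vanish. -/
theorem casimir_cocycle_left (hI : I ⊆ Finset.Icc 1 n) (hJ : J ⊆ Finset.Icc 1 n)
    (hL : L ⊆ Finset.Icc 1 n) (hM : M ⊆ Finset.Icc 1 n) (hIJ : AWLt I J) (hIL : AWLt I L)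
    (hIM : AWLt I M) (hJL : AWLt J L) (hJM : AWLt J M) (hLM : AWLt L M) :
    awCasimir q n (I ∪ J) L M - awCasimir q n I (J ∪ L) M =
      awCasimir q n J L M - awCasimir q n I J M := by
  rcases I.eq_empty_or_nonempty with rfl | hI0
  · rw [Finset.empty_union, D.awCasimir_empty_left (Finset.union_subset hJ hL) hM (hJM.union_left hLM),
      D.awCasimir_empty_left hJ hM hJM]
  rcases J.eq_empty_or_nonempty with rfl | hJ0
  · rw [Finset.empty_union, Finset.union_empty, D.awCasimir_empty_left hL hM hLM,
      D.awCasimir_empty_middle hI hM hIM, sub_self, sub_self]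
  rcases L.eq_empty_or_nonempty with rfl | hL0
  · rw [Finset.union_empty, D.awCasimir_empty_middle (Finset.union_subset hI hJ) hM
      (hIM.union_left hJM), D.awCasimir_empty_middle hJ hM hJM]
  rcases M.eq_empty_or_nonempty with rfl | hM0
  · rw [D.awCasimir_empty_right (Finset.union_subset hI hJ) hL (hIL.union_left hJL),
      D.awCasimir_empty_right hI (Finset.union_subset hJ hL) (by
        intro a ha b hb; rcases Finset.mem_union.mp hb with h | h
        exacts [hIJ a ha b h, hIL a ha b h]), D.awCasimir_empty_right hJ hL hJL,
      D.awCasimir_empty_right hI hJ hIJ]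
  obtain ⟨g, φ, b, c, d, e, T, -, -, -, he, e1, e2, e3, e4⟩ :=
    D.exists_transport_four hI hJ hL hM hIJ hIL hIM hJL hJM hLM
  apply g.injective
  rw [map_sub, map_sub, T.casimir (by grind) (by grind) (by grind),
    T.casimir (by grind) (by grind) (by grind), T.casimir (by grind) (by grind) (by grind),
    T.casimir (by grind) (by grind) (by grind), Finset.image_union, Finset.image_union]
  have h1 := hI0.image φ
  have h2 := hJ0.image φ
  have h3 := hL0.image φ
  have h4 := hM0.image φ
  rw [e1, Finset.nonempty_Ioc] at h1
  rw [e2, Finset.nonempty_Ioc] at h2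
  rw [e3, Finset.nonempty_Ioc] at h3
  rw [e4, Finset.nonempty_Ioc] at h4
  rw [e1, e2, e3, e4, Ioc_union_Ioc h1.le h2.le, Ioc_union_Ioc h2.le h3.le]
  apply D.smul_inj
  have S := D.chordSystem
  rw [smul_sub, smul_sub, smul_awCasimir_Ioc S D.ne_zero D.sq_ne_neg_one (by omega) h3 h4 he,
    smul_awCasimir_Ioc S D.ne_zero D.sq_ne_neg_one h1 (by omega) h4 he,
    smul_awCasimir_Ioc S D.ne_zero D.sq_ne_neg_one h2 h3 h4 he,
    smul_awCasimir_holeRight S D.ne_zero D.sq_ne_neg_one h1 h2 h3 h4 he, ChordSystem.holeRight]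
  abel

/-- The same with a hole after the first block. -/
theorem casimir_cocycle_right (hI : I ⊆ Finset.Icc 1 n) (hJ : J ⊆ Finset.Icc 1 n)
    (hL : L ⊆ Finset.Icc 1 n) (hM : M ⊆ Finset.Icc 1 n) (hIJ : AWLt I J) (hIL : AWLt I L)
    (hIM : AWLt I M) (hJL : AWLt J L) (hJM : AWLt J M) (hLM : AWLt L M) :
    awCasimir q n I (J ∪ L) M - awCasimir q n I J (L ∪ M) =
      awCasimir q n I L M - awCasimir q n I J L := by
  have hJLM : AWLt I (L ∪ M) := by
    intro a ha b hb; rcases Finset.mem_union.mp hb with h | h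
    exacts [hIL a ha b h, hIM a ha b h]
  rcases I.eq_empty_or_nonempty with rfl | hI0
  · rw [D.awCasimir_empty_left (Finset.union_subset hJ hL) hM (hJM.union_left hLM),
      D.awCasimir_empty_left hJ (Finset.union_subset hL hM) (by
        intro a ha b hb; rcases Finset.mem_union.mp hb with h | h
        exacts [hJL a ha b h, hJM a ha b h]), D.awCasimir_empty_left hL hM hLM,
      D.awCasimir_empty_left hJ hL hJL]
  rcases J.eq_empty_or_nonempty with rfl | hJ0
  · rw [Finset.empty_union, D.awCasimir_empty_middle hI (Finset.union_subset hL hM) hJLM,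
      D.awCasimir_empty_middle hI hL hIL]
  rcases L.eq_empty_or_nonempty with rfl | hL0
  · rw [Finset.union_empty, Finset.empty_union, D.awCasimir_empty_middle hI hM hIM,
      D.awCasimir_empty_right hI hJ hIJ, sub_self, sub_self]
  rcases M.eq_empty_or_nonempty with rfl | hM0
  · rw [Finset.union_empty, D.awCasimir_empty_right hI (Finset.union_subset hJ hL) (by
        intro a ha b hb; rcases Finset.mem_union.mp hb with h | h
        exacts [hIJ a ha b h, hIL a ha b h]), D.awCasimir_empty_right hI hL hIL]
  obtain ⟨g, φ, b, c, d, e, T, -, -, -, he, e1, e2, e3, e4⟩ :=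
    D.exists_transport_four hI hJ hL hM hIJ hIL hIM hJL hJM hLM
  apply g.injective
  rw [map_sub, map_sub, T.casimir (by grind) (by grind) (by grind),
    T.casimir (by grind) (by grind) (by grind), T.casimir (by grind) (by grind) (by grind),
    T.casimir (by grind) (by grind) (by grind), Finset.image_union, Finset.image_union]
  have h1 := hI0.image φ
  have h2 := hJ0.image φ
  have h3 := hL0.image φ
  have h4 := hM0.image φ
  rw [e1, Finset.nonempty_Ioc] at h1
  rw [e2, Finset.nonempty_Ioc] at h2
  rw [e3, Finset.nonempty_Ioc] at h3
  rw [e4, Finset.nonempty_Ioc] at h4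
  rw [e1, e2, e3, e4, Ioc_union_Ioc h2.le h3.le, Ioc_union_Ioc h3.le h4.le]
  apply D.smul_inj
  have S := D.chordSystem
  rw [smul_sub, smul_sub, smul_awCasimir_Ioc S D.ne_zero D.sq_ne_neg_one h1 (by omega) h4 he,
    smul_awCasimir_Ioc S D.ne_zero D.sq_ne_neg_one h1 h2 (by omega) he,
    smul_awCasimir_Ioc S D.ne_zero D.sq_ne_neg_one h1 h2 h3 (by omega),
    smul_awCasimir_holeLeft S D.ne_zero D.sq_ne_neg_one h1 h2 h3 h4 he, ChordSystem.holeLeft]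
  abel

theorem awCinc_fixed {p : ℕ} (hp : 1 ≤ p) (hpn : p < n) (hI : I ⊆ Finset.Icc 1 n)
    (h : p ∈ I ↔ p + 1 ∈ I) : r p (awCinc q n I) = awCinc q n I := by
  rw [half_twist_awCinc D.chordSystem D.ne_zero hpn (D.twist p hpn) hp hI h.mp, image_swap_eq_self h]

theorem casimir_fixed {p : ℕ} (hp : 1 ≤ p) (hpn : p < n) (hI : I ⊆ Finset.Icc 1 n)
    (hJ : J ⊆ Finset.Icc 1 n) (hL : L ⊆ Finset.Icc 1 n) (h1 : p ∈ I ↔ p + 1 ∈ I)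
    (h2 : p ∈ J ↔ p + 1 ∈ J) (h3 : p ∈ L ↔ p + 1 ∈ L) :
    r p (awCasimir q n I J L) = awCasimir q n I J L := by
  have key : ∀ T : Finset ℕ, T ⊆ Finset.Icc 1 n → (p ∈ T ↔ p + 1 ∈ T) →
      r p (awCinc q n T) = awCinc q n T := fun T hT h => D.awCinc_fixed hp hpn hT h
  have k1 := key _ hI h1
  have k2 := key _ hJ h2
  have k3 := key _ hL h3
  have k4 := key _ (Finset.union_subset hI hJ) (by simp only [Finset.mem_union, h1, h2])
  have k5 := key _ (Finset.union_subset hJ hL) (by simp only [Finset.mem_union, h2, h3])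
  have k6 := key _ (Finset.union_subset hI hL) (by simp only [Finset.mem_union, h1, h3])
  have k7 := key _ (Finset.union_subset (Finset.union_subset hI hJ) hL)
    (by simp only [Finset.mem_union, h1, h2, h3])
  simp only [awCasimir, map_add, map_sub, map_mul, map_smul, map_one, map_pow, k1, k2, k3, k4, k5, k6,
    k7]

theorem casimir_fixed_zero (hn : 0 < n) (hI : I ⊆ Finset.Icc 1 n)
    (hJ : J ⊆ Finset.Icc 1 n) (hL : L ⊆ Finset.Icc 1 n) (h1 : 1 ∉ I) (h2 : 1 ∉ J) (h3 : 1 ∉ L) :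
    r 0 (awCasimir q n I J L) = awCasimir q n I J L := by
  have key : ∀ T : Finset ℕ, T ⊆ Finset.Icc 1 n → 1 ∉ T →
      r 0 (awCinc q n T) = awCinc q n T := fun T hT h =>
    half_twist_awCinc_of_notMem D.chordSystem D.ne_zero (D.twist 0 hn) hT
      (fun h0 => absurd (Finset.mem_Icc.mp (hT h0)).1 (by omega)) h
  have k1 := key _ hI h1
  have k2 := key _ hJ h2
  have k3 := key _ hL h3
  have k4 := key _ (Finset.union_subset hI hJ) (by simp only [Finset.mem_union, h1, h2, or_self,
    not_false_eq_true])
  have k5 := key _ (Finset.union_subset hJ hL) (by simp only [Finset.mem_union, h2, h3, or_self,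
    not_false_eq_true])
  have k6 := key _ (Finset.union_subset hI hL) (by simp only [Finset.mem_union, h1, h3, or_self,
    not_false_eq_true])
  have k7 := key _ (Finset.union_subset (Finset.union_subset hI hJ) hL)
    (by simp only [Finset.mem_union, h1, h2, h3, or_self, not_false_eq_true])
  simp only [awCasimir, map_add, map_sub, map_mul, map_smul, map_one, map_pow, k1, k2, k3, k4, k5, k6,
    k7]

section Corner

variable {p : ℕ} (hp : 1 ≤ p) (hpn : p < n)
include hp hpn

/-- A transport of two blocks and the pair `p`, `p + 1` to adjacent intervals that commutes with the
half twist of the pair. -/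
theorem exists_transport_pair {X Y Z W : Finset ℕ} (hX : X ⊆ Finset.Icc 1 n) (hY : Y ⊆ Finset.Icc 1 n)
    (hZ : Z ⊆ Finset.Icc 1 n) (hW : W ⊆ Finset.Icc 1 n) (hXY : AWLt X Y) (hXp : AWLt X {p})
    (hYp : AWLt Y {p}) (hpZ : AWLt {p + 1} Z) (hpW : AWLt {p + 1} W) (hZW : AWLt Z W) :
    ∃ g φ a b c d, Transport q n g φ (X ∪ Y ∪ {p} ∪ {p + 1} ∪ Z ∪ W) ∧ Commute g (r p) ∧ a ≤ b ∧
      b ≤ p - 1 ∧ p + 1 ≤ c ∧ c ≤ d ∧ d ≤ n ∧ X.image φ = Finset.Ioc a b ∧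
      Y.image φ = Finset.Ioc b (p - 1) ∧ Z.image φ = Finset.Ioc (p + 1) c ∧
      W.image φ = Finset.Ioc c d ∧ ({p} : Finset ℕ).image φ = Finset.Ioc (p - 1) p ∧
      ({p + 1} : Finset ℕ).image φ = Finset.Ioc p (p + 1) := by
  obtain ⟨hps, hqs⟩ := pair_subset_Icc hp hpn
  have hXq : ∀ {X : Finset ℕ}, AWLt X {p} → AWLt X {p + 1} := fun h a ha b hb => by
    rw [Finset.mem_singleton] at hb
    have := h a ha p (by simp)
    omega
  have hpq : AWLt {p} {p + 1} := by intro a ha b hb; simp only [Finset.mem_singleton] at ha hb; omega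
  have hlt : ∀ {X Z : Finset ℕ}, AWLt X {p} → AWLt {p + 1} Z → AWLt X Z := fun h1 h2 a ha b hb => by
    have := h1 a ha p (by simp)
    have := h2 (p + 1) (by simp) b hb
    omega
  have hpZ' : ∀ {Z : Finset ℕ}, AWLt {p + 1} Z → AWLt {p} Z := fun h a ha b hb => by
    rw [Finset.mem_singleton] at ha
    have := h (p + 1) (by simp) b hb
    omega
  obtain ⟨g, φ, a, d, T, hc, f0, f1, hdn, hap, hpd, hV⟩ := D.exists_transport_corner hp hpn
    (U := X ∪ Y ∪ {p} ∪ {p + 1} ∪ Z ∪ W) (by grind) (by simp) (by simp)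
  rw [Finset.image_union] at hV
  obtain ⟨c, hac, hcd, e1, e2⟩ := exists_eq_Ioc_of_union (by omega) hV (T.awLt (by grind) (by grind)
    ((((((hlt hXp hpW).union_left (hlt hYp hpW)).union_left (hpZ' hpW)).union_left hpW)).union_left hZW))
  rw [Finset.image_union] at e1
  obtain ⟨c1, hac1, hc1, e3, e4⟩ := exists_eq_Ioc_of_union (by omega) e1 (T.awLt (by grind) (by grind)
    (((((hlt hXp hpZ).union_left (hlt hYp hpZ)).union_left (hpZ' hpZ)).union_left hpZ)))
  rw [Finset.image_union] at e3
  obtain ⟨c2, hac2, hc2, e5, e6⟩ := exists_eq_Ioc_of_union (by omega) e3 (T.awLt (by grind) (by grind)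
    ((((hXq hXp).union_left (hXq hYp)).union_left hpq)))
  rw [Finset.image_union] at e5
  obtain ⟨c3, hac3, hc3, e7, e8⟩ := exists_eq_Ioc_of_union (by omega) e5 (T.awLt (by grind) (by grind)
    (hXp.union_left hYp))
  rw [Finset.image_union] at e7
  obtain ⟨c4, hc4, hc43, e9, e10⟩ := exists_eq_Ioc_of_union (by omega) e7
    (T.awLt (by grind) (by grind) hXY)
  have s1 := e8
  have s2 := e6
  rw [Finset.image_singleton, f0] at s1
  rw [Finset.image_singleton, f1] at s2
  obtain ⟨t1, t2⟩ := singleton_eq_Ioc s1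
  obtain ⟨t3, t4⟩ := singleton_eq_Ioc s2
  have t5 : c3 = p - 1 := by omega
  subst t2 t4 t5
  exact ⟨g, φ, a, c4, c, d, T, hc, hc4, hc43, hc1, hcd, hdn, e9, e10, e4, e2, e8, e6⟩

/-- This lemma and the next two treat the position of the block `{p}`. The position `p + 1` is a
hole before the twist and `p` is one after it, so the transport must keep both in place and commute
with `r p`. -/
theorem twist_casimir_first (hJ : J ⊆ Finset.Icc 1 n) (hL : L ⊆ Finset.Icc 1 n) (hpJ : AWLt {p + 1} J)
    (hpL : AWLt {p + 1} L) (hJL : AWLt J L) :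
    r p (awCasimir q n {p} J L) = awCasimir q n {p + 1} J L := by
  obtain ⟨hps, hqs⟩ := pair_subset_Icc hp hpn
  have hpZ' : ∀ {Z : Finset ℕ}, AWLt {p + 1} Z → AWLt {p} Z := fun h a ha b hb => by
    rw [Finset.mem_singleton] at ha
    have := h (p + 1) (by simp) b hb
    omega
  rcases J.eq_empty_or_nonempty with rfl | hJ0
  · rw [D.awCasimir_empty_middle hps hL (hpZ' hpL), D.awCasimir_empty_middle hqs hL hpL, map_zero]
  rcases L.eq_empty_or_nonempty with rfl | hL0
  · rw [D.awCasimir_empty_right hps hJ (hpZ' hpJ), D.awCasimir_empty_right hqs hJ hpJ, map_zero]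
  obtain ⟨g, φ, a, b, c, d, T, hc, -, -, -, hcd, hdn, -, -, e3, e4, e5, e6⟩ :=
    D.exists_transport_pair hp hpn (X := ∅) (Y := ∅) (by simp) (by simp) hJ hL (by simp [AWLt])
      (by simp [AWLt]) (by simp [AWLt]) hpJ hpL hJL
  refine T.twist_casimir hc (by grind) (by grind) (by grind) (by grind) (by grind) (by grind) ?_
  have h1 := hJ0.image φ
  have h2 := hL0.image φ
  rw [e3, Finset.nonempty_Ioc] at h1
  rw [e4, Finset.nonempty_Ioc] at h2
  have S := D.chordSystem
  obtain ⟨H, hu⟩ := polygonCorner_pred hp hpn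
  rw [hu] at H
  rw [e3, e4, e5, e6]
  apply D.smul_inj
  rw [← map_smul, smul_awCasimir_holeLeft S D.ne_zero D.sq_ne_neg_one (by omega) (by omega) h1 h2 hdn,
    smul_awCasimir_Ioc S D.ne_zero D.sq_ne_neg_one (by omega) h1 h2 hdn]
  exact S.map_holeLeft (e := (r p).toAlgHom) H (hu ▸ D.twist p hpn) (by omega) h1 h2 hdn

theorem twist_casimir_middle (hI : I ⊆ Finset.Icc 1 n) (hL : L ⊆ Finset.Icc 1 n) (hIp : AWLt I {p})
    (hpL : AWLt {p + 1} L) : r p (awCasimir q n I {p} L) = awCasimir q n I {p + 1} L := by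
  obtain ⟨hps, hqs⟩ := pair_subset_Icc hp hpn
  rcases I.eq_empty_or_nonempty with rfl | hI0
  · rw [D.awCasimir_empty_left hps hL fun a ha b hb => ?_, D.awCasimir_empty_left hqs hL hpL, map_zero]
    rw [Finset.mem_singleton] at ha
    have := hpL (p + 1) (by simp) b hb
    omega
  rcases L.eq_empty_or_nonempty with rfl | hL0
  · rw [D.awCasimir_empty_right hI hps hIp, D.awCasimir_empty_right hI hqs fun a ha b hb => ?_, map_zero]
    rw [Finset.mem_singleton] at hb
    have := hIp a ha p (by simp)
    omega
  obtain ⟨g, φ, a, b, c, d, T, hc, -, -, -, hcd, hdn, -, e2, e3, -, e5, e6⟩ :=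
    D.exists_transport_pair hp hpn (X := ∅) (W := ∅) (by simp) hI hL (by simp) (by simp [AWLt])
      (by simp [AWLt]) hIp hpL (by simp [AWLt]) (by simp [AWLt])
  refine T.twist_casimir hc (by grind) (by grind) (by grind) (by grind) (by grind) (by grind) ?_
  have h1 := hI0.image φ
  have h2 := hL0.image φ
  rw [e2, Finset.nonempty_Ioc] at h1
  rw [e3, Finset.nonempty_Ioc] at h2
  have S := D.chordSystem
  obtain ⟨H, hu⟩ := polygonCorner_pred hp hpn
  rw [hu] at H
  rw [e2, e3, e5, e6]
  apply D.smul_inj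
  rw [← map_smul, smul_awCasimir_holeRight S D.ne_zero D.sq_ne_neg_one h1 (by omega) (by omega) h2
      (by omega),
    smul_awCasimir_holeLeft S D.ne_zero D.sq_ne_neg_one h1 (by omega) (by omega) h2 (by omega)]
  exact S.map_holeRight (e := (r p).toAlgHom) H (hu ▸ D.twist p hpn) (by omega) h1 h2 (by omega)

theorem twist_casimir_last (hI : I ⊆ Finset.Icc 1 n) (hJ : J ⊆ Finset.Icc 1 n) (hIp : AWLt I {p})
    (hJp : AWLt J {p}) (hIJ : AWLt I J) :
    r p (awCasimir q n I J {p}) = awCasimir q n I J {p + 1} := by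
  obtain ⟨hps, hqs⟩ := pair_subset_Icc hp hpn
  have hXq : ∀ {X : Finset ℕ}, AWLt X {p} → AWLt X {p + 1} := fun h a ha b hb => by
    rw [Finset.mem_singleton] at hb
    have := h a ha p (by simp)
    omega
  rcases I.eq_empty_or_nonempty with rfl | hI0
  · rw [D.awCasimir_empty_left hJ hps hJp, D.awCasimir_empty_left hJ hqs (hXq hJp), map_zero]
  rcases J.eq_empty_or_nonempty with rfl | hJ0
  · rw [D.awCasimir_empty_middle hI hps hIp, D.awCasimir_empty_middle hI hqs (hXq hIp), map_zero]
  obtain ⟨g, φ, a, b, c, d, T, hc, -, -, -, hcd, hdn, e1, e2, -, -, e5, e6⟩ :=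
    D.exists_transport_pair hp hpn (Z := ∅) (W := ∅) hI hJ (by simp) (by simp) hIJ hIp hJp
      (by simp [AWLt]) (by simp [AWLt]) (by simp [AWLt])
  refine T.twist_casimir hc (by grind) (by grind) (by grind) (by grind) (by grind) (by grind) ?_
  have h1 := hI0.image φ
  have h2 := hJ0.image φ
  rw [e1, Finset.nonempty_Ioc] at h1
  rw [e2, Finset.nonempty_Ioc] at h2
  have S := D.chordSystem
  obtain ⟨H, hu⟩ := polygonCorner_pred hp hpn
  rw [hu] at H
  rw [e1, e2, e5, e6]
  apply D.smul_inj
  rw [← map_smul, smul_awCasimir_Ioc S D.ne_zero D.sq_ne_neg_one h1 h2 (by omega) (by omega),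
    smul_awCasimir_holeRight S D.ne_zero D.sq_ne_neg_one h1 h2 (by omega) (by omega) (by omega)]
  exact S.map_chordCasimir_last (e := (r p).toAlgHom) H (hu ▸ D.twist p hpn) (by omega) h1 h2

theorem twist_casimir_pair_left (hL : L ⊆ Finset.Icc 1 n) (hpL : AWLt {p + 1} L) :
    r p (awCasimir q n {p} {p + 1} L) = awCasimir q n {p} {p + 1} L := by
  obtain ⟨hps, hqs⟩ := pair_subset_Icc hp hpn
  have hpq : AWLt {p} {p + 1} := by intro a ha b hb; simp only [Finset.mem_singleton] at ha hb; omega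
  rcases L.eq_empty_or_nonempty with rfl | hL0
  · rw [D.awCasimir_empty_right hps hqs hpq, map_zero]
  obtain ⟨g, φ, a, b, c, d, T, hc, -, -, -, hcd, hdn, -, -, e3, -, e5, e6⟩ :=
    D.exists_transport_pair hp hpn (X := ∅) (Y := ∅) (W := ∅) (by simp) (by simp) hL (by simp)
      (by simp [AWLt]) (by simp [AWLt]) (by simp [AWLt]) hpL (by simp [AWLt]) (by simp [AWLt])
  refine T.twist_casimir hc (by grind) (by grind) (by grind) (by grind) (by grind) (by grind) ?_
  have h1 := hL0.image φ
  rw [e3, Finset.nonempty_Ioc] at h1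
  have S := D.chordSystem
  obtain ⟨H, hu⟩ := polygonCorner_pred hp hpn
  rw [hu] at H
  rw [e3, e5, e6]
  apply D.smul_inj
  rw [← map_smul, smul_awCasimir_Ioc S D.ne_zero D.sq_ne_neg_one (by omega) (by omega) h1 (by omega)]
  exact S.map_chordCasimir_self (e := (r p).toAlgHom) H (hu ▸ D.twist p hpn) (by omega) (by omega)
    (Or.inl (by omega)) (by omega) (by omega)

theorem twist_casimir_pair_right (hI : I ⊆ Finset.Icc 1 n) (hIp : AWLt I {p}) :
    r p (awCasimir q n I {p} {p + 1}) = awCasimir q n I {p} {p + 1} := by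
  obtain ⟨hps, hqs⟩ := pair_subset_Icc hp hpn
  have hpq : AWLt {p} {p + 1} := by intro a ha b hb; simp only [Finset.mem_singleton] at ha hb; omega
  rcases I.eq_empty_or_nonempty with rfl | hI0
  · rw [D.awCasimir_empty_left hps hqs hpq, map_zero]
  obtain ⟨g, φ, a, b, c, d, T, hc, -, -, -, hcd, hdn, -, e2, -, -, e5, e6⟩ :=
    D.exists_transport_pair hp hpn (X := ∅) (Z := ∅) (W := ∅) (by simp) hI (by simp) (by simp)
      (by simp [AWLt]) (by simp [AWLt]) hIp (by simp [AWLt]) (by simp [AWLt]) (by simp [AWLt])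
  refine T.twist_casimir hc (by grind) (by grind) (by grind) (by grind) (by grind) (by grind) ?_
  have h1 := hI0.image φ
  rw [e2, Finset.nonempty_Ioc] at h1
  have S := D.chordSystem
  obtain ⟨H, hu⟩ := polygonCorner_pred hp hpn
  rw [hu] at H
  rw [e2, e5, e6]
  apply D.smul_inj
  rw [← map_smul, smul_awCasimir_Ioc S D.ne_zero D.sq_ne_neg_one h1 (by omega) (by omega) (by omega),
    ← S.chordCasimir_rotate (a := b) (Or.inl (by omega)) (by omega) (by omega) (by omega) (by omega)]
  exact S.map_chordCasimir_self (e := (r p).toAlgHom) H (hu ▸ D.twist p hpn) (by omega) (by omega)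
    (Or.inr (Or.inr (Or.inr (by omega)))) (by omega) (by omega)

end Corner

end HalfTwists

end SetCasimirs

/-! ### Alternating sums over subsets -/

section AltSum

variable {A B : Type*} [AddCommGroup A] [AddCommGroup B]

/-- The alternating sum over the subsets of a finite set. -/
def altSum (U : Finset ℕ) (f : Finset ℕ → A) : A := ∑ T ∈ U.powerset, (-1 : ℤ) ^ T.card • f T

variable {U V : Finset ℕ} {f g : Finset ℕ → A}

theorem altSum_congr (h : ∀ T, T ⊆ U → f T = g T) : altSum U f = altSum U g :=
  Finset.sum_congr rfl fun T hT => by rw [h T (Finset.mem_powerset.mp hT)]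

theorem altSum_sub : altSum U (fun T => f T - g T) = altSum U f - altSum U g := by
  simp only [altSum, smul_sub, Finset.sum_sub_distrib]

theorem altSum_zero : altSum U (fun _ => (0 : A)) = 0 := by simp [altSum]

theorem altSum_empty : altSum ∅ f = f ∅ := by simp [altSum]

theorem altSum_insert {a : ℕ} (ha : a ∉ U) :
    altSum (insert a U) f = altSum U f - altSum U (fun T => f (insert a T)) := by
  rw [altSum, Finset.sum_powerset_insert ha, sub_eq_add_neg, altSum, altSum, ← Finset.sum_neg_distrib]
  congr 1
  refine Finset.sum_congr rfl fun T hT => ?_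
  rw [Finset.card_insert_of_notMem fun h => ha (Finset.mem_powerset.mp hT h), pow_succ, mul_neg_one,
    neg_smul]

/-- Subsets with and without a fixed element of `U` cancel in pairs. -/
theorem altSum_const (hU : U.Nonempty) (x : A) : altSum U (fun _ => x) = 0 := by
  obtain ⟨a, ha⟩ := hU
  rw [← Finset.insert_erase ha, altSum_insert (Finset.notMem_erase a U), sub_self]

theorem altSum_union (h : Disjoint U V) :
    altSum (U ∪ V) f = altSum U fun X => altSum V fun Y => f (X ∪ Y) := by
  induction U using Finset.induction_on generalizing f with
  | empty => simp only [Finset.empty_union, altSum_empty]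
  | insert a s ha ih =>
    obtain ⟨h1, h2⟩ := Finset.disjoint_insert_left.mp h
    rw [Finset.insert_union, altSum_insert (by simp [ha, h1]), ih h2, ih h2, altSum_insert ha]
    simp only [Finset.insert_union]

theorem altSum_image {φ : ℕ → ℕ} (h : Set.InjOn φ U) :
    altSum (U.image φ) f = altSum U fun T => f (T.image φ) := by
  have key : ∀ s : Finset ℕ, Set.InjOn φ s → ∀ f : Finset ℕ → A,
      altSum (s.image φ) f = altSum s fun T => f (T.image φ) := by
    intro s
    induction s using Finset.induction_on with
    | empty => intro _ f; simp only [Finset.image_empty, altSum_empty]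
    | insert a s ha ih =>
      intro hs f
      have h1 : φ a ∉ s.image φ := fun h1 => by
        obtain ⟨x, hx, hxa⟩ := Finset.mem_image.mp h1
        exact ha (hs (by simp [hx]) (by simp) hxa ▸ hx)
      have h2 : Set.InjOn φ s := hs.mono (by simp)
      rw [Finset.image_insert, altSum_insert h1, altSum_insert ha, ih h2, ih h2]
      simp only [Finset.image_insert]
  exact key U h f

theorem map_altSum (e : A →+ B) : e (altSum U f) = altSum U fun T => e (f T) := by
  simp only [altSum, map_sum, map_zsmul]

/-- The term of the full set has coefficient one after the normalization of the sign, and all other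
terms lie in `M`. -/
theorem altSum_sub_mem {S : Type*} [SetLike S A] [AddSubgroupClass S A] (M : S)
    (h : ∀ T, T ⊂ U → f T ∈ M) : (-1 : ℤ) ^ U.card • altSum U f - f U ∈ M := by
  rw [altSum, ← Finset.sum_erase_add _ _ (Finset.mem_powerset_self U), smul_add, smul_smul, ← mul_pow,
    neg_one_mul, neg_neg, one_pow, one_smul, add_sub_cancel_right]
  refine zsmul_mem (sum_mem fun T hT => zsmul_mem (h T ?_) _) _
  rw [Finset.mem_erase, Finset.mem_powerset] at hT
  exact hT.2.ssubset_of_ne hT.1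

theorem altSum_mem {S : Type*} [SetLike S A] [AddSubgroupClass S A] (M : S)
    (h : ∀ T, T ⊆ U → f T ∈ M) : altSum U f ∈ M :=
  sum_mem fun T hT => zsmul_mem (h T (Finset.mem_powerset.mp hT)) _

end AltSum

/-! ### Cuts of a set and the sums that define `ω_S` -/

section Cuts

theorem AWLt.disjoint {I J : Finset ℕ} (h : AWLt I J) : Disjoint I J :=
  Finset.disjoint_left.mpr fun a ha hb => (h a ha a hb).false

theorem AWLt.trans {I J L : Finset ℕ} (h : AWLt I J) (h' : AWLt J L) (hJ : J.Nonempty) : AWLt I L :=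
  fun a ha b hb => by
    obtain ⟨c, hc⟩ := hJ
    exact (h a ha c hc).trans (h' c hc b hb)

theorem AWLt.union_right {I J L : Finset ℕ} (h : AWLt I J) (h' : AWLt I L) : AWLt I (J ∪ L) :=
  fun a ha b hb => (Finset.mem_union.mp hb).elim (fun h1 => h a ha b h1) fun h1 => h' a ha b h1

variable {S I J L I' J' L' : Finset ℕ}

theorem AWCut.lt (h : AWCut S I J L) : AWLt I L := by
  obtain ⟨-, h2, -, h4, h5, -⟩ := h
  exact h4.trans h5 h2

theorem AWCut.card_eq (h : AWCut S I J L) : S.card = I.card + J.card + L.card := by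
  have h6 := h.lt
  obtain ⟨-, -, -, h4, h5, rfl⟩ := h
  rw [Finset.card_union_of_disjoint (h6.union_left h5).disjoint, Finset.card_union_of_disjoint h4.disjoint]

/-- The exponent in the definition is a truncated difference. Since `N` is the sum of the three
cardinalities no truncation takes place, and the sign factors. -/
theorem sum_powerset_eq_altSum {A : Type*} [Ring A] (f : Finset ℕ → Finset ℕ → Finset ℕ → A) {N : ℕ}
    (hc : N = I.card + J.card + L.card) :
    ∑ I' ∈ I.powerset, ∑ J' ∈ J.powerset, ∑ L' ∈ L.powerset,
      (-1 : A) ^ (N - I'.card - J'.card - L'.card) * f I' J' L' =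
    (-1 : A) ^ N * altSum I fun I' => altSum J fun J' => altSum L fun L' => f I' J' L' := by
  have e1 : (-1 : A) ^ N = ((-1 : ℤ) ^ N : ℤ) := by push_cast; rfl
  rw [e1, ← zsmul_eq_mul]
  simp only [altSum, Finset.smul_sum, smul_smul]
  refine Finset.sum_congr rfl fun I' hI => Finset.sum_congr rfl fun J' hJ =>
    Finset.sum_congr rfl fun L' hL => ?_
  have h1 := Finset.card_le_card (Finset.mem_powerset.mp hI)
  have h2 := Finset.card_le_card (Finset.mem_powerset.mp hJ)
  have h3 := Finset.card_le_card (Finset.mem_powerset.mp hL)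
  obtain ⟨d, hd⟩ : ∃ d, N = I'.card + J'.card + L'.card + d :=
    ⟨N - (I'.card + J'.card + L'.card), by omega⟩
  have h4 : (-1 : ℤ) ^ N * (-1) ^ I'.card * (-1) ^ J'.card * (-1) ^ L'.card = (-1) ^ d := by
    have key : ∀ k : ℕ, (-1 : ℤ) ^ k * (-1) ^ k = 1 := fun k => by rw [← mul_pow]; simp
    rw [hd, pow_add, pow_add, pow_add]
    linear_combination ((-1) ^ d * (-1) ^ J'.card * (-1) ^ J'.card * (-1) ^ L'.card * (-1) ^ L'.card) *
      key I'.card + ((-1) ^ d * (-1) ^ L'.card * (-1) ^ L'.card) * key J'.card +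
      ((-1) ^ d) * key L'.card
  rw [← mul_assoc, ← mul_assoc, h4, hd, show I'.card + J'.card + L'.card + d - I'.card - J'.card - L'.card = d by omega,
    zsmul_eq_mul]
  push_cast
  rfl

theorem altSum_triple_sub_mem {A S : Type*} [Ring A] [SetLike S A] [AddSubgroupClass S A] (M : S)
    (f : Finset ℕ → Finset ℕ → Finset ℕ → A) {N : ℕ} (hc : N = I.card + J.card + L.card)
    (h : ∀ I' J' L', I' ⊆ I → J' ⊆ J → L' ⊆ L → I'.card + J'.card + L'.card < N → f I' J' L' ∈ M) :
    (-1 : A) ^ N * (altSum I fun I' => altSum J fun J' => altSum L fun L' => f I' J' L') - f I J L ∈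
      M := by
  have e1 : (-1 : A) ^ N = ((-1 : ℤ) ^ N : ℤ) := by push_cast; rfl
  have h1 := altSum_sub_mem (U := I) (f := fun I' => (-1 : ℤ) ^ J.card • altSum J fun J' =>
    (-1 : ℤ) ^ L.card • altSum L fun L' => f I' J' L') M fun T hT => zsmul_mem (altSum_mem _ fun J' hJ =>
      zsmul_mem (altSum_mem _ fun L' hL => h _ _ _ hT.1 hJ hL (by
        have := Finset.card_lt_card hT
        have := Finset.card_le_card hJ
        have := Finset.card_le_card hL
        omega)) _) _
  have h2 := altSum_sub_mem (U := J) (f := fun J' => (-1 : ℤ) ^ L.card • altSum L fun L' => f I J' L') M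
    fun T hT => zsmul_mem (altSum_mem _ fun L' hL => h _ _ _ subset_rfl hT.1 hL (by
        have := Finset.card_lt_card hT
        have := Finset.card_le_card hL
        omega)) _
  have h3 := altSum_sub_mem (U := L) (f := fun L' => f I J L') M
    fun T hT => h _ _ _ subset_rfl subset_rfl hT.1 (by
        have := Finset.card_lt_card hT
        omega)
  rw [e1, ← zsmul_eq_mul]
  convert add_mem (add_mem h1 h2) h3 using 1
  have key : ∀ (U : Finset ℕ) (k : ℤ) (g : Finset ℕ → A),
      altSum U (fun T => k • g T) = k • altSum U g := fun U k g => by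
    rw [altSum, altSum, Finset.smul_sum]
    exact Finset.sum_congr rfl fun T _ => smul_comm _ _ _
  simp only [key, smul_smul, hc, pow_add, mul_assoc]
  abel

theorem AWCut.image {φ : ℕ → ℕ} (h : AWCut S I J L) (hφ : StrictMonoOn φ S) :
    AWCut (S.image φ) (I.image φ) (J.image φ) (L.image φ) := by
  obtain ⟨h1, h2, h3, h4, h5, rfl⟩ := h
  have key : ∀ {X Y : Finset ℕ}, X ⊆ I ∪ J ∪ L → Y ⊆ I ∪ J ∪ L → AWLt X Y →
      AWLt (X.image φ) (Y.image φ) := by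
    intro X Y hX hY hXY a ha b hb
    obtain ⟨x, hx, rfl⟩ := Finset.mem_image.mp ha
    obtain ⟨y, hy, rfl⟩ := Finset.mem_image.mp hb
    exact hφ (hX hx) (hY hy) (hXY x hx y hy)
  exact ⟨h1.image φ, h2.image φ, h3.image φ, key (by grind) (by grind) h4, key (by grind) (by grind) h5,
    by rw [Finset.image_union, Finset.image_union]⟩

/-- The reference cut, to which all other cuts are compared, has the minimum and the maximum as
outer blocks. -/
theorem exists_awCut (h : 3 ≤ S.card) : ∃ m M, m ∈ S ∧ M ∈ S ∧ (∀ x ∈ S, m ≤ x ∧ x ≤ M) ∧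
    AWCut S {m} (S \ {m, M}) {M} := by
  have hS : S.Nonempty := Finset.card_pos.mp (by omega)
  have hm := S.min'_mem hS
  have hM := S.max'_mem hS
  have hx : ∀ x ∈ S, S.min' hS ≤ x ∧ x ≤ S.max' hS := fun x hx => ⟨S.min'_le x hx, S.le_max' x hx⟩
  refine ⟨_, _, hm, hM, hx, ⟨_, Finset.mem_singleton_self _⟩, ?_, ⟨_, Finset.mem_singleton_self _⟩, ?_, ?_,
    ?_⟩
  · rw [← Finset.card_pos]
    have := Finset.le_card_sdiff {S.min' hS, S.max' hS} S
    have := Finset.card_le_two (a := S.min' hS) (b := S.max' hS)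
    omega
  · intro a ha b hb
    simp only [Finset.mem_singleton, Finset.mem_sdiff, Finset.mem_insert, not_or] at ha hb
    have := hx b hb.1
    omega
  · intro a ha b hb
    simp only [Finset.mem_singleton, Finset.mem_sdiff, Finset.mem_insert, not_or] at ha hb
    have := hx a ha.1
    omega
  · grind

variable {K : Type*} [Field K] {q : K} {n : ℕ}

theorem awOmega_of_card_lt (h : S.card < 3) : awOmega q n S = 0 := by
  rw [awOmega, dif_neg]
  rintro ⟨t, ht⟩
  have := ht.card_eq
  have := ht.1.card_pos
  have := ht.2.1.card_pos
  have := ht.2.2.1.card_pos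
  omega

theorem awOmegaCut_eq (h : AWCut S I J L) : awOmegaCut q n S I J L = (-1 : AW K q n) ^ S.card *
    altSum I fun I' => altSum J fun J' => altSum L fun L' => awCasimir q n I' J' L' :=
  sum_powerset_eq_altSum _ h.card_eq

/-- Automorphisms that permute the Casimir elements act on their alternating sums. -/
theorem map_awOmegaCut {e : AW K q n ≃ₐ[K] AW K q n} {φ : ℕ → ℕ} (h : AWCut S I J L)
    (hφ : Set.InjOn φ S)
    (h' : AWCut (S.image φ) (I.image φ) (J.image φ) (L.image φ)) (he : ∀ I' J' L', I' ⊆ I → J' ⊆ J → L' ⊆ L →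
      e (awCasimir q n I' J' L') = awCasimir q n (I'.image φ) (J'.image φ) (L'.image φ)) :
    e (awOmegaCut q n S I J L) =
      awOmegaCut q n (S.image φ) (I.image φ) (J.image φ) (L.image φ) := by
  obtain ⟨-, -, -, -, -, hS⟩ := id h
  have hI : Set.InjOn φ I := hφ.mono (by rw [← hS]; grind)
  have hJ : Set.InjOn φ J := hφ.mono (by rw [← hS]; grind)
  have hL : Set.InjOn φ L := hφ.mono (by rw [← hS]; grind)
  rw [awOmegaCut_eq h, awOmegaCut_eq h', map_mul, map_pow, map_neg, map_one, Finset.card_image_of_injOn hφ, altSum_image hI]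
  have key : ∀ (U : Finset ℕ) (f : Finset ℕ → AW K q n), e (altSum U f) = altSum U fun T => e (f T) :=
    fun U f => map_altSum (e : AW K q n →+ AW K q n)
  congr 1
  rw [key]
  refine altSum_congr fun I' hI' => ?_
  rw [key, altSum_image hJ]
  refine altSum_congr fun J' hJ' => ?_
  rw [key, altSum_image hL]
  exact altSum_congr fun L' hL' => he I' J' L' hI' hJ' hL'

end Cuts

/-! ### Independence of the cut -/

section Omega

namespace HalfTwists

variable {K : Type*} [Field K] {q : K} {n : ℕ} {r : ℕ → (AW K q n ≃ₐ[K] AW K q n)}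
  {g : AW K q n ≃ₐ[K] AW K q n} {φ : ℕ → ℕ} {S U I J L M : Finset ℕ}

variable (D : HalfTwists q n r)
include D

/-- The block `J` may be moved from the first to the second argument: the alternating sum of the
cocycle identity has this difference on one side. -/
theorem altSum_casimir_left (hI : I ⊆ Finset.Icc 1 n) (hJ : J ⊆ Finset.Icc 1 n)
    (hL : L ⊆ Finset.Icc 1 n) (hM : M ⊆ Finset.Icc 1 n) (hIJ : AWLt I J) (hIL : AWLt I L)
    (hIM : AWLt I M) (hJL : AWLt J L) (hJM : AWLt J M) (hLM : AWLt L M) (hI0 : I.Nonempty)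
    (hL0 : L.Nonempty) :
    (altSum (I ∪ J) fun x => altSum L fun y => altSum M fun z => awCasimir q n x y z) =
      altSum I fun x => altSum (J ∪ L) fun y => altSum M fun z => awCasimir q n x y z := by
  -- Each of the two terms on the other side does not depend on one of the four variables, `x` or
  -- `z`, so its alternating sum vanishes.
  have e1 : (altSum I fun x => altSum J fun y => altSum L fun z => altSum M fun w =>
      awCasimir q n y z w - awCasimir q n x y w) = 0 := by
    simp only [altSum_sub]
    rw [altSum_const hI0]
    simp only [altSum_const hL0, altSum_zero, sub_zero]
  rw [altSum_union hIJ.disjoint, ← sub_eq_zero, ← altSum_sub, ← e1]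
  refine altSum_congr fun x hx => ?_
  rw [altSum_union hJL.disjoint, ← altSum_sub]
  refine altSum_congr fun y hy => ?_
  rw [← altSum_sub]
  refine altSum_congr fun z hz => ?_
  rw [← altSum_sub]
  refine altSum_congr fun w hw => ?_
  exact D.casimir_cocycle_left (hx.trans hI) (hy.trans hJ) (hz.trans hL) (hw.trans hM) (hIJ.mono hx hy)
    (hIL.mono hx hz) (hIM.mono hx hw) (hJL.mono hy hz) (hJM.mono hy hw) (hLM.mono hz hw)

theorem altSum_casimir_right (hI : I ⊆ Finset.Icc 1 n) (hJ : J ⊆ Finset.Icc 1 n)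
    (hL : L ⊆ Finset.Icc 1 n) (hM : M ⊆ Finset.Icc 1 n) (hIJ : AWLt I J) (hIL : AWLt I L)
    (hIM : AWLt I M) (hJL : AWLt J L) (hJM : AWLt J M) (hLM : AWLt L M) (hJ0 : J.Nonempty)
    (hM0 : M.Nonempty) :
    (altSum I fun x => altSum (J ∪ L) fun y => altSum M fun z => awCasimir q n x y z) =
      altSum I fun x => altSum J fun y => altSum (L ∪ M) fun z => awCasimir q n x y z := by
  have e1 : (altSum I fun x => altSum J fun y => altSum L fun z => altSum M fun w =>
      awCasimir q n x z w - awCasimir q n x y z) = 0 := by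
    simp only [altSum_sub]
    simp only [altSum_const hJ0, altSum_const hM0, altSum_zero, sub_zero]
  rw [← sub_eq_zero, ← altSum_sub, ← e1]
  refine altSum_congr fun x hx => ?_
  rw [altSum_union hJL.disjoint, ← altSum_sub]
  refine altSum_congr fun y hy => ?_
  rw [altSum_union hLM.disjoint, ← altSum_sub]
  refine altSum_congr fun z hz => ?_
  rw [← altSum_sub]
  refine altSum_congr fun w hw => ?_
  exact D.casimir_cocycle_right (hx.trans hI) (hy.trans hJ) (hz.trans hL) (hw.trans hM) (hIJ.mono hx hy)
    (hIL.mono hx hz) (hIM.mono hx hw) (hJL.mono hy hz) (hJM.mono hy hw) (hLM.mono hz hw)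

/-- All of `I` except the minimum, and all of `L` except the maximum, are moved to the middle block.
-/
theorem awOmegaCut_eq_minMax (hS : S ⊆ Finset.Icc 1 n) (h : AWCut S I J L) {m k : ℕ} (hm : m ∈ S)
    (hk : k ∈ S) (hx : ∀ x ∈ S, m ≤ x ∧ x ≤ k) (h' : AWCut S {m} (S \ {m, k}) {k}) :
    awOmegaCut q n S I J L = awOmegaCut q n S {m} (S \ {m, k}) {k} := by
  have hIL := h.lt
  rw [awOmegaCut_eq h, awOmegaCut_eq h']
  obtain ⟨hI, hJ, hL, hIJ, hJL, h6⟩ := h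
  have hIS : I ⊆ S := by grind
  have hJS : J ⊆ S := by grind
  have hLS : L ⊆ S := by grind
  have hmI : m ∈ I := by
    obtain ⟨i, hi⟩ := hI
    have := hx i (hIS hi)
    rw [← h6] at hm
    rcases Finset.mem_union.mp hm with hm | hm
    · rcases Finset.mem_union.mp hm with hm | hm
      · exact hm
      · have := hIJ i hi m hm; omega
    · have := hIL i hi m hm; omega
  have hkL : k ∈ L := by
    obtain ⟨i, hi⟩ := hL
    have := hx i (hLS hi)
    rw [← h6] at hk
    rcases Finset.mem_union.mp hk with hk | hk
    · rcases Finset.mem_union.mp hk with hk | hk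
      · have := hIL k hk i hi; omega
      · have := hJL k hk i hi; omega
    · exact hk
  have e1 : I = {m} ∪ I.erase m := by rw [← Finset.insert_eq, Finset.insert_erase hmI]
  have e2 : L = L.erase k ∪ {k} := by
    rw [Finset.union_comm, ← Finset.insert_eq, Finset.insert_erase hkL]
  have hm' : ({m} : Finset ℕ) ⊆ I := by simpa using hmI
  have hk' : ({k} : Finset ℕ) ⊆ L := by simpa using hkL
  have hI' := Finset.erase_subset m I
  have hL' := Finset.erase_subset k L
  have e3 : S \ {m, k} = I.erase m ∪ J ∪ L.erase k := by
    have h1 : k ∉ I := fun h => (hIL k h k hkL).false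
    have h2 : m ∉ L := fun h => (hIL m hmI m h).false
    have h3 : k ∉ J := fun h => (hJL k h k hkL).false
    have h4 : m ∉ J := fun h => (hIJ m hmI m h).false
    rw [← h6]
    ext x
    rcases eq_or_ne x m with rfl | hxm
    · simp [h2, h4]
    rcases eq_or_ne x k with rfl | hxk
    · simp [h1, h3]
    · simp [hxm, hxk]
  have hmI' : AWLt {m} (I.erase m) := fun a ha b hb => by
    rw [Finset.mem_singleton] at ha
    have := hx b (hIS (hI' hb))
    have := Finset.ne_of_mem_erase hb
    omega
  have hkL' : AWLt (L.erase k) {k} := fun a ha b hb => by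
    rw [Finset.mem_singleton] at hb
    have := hx a (hLS (hL' ha))
    have := Finset.ne_of_mem_erase ha
    omega
  congr 1
  calc _ = altSum ({m} ∪ I.erase m) fun I' => altSum J fun J' => altSum L fun L' =>
        awCasimir q n I' J' L' := by rw [← e1]
    _ = altSum {m} fun I' => altSum (I.erase m ∪ J) fun J' => altSum (L.erase k ∪ {k}) fun L' =>
        awCasimir q n I' J' L' := by
      rw [← e2]
      exact D.altSum_casimir_left (hm'.trans (hIS.trans hS)) (hI'.trans (hIS.trans hS)) (hJS.trans hS)
        (hLS.trans hS) hmI' (hIJ.mono hm' subset_rfl) (hIL.mono hm' subset_rfl)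
        (hIJ.mono hI' subset_rfl) (hIL.mono hI' subset_rfl) hJL ⟨m, by simp⟩ hJ
    _ = _ := by
      rw [← D.altSum_casimir_right (hm'.trans (hIS.trans hS))
        (Finset.union_subset (hI'.trans (hIS.trans hS)) (hJS.trans hS)) (hL'.trans (hLS.trans hS))
        (hk'.trans (hLS.trans hS)) (hmI'.union_right (hIJ.mono hm' subset_rfl)) (hIL.mono hm' hL')
        (hIL.mono hm' hk') ((hIL.mono hI' hL').union_left (hJL.mono subset_rfl hL'))
        ((hIL.mono hI' hk').union_left (hJL.mono subset_rfl hk')) hkL' (hJ.mono (by grind)) ⟨k, by simp⟩,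
        e3]

theorem awOmegaCut_eq_awOmega (hS : S ⊆ Finset.Icc 1 n) (h : AWCut S I J L) :
    awOmegaCut q n S I J L = awOmega q n S := by
  have h0 : ∃ t : Finset ℕ × Finset ℕ × Finset ℕ, AWCut S t.1 t.2.1 t.2.2 := ⟨(I, J, L), h⟩
  obtain ⟨m, k, hm, hk, hx, h'⟩ := exists_awCut (S := S) (by
    have := h.card_eq
    have := h.1.card_pos
    have := h.2.1.card_pos
    have := h.2.2.1.card_pos
    omega)
  rw [awOmega, dif_pos h0, D.awOmegaCut_eq_minMax hS h hm hk hx h',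
    D.awOmegaCut_eq_minMax hS h0.choose_spec hm hk hx h']

theorem map_awOmega {e : AW K q n ≃ₐ[K] AW K q n} (hS : S ⊆ Finset.Icc 1 n) (h : AWCut S I J L)
    (hφ : Set.InjOn φ S) (hφS : S.image φ ⊆ Finset.Icc 1 n)
    (h' : AWCut (S.image φ) (I.image φ) (J.image φ) (L.image φ)) (he : ∀ I' J' L', I' ⊆ I → J' ⊆ J → L' ⊆ L →
      e (awCasimir q n I' J' L') = awCasimir q n (I'.image φ) (J'.image φ) (L'.image φ)) :
    e (awOmega q n S) = awOmega q n (S.image φ) := by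
  rw [← D.awOmegaCut_eq_awOmega hS h, ← D.awOmegaCut_eq_awOmega hφS h']
  exact map_awOmegaCut h hφ h' he

theorem map_awOmega_self {e : AW K q n ≃ₐ[K] AW K q n} (hS : S ⊆ Finset.Icc 1 n) (h : AWCut S I J L)
    (he : ∀ I' J' L', I' ⊆ I → J' ⊆ J → L' ⊆ L →
      e (awCasimir q n I' J' L') = awCasimir q n I' J' L') : e (awOmega q n S) = awOmega q n S := by
  have := D.map_awOmega (φ := id) (e := e) hS h (Set.injOn_id _) (by simpa using hS) (by simpa using h)
    (by simpa using he)
  simpa using this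

theorem transport_awOmega (T : Transport q n g φ S) (hS : S ⊆ Finset.Icc 1 n) :
    g (awOmega q n S) = awOmega q n (S.image φ) := by
  rcases lt_or_ge S.card 3 with h | h
  · rw [awOmega_of_card_lt h, awOmega_of_card_lt (Finset.card_image_le.trans_lt h), map_zero]
  · obtain ⟨m, k, -, -, -, h'⟩ := exists_awCut h
    obtain ⟨-, -, -, -, -, h6⟩ := id h'
    exact D.map_awOmega hS h' T.mono.injOn T.mem (h'.image T.mono) fun I' J' L' hI hJ hL =>
      T.casimir (hI.trans (by rw [← h6]; grind)) (hJ.trans (by grind)) (hL.trans (by rw [← h6]; grind))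

end HalfTwists

end Omega

/-! ### Quadrilaterals adapted to a chord -/

section CasimirCommute

variable {K A : Type*} [Field K] [Ring A] [Algebra K A] {p : K} {n : ℕ} {C : ℕ → ℕ → A}

theorem commute_chordCasimir {a b c d : ℕ} {t : A} (h₁ : Commute t (C a b)) (h₂ : Commute t (C b c))
    (h₃ : Commute t (C c d)) (h₄ : Commute t (C a d)) (hx : Commute t (C a c)) (hy : Commute t (C b d)) :
    Commute t (chordCasimir p C a b c d) := by
  refine ChordSystem.commute_quadCasimir hx hy ?_ h₁ h₂ h₃ h₄
  have h5 := hx.mul_right hy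
  have h6 := hy.mul_right hx
  have h7 := (h₁.mul_right h₃).add_right (h₂.mul_right h₄)
  exact h7.sub_right (((h5.smul_right p).sub_right h6).smul_right _)

namespace ChordSystem

variable {a b c d e : ℕ}

theorem chordCasimir_commute' (h : ChordSystem p n C) (H : Cyc5 a b c d e) (ha : a ≤ n)
    (hb : b ≤ n) (hc : c ≤ n) (hd : d ≤ n) (he : e ≤ n) :
    Commute (chordCasimir p C a b c d) (C b e) := by
  obtain ⟨M, P⟩ := h.exists_pentagon_vec H ha hb hc hd he
  have n1 : (-1 : Fin 5) = 4 := rfl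
  have n3 : (-3 : Fin 5) = 2 := rfl
  have n4 : (-4 : Fin 5) = 1 := rfl
  have := congrArg Subtype.val (P.reflect.casimir_commute 1)
  simp only [Pentagon.casimir, Subalgebra.coe_mul, M.val_quadCasimir,
    M.val_one_smul, M.val_d, M.val_v, n1, n3, n4,
    Fin.isValue, Fin.reduceAdd, Fin.reduceSub, neg_zero, zero_add] at this
  have H1 := H.quads.1
  have H2 := H1.rotate
  have S := h.sides (p := p) H2 hb hc hd ha
  rw [h.symm b e, ← h.chordCasimir_rotate_two H1 ha hb hc hd, h.chordCasimir_rotate H2 hb hc hd ha]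
  unfold chordCasimir
  rw [← (quadCasimir_klein (S _ (by tauto) _ (by tauto)) (S _ (by tauto) _ (by tauto))
      (S _ (by tauto) _ (by tauto)) (S _ (by tauto) _ (by tauto)) (S _ (by tauto) _ (by tauto))
      (S _ (by tauto) _ (by tauto))).1]
  rw [h.symm c a, h.symm b a]
  exact this

theorem commute_side (h : ChordSystem p n C) (H : Cyc4 a b c d) (ha : a ≤ n) (hb : b ≤ n) (hc : c ≤ n)
    (hd : d ≤ n) {s : A} (hs : s = C a b ∨ s = C b c ∨ s = C c d ∨ s = C a d) :
    Commute s (chordCasimir p C a b c d) :=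
  have S := h.sides (p := p) H ha hb hc hd s hs
  commute_chordCasimir (S _ (by tauto)) (S _ (by tauto)) (S _ (by tauto)) (S _ (by tauto))
    (S _ (by tauto)) (S _ (by tauto))

/-- The inner vertices `a` and `b` are chosen among the end points of the chord where this is
possible. Then the chord does not cross the quadrilateral, is one of its sides or diagonals, or
starts at one of its vertices and crosses a single side. -/
theorem exists_chordCasimir_commute (h : ChordSystem p n C) {k x y : ℕ} (hk : 3 ≤ k) (hkn : k ≤ n)
    (hxy : x < y) (hy : y ≤ n) :
    ∃ a b, 0 < a ∧ a < b ∧ b < k ∧ Commute (C x y) (chordCasimir p C 0 a b k) := by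
  have side : ∀ {a b}, 0 < a → a < b → b < k →
      ∀ s, (s = C 0 a ∨ s = C a b ∨ s = C b k ∨ s = C 0 k) → Commute s (chordCasimir p C 0 a b k) :=
    fun h1 h2 h3 s hs => h.commute_side (Or.inl (by omega)) (by omega) (by omega) (by omega) hkn hs
  rcases Nat.lt_or_ge k y with hky | hky
  · rcases Nat.eq_zero_or_pos x with rfl | hx
    · refine ⟨1, 2, by omega, by omega, by omega, ?_⟩
      have key : ∀ i j, i ≤ j → j ≤ k → Commute (C 0 y) (C i j) := fun i j hi hj =>
        (h.comm 0 i j y (by omega) hi (by omega) hy).2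
      exact commute_chordCasimir (key _ _ (by omega) (by omega)) (key _ _ (by omega) (by omega))
        (key _ _ (by omega) (by omega)) (key _ _ (by omega) (by omega)) (key _ _ (by omega) (by omega))
        (key _ _ (by omega) (by omega))
    rcases Nat.lt_or_ge x k with hxk | hxk
    · rcases Nat.lt_or_ge x 2 with hx2 | hx2
      · obtain rfl : x = 1 := by omega
        exact ⟨1, 2, by omega, by omega, by omega, (h.chordCasimir_commute' (Or.inl (by omega)) (by omega)
          (by omega) (by omega) (by omega) hy).symm⟩
      · exact ⟨1, x, by omega, by omega, by omega, (h.chordCasimir_commute (Or.inl (by omega)) (by omega)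
          (by omega) (by omega) (by omega) hy).symm⟩
    · refine ⟨1, 2, by omega, by omega, by omega, ?_⟩
      have key : ∀ i j, i ≤ j → j ≤ k → Commute (C x y) (C i j) := fun i j hi hj =>
        ((h.comm i j x y hi (by omega) hxy.le hy).1).symm
      exact commute_chordCasimir (key _ _ (by omega) (by omega)) (key _ _ (by omega) (by omega))
        (key _ _ (by omega) (by omega)) (key _ _ (by omega) (by omega)) (key _ _ (by omega) (by omega))
        (key _ _ (by omega) (by omega))
  · rcases Nat.eq_zero_or_pos x with rfl | hx
    · rcases Nat.lt_or_ge y k with hyk | hyk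
      · rcases Nat.lt_or_ge y 2 with hy2 | hy2
        · obtain rfl : y = 1 := by omega
          exact ⟨1, 2, by omega, by omega, by omega, side (by omega) (by omega) (by omega) _ (by tauto)⟩
        · refine ⟨1, y, by omega, by omega, by omega, ?_⟩
          rw [h.symm]
          exact (h.chordCasimir_commute (e := 0) (Or.inr (Or.inr (Or.inr (Or.inr (by omega))))) (by omega)
            (by omega) (by omega) (by omega) (by omega)).symm
      · obtain rfl : y = k := by omega
        exact ⟨1, 2, by omega, by omega, by omega, side (by omega) (by omega) (by omega) _ (by tauto)⟩
    rcases Nat.lt_or_ge y k with hyk | hyk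
    · exact ⟨x, y, by omega, by omega, by omega, side (by omega) (by omega) (by omega) _ (by tauto)⟩
    obtain rfl : y = k := by omega
    rcases Nat.lt_or_ge (x + 1) y with hx1 | hx1
    · exact ⟨x, x + 1, by omega, by omega, by omega, (h.chordCasimir_commute' (Or.inl (by omega)) (by omega)
        (by omega) (by omega) (by omega) (by omega)).symm⟩
    · exact ⟨1, x, by omega, by omega, by omega, side (by omega) (by omega) (by omega) _ (by tauto)⟩

end ChordSystem

end CasimirCommute

/-! ### Centrality of `ω_S` -/

section Center

variable {K : Type*} [Field K] {q : K} {n : ℕ}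

theorem mem_center_of_commute_awChord {z : AW K q n}
    (h : ∀ x y, x < y → y ≤ n → Commute (awChord q n x y) z) : z ∈ Subalgebra.center K (AW K q n) := by
  rw [Subalgebra.mem_center_iff]
  intro w
  obtain ⟨w, rfl⟩ := RingQuot.mkAlgHom_surjective K (AWRel K q n) w
  induction w using FreeAlgebra.induction with
  | grade0 c => rw [AlgHom.commutes]; exact Algebra.commutes c z
  | grade1 I =>
    obtain ⟨I, hI⟩ := I
    obtain ⟨a, b, hab, hb, rfl⟩ := awConn_iff.mp hI
    have := h a b hab hb
    rw [← awC_Ioc hab.le, awC, awFreeC, dif_pos hI] at this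
    exact this
  | mul u v hu hv => rw [map_mul, mul_assoc, hv, ← mul_assoc, hu, mul_assoc]
  | add u v hu hv => rw [map_add, add_mul, mul_add, hu, hv]

theorem map_mem_center {B : Type*} [Ring B] [Algebra K B] (g : B ≃ₐ[K] B) {x : B}
    (h : g x ∈ Subalgebra.center K B) : x ∈ Subalgebra.center K B := by
  rw [Subalgebra.mem_center_iff] at *
  intro b
  apply g.injective
  rw [map_mul, map_mul, h]

namespace HalfTwists

variable {r : ℕ → (AW K q n ≃ₐ[K] AW K q n)} {S I J L : Finset ℕ} (D : HalfTwists q n r)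
include D

/-- Casimir elements of three possibly empty blocks lie in a subgroup once this holds for non-empty
blocks. -/
theorem casimir_mem_of_nonempty {T : Type*} [SetLike T (AW K q n)] [AddSubgroupClass T (AW K q n)] (M : T)
    (hI : I ⊆ Finset.Icc 1 n) (hJ : J ⊆ Finset.Icc 1 n) (hL : L ⊆ Finset.Icc 1 n) (hIJ : AWLt I J)
    (hJL : AWLt J L) (hIL : AWLt I L)
    (h : I.Nonempty → J.Nonempty → L.Nonempty → awCasimir q n I J L ∈ M) : awCasimir q n I J L ∈ M := by
  rcases I.eq_empty_or_nonempty with rfl | hI0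
  · rw [D.awCasimir_empty_left hJ hL hJL]
    exact zero_mem M
  rcases J.eq_empty_or_nonempty with rfl | hJ0
  · rw [D.awCasimir_empty_middle hI hL hIL]
    exact zero_mem M
  rcases L.eq_empty_or_nonempty with rfl | hL0
  · rw [D.awCasimir_empty_right hI hJ hIJ]
    exact zero_mem M
  exact h hI0 hJ0 hL0

/-- The leading term of the alternating sum is the Casimir element of the cut. All other terms
belong to smaller sets, and those with an empty block vanish. -/
theorem awOmega_sub_casimir_mem {T : Type*} [SetLike T (AW K q n)] [AddSubgroupClass T (AW K q n)] (M : T)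
    (hS : S ⊆ Finset.Icc 1 n) (h : AWCut S I J L)
    (H : ∀ I' J' L', I' ⊆ I → J' ⊆ J → L' ⊆ L → AWCut (I' ∪ J' ∪ L') I' J' L' →
      (I' ∪ J' ∪ L').card < S.card → awCasimir q n I' J' L' ∈ M) :
    awOmega q n S - awCasimir q n I J L ∈ M := by
  have h0 := h.lt
  have h' := h
  rw [← D.awOmegaCut_eq_awOmega hS h, awOmegaCut_eq h]
  obtain ⟨-, -, -, h4, h5, h6⟩ := h'
  refine altSum_triple_sub_mem M _ h.card_eq fun I' J' L' hI hJ hL hc => ?_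
  refine D.casimir_mem_of_nonempty M (hI.trans (by grind)) (hJ.trans (by grind)) (hL.trans (by grind))
    (h4.mono hI hJ) (h5.mono hJ hL) (h0.mono hI hL) fun h1 h2 h3 => ?_
  have hcut : AWCut (I' ∪ J' ∪ L') I' J' L' := ⟨h1, h2, h3, h4.mono hI hJ, h5.mono hJ hL, rfl⟩
  exact H I' J' L' hI hJ hL hcut (by rwa [hcut.card_eq])

theorem casimir_mem {T : Type*} [SetLike T (AW K q n)] [AddSubgroupClass T (AW K q n)] (M : T)
    (H : ∀ S, S ⊆ Finset.Icc 1 n → awOmega q n S ∈ M) :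
    ∀ S I J L, S ⊆ Finset.Icc 1 n → AWCut S I J L → awCasimir q n I J L ∈ M := by
  intro S
  induction S using Finset.strongInductionOn with
  | _ S ih =>
    intro I J L hS h
    have := D.awOmega_sub_casimir_mem M hS h fun I' J' L' hI hJ hL hcut hc => by
      obtain ⟨-, -, -, -, -, h6⟩ := h
      have hs : I' ∪ J' ∪ L' ⊂ S := by
        refine Finset.ssubset_iff_subset_ne.mpr ⟨?_, fun h => absurd (h ▸ hc) (lt_irrefl _)⟩
        rw [← h6]
        exact Finset.union_subset_union (Finset.union_subset_union hI hJ) hL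
      exact ih _ hs I' J' L' (hs.1.trans hS) hcut
    simpa using sub_mem (H S hS) this

/-- Induction on the cardinality. Modulo the centre, `ω_S` is the Casimir element of any cut, since
the smaller ones are central. After transport of `S` to an interval there is, for every chord, a cut
whose Casimir element commutes with it. -/
theorem central_aux : ∀ m S I J L, S.card = m → S ⊆ Finset.Icc 1 n → AWCut S I J L →
    awOmega q n S ∈ Subalgebra.center K (AW K q n) ∧
      awCasimir q n I J L ∈ Subalgebra.center K (AW K q n) := by
  intro m
  induction m using Nat.strong_induction_on with
  | _ m ih =>
    intro S I J L hm hS h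
    have sub : ∀ S I J L, S.card = m → S ⊆ Finset.Icc 1 n → AWCut S I J L →
        awOmega q n S - awCasimir q n I J L ∈ Subalgebra.center K (AW K q n) := by
      intro S I J L hm hS h
      refine D.awOmega_sub_casimir_mem _ hS h fun I' J' L' hI hJ hL hcut hc =>
        (ih _ (hm ▸ hc) _ I' J' L' rfl ?_ hcut).2
      obtain ⟨-, -, -, -, -, h6⟩ := h
      refine subset_trans ?_ hS
      rw [← h6]
      exact Finset.union_subset_union (Finset.union_subset_union hI hJ) hL
    have hω : awOmega q n S ∈ Subalgebra.center K (AW K q n) := by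
      obtain ⟨g, φ, k, T, hk, hV⟩ := D.exists_transport_Ioc hS
      apply map_mem_center g
      rw [D.transport_awOmega T hS, hV]
      have hcard : (Finset.Ioc 0 k).card = m := by
        rw [← hV, Finset.card_image_of_injOn T.mono.injOn, hm]
      have hk3 : 3 ≤ k := by
        have := h.card_eq
        have := h.1.card_pos
        have := h.2.1.card_pos
        have := h.2.2.1.card_pos
        rw [Nat.card_Ioc] at hcard
        omega
      have hS' : Finset.Ioc 0 k ⊆ Finset.Icc 1 n := hV ▸ T.mem
      refine mem_center_of_commute_awChord fun x y hxy hy => ?_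
      obtain ⟨a, b, ha, hab, hbk, hc⟩ := D.chordSystem.exists_chordCasimir_commute hk3 hk hxy hy
      have hcut : AWCut (Finset.Ioc 0 k) (Finset.Ioc 0 a) (Finset.Ioc a b) (Finset.Ioc b k) := by
        refine ⟨by simpa using ha, by simpa using hab, by simpa using hbk, ?_, ?_, ?_⟩
        · intro x hx y hy
          rw [Finset.mem_Ioc] at hx hy
          omega
        · intro x hx y hy
          rw [Finset.mem_Ioc] at hx hy
          omega
        · rw [Ioc_union_Ioc (by omega) (by omega), Ioc_union_Ioc (by omega) (by omega)]
      have h1 := sub _ _ _ _ hcard hS' hcut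
      rw [Subalgebra.mem_center_iff] at h1
      rw [← smul_awCasimir_Ioc D.chordSystem D.ne_zero D.sq_ne_neg_one ha hab hbk hk] at hc
      have h2 := hc.smul_right (q * (q ^ 2 + 1))⁻¹
      rw [inv_smul_smul₀ D.scalar_ne] at h2
      have h3 := Commute.add_right (h1 (awChord q n x y)) h2
      rwa [sub_add_cancel] at h3
    refine ⟨hω, ?_⟩
    simpa using sub_mem hω (sub S I J L hm hS h)

theorem awOmega_mem_center (hS : S ⊆ Finset.Icc 1 n) :
    awOmega q n S ∈ Subalgebra.center K (AW K q n) := by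
  rcases lt_or_ge S.card 3 with h | h
  · rw [awOmega_of_card_lt h]
    exact zero_mem _
  · obtain ⟨m, k, -, -, -, h'⟩ := exists_awCut h
    exact (D.central_aux _ S _ _ _ rfl hS h').1

end HalfTwists

end Center

/-! ### The automorphisms `r_p` with `p ≥ 1` permute the `ω_S` -/

section Permutation

theorem exists_split {B : Finset ℕ} (h : 2 ≤ B.card) :
    ∃ J L : Finset ℕ, J.Nonempty ∧ L.Nonempty ∧ AWLt J L ∧ J ∪ L = B := by
  have hB : B.Nonempty := Finset.card_pos.mp (by omega)
  have hm := B.min'_mem hB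
  refine ⟨{B.min' hB}, B.erase (B.min' hB), by simp, ?_, fun a ha b hb => ?_, ?_⟩
  · rw [← Finset.card_pos, Finset.card_erase_of_mem hm]
    omega
  · rw [Finset.mem_singleton] at ha
    have := B.min'_le b (Finset.mem_of_mem_erase hb)
    have := Finset.ne_of_mem_erase hb
    omega
  · rw [← Finset.insert_eq, Finset.insert_erase hm]

theorem image_swap_subset_Icc {p n : ℕ} (hp : 1 ≤ p) (hpn : p < n) {S : Finset ℕ}
    (hS : S ⊆ Finset.Icc 1 n) : S.image (Equiv.swap p (p + 1)) ⊆ Finset.Icc 1 n := by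
  intro x hx
  obtain ⟨y, hy, rfl⟩ := Finset.mem_image.mp hx
  have := Finset.mem_Icc.mp (hS hy)
  rw [Equiv.swap_apply_def, Finset.mem_Icc]
  split_ifs <;> omega

namespace HalfTwists

variable {K : Type*} [Field K] {q : K} {n : ℕ} {r : ℕ → (AW K q n ≃ₐ[K] AW K q n)}
  {S I J L : Finset ℕ} (D : HalfTwists q n r) {p : ℕ} (hp : 1 ≤ p) (hpn : p < n)
include D hp hpn

theorem casimir_swap_of_notMem (hI : I ⊆ Finset.Icc 1 n) (hJ : J ⊆ Finset.Icc 1 n)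
    (hL : L ⊆ Finset.Icc 1 n) (h1 : p ∉ I) (h2 : p ∉ J) (h3 : p ∉ L) :
    r p (awCasimir q n I J L) = awCasimir q n (I.image (Equiv.swap p (p + 1)))
      (J.image (Equiv.swap p (p + 1))) (L.image (Equiv.swap p (p + 1))) :=
  (D.transport_down hp hpn (U := I ∪ J ∪ L) (Finset.union_subset (Finset.union_subset hI hJ) hL)
    (by simp [h1, h2, h3])).casimir (by grind) (by grind) (by grind)

/-- Although `r p` does not act on `C_S` by the transposition when `S` contains only `p`, it does so
on Casimir elements that have `{p}` as a block. The cut is chosen with `{p}` as the first, last or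
middle block, according to the letters below and above `p`. -/
theorem awOmega_swap_of_mem_of_notMem (hS : S ⊆ Finset.Icc 1 n) (h0 : p ∈ S) (h1 : p + 1 ∉ S) :
    r p (awOmega q n S) = awOmega q n (S.image (Equiv.swap p (p + 1))) := by
  have T := D.transport_up hp hpn hS h1
  rcases lt_or_ge S.card 3 with hc | hc
  · rw [awOmega_of_card_lt hc, awOmega_of_card_lt (Finset.card_image_le.trans_lt hc), map_zero]
  have ep : ({p} : Finset ℕ).image (Equiv.swap p (p + 1)) = {p + 1} := by simp
  have key : ∀ {I J L : Finset ℕ}, AWCut S I J L → (∀ I' J' L', I' ⊆ I → J' ⊆ J → L' ⊆ L →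
      p ∈ I' ∪ J' ∪ L' → r p (awCasimir q n I' J' L') = awCasimir q n (I'.image (Equiv.swap p (p + 1)))
      (J'.image (Equiv.swap p (p + 1))) (L'.image (Equiv.swap p (p + 1)))) →
      r p (awOmega q n S) = awOmega q n (S.image (Equiv.swap p (p + 1))) := by
    intro I J L hcut H
    have h6 := hcut.2.2.2.2.2
    refine D.map_awOmega hS hcut (Equiv.injective _).injOn (image_swap_subset_Icc hp hpn hS)
      (hcut.image T.mono) fun I' J' L' hI hJ hL => ?_
    by_cases h : p ∈ I' ∪ J' ∪ L'
    · exact H I' J' L' hI hJ hL h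
    · simp only [Finset.mem_union, not_or] at h
      exact D.casimir_swap_of_notMem hp hpn (hI.trans (by grind)) (hJ.trans (by grind))
        (hL.trans (by grind)) h.1.1 h.1.2 h.2
  have fixed : ∀ {X : Finset ℕ}, X ⊆ S.erase p → X.image (Equiv.swap p (p + 1)) = X := fun h =>
    image_swap_eq_self (iff_of_false (fun h' => absurd (h h') (by simp))
      fun h' => h1 (Finset.mem_of_mem_erase (h h')))
  have hA : AWLt (S.filter (· < p)) {p} := fun a ha b hb => by
    rw [Finset.mem_singleton] at hb
    have := (Finset.mem_filter.mp ha).2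
    omega
  have hB : AWLt {p + 1} (S.filter (p < ·)) := fun a ha b hb => by
    rw [Finset.mem_singleton] at ha
    have h2 := Finset.mem_filter.mp hb
    have h3 : b ≠ p + 1 := fun h => h1 (h ▸ h2.1)
    omega
  have hB' : AWLt {p} (S.filter (p < ·)) := fun a ha b hb => by
    rw [Finset.mem_singleton] at ha
    have := (Finset.mem_filter.mp hb).2
    omega
  have hAs : S.filter (· < p) ⊆ S.erase p := fun x hx => by
    have := Finset.mem_filter.mp hx
    exact Finset.mem_erase.mpr ⟨by omega, this.1⟩
  have hBs : S.filter (p < ·) ⊆ S.erase p := fun x hx => by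
    have := Finset.mem_filter.mp hx
    exact Finset.mem_erase.mpr ⟨by omega, this.1⟩
  have hU : S.filter (· < p) ∪ {p} ∪ S.filter (p < ·) = S := by
    ext x
    simp only [Finset.mem_union, Finset.mem_filter, Finset.mem_singleton]
    constructor
    · rintro ((h | rfl) | h)
      exacts [h.1, h0, h.1]
    · intro h
      rcases lt_trichotomy x p with h' | h' | h'
      exacts [Or.inl (Or.inl ⟨h, h'⟩), Or.inl (Or.inr h'), Or.inr ⟨h, h'⟩]
  have hcard := congrArg Finset.card hU
  rw [Finset.card_union_of_disjoint ((hA.trans hB' (by simp)).union_left hB').disjoint,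
    Finset.card_union_of_disjoint hA.disjoint, Finset.card_singleton] at hcard
  have hES : S.erase p ⊆ Finset.Icc 1 n := (Finset.erase_subset p S).trans hS
  generalize S.filter (· < p) = X at *
  generalize S.filter (p < ·) = Y at *
  have hpX : p ∉ X := fun h => absurd (hAs h) (by simp)
  have hpY : p ∉ Y := fun h => absurd (hBs h) (by simp)
  rcases X.eq_empty_or_nonempty with rfl | hX0
  · obtain ⟨J, L, hJ0, hL0, hJL, rfl⟩ := exists_split (B := Y) (by simp at hcard; omega)
    have hJs : J ⊆ J ∪ L := Finset.subset_union_left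
    have hLs : L ⊆ J ∪ L := Finset.subset_union_right
    refine key (I := {p}) (J := J) (L := L) ⟨by simp, hJ0, hL0, hB'.mono subset_rfl hJs, hJL,
      by rw [← hU, Finset.empty_union, Finset.union_assoc]⟩ fun I' J' L' hI hJ hL h => ?_
    rcases Finset.subset_singleton_iff.mp hI with rfl | rfl
    · exfalso
      grind
    · have hJ' := hJ.trans hJs
      have hL' := hL.trans hLs
      rw [ep, fixed (hJ'.trans hBs), fixed (hL'.trans hBs)]
      exact D.twist_casimir_first hp hpn (hJ'.trans (hBs.trans hES)) (hL'.trans (hBs.trans hES))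
        (hB.mono subset_rfl hJ') (hB.mono subset_rfl hL') (hJL.mono hJ hL)
  rcases Y.eq_empty_or_nonempty with rfl | hY0
  · obtain ⟨I, J, hI0, hJ0, hIJ, rfl⟩ := exists_split (B := X) (by simp at hcard; omega)
    have hIs : I ⊆ I ∪ J := Finset.subset_union_left
    have hJs : J ⊆ I ∪ J := Finset.subset_union_right
    refine key (I := I) (J := J) (L := {p}) ⟨hI0, hJ0, by simp, hIJ, hA.mono hJs subset_rfl,
      by rw [← hU, Finset.union_empty]⟩ fun I' J' L' hI hJ hL h => ?_
    rcases Finset.subset_singleton_iff.mp hL with rfl | rfl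
    · exfalso
      grind
    · have hI' := hI.trans hIs
      have hJ' := hJ.trans hJs
      rw [ep, fixed (hI'.trans hAs), fixed (hJ'.trans hAs)]
      exact D.twist_casimir_last hp hpn (hI'.trans (hAs.trans hES)) (hJ'.trans (hAs.trans hES))
        (hA.mono hI' subset_rfl) (hA.mono hJ' subset_rfl) (hIJ.mono hI hJ)
  · refine key (I := X) (J := {p}) (L := Y) ⟨hX0, by simp, hY0, hA, hB', hU⟩
      fun I' J' L' hI hJ hL h => ?_
    rcases Finset.subset_singleton_iff.mp hJ with rfl | rfl
    · exfalso
      grind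
    · rw [ep, fixed (hI.trans hAs), fixed (hL.trans hBs)]
      exact D.twist_casimir_middle hp hpn (hI.trans (hAs.trans hES)) (hL.trans (hBs.trans hES))
        (hA.mono hI subset_rfl) (hB.mono subset_rfl hL)

/-- If there are no letters on one side of the pair, `p` and `p + 1` are taken as separate blocks
and every Casimir element in the sum is fixed. Otherwise the pair is the middle block and the terms
are permuted. -/
theorem awOmega_fixed_of_mem_of_mem (hS : S ⊆ Finset.Icc 1 n) (h0 : p ∈ S) (h1 : p + 1 ∈ S) :
    r p (awOmega q n S) = awOmega q n S := by
  rcases lt_or_ge S.card 3 with hc | hc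
  · rw [awOmega_of_card_lt hc, map_zero]
  have hpq : AWLt {p} {p + 1} := by intro a ha b hb; simp only [Finset.mem_singleton] at ha hb; omega
  have hA : AWLt (S.filter (· < p)) {p} := fun a ha b hb => by
    rw [Finset.mem_singleton] at hb
    have := (Finset.mem_filter.mp ha).2
    omega
  have hA' : AWLt (S.filter (· < p)) {p + 1} := hA.trans hpq (by simp)
  have hB : AWLt {p + 1} (S.filter (p + 1 < ·)) := fun a ha b hb => by
    rw [Finset.mem_singleton] at ha
    have := (Finset.mem_filter.mp hb).2
    omega
  have hB' : AWLt {p} (S.filter (p + 1 < ·)) := hpq.trans hB (by simp)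
  have hAB : AWLt (S.filter (· < p)) (S.filter (p + 1 < ·)) := hA.trans hB' (by simp)
  have hU : S.filter (· < p) ∪ {p, p + 1} ∪ S.filter (p + 1 < ·) = S := by
    ext x
    simp only [Finset.mem_union, Finset.mem_filter, Finset.mem_singleton, Finset.mem_insert]
    constructor
    · rintro ((h | rfl | rfl) | h)
      exacts [h.1, h0, h1, h.1]
    · intro h
      by_cases h2 : x < p
      · exact Or.inl (Or.inl ⟨h, h2⟩)
      by_cases h3 : p + 1 < x
      · exact Or.inr ⟨h, h3⟩
      · exact Or.inl (Or.inr (by omega))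
  have hAn : S.filter (· < p) ⊆ Finset.Icc 1 n := (Finset.filter_subset _ _).trans hS
  have hBn : S.filter (p + 1 < ·) ⊆ Finset.Icc 1 n := (Finset.filter_subset _ _).trans hS
  generalize S.filter (· < p) = X at *
  generalize S.filter (p + 1 < ·) = Y at *
  obtain ⟨hps, hqs⟩ := pair_subset_Icc hp hpn
  have epq : ({p, p + 1} : Finset ℕ) = {p} ∪ {p + 1} := Finset.insert_eq _ _
  rcases X.eq_empty_or_nonempty with rfl | hX0
  · have hY0 : Y.Nonempty := by
      rw [Finset.nonempty_iff_ne_empty]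
      rintro rfl
      rw [Finset.empty_union, Finset.union_empty] at hU
      rw [← hU] at hc
      have := Finset.card_le_two (a := p) (b := p + 1)
      omega
    refine D.map_awOmega_self hS (I := {p}) (J := {p + 1}) (L := Y) ⟨by simp, by simp, hY0, hpq, hB,
      by rw [← hU, Finset.empty_union, epq]⟩ fun I' J' L' hI hJ hL => ?_
    have hLn := hL.trans hBn
    rcases Finset.subset_singleton_iff.mp hI with rfl | rfl
    · rw [D.awCasimir_empty_left (hJ.trans hqs) hLn (hB.mono hJ hL), map_zero]
    rcases Finset.subset_singleton_iff.mp hJ with rfl | rfl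
    · rw [D.awCasimir_empty_middle (hI.trans hps) hLn (hB'.mono hI hL), map_zero]
    exact D.twist_casimir_pair_left hp hpn hLn (hB.mono hJ hL)
  rcases Y.eq_empty_or_nonempty with rfl | hY0
  · refine D.map_awOmega_self hS (I := X) (J := {p}) (L := {p + 1}) ⟨hX0, by simp, by simp, hA, hpq,
      by rw [← hU, Finset.union_empty, epq, Finset.union_assoc]⟩ fun I' J' L' hI hJ hL => ?_
    have hIn := hI.trans hAn
    rcases Finset.subset_singleton_iff.mp hJ with rfl | rfl
    · rw [D.awCasimir_empty_middle hIn (hL.trans hqs) (hA'.mono hI hL), map_zero]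
    rcases Finset.subset_singleton_iff.mp hL with rfl | rfl
    · rw [D.awCasimir_empty_right hIn (hJ.trans hps) (hA.mono hI hJ), map_zero]
    exact D.twist_casimir_pair_right hp hpn hIn (hA.mono hI hJ)
  · have hpX : p ∉ X := fun h => (hA p h p (by simp)).false
    have hqX : p + 1 ∉ X := fun h => (hA' _ h _ (Finset.mem_singleton_self _)).false
    have hpY : p ∉ Y := fun h => (hB' p (by simp) p h).false
    have hqY : p + 1 ∉ Y := fun h => (hB _ (by simp) _ h).false
    have hSS : S.image (Equiv.swap p (p + 1)) = S := image_swap_eq_self (by simp [h0, h1])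
    have hXX : X.image (Equiv.swap p (p + 1)) = X := image_swap_eq_self (by simp [hpX, hqX])
    have hYY : Y.image (Equiv.swap p (p + 1)) = Y := image_swap_eq_self (by simp [hpY, hqY])
    have hpp : ({p, p + 1} : Finset ℕ).image (Equiv.swap p (p + 1)) = {p, p + 1} :=
      image_swap_eq_self (by simp)
    have hcut : AWCut S X {p, p + 1} Y := by
      refine ⟨hX0, by simp, hY0, ?_, ?_, hU⟩
      · rw [epq]; exact hA.union_right hA'
      · rw [epq]; exact hB'.union_left hB
    have := D.map_awOmega (e := r p) (φ := Equiv.swap p (p + 1)) hS hcut (Equiv.injective _).injOn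
      (by rwa [hSS]) (by rwa [hSS, hXX, hYY, hpp]) fun I' J' L' hI hJ hL => ?_
    · rwa [hSS] at this
    have hIn := hI.trans hAn
    have hLn := hL.trans hBn
    have hJn : J' ⊆ Finset.Icc 1 n := hJ.trans (by rw [epq]; exact Finset.union_subset hps hqs)
    have hpI : p ∉ I' := fun h => hpX (hI h)
    have hpL : p ∉ L' := fun h => hpY (hL h)
    have hqI : p + 1 ∉ I' := fun h => hqX (hI h)
    have hqL : p + 1 ∉ L' := fun h => hqY (hL h)
    -- The subset `J'` of `{p, p + 1}` goes to its image under the transposition; its members decide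
    -- which of the earlier formulas applies.
    by_cases hpJ : p ∈ J'
    · rw [image_swap_eq_self (J := I') (by simp [hpI, hqI]),
        image_swap_eq_self (J := L') (by simp [hpL, hqL])]
      by_cases hqJ : p + 1 ∈ J'
      · rw [image_swap_eq_self (J := J') (by simp [hpJ, hqJ])]
        exact D.casimir_fixed hp hpn hIn hJn hLn (by simp [hpI, hqI]) (by simp [hpJ, hqJ])
          (by simp [hpL, hqL])
      · obtain rfl : J' = {p} := by
          ext x
          have := @hJ x
          simp only [Finset.mem_insert, Finset.mem_singleton] at this ⊢
          constructor
          · intro h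
            exact (this h).resolve_right fun h' => hqJ (h' ▸ h)
          · rintro rfl
            exact hpJ
        rw [Finset.image_singleton, Equiv.swap_apply_left]
        exact D.twist_casimir_middle hp hpn hIn hLn (hA.mono hI subset_rfl) (hB.mono subset_rfl hL)
    · exact D.casimir_swap_of_notMem hp hpn hIn hJn hLn hpI hpJ hpL

theorem awOmega_swap (hS : S ⊆ Finset.Icc 1 n) :
    r p (awOmega q n S) = awOmega q n (S.image (Equiv.swap p (p + 1))) := by
  by_cases h0 : p ∈ S
  · by_cases h1 : p + 1 ∈ S
    · rw [image_swap_eq_self (by simp [h0, h1])]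
      exact D.awOmega_fixed_of_mem_of_mem hp hpn hS h0 h1
    · exact D.awOmega_swap_of_mem_of_notMem hp hpn hS h0 h1
  · exact D.transport_awOmega (D.transport_down hp hpn hS h0) hS

end HalfTwists

end Permutation

/-! ### The action on `Γ_n`, in particular of `r_0` -/

section Gamma

theorem AWCut.Ioc {a b c d : ℕ} (hab : a < b) (hbc : b < c) (hcd : c < d) :
    AWCut (Finset.Ioc a d) (Finset.Ioc a b) (Finset.Ioc b c) (Finset.Ioc c d) := by
  refine ⟨by simpa using hab, by simpa using hbc, by simpa using hcd, fun x hx y hy => ?_,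
    fun x hx y hy => ?_, ?_⟩
  · rw [Finset.mem_Ioc] at hx hy
    omega
  · rw [Finset.mem_Ioc] at hx hy
    omega
  · rw [Ioc_union_Ioc (by omega) (by omega), Ioc_union_Ioc (by omega) (by omega)]

variable {K : Type*} [Field K] {q : K} {n : ℕ}

theorem awOmega_mem_awGamma {S : Finset ℕ} (hS : S ⊆ Finset.Icc 1 n) : awOmega q n S ∈ awGamma q n :=
  Submodule.subset_span ⟨S, hS, rfl⟩

theorem map_mem_awGamma {e : AW K q n ≃ₐ[K] AW K q n}
    (h : ∀ S, S ⊆ Finset.Icc 1 n → e (awOmega q n S) ∈ awGamma q n) {x : AW K q n}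
    (hx : x ∈ awGamma q n) : e x ∈ awGamma q n := by
  have : awGamma q n ≤ (awGamma q n).comap e.toLinearMap :=
    Submodule.span_le.mpr fun y ⟨S, hS, hy⟩ => hy ▸ h S hS
  exact this hx

theorem map_eq_self_of_mem_awGamma {e : AW K q n ≃ₐ[K] AW K q n}
    (h : ∀ S, S ⊆ Finset.Icc 1 n → e (awOmega q n S) = awOmega q n S) {x : AW K q n}
    (hx : x ∈ awGamma q n) : e x = x := by
  have : awGamma q n ≤ LinearMap.eqLocus e.toLinearMap LinearMap.id :=
    Submodule.span_le.mpr fun y ⟨S, hS, hy⟩ => hy ▸ h S hS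
  exact this hx

/-- The automorphisms that leave `Γ_n` stable. -/
def awGammaStabilizer (q : K) (n : ℕ) : Subgroup (AW K q n ≃ₐ[K] AW K q n) where
  carrier := {g | ∀ x, g x ∈ awGamma q n ↔ x ∈ awGamma q n}
  mul_mem' := fun {f g} hf hg x => (hf (g x)).trans (hg x)
  one_mem' := fun _ => Iff.rfl
  inv_mem' := fun {g} hg x => by
    rw [← hg (g⁻¹ x)]
    change g (g.symm x) ∈ _ ↔ _
    rw [AlgEquiv.apply_symm_apply]

/-- If `e x` lies in `Γ_n`, then `e (e (e x)) = e x`, hence `x = e (e x)` lies in `Γ_n` as well. -/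
theorem mem_awGammaStabilizer {e : AW K q n ≃ₐ[K] AW K q n}
    (h1 : ∀ S, S ⊆ Finset.Icc 1 n → e (awOmega q n S) ∈ awGamma q n)
    (h2 : ∀ S, S ⊆ Finset.Icc 1 n → e (e (awOmega q n S)) = awOmega q n S) :
    e ∈ awGammaStabilizer q n := by
  intro x
  refine ⟨fun hx => ?_, map_mem_awGamma h1⟩
  have h3 : e (e (e x)) = e x := map_eq_self_of_mem_awGamma (e := e * e) h2 hx
  have h4 : e (e x) = x := e.injective h3
  rw [← h4]
  exact map_mem_awGamma h1 hx

namespace HalfTwists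

variable {r : ℕ → (AW K q n ≃ₐ[K] AW K q n)} {S I J L : Finset ℕ} (D : HalfTwists q n r)
include D

theorem awOmega_twist_twist {p : ℕ} (hp : 1 ≤ p) (hpn : p < n) (hS : S ⊆ Finset.Icc 1 n) :
    r p (r p (awOmega q n S)) = awOmega q n S := by
  rw [D.awOmega_swap hp hpn hS, D.awOmega_swap hp hpn (image_swap_subset_Icc hp hpn hS),
    Finset.image_image]
  congr 1
  convert Finset.image_id (s := S) using 2
  ext x
  simp

theorem twist_mem_stabilizer {p : ℕ} (hp : 1 ≤ p) (hpn : p < n) : r p ∈ awGammaStabilizer q n :=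
  mem_awGammaStabilizer (fun _ hS => by
    rw [D.awOmega_swap hp hpn hS]
    exact awOmega_mem_awGamma (image_swap_subset_Icc hp hpn hS)) fun _ hS => D.awOmega_twist_twist hp hpn hS

theorem chordCasimir_mem_awGamma {a b c d : ℕ} (hab : a < b) (hbc : b < c) (hcd : c < d) (hd : d ≤ n) :
    chordCasimir (q ^ 2) (awChord q n) a b c d ∈ awGamma q n := by
  rw [← smul_awCasimir_Ioc D.chordSystem D.ne_zero D.sq_ne_neg_one hab hbc hcd hd]
  refine Submodule.smul_mem _ _ (D.casimir_mem _ (fun S hS => awOmega_mem_awGamma hS) _ _ _ _ ?_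
    (AWCut.Ioc hab hbc hcd))
  intro x hx
  rw [Finset.mem_Ioc] at hx
  rw [Finset.mem_Icc]
  omega

/-- The neighbours of the vertex `0` are `n` and `1`. For `b = n` the quadrilateral contains both
and is fixed. For `b < n` the image consists of three Casimir elements, two of them fixed, and a
second application cancels these two. -/
theorem twist_zero_chordCasimir {b c : ℕ} (hc : 1 < c) (hcb : c < b) (hb : b ≤ n) :
    r 0 (chordCasimir (q ^ 2) (awChord q n) 0 1 c b) ∈ awGamma q n ∧
      r 0 (r 0 (chordCasimir (q ^ 2) (awChord q n) 0 1 c b)) =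
        chordCasimir (q ^ 2) (awChord q n) 0 1 c b := by
  have S := D.chordSystem
  have hn : 0 < n := by omega
  have H : PolygonCorner n n 0 1 := by simpa [prevVertex] using polygonCorner hn
  have he : ∀ x y, x ≤ n → y ≤ n →
      (r 0).toAlgHom (awChord q n x y) = _root_.twist (q ^ 2) (awChord q n) n 0 1 x y := D.twist 0 hn
  have rot : ∀ {x y z : ℕ}, 0 ≤ x → x ≤ y → y ≤ z → z ≤ n →
      chordCasimir (q ^ 2) (awChord q n) x y z 0 = chordCasimir (q ^ 2) (awChord q n) 0 x y z :=
    fun h1 h2 h3 h4 => S.chordCasimir_rotate (Or.inl (by omega)) (by omega) (by omega) (by omega) h4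
  have self : ∀ {x : ℕ}, 1 < x → x ≤ n → r 0 (chordCasimir (q ^ 2) (awChord q n) 0 1 x n) =
      chordCasimir (q ^ 2) (awChord q n) 0 1 x n := by
    intro x h1 h2
    rw [← S.chordCasimir_rotate_three (Or.inl (by omega)) (by omega) (by omega) h2 le_rfl]
    exact S.map_chordCasimir_self (e := (r 0).toAlgHom) H he (by omega) (by omega)
      (Or.inr (Or.inl (by omega))) le_rfl h2
  rcases hb.eq_or_lt with rfl | hbn
  · rw [self hc hcb.le, self hc hcb.le]
    exact ⟨D.chordCasimir_mem_awGamma (by omega) hc hcb le_rfl, rfl⟩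
  have e1 : r 0 (chordCasimir (q ^ 2) (awChord q n) 0 1 c b) =
      chordCasimir (q ^ 2) (awChord q n) 0 1 c n - chordCasimir (q ^ 2) (awChord q n) 0 1 b n +
        chordCasimir (q ^ 2) (awChord q n) 0 c b n := by
    rw [← rot (x := 1) (y := c) (z := b) (by omega) (by omega) (by omega) hb,
      ← rot (x := 1) (y := c) (z := n) (by omega) (by omega) (by omega) le_rfl,
      ← rot (x := 1) (y := b) (z := n) (by omega) (by omega) (by omega) le_rfl,
      ← rot (x := c) (y := b) (z := n) (by omega) (by omega) (by omega) le_rfl]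
    exact S.map_chordCasimir_left (e := (r 0).toAlgHom) H he (by omega) (by omega)
      (Or.inr (Or.inr (Or.inr (Or.inr (by omega))))) le_rfl (by omega) hb
  have e2 : r 0 (chordCasimir (q ^ 2) (awChord q n) 0 c b n) =
      chordCasimir (q ^ 2) (awChord q n) b n 0 1 - chordCasimir (q ^ 2) (awChord q n) n 0 1 c +
        chordCasimir (q ^ 2) (awChord q n) 0 1 c b := by
    rw [← rot (x := c) (y := b) (z := n) (by omega) (by omega) (by omega) le_rfl]
    exact S.map_chordCasimir_right (e := (r 0).toAlgHom) H he (by omega) (by omega) (by omega)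
      (Or.inr (Or.inr (Or.inr (Or.inl (by omega))))) le_rfl (by omega) hb
  refine ⟨?_, ?_⟩
  · rw [e1]
    exact add_mem (sub_mem (D.chordCasimir_mem_awGamma (by omega) hc (by omega) le_rfl)
      (D.chordCasimir_mem_awGamma (by omega) (by omega) hbn le_rfl))
      (D.chordCasimir_mem_awGamma (by omega) hcb hbn le_rfl)
  · rw [e1, map_add, map_sub, self hc (by omega), self (by omega) hb, e2,
      S.chordCasimir_rotate_two (a := 0) (b := 1) (c := b) (d := n) (Or.inl (by omega)) (by omega)
        (by omega) hb le_rfl,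
      S.chordCasimir_rotate_three (a := 0) (b := 1) (c := c) (d := n) (Or.inl (by omega)) (by omega)
        (by omega) (by omega) le_rfl]
    abel

/-- The blocks are compressed by half twists `r j` with `j > 1` only. These fix the letter `1`,
commute with `r 0` and leave `Γ_n` stable, so both claims can be checked for adjacent intervals. -/
theorem twist_zero_casimir (hJ : J ⊆ Finset.Icc 1 n) (hL : L ⊆ Finset.Icc 1 n) (h1J : AWLt {1} J)
    (hJL : AWLt J L) (hJ0 : J.Nonempty) (hL0 : L.Nonempty) :
    r 0 (awCasimir q n {1} J L) ∈ awGamma q n ∧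
      r 0 (r 0 (awCasimir q n {1} J L)) = awCasimir q n {1} J L := by
  have h1L := h1J.trans hJL hJ0
  have hn : 0 < n := by
    obtain ⟨x, hx⟩ := hJ0
    have := Finset.mem_Icc.mp (hJ hx)
    omega
  have comm : ∀ f, f ∈ Subgroup.centralizer {r 0} ↔ Commute f (r 0) := fun f => by
    rw [Subgroup.mem_centralizer_singleton_iff]
    exact ⟨fun h => h, fun h => h⟩
  have hU : {1} ∪ J ∪ L ⊆ Finset.Icc 1 n := Finset.union_subset (Finset.union_subset (by
    rw [Finset.singleton_subset_iff, Finset.mem_Icc]; omega) hJ) hL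
  obtain ⟨g, hg, φ, T, hφ, hV⟩ := D.compress_down
    (Subgroup.centralizer {r 0} ⊓ awGammaStabilizer q n) 1 (fun j hj hjn =>
      ⟨(comm _).mpr (half_twist_far D.chordSystem (by omega) hjn (D.twist 0 hn) (D.twist j hjn)).symm,
        D.twist_mem_stabilizer hj.le hjn⟩) _ hU
  obtain ⟨hg1, hg2⟩ := hg
  replace hg1 := (comm g).mp hg1
  have f1 : φ 1 = 1 := hφ 1 (by simp) le_rfl
  obtain ⟨b, h1b, hbV, hfil⟩ := exists_filter_eq_Ioc_right hV
  have hbn : b ≤ n := by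
    rcases hbV with rfl | hbV
    · omega
    · exact (Finset.mem_Icc.mp (T.mem hbV)).2
  have k1 := T.awLt (by grind) (by grind) h1J
  have k2 := T.awLt (by grind) (by grind) h1L
  have k3 := T.awLt (by grind) (by grind) hJL
  have e1 : ({1} : Finset ℕ).image φ = Finset.Ioc 0 1 := by
    rw [Finset.image_singleton, f1]
    rfl
  rw [e1] at k1 k2
  have e2 : J.image φ ∪ L.image φ = Finset.Ioc 1 b := by
    rw [← hfil, Finset.image_union, Finset.image_union, e1]
    ext x
    simp only [Finset.mem_union, Finset.mem_filter, Finset.mem_Ioc]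
    constructor
    · rintro (h | h)
      · exact ⟨Or.inl (Or.inr h), k1 1 (by simp) x h⟩
      · exact ⟨Or.inr h, k2 1 (by simp) x h⟩
    · rintro ⟨(h | h) | h, h'⟩
      · omega
      · exact Or.inl h
      · exact Or.inr h
  obtain ⟨c, -, hcb, e3, e4⟩ := exists_eq_Ioc_of_union h1b e2 k3
  have h2 := hJ0.image φ
  have h3 := hL0.image φ
  rw [e3, Finset.nonempty_Ioc] at h2
  rw [e4, Finset.nonempty_Ioc] at h3
  have e5 := T.casimir (I := {1}) (J := J) (L := L) (by grind) (by grind) (by grind)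
  have key : ∀ x, g (r 0 x) = r 0 (g x) := fun x => DFunLike.congr_fun hg1.eq x
  obtain ⟨t1, t2⟩ := D.twist_zero_chordCasimir h2 h3 hbn
  rw [← smul_awCasimir_Ioc D.chordSystem D.ne_zero D.sq_ne_neg_one (by omega) h2 h3 hbn, ← e1, ← e3, ← e4,
    ← e5, map_smul, ← key] at t1 t2
  refine ⟨(hg2 _).mp ?_, g.injective (D.smul_inj ?_)⟩
  · have := Submodule.smul_mem _ (q * (q ^ 2 + 1))⁻¹ t1
    rwa [inv_smul_smul₀ D.scalar_ne] at this
  · rw [map_smul, ← key] at t2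
    exact t2

/-- If `1 ∈ S`, the cut with first block `{1}` is used: every non-zero Casimir element in the sum
has this first block, so `twist_zero_casimir` applies. If `1 ∉ S`, all terms are fixed. -/
theorem twist_zero_awOmega (hn : 0 < n) (hS : S ⊆ Finset.Icc 1 n) :
    r 0 (awOmega q n S) ∈ awGamma q n ∧ r 0 (r 0 (awOmega q n S)) = awOmega q n S := by
  rcases lt_or_ge S.card 3 with hc | hc
  · rw [awOmega_of_card_lt hc, map_zero, map_zero]
    exact ⟨zero_mem _, rfl⟩
  obtain ⟨m, k, hm, hk, hx, h'⟩ := exists_awCut hc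
  have h6 := h'.2.2.2.2.2
  by_cases h1 : 1 ∈ S
  · obtain rfl : m = 1 := le_antisymm (hx 1 h1).1 (Finset.mem_Icc.mp (hS hm)).1
    -- Both claims define one subspace, which contains `ω_S` as soon as it contains the Casimir
    -- elements.
    let M : Submodule K (AW K q n) := (awGamma q n).comap (r 0).toLinearMap ⊓
      LinearMap.eqLocus (r 0 * r 0).toLinearMap LinearMap.id
    have hM : ∀ x, x ∈ M ↔ r 0 x ∈ awGamma q n ∧ r 0 (r 0 x) = x := fun x => Iff.rfl
    have key : ∀ {I J L : Finset ℕ}, I ⊆ {1} → J ⊆ S → L ⊆ S → I.Nonempty → J.Nonempty → L.Nonempty →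
        AWLt I J → AWLt J L → awCasimir q n I J L ∈ M := by
      intro I J L hI hJ hL hI0 hJ0 hL0 hIJ hJL
      obtain rfl : I = {1} := (Finset.subset_singleton_iff.mp hI).resolve_left hI0.ne_empty
      exact D.twist_zero_casimir (hJ.trans hS) (hL.trans hS) hIJ hJL hJ0 hL0
    rw [← hM]
    have hJS : S \ {1, k} ⊆ S := Finset.sdiff_subset
    have hLS : {k} ⊆ S := by simpa using hk
    have t1 := D.awOmega_sub_casimir_mem M hS h' fun I' J' L' hI hJ hL hcut _ =>
      key hI (hJ.trans hJS) (hL.trans hLS) hcut.1 hcut.2.1 hcut.2.2.1 hcut.2.2.2.1 hcut.2.2.2.2.1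
    have t2 := key subset_rfl hJS hLS h'.1 h'.2.1 h'.2.2.1 h'.2.2.2.1 h'.2.2.2.2.1
    have := add_mem t1 t2
    rwa [sub_add_cancel] at this
  · have := D.map_awOmega_self (e := r 0) hS h' fun I' J' L' hI hJ hL => by
      have hI' : I' ⊆ S := hI.trans (by simpa using hm)
      have hJ' : J' ⊆ S := hJ.trans Finset.sdiff_subset
      have hL' : L' ⊆ S := hL.trans (by simpa using hk)
      exact D.casimir_fixed_zero hn (hI'.trans hS) (hJ'.trans hS) (hL'.trans hS) (fun h => h1 (hI' h))
        (fun h => h1 (hJ' h)) fun h => h1 (hL' h)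
    rw [this, this]
    exact ⟨awOmega_mem_awGamma hS, rfl⟩

theorem twist_mem_awGammaStabilizer {a : ℕ} (ha : a < n) : r a ∈ awGammaStabilizer q n := by
  rcases Nat.eq_zero_or_pos a with rfl | h
  · exact mem_awGammaStabilizer (fun _ hS => (D.twist_zero_awOmega ha hS).1)
      fun _ hS => (D.twist_zero_awOmega ha hS).2
  · exact D.twist_mem_stabilizer h ha

theorem twist_twist_awOmega {a : ℕ} (ha : a < n) (hS : S ⊆ Finset.Icc 1 n) :
    r a (r a (awOmega q n S)) = awOmega q n S := by
  rcases Nat.eq_zero_or_pos a with rfl | h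
  · exact (D.twist_zero_awOmega ha hS).2
  · exact D.awOmega_twist_twist h ha hS

end HalfTwists

end Gamma

/-! ### Involutions with braid relations and the symmetric group -/

section Coxeter

variable {G X : Type*} [Group G] {N : ℕ} {s : ℕ → G}

/-- The product `s_k s_{k-1} ⋯` of `m` factors. -/
def descendingProd (s : ℕ → G) (k : ℕ) : ℕ → G
  | 0 => 1
  | m + 1 => descendingProd s k m * s (k - m)

/-- Involutions that satisfy the braid relations. -/
structure BraidInvolutions (N : ℕ) (s : ℕ → G) : Prop where
  sq : ∀ i, i < N → s i * s i = 1
  braid : ∀ i, i + 1 < N → s i * s (i + 1) * s i = s (i + 1) * s i * s (i + 1)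
  far : ∀ i j, i + 1 < j → j < N → s i * s j = s j * s i

namespace BraidInvolutions

variable (B : BraidInvolutions N s)
include B

theorem commute_descendingProd {k m i : ℕ} (hk : k < N) (h : i + m < k) :
    s i * descendingProd s k m = descendingProd s k m * s i := by
  induction m with
  | zero => simp [descendingProd]
  | succ m ih =>
    rw [descendingProd, ← mul_assoc, ih (by omega), mul_assoc, B.far i (k - m) (by omega) (by omega),
      ← mul_assoc]

/-- The factor `s i` commutes with the factors of small index, and the braid relation where it meets
`s i` and `s (i - 1)` lowers its index by one. -/
theorem descendingProd_mul {k m i : ℕ} (hk : k < N) (hm : m ≤ k) (h1 : k < i + m) (h2 : i ≤ k) :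
    descendingProd s k (m + 1) * s i = s (i - 1) * descendingProd s k (m + 1) := by
  induction m generalizing i with
  | zero => omega
  | succ m ih =>
    rcases Nat.lt_or_ge k (i + m) with h | h
    · have hf := B.far (k - (m + 1)) i (by omega) (by omega)
      calc _ = descendingProd s k (m + 1) * (s (k - (m + 1)) * s i) := by rw [descendingProd, mul_assoc]
        _ = descendingProd s k (m + 1) * s i * s (k - (m + 1)) := by rw [hf, mul_assoc]
        _ = s (i - 1) * descendingProd s k (m + 1) * s (k - (m + 1)) := by rw [ih (by omega) h h2]
        _ = _ := by rw [mul_assoc, ← descendingProd]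
    · obtain ⟨j, rfl⟩ : ∃ j, i = j + 1 := ⟨i - 1, by omega⟩
      have e1 : k - m = j + 1 := by omega
      have e2 : k - (m + 1) = j := by omega
      have hb := B.braid j (by omega)
      calc _ = descendingProd s k m * (s (j + 1) * s j * s (j + 1)) := by
            rw [descendingProd, descendingProd, e1, e2]; simp only [mul_assoc]
        _ = descendingProd s k m * s j * (s (j + 1) * s j) := by rw [← hb]; simp only [mul_assoc]
        _ = s j * descendingProd s k m * (s (j + 1) * s j) := by
            rw [B.commute_descendingProd hk (by omega)]
        _ = _ := by
            rw [descendingProd, descendingProd, e1, e2, Nat.add_sub_cancel]; simp only [mul_assoc]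

/-- The cosets of the subgroup generated by `s 0, …, s (k - 1)` that are represented by the `k + 2`
descending products are permuted by right multiplication with the generators. -/
theorem exists_coset {k : ℕ} (hk : k < N) {g : G} (hg : g ∈ Subgroup.closure (s '' Set.Iio (k + 1))) :
    ∃ h ∈ Subgroup.closure (s '' Set.Iio k), ∃ m, m ≤ k + 1 ∧ g = h * descendingProd s k m := by
  have hmem : ∀ i, i < k → s i ∈ Subgroup.closure (s '' Set.Iio k) := fun i hi =>
    Subgroup.subset_closure ⟨i, hi, rfl⟩
  have step : ∀ i, i ≤ k → ∀ m, m ≤ k + 1 → ∃ h ∈ Subgroup.closure (s '' Set.Iio k), ∃ m', m' ≤ k + 1 ∧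
      descendingProd s k m * s i = h * descendingProd s k m' := by
    intro i hi m hm
    rcases lt_trichotomy (i + m) k with h | h | h
    · exact ⟨s i, hmem i (by omega), m, hm, (B.commute_descendingProd hk h).symm⟩
    · exact ⟨1, one_mem _, m + 1, by omega, by rw [one_mul, descendingProd, ← h, Nat.add_sub_cancel]⟩
    · obtain ⟨m, rfl⟩ : ∃ m', m = m' + 1 := ⟨m - 1, by omega⟩
      rcases Nat.lt_or_ge k (i + m) with h' | h'
      · exact ⟨s (i - 1), hmem _ (by omega), m + 1, hm, B.descendingProd_mul hk (by omega) h' hi⟩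
      · refine ⟨1, one_mem _, m, by omega, ?_⟩
        rw [descendingProd, mul_assoc, show k - m = i by omega, B.sq i (by omega), mul_one, one_mul]
  induction hg using Subgroup.closure_induction_right with
  | one => exact ⟨1, one_mem _, 0, by omega, by simp [descendingProd]⟩
  | mul_right x _ y hy ih =>
    obtain ⟨h, hh, m, hm, rfl⟩ := ih
    obtain ⟨i, hi, rfl⟩ := hy
    obtain ⟨h', hh', m', hm', e⟩ := step i (Nat.lt_succ_iff.mp hi) m hm
    exact ⟨h * h', mul_mem hh hh', m', hm', by rw [mul_assoc, e, mul_assoc]⟩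
  | mul_inv_cancel x _ y hy ih =>
    obtain ⟨h, hh, m, hm, rfl⟩ := ih
    obtain ⟨i, hi, rfl⟩ := hy
    have hi' : i < k + 1 := hi
    obtain ⟨h', hh', m', hm', e⟩ := step i (Nat.lt_succ_iff.mp hi) m hm
    refine ⟨h * h', mul_mem hh hh', m', hm', ?_⟩
    rw [inv_eq_of_mul_eq_one_right (B.sq i (by omega)), mul_assoc, e, mul_assoc]

/-- A word in the involutions that acts trivially on the letters is trivial. -/
theorem eq_one_of_fixes (π : G →* Equiv.Perm X) (v : ℕ → X) (hv : Set.InjOn v (Set.Iic N))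
    (hπ : ∀ i, i < N → ∀ j, j ≤ N → π (s i) (v j) = v (Equiv.swap i (i + 1) j)) :
    ∀ k, k ≤ N → ∀ g ∈ Subgroup.closure (s '' Set.Iio k), (∀ j, j ≤ N → π g (v j) = v j) → g = 1 := by
  intro k
  induction k with
  | zero =>
    intro _ g hg _
    have : s '' Set.Iio 0 = ∅ := by ext; simp
    rw [this, Subgroup.closure_empty] at hg
    exact Subgroup.mem_bot.mp hg
  | succ k ih =>
    intro hk g hg hfix
    obtain ⟨h, hh, m, hm, rfl⟩ := B.exists_coset hk hg
    -- The letter that is sent to `k + 1` tells the representatives apart, while the smaller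
    -- subgroup fixes `k + 1`. So an element that fixes all letters has `m = 0` and lies in the
    -- smaller subgroup.
    have hd : ∀ m, m ≤ k + 1 → π (descendingProd s k m) (v (k + 1 - m)) = v (k + 1) := by
      intro m
      induction m with
      | zero => intro _; simp [descendingProd]
      | succ m ihm =>
        intro hm
        rw [descendingProd, map_mul, Equiv.Perm.mul_apply, hπ _ (by omega) _ (by omega),
          show k + 1 - (m + 1) = k - m by omega, Equiv.swap_apply_left,
          show k - m + 1 = k + 1 - m by omega]
        exact ihm (by omega)
    have hh' : π h (v (k + 1)) = v (k + 1) := by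
      have hle : Subgroup.closure (s '' Set.Iio k) ≤ (MulAction.stabilizer (Equiv.Perm X) (v (k + 1))).comap π := by
        rw [Subgroup.closure_le]
        rintro _ ⟨i, hi, rfl⟩
        have hi' : i < k := hi
        change π (s i) (v (k + 1)) = v (k + 1)
        rw [hπ i (by omega) _ hk, Equiv.swap_apply_of_ne_of_ne (by omega) (by omega)]
      exact hle hh
    have e1 := hfix (k + 1 - m) (by omega)
    rw [map_mul, Equiv.Perm.mul_apply, hd m hm, hh'] at e1
    have e2 := hv (Set.mem_Iic.mpr hk) (Set.mem_Iic.mpr (by omega)) e1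
    obtain rfl : m = 0 := by omega
    rw [descendingProd, mul_one] at hfix ⊢
    exact ih (by omega) h hh hfix

end BraidInvolutions

end Coxeter

/-! ### Factorization of braid group actions through the symmetric group -/

section Factor

variable {n : ℕ}

theorem braidPerm_σ (a : Fin n) : braidPerm n (braidσ a) = Equiv.swap a.castSucc a.succ :=
  PresentedGroup.toGroup.of _

theorem braidPerm_surjective (n : ℕ) : Function.Surjective (braidPerm n) := by
  intro σ
  have h : σ ∈ Submonoid.closure (Set.range fun a : Fin n => Equiv.swap a.castSucc a.succ) := by
    rw [Equiv.Perm.mclosure_swap_castSucc_succ]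
    trivial
  have hle : Submonoid.closure (Set.range fun a : Fin n => Equiv.swap a.castSucc a.succ) ≤
      MonoidHom.mrange (braidPerm n) := by
    rw [Submonoid.closure_le]
    rintro _ ⟨a, rfl⟩
    exact ⟨braidσ a, braidPerm_σ a⟩
  exact hle h

theorem braid_rel (a b : Fin n) (h : (a : ℕ) + 1 = b) :
    braidσ a * braidσ b * braidσ a = braidσ b * braidσ a * braidσ b := by
  have := PresentedGroup.one_of_mem (rels := braidRels n) (Or.inl ⟨a, b, h, rfl⟩)
  rw [map_mul, map_inv, mul_inv_eq_one] at this
  simp only [map_mul] at this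
  exact this

theorem far_rel (a b : Fin n) (h : (a : ℕ) + 1 < b) : braidσ a * braidσ b = braidσ b * braidσ a := by
  have := PresentedGroup.one_of_mem (rels := braidRels n) (Or.inr ⟨a, b, h, rfl⟩)
  rw [map_mul, map_inv, mul_inv_eq_one] at this
  simp only [map_mul] at this
  exact this

/-- A morphism from the braid group that sends the generators to involutions factors through the
symmetric group. -/
theorem eq_one_of_braidPerm_eq_one {L : Type*} [Group L] (ψ : BraidGroupSucc n →* L)
    (h : ∀ a, ψ (braidσ a) * ψ (braidσ a) = 1) {b : BraidGroupSucc n} (hb : braidPerm n b = 1) :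
    ψ b = 1 := by
  -- The group `L` need not act on the letters. In the product with the symmetric group the
  -- generators are still involutions, the second factor provides the action, and the first
  -- component of the conclusion is the claim.
  let Ψ : BraidGroupSucc n →* L × Equiv.Perm (Fin (n + 1)) := ψ.prod (braidPerm n)
  let s : ℕ → L × Equiv.Perm (Fin (n + 1)) := fun i =>
    if hi : i < n then Ψ (braidσ ⟨i, hi⟩) else 1
  have hs : ∀ i (hi : i < n), s i = Ψ (braidσ ⟨i, hi⟩) := fun i hi => dif_pos hi
  have B : BraidInvolutions n s := by
    refine ⟨fun i hi => ?_, fun i hi => ?_, fun i j hij hj => ?_⟩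
    · rw [hs i hi]
      refine Prod.ext (h _) ?_
      change braidPerm n _ * braidPerm n _ = 1
      rw [braidPerm_σ, Equiv.swap_mul_self]
    · rw [hs i (by omega), hs (i + 1) hi, ← map_mul, ← map_mul, ← map_mul, ← map_mul,
        braid_rel _ _ (by simp)]
    · rw [hs i (by omega), hs j hj, ← map_mul, ← map_mul, far_rel _ _ (by simpa using hij)]
  have hmem : ∀ c, Ψ c ∈ Subgroup.closure (s '' Set.Iio n) := by
    intro c
    have h1 : c ∈ Subgroup.closure (Set.range (PresentedGroup.of (rels := braidRels n))) := by
      rw [PresentedGroup.closure_range_of]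
      trivial
    have hle : Subgroup.closure (Set.range (PresentedGroup.of (rels := braidRels n))) ≤
        (Subgroup.closure (s '' Set.Iio n)).comap Ψ := by
      rw [Subgroup.closure_le]
      rintro _ ⟨a, rfl⟩
      exact Subgroup.subset_closure ⟨a, a.2, hs a a.2⟩
    exact hle h1
  have := B.eq_one_of_fixes (MonoidHom.snd L (Equiv.Perm (Fin (n + 1)))) (fun j => Fin.ofNat (n + 1) j)
    (fun i hi j hj hij => by
      have := congrArg Fin.val hij
      simp only [Fin.val_ofNat, Set.mem_Iic] at this hi hj
      rwa [Nat.mod_eq_of_lt (by omega), Nat.mod_eq_of_lt (by omega)] at this)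
    (fun i hi j hj => by
      have e : (MonoidHom.snd L (Equiv.Perm (Fin (n + 1)))) (Ψ (braidσ ⟨i, hi⟩)) =
          braidPerm n (braidσ ⟨i, hi⟩) := rfl
      rw [hs i hi, e, braidPerm_σ]
      ext
      simp only [Equiv.swap_apply_def, Fin.ext_iff, Fin.val_castSucc, Fin.val_succ, Fin.val_ofNat,
        Nat.mod_eq_of_lt (show j < n + 1 by omega)]
      split_ifs <;> simp only [Fin.val_castSucc, Fin.val_succ, Fin.val_ofNat] <;>
        rw [Nat.mod_eq_of_lt (by omega)])
    n le_rfl (Ψ b) (hmem b) fun j hj => by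
      change braidPerm n b _ = _
      rw [hb]
      rfl
  exact congrArg Prod.fst this

end Factor

theorem exists_braid_action {K : Type*} [Field K] {q : K} {n : ℕ}
    {r : ℕ → (AW K q n ≃ₐ[K] AW K q n)} (D : HalfTwists q n r) :
    ∃ ρ : BraidGroupSucc n →* (AW K q n ≃ₐ[K] AW K q n), ∀ a : Fin n, ρ (braidσ a) = r a := by
  have h : ∀ w ∈ braidRels n, FreeGroup.lift (fun a : Fin n => r a) w = 1 := by
    rintro w (⟨a, b, hab, rfl⟩ | ⟨a, b, hab, rfl⟩)
    · have hb := b.2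
      simp only [map_mul, map_inv, FreeGroup.lift_apply_of, mul_inv_eq_one]
      rw [← hab] at hb ⊢
      exact half_twist_braid D.chordSystem hb (D.twist _ a.2) (D.twist _ hb)
    · simp only [map_mul, map_inv, FreeGroup.lift_apply_of, mul_inv_eq_one]
      exact half_twist_far D.chordSystem hab b.2 (D.twist _ a.2) (D.twist _ b.2)
  exact ⟨PresentedGroup.toGroup h, fun a => PresentedGroup.toGroup.of h⟩

/-- An action that leaves `Γ_n` stable, restricted to `Γ_n`. -/
theorem exists_restriction {K : Type*} [Field K] {q : K} {n : ℕ} {B : Type*} [Group B]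
    (ρ : B →* (AW K q n ≃ₐ[K] AW K q n)) (h : ∀ b, ρ b ∈ awGammaStabilizer q n) :
    ∃ ψ : B →* (awGamma q n ≃ₗ[K] awGamma q n), ∀ b x, (ψ b x : AW K q n) = ρ b x := by
  let f : B →* Module.End K (awGamma q n) :=
    { toFun := fun b => (ρ b).toLinearMap.restrict fun x hx => (h b x).mpr hx
      map_one' := by
        ext x
        change ρ 1 x = x
        rw [map_one]
        rfl
      map_mul' := fun b c => by
        ext x
        change ρ (b * c) x = ρ b (ρ c x)
        rw [map_mul]
        rfl }
  exact ⟨(LinearMap.GeneralLinearGroup.generalLinearEquiv K (awGamma q n)).toMonoidHom.comp f.toHomUnits,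
    fun b x => rfl⟩

theorem mainTheorem9 {K : Type*} [Field K] [Algebra ℂ K] (q : K)
    (hq0 : q ≠ 0) (hq1 : q ^ 2 ≠ 1) (hq2 : q ^ 2 ≠ -1) (n : ℕ) (hn : 0 < n) :
    -- the elements `ω_S` are well defined and central
    (∀ S I₁ I₂ I₃ : Finset ℕ, S ⊆ Finset.Icc 1 n → AWCut S I₁ I₂ I₃ →
      awOmegaCut q n S I₁ I₂ I₃ = awOmega q n S) ∧
    (∀ S : Finset ℕ, S ⊆ Finset.Icc 1 n →
      awOmega q n S ∈ Subalgebra.center K (AW K q n)) ∧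
    -- the action of the braid group on `n + 1` strands by the automorphisms `r_a`
    ∃ ρ : BraidGroupSucc n →* (AW K q n ≃ₐ[K] AW K q n),
      (∀ (a : Fin n) (I : Finset ℕ), AWConn n I → ρ (braidσ a) (awC q n I) = awR q n a I) ∧
      -- `r_0` leaves `Γ_n` stable, and `r_0²` fixes each `ω_S`
      (awGamma q n).map (ρ (braidσ ⟨0, hn⟩)).toLinearMap = awGamma q n ∧
      (∀ S : Finset ℕ, S ⊆ Finset.Icc 1 n →
        ρ (braidσ ⟨0, hn⟩) (ρ (braidσ ⟨0, hn⟩) (awOmega q n S)) = awOmega q n S) ∧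
      -- the braid group action restricts to `Γ_n`, where it factors through `S_{n+1}`
      ∃ τ : Equiv.Perm (Fin (n + 1)) →* (awGamma q n ≃ₗ[K] awGamma q n),
        ∀ (b : BraidGroupSucc n) (x : awGamma q n),
          (τ (braidPerm n b) x : AW K q n) = ρ b x := by
  have ex : ∀ a : ℕ, ∃ e : AW K q n ≃ₐ[K] AW K q n, a < n →
      ∀ x y, x ≤ n → y ≤ n → e (awChord q n x y) = awTwist q n a x y := fun a => by
    by_cases ha : a < n
    · obtain ⟨e, he⟩ := exists_half_twist hq0 hq1 hq2 ha
      exact ⟨e, fun _ => he⟩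
    · exact ⟨1, fun h => absurd h ha⟩
  choose r hr using ex
  have D : HalfTwists q n r := ⟨hq0, hq1, hq2, hr⟩
  obtain ⟨ρ, hρ⟩ := exists_braid_action D
  have hstab : ∀ b, ρ b ∈ awGammaStabilizer q n := by
    have hle : Subgroup.closure (Set.range (PresentedGroup.of (rels := braidRels n))) ≤
        (awGammaStabilizer q n).comap ρ := by
      rw [Subgroup.closure_le]
      rintro _ ⟨a, rfl⟩
      exact Subgroup.mem_comap.mpr ((hρ a).symm ▸ D.twist_mem_awGammaStabilizer a.2)
    rw [PresentedGroup.closure_range_of] at hle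
    exact fun b => hle (Subgroup.mem_top b)
  obtain ⟨ψ, hψ⟩ := exists_restriction ρ hstab
  -- The generators act on `Γ_n` by involutions, since their squares fix the spanning elements
  -- `ω_S`.
  have hker : (braidPerm n).ker ≤ ψ.ker := fun b hb => by
    refine eq_one_of_braidPerm_eq_one ψ (fun a => ?_) hb
    ext x
    change (ψ (braidσ a) (ψ (braidσ a) x) : AW K q n) = x
    rw [hψ, hψ, hρ]
    exact map_eq_self_of_mem_awGamma (e := r a * r a) (fun S hS => D.twist_twist_awOmega a.2 hS) x.2
  refine ⟨fun S I₁ I₂ I₃ hS h => D.awOmegaCut_eq_awOmega hS h, fun S hS => D.awOmega_mem_center hS, ρ,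
    fun a I hI => ?_, ?_, fun S hS => ?_,
    (braidPerm n).liftOfSurjective (braidPerm_surjective n) ⟨ψ, hker⟩, fun b x => ?_⟩
  · rw [hρ]
    exact half_twist_awC D.chordSystem hq0 a.2 (hr a a.2) hI
  · have h0 := hstab (braidσ ⟨0, hn⟩)
    refine le_antisymm ?_ fun x hx => ?_
    · rintro _ ⟨x, hx, rfl⟩
      exact (h0 x).mpr hx
    · refine ⟨(ρ (braidσ ⟨0, hn⟩)).symm x, (h0 _).mp ?_, ?_⟩
      · rwa [AlgEquiv.apply_symm_apply]
      · exact AlgEquiv.apply_symm_apply _ x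
  · rw [hρ]
    exact D.twist_twist_awOmega hn hS
  · rw [← hψ, MonoidHom.liftOfRightInverse_comp_apply]
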